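/- All arithmetic on bit strings is over $\mathbb F_2$, $\mathrm{wt}$ is the Hamming weight, $\mathrm{Ber}(n,\eta)$ is the distribution of $n$ independent bits with expectation $\eta$, and a function $\mu(n)$ is negligible if $n^c\mu(n)\to 0$ for every $c$. A randomized algorithm is polynomial-time if a machine with fair coins produces its output distribution up to negligible statistical distance, halting for all coins within a number of steps polynomial in the input length. For $n,g,t,r$ with $t\le n$, let $\mathsf{LDPC}[n,g,t,r]$ be the distribution of $(P,G)$, where $P\in\mathbb F_2^{r\times n}$ is uniform among the matrices all of whose rows have weight $t$, and $G\in\mathbb F_2^{n\times g}$ is uniform subject to $PG=0$. For functions $g,t,r,\zeta$ of the security parameter $n$ and a constant $\eta\in[0,1/2)$, the scheme $\mathsf{LDPC\text{-}PRC}_0[n,g,t,r,\eta,\zeta]$ consists of - $\mathsf{KeyGen}(1^n)$: sample $(P,G)\gets\mathsf{LDPC}[n,g,t,r]$ and uniform $z\in\mathbb F_2^n$; output $\mathsf{sk}=(P,z)$, $\mathsf{pk}=(G,z)$; - $\mathsf{Encode}(1^n,(G,z))$: sample uniform $u\in\mathbb F_2^g$ and $e\gets\mathrm{Ber}(n,\eta)$;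 output $Gu\oplus z\oplus e$; - $\mathsf{Decode}(1^n,(P,z),x)$: output $1$ if $x\in\mathbb F_2^n$ and $\mathrm{wt}(Px\oplus Pz)<(\tfrac12-\zeta)r$; otherwise output $\bot$. A length-preserving binary channel $\mathcal E$ (a randomized map) is $p$-bounded if $\Pr_{x\gets\{0,1\}^n}[\mathrm{wt}(\mathcal E(x)\oplus x)>pn]$ is at most a negligible function of $n$. A triple $(\mathsf{KeyGen},\mathsf{Encode},\mathsf{Decode})$ is a zero-bit public-key pseudorandom code (PRC) robust to $\mathcal E$ if (i) the three algorithms are polynomial-time; (ii) (robustness) $\mathsf{Decode}(1^n,\mathsf{sk},\mathcal E(\mathsf{Encode}(1^n,\mathsf{pk})))=1$ with probability $1-\mathrm{negl}(n)$ over $(\mathsf{sk},\mathsf{pk})\gets\mathsf{KeyGen}(1^n)$ and all other randomness; (iii) (soundness) for every fixed string $c$, $\mathsf{Decode}(1^n,\mathsf{sk},c)=\bot$ with probability $1-\mathrm{negl}(n)$; (iv) (pseudorandomness) every polynomial-time adversary that is given $1^n$ and $\mathsf{pk}$ has negligible advantage in distinguishing an oracle that returns fresh samples of $\mathsf{Encode}(1^n,\mathsf{pk})$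 from an oracle that returns fresh uniformly random strings of the same length. The $\mathsf{LPN}_{g,\eta}$ assumption states that every polynomial-time adversary has negligible advantage (as a function of $n$) in distinguishing $(A,As\oplus e)$ from $(A,u)$, where $A\gets\mathbb F_2^{n\times g(n)}$, $s\gets\mathbb F_2^{g(n)}$, $u\gets\mathbb F_2^n$ are uniform and $e\gets\mathrm{Ber}(n,\eta)$. **Theorem.** Let $p,\eta\in(0,1/2)$, where $\eta$ is efficiently computable (a polynomial-time algorithm computes on input $1^n$ a binary approximation of $\eta$ with error at most $2^{-n}$). There are functions $g=\Omega(\log^2 n)$ and $t=\Theta(\log n)$ with $t(n)\le n$ such that the scheme $$\mathsf{LDPC\text{-}PRC}_0\bigl[n,\,g,\,t,\,\lfloor 0.99n\rfloor,\,\eta,\,(0.99n)^{-1/4}\bigr]$$ consists of polynomial-time algorithms, is sound, and is robust to every $p$-bounded channel; and, under the $\mathsf{LPN}_{g,\eta}$ assumption, it is also pseudorandom, i.e. it is a zero-bit public-key PRC robust to every $p$-bounded channel. -/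

import Mathlib

open scoped ENNReal Topology
open Filter Asymptotics

namespace PRC

/-! ### Strings, matrices, probabilities -/

/-- Bits, as elements of the field with two elements. -/
abbrev F2 : Type := ZMod 2

/-- Bit strings of length `n`, i.e. vectors in `F2 ^ n`. -/
abbrev Vec (n : ℕ) : Type := Fin n → F2

/-- The matrix `M`, written as a bit string row by row. -/
def flat {m k : ℕ} (M : Matrix (Fin m) (Fin k) F2) : Vec (m * k) :=
  fun i => M (finProdFinEquiv.symm i).1 (finProdFinEquiv.symm i).2

/-- The `m × k` matrix whose rows, one after another, form the bit string `v`. -/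
def unflat {m k : ℕ} (v : Vec (m * k)) : Matrix (Fin m) (Fin k) F2 :=
  Matrix.of fun i j => v (finProdFinEquiv (i, j))

/-- The bit string for a pair consisting of an `m × k` matrix and a vector of length `n`. -/
def packPair {m k n : ℕ} (M : Matrix (Fin m) (Fin k) F2) (z : Vec n) : Vec (m * k + n) :=
  Fin.append (flat M) z

/-- The matrix in the bit string of a pair. -/
def pairMatrix {m k n : ℕ} (v : Vec (m * k + n)) : Matrix (Fin m) (Fin k) F2 :=
  unflat fun i => v (Fin.castAdd n i)

/-- The vector in the bit string of a pair. -/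
def pairVec {m k n : ℕ} (v : Vec (m * k + n)) : Vec n :=
  fun i => v (Fin.natAdd (m * k) i)

theorem pairMatrix_packPair {m k n : ℕ} (M : Matrix (Fin m) (Fin k) F2) (z : Vec n) :
    pairMatrix (packPair M z) = M := by
  ext i j
  simp [pairMatrix, packPair, unflat, flat]

theorem pairVec_packPair {m k n : ℕ} (M : Matrix (Fin m) (Fin k) F2) (z : Vec n) :
    pairVec (packPair M z) = z := by
  ext i
  simp [pairVec, packPair]

/-- The probability of the event `S`. -/
noncomputable def pr {α : Type} (D : PMF α) (S : Set α) : ℝ := (D.toOuterMeasure S).toReal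

/-- The statistical (total variation) distance of the two distributions is at most `ε`. -/
def StatClose {α : Type} (D D' : PMF α) (ε : ℝ) : Prop :=
  ∀ S : Set α, |pr D S - pr D' S| ≤ ε

/-- Negligible functions: `k ^ c * μ k → 0` for every `c`. -/
def Negligible (μ : ℕ → ℝ) : Prop :=
  SuperpolynomialDecay atTop (fun k : ℕ => (k : ℝ)) μ

/-- The Bernoulli distribution on `{0, 1}` with expectation `η`. -/
noncomputable def ber (η : ℝ) (hη : η ∈ Set.Ico (0 : ℝ) (1 / 2)) : PMF F2 :=
  PMF.ofFintype (fun b => if b = 1 then ENNReal.ofReal η else ENNReal.ofReal (1 - η)) (by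
    have h : (Finset.univ : Finset F2) = {0, 1} := by decide
    have h1 : η < 1 := by linarith [hη.2]
    rw [h, Finset.sum_pair (by decide), if_neg (by decide), if_pos rfl,
      ← ENNReal.ofReal_add (by linarith) hη.1]
    simp)

/-- The vector of `n` independent samples from `D`. -/
noncomputable def iid {α : Type} (D : PMF α) : (n : ℕ) → PMF (Fin n → α)
  | 0 => PMF.pure Fin.elim0
  | n + 1 => D.bind fun a => (iid D n).map fun v => (Fin.cons a v : Fin (n + 1) → α)

/-! ### Probabilistic oracle machines with a step count

The machine model is a random access machine. The memory consists of two-dimensional arrays of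
natural numbers, indexed by natural numbers; a program mentions finitely many arrays. The only
arithmetic operations are addition and truncated subtraction, so that a machine of this kind and a
Turing machine simulate each other with polynomial overhead. Randomness comes from fair coins. -/

/-- The memory: entry `(i, j)` of array `a` is `m a i j`. -/
abbrev Mem : Type := ℕ → ℕ → ℕ → ℕ

/-- Expressions: constants, memory cells, sum and truncated difference. -/
inductive Expr : Type
  | const (c : ℕ)
  | get (a : ℕ) (i j : Expr)
  | add (e₁ e₂ : Expr)
  | sub (e₁ e₂ : Expr)

/-- The value of an expression. -/
def Expr.eval (m : Mem) : Expr → ℕ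
  | .const c => c
  | .get a i j => m a (i.eval m) (j.eval m)
  | .add e₁ e₂ => e₁.eval m + e₂.eval m
  | .sub e₁ e₂ => e₁.eval m - e₂.eval m

/-- Programs. `set a i j e` stores the value of `e` in cell `(i, j)` of array `a`, `coin a i j`
stores a fair random bit there, `query a` asks the oracle for a bit string and stores it in row `0`
of array `a` and its length in cell `(1, 0)` of array `a`. Tests are for being nonzero. -/
inductive Cmd : Type
  | skip
  | set (a : ℕ) (i j e : Expr)
  | coin (a : ℕ) (i j : Expr)
  | query (a : ℕ)
  | seq (c₁ c₂ : Cmd)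
  | ite (e : Expr) (c₁ c₂ : Cmd)
  | loop (e : Expr) (c : Cmd)

/-- Store `v` in cell `(i, j)` of array `a`. -/
def store (m : Mem) (a i j v : ℕ) : Mem :=
  fun a' i' j' => if a' = a ∧ i' = i ∧ j' = j then v else m a' i' j'

/-- Store an answer of the oracle. -/
def storeAnswer (m : Mem) (a : ℕ) (w : List F2) : Mem :=
  fun a' i' j' =>
    if a' = a ∧ i' = 0 ∧ j' < w.length then (w.getD j' 0).val
    else if a' = a ∧ i' = 1 ∧ j' = 0 then w.length
    else m a' i' j'

/-- A configuration: the commands that are still to be executed, and the memory. The machine has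
halted when no command is left. -/
abbrev Cfg : Type := List Cmd × Mem

/-- One step of the machine. The oracle takes no input and answers every query with a fresh sample
from `O`. -/
noncomputable def step (O : PMF (List F2)) : Cfg → PMF Cfg
  | ([], m) => PMF.pure ([], m)
  | (.skip :: K, m) => PMF.pure (K, m)
  | (.set a i j e :: K, m) => PMF.pure (K, store m a (i.eval m) (j.eval m) (e.eval m))
  | (.coin a i j :: K, m) =>
      (PMF.uniformOfFintype F2).map fun b => (K, store m a (i.eval m) (j.eval m) b.val)
  | (.query a :: K, m) => O.map fun w => (K, storeAnswer m a w)
  | (.seq c₁ c₂ :: K, m) => PMF.pure (c₁ :: c₂ :: K, m)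
  | (.ite e c₁ c₂ :: K, m) => PMF.pure (if e.eval m ≠ 0 then (c₁ :: K, m) else (c₂ :: K, m))
  | (.loop e c :: K, m) =>
      PMF.pure (if e.eval m ≠ 0 then (c :: .loop e c :: K, m) else (K, m))

/-- The distribution of the configuration after `T` steps. -/
noncomputable def run (O : PMF (List F2)) : ℕ → Cfg → PMF Cfg
  | 0, s => PMF.pure s
  | T + 1, s => (step O s).bind (run O T)

/-- The memory that holds the bit strings `inp`: row `k` of array `0` holds the `k`-th string, cell
`(k, 0)` of array `1` its length, and all other cells are `0`. -/
def load (inp : List (List F2)) : Mem := fun a i j =>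
  if a = 0 then ((inp.getD i []).getD j 0).val
  else if a = 1 ∧ j = 0 then (inp.getD i []).length
  else 0

/-- The machine with program `c` on input `inp`, after `T` steps. -/
noncomputable def runOn (O : PMF (List F2)) (c : Cmd) (T : ℕ) (inp : List (List F2)) : PMF Cfg :=
  run O T ([c], load inp)

/-- The machine halts within `T` steps, whatever the coins and the answers of the oracle `O`. -/
def HaltsWithin (O : PMF (List F2)) (c : Cmd) (T : ℕ) (inp : List (List F2)) : Prop :=
  ∀ s ∈ (runOn O c T inp).support, s.1 = []

/-- The total length of the input strings. -/
def inputLength (inp : List (List F2)) : ℕ := (inp.map List.length).sum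

/-- The `K` output strings, read from the rows of array `2`, with their lengths in column `0` of
array `3`. At most `T` symbols of each are read, where `T` is the time bound: a machine cannot write
more symbols than it makes steps. -/
def readStrings (K T : ℕ) (m : Mem) : List (List F2) :=
  List.ofFn fun k : Fin K =>
    List.ofFn fun j : Fin (min (m 3 k 0) T) => ((m 2 k j : ℕ) : F2)

/-- The output bit of a machine: whether cell `(0, 0)` of array `2` is `1`. -/
def readBit (m : Mem) : Bool := decide (m 2 0 0 = 1)

/-- The output bit of the machine with program `c` after `T` steps. -/
noncomputable def outBit (O : PMF (List F2)) (c : Cmd) (T : ℕ) (inp : List (List F2)) : PMF Bool :=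
  (runOn O c T inp).map fun s => readBit s.2

/-- The trivial oracle, which always returns the empty string. -/
noncomputable def noOracle : PMF (List F2) := PMF.pure []

/-- The strings `1 ^ n`. -/
def ones (n : ℕ) : List F2 := List.replicate n 1

/-- A randomized algorithm, given by the output distributions `out i` (on lists of `K` bit strings)
for the inputs `inp i`, is polynomial time: there is a machine that halts within a number of steps
polynomial in the total length of the input, for all coins, and whose output distribution has
statistical distance from `out i` at most negligible in the security parameter `sec i`. (A machine
that tosses fair coins cannot sample, say, exactly uniformly from a three-element set in bounded
time.) -/
def PolyTimeAlgorithm {I : Type} (sec : I → ℕ) (inp : I → List (List F2)) (K : ℕ)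
    (out : I → PMF (List (List F2))) : Prop :=
  ∃ (c : Cmd) (q : Polynomial ℕ) (μ : ℕ → ℝ), Negligible μ ∧ ∀ i,
    HaltsWithin noOracle c (q.eval (inputLength (inp i))) (inp i) ∧
    StatClose
      ((runOn noOracle c (q.eval (inputLength (inp i))) (inp i)).map fun s =>
        readStrings K (q.eval (inputLength (inp i))) s.2)
      (out i) (μ (sec i))

/-- The real number in `[0, 1]` with the binary digits `w` after the point. -/
noncomputable def binaryValue (w : List F2) : ℝ :=
  ∑ i : Fin w.length, ((w.get i).val : ℝ) / 2 ^ ((i : ℕ) + 1)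

/-- The real number `x ∈ [0, 1]` is efficiently computable: a polynomial-time algorithm computes on
input `1 ^ n` an approximation in binary with error at most `2 ^ (-n)`. -/
def EfficientlyComputable (x : ℝ) : Prop :=
  ∃ w : ℕ → List F2, (∀ n, |x - binaryValue (w n)| ≤ 1 / 2 ^ n) ∧
    PolyTimeAlgorithm (I := ℕ) (fun n => n) (fun n => [ones n]) 1 (fun n => PMF.pure [w n])

/-! ### Channels and zero-bit public-key pseudorandom codes -/

/-- Length-preserving binary channels: randomized maps of bit strings that preserve the length. -/
abbrev Channel : Type := (n : ℕ) → Vec n → PMF (Vec n)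

/-- `E` is `p`-bounded: on a uniformly random string of length `n`, the probability that the channel
changes more than `p * n` bits is negligible. -/
def IsBounded (p : ℝ) (E : Channel) : Prop :=
  ∃ μ : ℕ → ℝ, Negligible μ ∧ ∀ n,
    pr ((PMF.uniformOfFintype (Vec n)).bind fun x => (E n x).map fun y => y + x)
      {e | p * n < (hammingNorm e : ℝ)} ≤ μ n

/-- The syntax of a zero-bit public-key code over the binary alphabet, i.e. one with a single
message. All functions are indexed by the security parameter. `keyGen` samples a pair of secret key
and public key, `encode` maps a public key to a random encoding of the message, and `decode` maps a
secret key and any string to the message, which is written `some ()`, or to `⊥`, which is written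
`none`. -/
structure ZeroBitScheme where
  blockLen : ℕ → ℕ
  skLen : ℕ → ℕ
  pkLen : ℕ → ℕ
  keyGen : (lam : ℕ) → PMF (Vec (skLen lam) × Vec (pkLen lam))
  encode : (lam : ℕ) → Vec (pkLen lam) → PMF (Vec (blockLen lam))
  decode : (lam : ℕ) → Vec (skLen lam) → List F2 → PMF (Option Unit)

namespace ZeroBitScheme

variable (S : ZeroBitScheme)

/-- The three algorithms run in polynomial time. -/
structure PolyTime : Prop where
  keyGen : PolyTimeAlgorithm (I := ℕ) (fun lam => lam) (fun lam => [ones lam]) 2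
    (fun lam => (S.keyGen lam).map fun k => [List.ofFn k.1, List.ofFn k.2])
  encode : PolyTimeAlgorithm (I := Σ lam : ℕ, Vec (S.pkLen lam)) (fun i => i.1)
    (fun i => [ones i.1, List.ofFn i.2]) 1
    (fun i => (S.encode i.1 i.2).map fun x => [List.ofFn x])
  decode : PolyTimeAlgorithm (I := (Σ lam : ℕ, Vec (S.skLen lam)) × List F2) (fun i => i.1.1)
    (fun i => [ones i.1.1, List.ofFn i.1.2, i.2]) 1
    (fun i => (S.decode i.1.1 i.1.2 i.2).map fun o => [if o = some () then [1] else []])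

/-- Key generation, encoding, transmission through the channel, decoding. -/
noncomputable def transmit (E : Channel) (lam : ℕ) : PMF (Option Unit) :=
  (S.keyGen lam).bind fun k =>
    (S.encode lam k.2).bind fun x =>
      (E (S.blockLen lam) x).bind fun y => S.decode lam k.1 (List.ofFn y)

/-- Error correction, or robustness to the channel `E`. -/
def RobustTo (E : Channel) : Prop :=
  ∃ μ : ℕ → ℝ, Negligible μ ∧ ∀ lam, 1 - μ lam ≤ pr (S.transmit E lam) {some ()}

/-- Soundness: every fixed string is decoded to `⊥` with overwhelming probability. -/
def Sound : Prop :=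
  ∃ μ : ℕ → ℝ, Negligible μ ∧ ∀ (lam : ℕ) (c : List F2),
    1 - μ lam ≤ pr ((S.keyGen lam).bind fun k => S.decode lam k.1 c) {none}

/-- The output of the adversary `A`, which gets the public key and oracle access to `encode`. -/
noncomputable def realGame (A : Cmd) (q : Polynomial ℕ) (lam : ℕ) : PMF Bool :=
  (S.keyGen lam).bind fun k =>
    outBit ((S.encode lam k.2).map List.ofFn) A (q.eval (lam + S.pkLen lam))
      [ones lam, List.ofFn k.2]

/-- The output of the adversary `A`, which gets the public key and an oracle that returns fresh
uniformly random strings. -/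
noncomputable def idealGame (A : Cmd) (q : Polynomial ℕ) (lam : ℕ) : PMF Bool :=
  (S.keyGen lam).bind fun k =>
    outBit ((PMF.uniformOfFintype (Vec (S.blockLen lam))).map List.ofFn) A
      (q.eval (lam + S.pkLen lam)) [ones lam, List.ofFn k.2]

/-- Pseudorandomness against all adversaries `A` that run in polynomial time, for all public keys
and all oracles that return strings of the right length. -/
def Pseudorandom : Prop :=
  ∀ (A : Cmd) (q : Polynomial ℕ),
    (∀ (lam : ℕ) (pk : Vec (S.pkLen lam)) (O : PMF (Vec (S.blockLen lam))),
      HaltsWithin (O.map List.ofFn) A (q.eval (lam + S.pkLen lam)) [ones lam, List.ofFn pk]) →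
    Negligible fun lam => |pr (S.realGame A q lam) {true} - pr (S.idealGame A q lam) {true}|

/-- `S` is a zero-bit public-key pseudorandom code with robustness to the channel `E`. -/
structure IsPublicKeyPRC (E : Channel) : Prop where
  polyTime : S.PolyTime
  robust : S.RobustTo E
  sound : S.Sound
  pseudorandom : S.Pseudorandom

end ZeroBitScheme

/-! ### The LPN assumption -/

/-- The input of an LPN adversary: `1 ^ n`, a matrix and a vector. -/
def lpnInput {n g : ℕ} (A : Matrix (Fin n) (Fin g) F2) (b : Vec n) : List (List F2) :=
  [ones n, List.ofFn (flat A), List.ofFn b]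

/-- The distribution of `(A, A s + e)`. -/
noncomputable def lpnSamples (n g : ℕ) (η : ℝ) (hη : η ∈ Set.Ico (0 : ℝ) (1 / 2)) :
    PMF (Matrix (Fin n) (Fin g) F2 × Vec n) :=
  (PMF.uniformOfFintype (Matrix (Fin n) (Fin g) F2)).bind fun A =>
    (PMF.uniformOfFintype (Vec g)).bind fun s =>
      (iid (ber η hη) n).map fun e => (A, A.mulVec s + e)

/-- The distribution of `(A, u)` with uniform `u`. -/
noncomputable def lpnUniform (n g : ℕ) : PMF (Matrix (Fin n) (Fin g) F2 × Vec n) :=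
  (PMF.uniformOfFintype (Matrix (Fin n) (Fin g) F2)).bind fun A =>
    (PMF.uniformOfFintype (Vec n)).map fun u => (A, u)

/-- The (decisional, constant-noise) LPN assumption with secrets of size `g n`: no polynomial-time
adversary `D` distinguishes `(A, A s + e)` from `(A, u)`. -/
def LPN (g : ℕ → ℕ) (η : ℝ) (hη : η ∈ Set.Ico (0 : ℝ) (1 / 2)) : Prop :=
  ∀ (D : Cmd) (q : Polynomial ℕ),
    (∀ (n : ℕ) (A : Matrix (Fin n) (Fin (g n)) F2) (b : Vec n),
      HaltsWithin noOracle D (q.eval (inputLength (lpnInput A b))) (lpnInput A b)) →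
    Negligible fun n =>
      |pr ((lpnSamples n (g n) η hη).bind fun x =>
            outBit noOracle D (q.eval (inputLength (lpnInput x.1 x.2))) (lpnInput x.1 x.2)) {true}
        - pr ((lpnUniform n (g n)).bind fun x =>
            outBit noOracle D (q.eval (inputLength (lpnInput x.1 x.2))) (lpnInput x.1 x.2)) {true}|

/-! ### Random LDPC codes and the code built from them -/

/-- The set of `r × n` matrices all of whose rows have weight `t`. -/
def sparseMatrices (t r n : ℕ) : Finset (Matrix (Fin r) (Fin n) F2) :=
  Finset.univ.filter fun P => ∀ i, hammingNorm (P i) = t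

theorem sparseMatrices_nonempty {t n : ℕ} (h : t ≤ n) (r : ℕ) :
    (sparseMatrices t r n).Nonempty := by
  refine ⟨Matrix.of fun _ j => if (j : ℕ) < t then 1 else 0, ?_⟩
  simp only [sparseMatrices, Finset.mem_filter, Finset.mem_univ, true_and]
  intro i
  have : (Finset.univ.filter fun j : Fin n => (j : ℕ) < t).card = t := by
    rw [Fin.card_filter_val_lt, min_eq_right h]
  simpa [hammingNorm] using this

/-- The set of `n × g` matrices `G` with `P * G = 0`. -/
def kernelMatrices {r n : ℕ} (P : Matrix (Fin r) (Fin n) F2) (g : ℕ) :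
    Finset (Matrix (Fin n) (Fin g) F2) :=
  Finset.univ.filter fun G => P * G = 0

theorem kernelMatrices_nonempty {r n : ℕ} (P : Matrix (Fin r) (Fin n) F2) (g : ℕ) :
    (kernelMatrices P g).Nonempty :=
  ⟨0, by simp [kernelMatrices]⟩

/-- The distribution `LDPC[n, g, t, r]`: a uniformly random `r × n` matrix `P` with rows of weight
`t`, and a uniformly random `n × g` matrix `G` subject to `P * G = 0`. -/
noncomputable def ldpc (n g t r : ℕ) (ht : t ≤ n) :
    PMF (Matrix (Fin r) (Fin n) F2 × Matrix (Fin n) (Fin g) F2) :=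
  (PMF.uniformOfFinset (sparseMatrices t r n) (sparseMatrices_nonempty ht r)).bind fun P =>
    (PMF.uniformOfFinset (kernelMatrices P g) (kernelMatrices_nonempty P g)).map fun G => (P, G)

open Classical in
/-- The zero-bit code `LDPC-PRC₀[n, g, t, r, η, ζ]`; the block length `n` is the security parameter.
The secret key is `(P, z)` and the public key is `(G, z)`. Strings whose length differs from the
block length are decoded to `⊥`. -/
noncomputable def ldpcPRC (g t r : ℕ → ℕ) (η : ℝ) (hη : η ∈ Set.Ico (0 : ℝ) (1 / 2)) (ζ : ℕ → ℝ)
    (ht : ∀ n, t n ≤ n) : ZeroBitScheme where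
  blockLen n := n
  skLen n := r n * n + n
  pkLen n := n * g n + n
  keyGen n :=
    (ldpc n (g n) (t n) (r n) (ht n)).bind fun PG =>
      (PMF.uniformOfFintype (Vec n)).map fun z => (packPair PG.1 z, packPair PG.2 z)
  encode n pk :=
    (PMF.uniformOfFintype (Vec (g n))).bind fun u =>
      (iid (ber η hη) n).map fun e => (pairMatrix pk).mulVec u + pairVec pk + e
  decode n sk x :=
    let P : Matrix (Fin (r n)) (Fin n) F2 := pairMatrix sk
    let z : Vec n := pairVec sk
    let x' : Vec n := fun i => x.getD i 0
    PMF.pure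
      (if x.length = n ∧ (hammingNorm (P.mulVec x' + P.mulVec z) : ℝ) < (1 / 2 - ζ n) * r n
        then some () else none)

end PRC

namespace PRC

/-! The row weight is `t = ⌊log₂ n / K⌋` for a constant `K = 8m`, and `g = t²`. All statistical
statements rest on one fact: for fixed `y` and a uniformly random vector `x` of weight `t`, the mean
of `(-1)^(x·y)` (the `bias`) equals, up to an error `t²/n`, the `t`-th power of the mean sign `1 -
2|y|/n` of the coordinates of `y` (`abs_bias_sub_pow_le`).

Robustness. Let `e` be the noise of the encoder and `e'` the error of the channel. Since `PG = 0`,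
the decoder sees the syndrome `P(e + e')`. The pad `z` makes the transmitted word uniform even when
`P`, `G`, `u` and `e` are given, so `e'` is independent of them and rarely has weight above `pn`
(`prob_transmit`). Then `e + e'` has mean sign at least a positive constant `2^(-m)`, every parity
check has bias at least about `2^(-mt) ≥ n^(-1/8)`, and this dominates the slack of order `n^(-1/4)`
in the threshold. A Chernoff bound over the independent rows finishes the argument (`code_robust`).

Soundness. For a fixed string `c`, the decoder computes `P(c + z)` with `c + z` uniform. Its mean
sign is below `n^(-1/4)` except with negligible probability, so the checks are almost unbiased and
the threshold is missed (`code_sound`).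

Pseudorandomness. The generator matrix alone is statistically close to uniform
(`eventually_dist_genDist`). To see this, the rows of `P` are added one at a time. The change caused
by the next row is controlled by a second moment, hence by `2^g` times the probability that the sum
of two random sparse rows lies in the span of the `j` rows that are already there. Fourier analysis
bounds this probability by the mean over uniform `w` of `bias(w)² (1 + bias(w))^j`
(`sum_iid_delta_le`). Vectors `w` with small mean sign contribute about `1 / (n choose t) =
2^(-Ω(t²))` by Parseval; for intermediate ones the probability is exponentially small and the power
is `e^(o(n))`; for nearly constant `w` the power is at most `2^j` with `j ≤ 0.99n`, which the
probability, close to `2^(-n)`, compensates (`biasMean_le`). With a uniform matrix `G` and a uniform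
`z`, an encoding is an LPN sample shifted by `z`, and a hybrid argument over the queries of the
adversary reduces to LPN (`pseudorandom_code`).

Running time. The algorithms and the reduction are explicit programs of the machine model. A program
logic (`Spec`) couples the final memory with an ideal random variable. Sparse rows come from
selection sampling, kernel matrices from Gaussian elimination, noise from comparing a random number
with an approximation of `η`; the decoder is exact after taking fourth powers in its threshold. -/

/-! ### Expectations -/

/-- The expectation of a nonnegative function. -/
noncomputable def expect {α : Type} (X : PMF α) (f : α → ℝ≥0∞) : ℝ≥0∞ := ∑' a, X a * f a

section expect
variable {α β : Type}

theorem expect_pure (a : α) (f : α → ℝ≥0∞) : expect (PMF.pure a) f = f a := by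
  unfold expect
  rw [tsum_eq_single a]
  · simp
  · intro b hb; simp [hb]

theorem expect_bind (X : PMF α) (Y : α → PMF β) (f : β → ℝ≥0∞) :
    expect (X.bind Y) f = expect X fun a => expect (Y a) f := by
  unfold expect
  simp only [PMF.bind_apply, ← ENNReal.tsum_mul_right, ← ENNReal.tsum_mul_left]
  rw [ENNReal.tsum_comm]
  simp only [mul_assoc]

theorem expect_map (X : PMF α) (g : α → β) (f : β → ℝ≥0∞) :
    expect (X.map g) f = expect X fun a => f (g a) := by
  rw [← PMF.bind_pure_comp, expect_bind]
  simp [expect_pure]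

theorem expect_const (X : PMF α) (c : ℝ≥0∞) : (expect X fun _ => c) = c := by
  simp [expect, ENNReal.tsum_mul_right]

theorem expect_mono_support {X : PMF α} {f g : α → ℝ≥0∞} (h : ∀ a ∈ X.support, f a ≤ g a) :
    expect X f ≤ expect X g := by
  refine ENNReal.tsum_le_tsum fun a => ?_
  by_cases ha : a ∈ X.support
  · gcongr; exact h a ha
  · rw [PMF.mem_support_iff, not_not] at ha; simp [ha]

theorem expect_mono {X : PMF α} {f g : α → ℝ≥0∞} (h : ∀ a, f a ≤ g a) :
    expect X f ≤ expect X g := expect_mono_support fun a _ => h a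

theorem expect_add (X : PMF α) (f g : α → ℝ≥0∞) :
    (expect X fun a => f a + g a) = expect X f + expect X g := by
  simp [expect, mul_add, ENNReal.tsum_add]

theorem expect_const_mul (X : PMF α) (c : ℝ≥0∞) (f : α → ℝ≥0∞) :
    (expect X fun a => c * f a) = c * expect X f := by
  simp only [expect, ← ENNReal.tsum_mul_left]
  refine tsum_congr fun a => by ring

theorem expect_le_const {X : PMF α} {f : α → ℝ≥0∞} {c : ℝ≥0∞} (h : ∀ a ∈ X.support, f a ≤ c) :
    expect X f ≤ c := (expect_mono_support h).trans_eq (expect_const X c)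

theorem expect_comm (X : PMF α) (Y : PMF β) (f : α → β → ℝ≥0∞) :
    (expect X fun a => expect Y (f a)) = expect Y fun b => expect X fun a => f a b := by
  simp only [expect, ← ENNReal.tsum_mul_left]
  rw [ENNReal.tsum_comm]
  refine tsum_congr fun b => tsum_congr fun a => by ring

theorem expect_fintype [Fintype α] (X : PMF α) (f : α → ℝ≥0∞) :
    expect X f = ∑ a, X a * f a := tsum_fintype _

/-- The probability of an event, in `[0, ∞]`. -/
noncomputable def prob (X : PMF α) (S : Set α) : ℝ≥0∞ := expect X (S.indicator 1)

theorem prob_eq (X : PMF α) (S : Set α) : X.toOuterMeasure S = prob X S := by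
  rw [PMF.toOuterMeasure_apply, prob, expect]
  refine tsum_congr fun a => ?_
  by_cases h : a ∈ S <;> simp [h]

theorem pr_eq (X : PMF α) (S : Set α) : pr X S = (prob X S).toReal := by rw [pr, prob_eq]

theorem indicator_one_le (S : Set α) (a : α) : (S.indicator 1 a : ℝ≥0∞) ≤ 1 := by
  by_cases h : a ∈ S <;> simp [h]

theorem prob_le_one (X : PMF α) (S : Set α) : prob X S ≤ 1 :=
  expect_le_const fun a _ => indicator_one_le S a

theorem prob_ne_top (X : PMF α) (S : Set α) : prob X S ≠ ⊤ :=
  ((prob_le_one X S).trans_lt ENNReal.one_lt_top).ne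

theorem prob_eq_ofReal (X : PMF α) (S : Set α) : prob X S = ENNReal.ofReal (pr X S) := by
  rw [pr_eq, ENNReal.ofReal_toReal (prob_ne_top X S)]

theorem pr_nonneg (X : PMF α) (S : Set α) : 0 ≤ pr X S := ENNReal.toReal_nonneg

theorem pr_le_one (X : PMF α) (S : Set α) : pr X S ≤ 1 := by
  rw [pr_eq]; exact ENNReal.toReal_le_of_le_ofReal zero_le_one (by simpa using prob_le_one X S)

theorem pr_le_iff (X : PMF α) (S : Set α) {c : ℝ} (hc : 0 ≤ c) :
    pr X S ≤ c ↔ prob X S ≤ ENNReal.ofReal c := by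
  rw [prob_eq_ofReal, ENNReal.ofReal_le_ofReal_iff hc]

theorem prob_add_compl (X : PMF α) (S : Set α) : prob X S + prob X Sᶜ = 1 := by
  rw [prob, prob, ← expect_add, ← expect_const X 1]
  congr 1; funext a
  by_cases h : a ∈ S <;> simp [h]

theorem pr_compl (X : PMF α) (S : Set α) : pr X Sᶜ = 1 - pr X S := by
  have h := congrArg ENNReal.toReal (prob_add_compl X S)
  rw [ENNReal.toReal_add (prob_ne_top _ _) (prob_ne_top _ _), ← pr_eq, ← pr_eq] at h
  simp at h; linarith

theorem prob_mono {X : PMF α} {S S' : Set α} (h : ∀ a ∈ X.support, a ∈ S → a ∈ S') :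
    prob X S ≤ prob X S' := by
  refine expect_mono_support fun a ha => ?_
  by_cases hS : a ∈ S
  · simp [hS, h a ha hS]
  · simp [hS]

theorem prob_union_le (X : PMF α) (S S' : Set α) : prob X (S ∪ S') ≤ prob X S + prob X S' := by
  rw [prob, prob, prob, ← expect_add]
  refine expect_mono fun a => ?_
  by_cases h : a ∈ S <;> by_cases h' : a ∈ S' <;> simp [h, h']

theorem prob_bind (X : PMF α) (Y : α → PMF β) (S : Set β) :
    prob (X.bind Y) S = expect X fun a => prob (Y a) S := expect_bind _ _ _

theorem prob_map (X : PMF α) (g : α → β) (S : Set β) :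
    prob (X.map g) S = prob X (g ⁻¹' S) := by
  rw [prob, expect_map]; rfl

theorem prob_pure (a : α) (S : Set α) : prob (PMF.pure a) S = S.indicator 1 a := expect_pure _ _

/-- Splitting an expectation of a function bounded by `1` according to an event. -/
theorem expect_le_prob_add {X : PMF α} {f : α → ℝ≥0∞} (S : Set α) {c : ℝ≥0∞}
    (h1 : ∀ a, f a ≤ 1) (h : ∀ a ∉ S, f a ≤ c) : expect X f ≤ prob X S + c := by
  rw [← expect_const X c, prob, ← expect_add]
  refine expect_mono fun a => ?_
  by_cases ha : a ∈ S
  · simpa [ha] using (h1 a).trans le_self_add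
  · simpa [ha] using h a ha

end expect

/-! ### Statistical distance -/

/-- The statistical distance is at most `ε`. -/
def Dist {α : Type} (X Y : PMF α) (ε : ℝ≥0∞) : Prop :=
  ∀ f : α → ℝ≥0∞, (∀ a, f a ≤ 1) → expect X f ≤ expect Y f + ε

namespace Dist
variable {α β : Type}

theorem refl (X : PMF α) : Dist X X 0 := fun f _ => by simp

theorem of_eq {X Y : PMF α} (h : X = Y) : Dist X Y 0 := h ▸ refl X

theorem mono {X Y : PMF α} {ε δ : ℝ≥0∞} (h : Dist X Y ε) (hε : ε ≤ δ) : Dist X Y δ :=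
  fun f hf => (h f hf).trans (by gcongr)

/-- The test `1 - f` exchanges the roles of the two distributions, so the one-sided inequality in
`Dist` suffices. All expectations of tests are finite, which permits the cancellation. -/
theorem symm {X Y : PMF α} {ε : ℝ≥0∞} (h : Dist X Y ε) : Dist Y X ε := by
  intro f hf
  have h1 : ∀ Z : PMF α, expect Z (fun a => 1 - f a) + expect Z f = 1 := fun Z => by
    rw [← expect_add]
    refine Eq.trans ?_ (expect_const Z 1)
    congr 1; funext a
    exact tsub_add_cancel_of_le (hf a)
  have h2 := h (fun a => 1 - f a) fun a => tsub_le_self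
  have hY : expect Y (fun a => 1 - f a) ≠ ⊤ := fun h => by
    have := h1 Y; simp [h] at this
  refine (ENNReal.add_le_add_iff_left hY).1 ?_
  rw [h1 Y]
  calc 1 = _ := (h1 X).symm
    _ ≤ expect Y (fun a => 1 - f a) + ε + expect X f := by gcongr
    _ = _ := by ring

theorem trans {X Y Z : PMF α} {ε δ : ℝ≥0∞} (h : Dist X Y ε) (h' : Dist Y Z δ) :
    Dist X Z (ε + δ) := fun f hf =>
  (h f hf).trans ((add_le_add_left (h' f hf) ε).trans_eq (by ring))

/-- The conditional expectation of a test in the second stage is again a test for the first stage.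
This is why tests are functions with values in `[0, 1]` and not only events. -/
theorem bind {X X' : PMF α} {Y Y' : α → PMF β} {ε δ : ℝ≥0∞} (h : Dist X X' ε)
    (h' : ∀ a ∈ X.support, Dist (Y a) (Y' a) δ) : Dist (X.bind Y) (X'.bind Y') (ε + δ) := by
  intro f hf
  rw [expect_bind, expect_bind]
  calc _ ≤ expect X (fun a => expect (Y' a) f + δ) := expect_mono_support fun a ha => h' a ha f hf
    _ = expect X (fun a => expect (Y' a) f) + δ := by rw [expect_add, expect_const]
    _ ≤ expect X' (fun a => expect (Y' a) f) + ε + δ := by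
      gcongr; exact h _ fun a => expect_le_const fun b _ => hf b
    _ = _ := by ring

theorem bind_left {X X' : PMF α} (Y : α → PMF β) {ε : ℝ≥0∞} (h : Dist X X' ε) :
    Dist (X.bind Y) (X'.bind Y) ε := by
  simpa using h.bind (Y := Y) (Y' := Y) fun a _ => refl _

theorem bind_right (X : PMF α) {Y Y' : α → PMF β} {ε : ℝ≥0∞}
    (h : ∀ a ∈ X.support, Dist (Y a) (Y' a) ε) : Dist (X.bind Y) (X.bind Y') ε := by
  simpa using (refl X).bind h

/-- The average of pointwise distances. -/
theorem bind_expect (X : PMF α) {Y Y' : α → PMF β} {ε : α → ℝ≥0∞}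
    (h : ∀ a, Dist (Y a) (Y' a) (ε a)) : Dist (X.bind Y) (X.bind Y') (expect X ε) := by
  intro f hf
  rw [expect_bind, expect_bind, ← expect_add]
  exact expect_mono fun a => h a f hf

theorem map {X X' : PMF α} (g : α → β) {ε : ℝ≥0∞} (h : Dist X X' ε) :
    Dist (X.map g) (X'.map g) ε := by
  rw [← PMF.bind_pure_comp, ← PMF.bind_pure_comp]; exact h.bind_left _

theorem one (X Y : PMF α) : Dist X Y 1 := fun _ hf =>
  (expect_le_const fun a _ => hf a).trans le_add_self

theorem prob_le {X Y : PMF α} {ε : ℝ≥0∞} (h : Dist X Y ε) (S : Set α) :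
    prob X S ≤ prob Y S + ε := h _ (indicator_one_le S)

theorem abs_pr_le {X Y : PMF α} {ε : ℝ} (h : Dist X Y (ENNReal.ofReal ε)) (hε : 0 ≤ ε)
    (S : Set α) : |pr X S - pr Y S| ≤ ε := by
  have key : ∀ {X Y : PMF α}, Dist X Y (ENNReal.ofReal ε) → pr X S - pr Y S ≤ ε := by
    intro X Y h
    have := h.prob_le S
    rw [prob_eq_ofReal, prob_eq_ofReal, ← ENNReal.ofReal_add (pr_nonneg _ _) hε,
      ENNReal.ofReal_le_ofReal_iff (add_nonneg (pr_nonneg _ _) hε)] at this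
    linarith
  rw [abs_le]
  exact ⟨by linarith [key h.symm], key h⟩

theorem statClose {X Y : PMF α} {ε : ℝ} (h : Dist X Y (ENNReal.ofReal ε)) (hε : 0 ≤ ε) :
    StatClose X Y ε := fun S => h.abs_pr_le hε S

/-- The customary factor `1/2` in front of the `ℓ¹` distance is dropped; the loss is harmless here.
-/
theorem of_sum_abs [Fintype α] {X Y : PMF α} {ε : ℝ}
    (h : ∑ a, |(X a).toReal - (Y a).toReal| ≤ ε) : Dist X Y (ENNReal.ofReal ε) := by
  intro f hf
  have hε : 0 ≤ ε := (Finset.sum_nonneg fun _ _ => abs_nonneg _).trans h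
  calc expect X f = ∑ a, X a * f a := expect_fintype _ _
    _ ≤ ∑ a, (Y a * f a + ENNReal.ofReal |(X a).toReal - (Y a).toReal|) := by
      refine Finset.sum_le_sum fun a _ => ?_
      have : X a ≤ Y a + ENNReal.ofReal |(X a).toReal - (Y a).toReal| := by
        rw [← ENNReal.ofReal_toReal (X.apply_ne_top a), ← ENNReal.ofReal_toReal (Y.apply_ne_top a),
          ← ENNReal.ofReal_add (by simp) (abs_nonneg _)]
        refine ENNReal.ofReal_le_ofReal ?_
        simp only [ENNReal.toReal_ofReal, ENNReal.toReal_nonneg]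
        linarith [le_abs_self ((X a).toReal - (Y a).toReal)]
      calc X a * f a ≤ (Y a + ENNReal.ofReal |(X a).toReal - (Y a).toReal|) * f a := by gcongr
        _ ≤ _ := by
          rw [add_mul]; gcongr
          exact mul_le_of_le_one_right' (hf a)
    _ = expect Y f + ENNReal.ofReal (∑ a, |(X a).toReal - (Y a).toReal|) := by
      rw [Finset.sum_add_distrib, expect_fintype,
        ENNReal.ofReal_sum_of_nonneg fun _ _ => abs_nonneg _]
    _ ≤ _ := by gcongr

theorem iid {X Y : PMF α} {ε : ℝ≥0∞} (h : Dist X Y ε) (n : ℕ) :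
    Dist (PRC.iid X n) (PRC.iid Y n) (n * ε) := by
  induction n with
  | zero => simpa [PRC.iid] using refl _
  | succ n ih =>
    have := h.bind (Y := fun a => (PRC.iid X n).map fun v => (Fin.cons a v : Fin (n + 1) → α))
      (Y' := fun a => (PRC.iid Y n).map fun v => (Fin.cons a v : Fin (n + 1) → α))
      fun a _ => ih.map _
    refine this.mono (le_of_eq ?_)
    push_cast; ring

end Dist

/-! ### Independent samples -/

section iid
variable {α β : Type}

/-- Independence in the form needed below: with exponentials as factors it gives the Chernoff
bounds, with indicators of points the point probabilities. -/
theorem expect_iid_prod (D : PMF α) (n : ℕ) (f : Fin n → α → ℝ≥0∞) :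
    (expect (iid D n) fun v => ∏ i, f i (v i)) = ∏ i, expect D (f i) := by
  induction n with
  | zero => simp [expect_const]
  | succ n ih =>
    simp only [iid, expect_bind, expect_map, Fin.prod_univ_succ, Fin.cons_zero, Fin.cons_succ]
    simp only [expect_const_mul, ih fun i => f i.succ]
    simp only [mul_comm _ (∏ i : Fin n, expect D (f i.succ)), expect_const_mul]

theorem iid_apply (D : PMF α) (n : ℕ) (v : Fin n → α) : iid D n v = ∏ i, D (v i) := by
  classical
  have h1 : ∀ (X : PMF (Fin n → α)), expect X (fun w => if w = v then 1 else 0) = X v := by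
    intro X
    rw [expect, tsum_eq_single v] <;> simp +contextual
  have h2 : ∀ i, expect D (fun a => if a = v i then (1 : ℝ≥0∞) else 0) = D (v i) := by
    intro i
    rw [expect, tsum_eq_single (v i)] <;> simp +contextual
  rw [← h1, ← Finset.prod_congr rfl fun i _ => h2 i, ← expect_iid_prod]
  congr 1; funext w
  by_cases h : w = v
  · simp [h]
  · obtain ⟨i, hi⟩ := Function.ne_iff.1 h
    rw [if_neg h, Finset.prod_eq_zero (Finset.mem_univ i) (by simp [hi])]

theorem iid_uniform [Fintype α] [Nonempty α] (n : ℕ) :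
    iid (PMF.uniformOfFintype α) n = PMF.uniformOfFintype (Fin n → α) := by
  ext v
  simp [iid_apply]
  rw [ENNReal.inv_pow]

theorem exp_sub_one_le {l : ℝ} (h0 : 0 ≤ l) (h1 : l ≤ 1) : Real.exp l - 1 ≤ l + l ^ 2 := by
  have := Real.abs_exp_sub_one_sub_id_le (x := l) (by rwa [abs_of_nonneg h0])
  linarith [le_abs_self (Real.exp l - 1 - l)]

/-- A Chernoff bound for the number of events that occur among independent samples. -/
theorem iid_tail (D : PMF α) (n : ℕ) (S : Fin n → Set α) (β : Fin n → ℝ)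
    (hβ : ∀ i, pr D (S i) ≤ β i) (hB : ∑ i, β i ≤ n) {δ : ℝ} (h0 : 0 ≤ δ) (h2 : δ ≤ 2) :
    pr (iid D n) {v | ∑ i, β i + δ * n ≤ ∑ i, (S i).indicator (1 : α → ℝ) (v i)}
      ≤ Real.exp (-(δ ^ 2 * n / 4)) := by
  rw [pr_le_iff _ _ (Real.exp_pos _).le]
  -- This value minimizes the exponent `-l δ n + l² n`, which then equals `-δ² n / 4`. The
  -- assumption `δ ≤ 2` gives `l ≤ 1`, as the quadratic bound for `exp` requires.
  set l := δ / 2 with hl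
  set B := ∑ i, β i with hBdef
  have hl0 : 0 ≤ l := by positivity
  have hl1 : l ≤ 1 := by linarith
  have hexp : 1 ≤ Real.exp l := Real.one_le_exp hl0
  have hE : ∀ i, (expect D fun a => ENNReal.ofReal (Real.exp (l * (S i).indicator 1 a)))
      ≤ ENNReal.ofReal (Real.exp ((l + l ^ 2) * β i)) := by
    intro i
    have hb : 0 ≤ β i := (pr_nonneg _ _).trans (hβ i)
    have h3 : (expect D fun a => ENNReal.ofReal (Real.exp (l * (S i).indicator 1 a)))
        = 1 + ENNReal.ofReal (Real.exp l - 1) * prob D (S i) := by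
      rw [prob, ← expect_const_mul, ← expect_const D 1, ← expect_add]
      congr 1; funext a
      by_cases h : a ∈ S i
      · simp only [h, Set.indicator_of_mem, Pi.one_apply, mul_one]
        rw [← ENNReal.ofReal_one, ← ENNReal.ofReal_add zero_le_one (by linarith)]
        congr 1; ring
      · simp [h]
    rw [h3, prob_eq_ofReal, ← ENNReal.ofReal_mul (by linarith), ← ENNReal.ofReal_one,
      ← ENNReal.ofReal_add zero_le_one (mul_nonneg (by linarith) (pr_nonneg _ _))]
    refine ENNReal.ofReal_le_ofReal ?_
    calc 1 + (Real.exp l - 1) * pr D (S i) ≤ 1 + (l + l ^ 2) * β i := by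
          gcongr
          · exact pr_nonneg _ _
          · exact exp_sub_one_le hl0 hl1
          · exact hβ i
      _ ≤ _ := by linarith [Real.add_one_le_exp ((l + l ^ 2) * β i)]
  calc prob (iid D n) {v | B + δ * n ≤ ∑ i, (S i).indicator (1 : α → ℝ) (v i)}
      ≤ expect (iid D n) fun v => ENNReal.ofReal (Real.exp (-(l * (B + δ * n)))) *
          ∏ i, ENNReal.ofReal (Real.exp (l * (S i).indicator 1 (v i))) := by
        refine expect_mono fun v => ?_
        by_cases h : v ∈ {v : Fin n → α | B + δ * n ≤ ∑ i, (S i).indicator (1 : α → ℝ) (v i)}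
        · rw [Set.indicator_of_mem h, Pi.one_apply,
            ← ENNReal.ofReal_prod_of_nonneg fun _ _ => (Real.exp_pos _).le, ← Real.exp_sum,
            ← ENNReal.ofReal_mul (Real.exp_pos _).le, ← Real.exp_add, ← Finset.mul_sum]
          rw [ENNReal.one_le_ofReal, Real.one_le_exp_iff]
          have h' : B + δ * n ≤ ∑ i, (S i).indicator (1 : α → ℝ) (v i) := h
          nlinarith
        · rw [Set.indicator_of_notMem h]; exact zero_le
    _ = ENNReal.ofReal (Real.exp (-(l * (B + δ * n)))) *
          ∏ i, expect D fun a => ENNReal.ofReal (Real.exp (l * (S i).indicator 1 a)) := by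
        rw [expect_const_mul,
          expect_iid_prod D n fun i a => ENNReal.ofReal (Real.exp (l * (S i).indicator 1 a))]
    _ ≤ ENNReal.ofReal (Real.exp (-(l * (B + δ * n)))) *
          ∏ i, ENNReal.ofReal (Real.exp ((l + l ^ 2) * β i)) := by
        gcongr; exact hE _
    _ = ENNReal.ofReal (Real.exp (-(l * (B + δ * n)) + (l + l ^ 2) * B)) := by
        rw [← ENNReal.ofReal_prod_of_nonneg fun _ _ => (Real.exp_pos _).le, ← Real.exp_sum,
          ← ENNReal.ofReal_mul (Real.exp_pos _).le, ← Real.exp_add, ← Finset.mul_sum]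
    _ ≤ _ := by
        refine ENNReal.ofReal_le_ofReal (Real.exp_le_exp.2 ?_)
        have : l ^ 2 * B ≤ l ^ 2 * n := by gcongr
        rw [hl] at this ⊢
        nlinarith

/-- The number of independent samples outside `S` is rarely small. -/
theorem iid_tail_exp (D : PMF α) (n : ℕ) (S : Set α) {z : ℝ} (hz : 0 < z) (hz1 : z ≤ 1) (k : ℝ) :
    pr (iid D n) {v | ∑ i, S.indicator (1 : α → ℝ) (v i) ≤ k}
      ≤ (1 - (1 - z) * pr D S) ^ n * z ^ (-k) := by
  have hp := pr_le_one D S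
  have hp0 := pr_nonneg D S
  have hb : 0 ≤ 1 - (1 - z) * pr D S := by nlinarith
  rw [pr_le_iff _ _ (by positivity)]
  -- Markov's inequality is applied to `z` raised to the number of hits, which is large for `z ≤ 1`
  -- when there are few hits.
  have h3 : (expect D fun a => ENNReal.ofReal (z ^ (S.indicator 1 a : ℝ)))
        = ENNReal.ofReal (1 - (1 - z) * pr D S) := by
    have e : (fun a => ENNReal.ofReal (z ^ (S.indicator 1 a : ℝ)))
        = fun a => ENNReal.ofReal z * S.indicator 1 a + Sᶜ.indicator 1 a := by
      funext a
      by_cases h : a ∈ S <;> simp [h]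
    rw [e, expect_add, expect_const_mul, ← prob, ← prob, prob_eq_ofReal, prob_eq_ofReal, pr_compl,
      ← ENNReal.ofReal_mul hz.le, ← ENNReal.ofReal_add (by positivity) (by linarith)]
    congr 1; ring
  calc prob (iid D n) {v | ∑ i, S.indicator (1 : α → ℝ) (v i) ≤ k}
      ≤ expect (iid D n) fun v => ENNReal.ofReal (z ^ (-k)) *
          ∏ i, ENNReal.ofReal (z ^ (S.indicator 1 (v i) : ℝ)) := by
        refine expect_mono fun v => ?_
        by_cases h : v ∈ {v : Fin n → α | ∑ i, S.indicator (1 : α → ℝ) (v i) ≤ k}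
        · rw [Set.indicator_of_mem h, Pi.one_apply,
            ← ENNReal.ofReal_prod_of_nonneg fun _ _ => by positivity,
            ← ENNReal.ofReal_mul (by positivity), ← Real.rpow_sum_of_pos hz, ← Real.rpow_add hz]
          rw [ENNReal.one_le_ofReal]
          have h' : ∑ i, S.indicator (1 : α → ℝ) (v i) ≤ k := h
          exact Real.one_le_rpow_of_pos_of_le_one_of_nonpos hz hz1 (by linarith)
        · rw [Set.indicator_of_notMem h]; exact zero_le
    _ = ENNReal.ofReal ((1 - (1 - z) * pr D S) ^ n * z ^ (-k)) := by
        rw [expect_const_mul,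
          expect_iid_prod D n fun i a => ENNReal.ofReal (z ^ (S.indicator 1 a : ℝ))]
        simp only [h3, Finset.prod_const, Finset.card_univ, Fintype.card_fin]
        rw [← ENNReal.ofReal_pow hb, mul_comm, ← ENNReal.ofReal_mul (by positivity)]

end iid

/-! ### Characters and the bias of sparse parities -/

theorem F2.eq_zero_or_one (a : F2) : a = 0 ∨ a = 1 := by revert a; decide

theorem F2.add_self (a : F2) : a + a = 0 := by revert a; decide

/-- The sign `(-1) ^ a`. -/
noncomputable def sgn (a : F2) : ℝ := if a = 1 then -1 else 1

@[simp] theorem sgn_zero : sgn 0 = 1 := by simp [sgn]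

@[simp] theorem sgn_one : sgn 1 = -1 := by simp [sgn]

theorem sgn_add (a b : F2) : sgn (a + b) = sgn a * sgn b := by
  rcases F2.eq_zero_or_one a with rfl | rfl <;> rcases F2.eq_zero_or_one b with rfl | rfl <;>
    simp [F2.add_self]

theorem abs_sgn (a : F2) : |sgn a| = 1 := by
  rcases F2.eq_zero_or_one a with rfl | rfl <;> simp

theorem sgn_sum {ι : Type} (s : Finset ι) (f : ι → F2) : sgn (∑ i ∈ s, f i) = ∏ i ∈ s, sgn (f i) := by
  classical
  induction s using Finset.induction_on with
  | empty => simp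
  | insert i s hi ih => rw [Finset.sum_insert hi, sgn_add, ih, Finset.prod_insert hi]

/-- The character `(-1) ^ (x · y)`. -/
noncomputable def chi {n : ℕ} (x y : Vec n) : ℝ := sgn (x ⬝ᵥ y)

theorem chi_add_left {n : ℕ} (x x' y : Vec n) : chi (x + x') y = chi x y * chi x' y := by
  simp [chi, add_dotProduct, sgn_add]

theorem chi_add_right {n : ℕ} (x y y' : Vec n) : chi x (y + y') = chi x y * chi x y' := by
  simp [chi, dotProduct_add, sgn_add]

theorem abs_chi {n : ℕ} (x y : Vec n) : |chi x y| = 1 := abs_sgn _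

/-- The vectors of weight `t`. -/
def wtSet (t n : ℕ) : Finset (Vec n) := Finset.univ.filter fun x => hammingNorm x = t

theorem mem_wtSet {t n : ℕ} {x : Vec n} : x ∈ wtSet t n ↔ hammingNorm x = t := by simp [wtSet]

/-- The mean of `(-1) ^ (x · y)` over the vectors `x` of weight `t`. -/
noncomputable def bias (t : ℕ) {n : ℕ} (y : Vec n) : ℝ :=
  (∑ x ∈ wtSet t n, chi x y) / (wtSet t n).card

-- Expanding the product amounts to choosing the bit `x i` for every coordinate; the exponent of `X`
-- in the resulting term is the weight of `x`, and its coefficient is the character.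
open Polynomial in
theorem sum_chi_eq_coeff (t : ℕ) {n : ℕ} (y : Vec n) :
    ∑ x ∈ wtSet t n, chi x y = (∏ i, (1 + C (sgn (y i)) * X) : ℝ[X]).coeff t := by
  have h1 : (∏ i, (1 + C (sgn (y i)) * X) : ℝ[X])
      = ∏ i, ∑ a : F2, (if a = 1 then C (sgn (y i)) * X else 1 : ℝ[X]) := by
    refine Finset.prod_congr rfl fun i _ => ?_
    have : (Finset.univ : Finset F2) = {0, 1} := by decide
    rw [this, Finset.sum_pair (by decide)]
    simp
  have h2 : ∀ x : Vec n, (∏ i, (if x i = 1 then C (sgn (y i)) * X else 1 : ℝ[X]))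
      = C (chi x y) * X ^ hammingNorm x := by
    intro x
    rw [Finset.prod_ite, Finset.prod_const_one, mul_one, Finset.prod_mul_distrib,
      Finset.prod_const, chi, dotProduct, sgn_sum, ← map_prod]
    have hs : (Finset.univ.filter fun i => x i = 1) = Finset.univ.filter fun i => x i ≠ 0 := by
      ext i
      rcases F2.eq_zero_or_one (x i) with h | h <;> simp [h]
    congr 2
    · rw [Finset.prod_filter]
      refine Finset.prod_congr rfl fun i _ => ?_
      rcases F2.eq_zero_or_one (x i) with h | h <;> simp [h]
    · rw [hs, hammingNorm]
  rw [h1, Finset.prod_univ_sum, Fintype.piFinset_univ]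
  simp only [h2, finsetSum_coeff, coeff_C_mul, coeff_X_pow]
  rw [wtSet, Finset.sum_filter]
  refine Finset.sum_congr rfl fun x _ => ?_
  by_cases h : hammingNorm x = t
  · simp [h]
  · simp [h, Ne.symm h]

-- The bias therefore depends on `y` only through its weight: the coefficients of this polynomial
-- are the values of the Krawtchouk polynomials.
open Polynomial in
theorem prod_sgn_eq {n : ℕ} (y : Vec n) : (∏ i, (1 + C (sgn (y i)) * X) : ℝ[X])
    = (1 - X) ^ hammingNorm y * (1 + X) ^ (n - hammingNorm y) := by
  have h : ∀ i, (1 + C (sgn (y i)) * X : ℝ[X]) = if y i ≠ 0 then 1 - X else 1 + X := by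
    intro i
    rcases F2.eq_zero_or_one (y i) with h | h <;> simp [h]; ring
  simp only [h]
  rw [Finset.prod_ite, Finset.prod_const, Finset.prod_const]
  congr 2
  have := Finset.card_filter_add_card_filter_not (s := (Finset.univ : Finset (Fin n))) (fun i => y i ≠ 0)
  simp only [Finset.card_univ, Fintype.card_fin] at this
  simp only [hammingNorm]
  omega

theorem hammingNorm_le {n : ℕ} (y : Vec n) : hammingNorm y ≤ n := by
  simpa using hammingNorm_le_card_fintype (x := y)

theorem card_wtSet (t n : ℕ) : (wtSet t n).card = n.choose t := by
  have h := sum_chi_eq_coeff t (0 : Vec n)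
  rw [prod_sgn_eq] at h
  simp only [chi, dotProduct_zero, sgn_zero, Finset.sum_const, nsmul_eq_mul, mul_one,
    hammingNorm_zero, pow_zero, one_mul, Nat.sub_zero, Polynomial.coeff_one_add_X_pow] at h
  exact_mod_cast h

theorem wtSet_nonempty {t n : ℕ} (h : t ≤ n) : (wtSet t n).Nonempty := by
  rw [← Finset.card_pos, card_wtSet]; exact Nat.choose_pos h

theorem abs_bias_le_one (t : ℕ) {n : ℕ} (y : Vec n) : |bias t y| ≤ 1 := by
  rw [bias, abs_div, Nat.abs_cast]
  refine div_le_one_of_le₀ ?_ (by positivity)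
  refine (Finset.abs_sum_le_sum_abs _ _).trans ?_
  simp [abs_chi]

/-- The mean sign `1 - 2 |y| / n` of the coordinates of `y`. -/
noncomputable def meanSign {n : ℕ} (y : Vec n) : ℝ := 1 - 2 * hammingNorm y / n

theorem abs_meanSign_le_one {n : ℕ} (y : Vec n) : |meanSign y| ≤ 1 := by
  have h : (hammingNorm y : ℝ) / n ≤ 1 :=
    div_le_one_of_le₀ (by exact_mod_cast hammingNorm_le y) (by positivity)
  have h0 : 0 ≤ (hammingNorm y : ℝ) / n := by positivity
  rw [meanSign, abs_le, mul_div_assoc]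
  constructor <;> linarith

-- The product `F` satisfies the differential equation `(1 - X²) F' = ((v - w) - (v + w) X) F`;
-- comparing coefficients gives the three-term recurrence of the Krawtchouk polynomials.
open Polynomial in
theorem coeff_recurrence (w v t : ℕ) :
    ((t : ℝ) + 2) * ((1 - X) ^ w * (1 + X) ^ v : ℝ[X]).coeff (t + 2)
      = ((v : ℝ) - w) * ((1 - X) ^ w * (1 + X) ^ v : ℝ[X]).coeff (t + 1)
        - ((v : ℝ) + w - t) * ((1 - X) ^ w * (1 + X) ^ v : ℝ[X]).coeff t := by
  set F : ℝ[X] := (1 - X) ^ w * (1 + X) ^ v with hF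
  have ode : (1 - X * X) * derivative F = (C ((v : ℝ) - w) - C ((v : ℝ) + w) * X) * F := by
    have e1 : (1 - X) * derivative ((1 - X : ℝ[X]) ^ w) = - C (w : ℝ) * (1 - X) ^ w := by
      cases w with
      | zero => simp
      | succ w => rw [derivative_pow_succ]; simp; ring
    have e2 : (1 + X) * derivative ((1 + X : ℝ[X]) ^ v) = C (v : ℝ) * (1 + X) ^ v := by
      cases v with
      | zero => simp
      | succ v => rw [derivative_pow_succ]; simp; ring
    rw [hF, derivative_mul, C_sub, C_add]
    linear_combination (1 + X) * (1 + X) ^ v * e1 + (1 - X) * (1 - X) ^ w * e2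
  have h := congrArg (fun p => coeff p (t + 1)) ode
  simp only [sub_mul, one_mul, mul_assoc, coeff_sub, coeff_C_mul, coeff_X_mul] at h
  rw [coeff_derivative, coeff_derivative_X_mul_aux F t] at h
  push_cast at h
  linarith
where
  coeff_derivative_X_mul_aux (F : ℝ[X]) (t : ℕ) :
      (X * derivative F).coeff t = t * F.coeff t := by
    cases t with
    | zero => simp
    | succ t => rw [coeff_X_mul, coeff_derivative]; push_cast; ring

theorem bias_eq (t : ℕ) {n : ℕ} (y : Vec n) : bias t y * n.choose t =
    ((1 - Polynomial.X) ^ hammingNorm y * (1 + Polynomial.X) ^ (n - hammingNorm y) :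
      Polynomial ℝ).coeff t := by
  rw [bias, sum_chi_eq_coeff, prod_sgn_eq, card_wtSet]
  rcases eq_or_ne (n.choose t) 0 with h | h
  · have : ((1 - Polynomial.X) ^ hammingNorm y * (1 + Polynomial.X) ^ (n - hammingNorm y) :
      Polynomial ℝ).coeff t = 0 := by
      rw [← prod_sgn_eq, ← sum_chi_eq_coeff, Finset.card_eq_zero.1 ((card_wtSet t n).trans h)]
      simp
    simp [this]
  · rw [div_mul_cancel₀]; exact_mod_cast h

theorem bias_zero {n : ℕ} (y : Vec n) : bias 0 y = 1 := by
  have := bias_eq 0 y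
  simpa [Polynomial.coeff_zero_eq_eval_zero] using this

theorem bias_one {n : ℕ} (hn : 0 < n) (y : Vec n) : bias 1 y = meanSign y := by
  have h := bias_eq 1 y
  have hn' : (n : ℝ) ≠ 0 := by positivity
  have hc : ∀ F : Polynomial ℝ, F.coeff 1 = (Polynomial.derivative F).coeff 0 := by
    intro F; rw [Polynomial.coeff_derivative]; simp
  rw [hc, Polynomial.derivative_mul] at h
  simp [Polynomial.coeff_zero_eq_eval_zero, Polynomial.derivative_pow] at h
  rw [meanSign]
  have hle := hammingNorm_le y
  rw [Nat.cast_sub hle] at h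
  field_simp
  linarith

theorem bias_recurrence (t : ℕ) {n : ℕ} (ht : t + 2 ≤ n) (y : Vec n) :
    ((n : ℝ) - (t + 1)) * bias (t + 2) y
      = n * meanSign y * bias (t + 1) y - (t + 1) * bias t y := by
  have hn : (n : ℝ) ≠ 0 := by
    have : 0 < n := by omega
    positivity
  have h := coeff_recurrence (hammingNorm y) (n - hammingNorm y) t
  rw [← bias_eq, ← bias_eq, ← bias_eq, Nat.cast_sub (hammingNorm_le y)] at h
  have c1 : (n.choose (t + 2) : ℝ) * (t + 2) = n.choose (t + 1) * ((n : ℝ) - (t + 1)) := by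
    have := Nat.choose_succ_right_eq n (t + 1)
    have h2 := congrArg (Nat.cast (R := ℝ)) this
    push_cast [Nat.cast_sub (show t + 1 ≤ n by omega)] at h2
    linarith
  have c2 : (n.choose (t + 1) : ℝ) * (t + 1) = n.choose t * ((n : ℝ) - t) := by
    have := Nat.choose_succ_right_eq n t
    have h2 := congrArg (Nat.cast (R := ℝ)) this
    push_cast [Nat.cast_sub (show t ≤ n by omega)] at h2
    linarith
  have hpos : (n.choose (t + 1) : ℝ) ≠ 0 := by
    have := Nat.choose_pos (show t + 1 ≤ n by omega)
    positivity
  have hm : n * meanSign y = n - 2 * hammingNorm y := by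
    rw [meanSign]; field_simp
  rw [hm]
  apply mul_left_cancel₀ hpos
  linear_combination h - bias (t + 2) y * c1 + bias t y * c2

/-- In the recurrence, the terms that do not carry the factor `n` combine to a multiple, by the
weight, of the difference of two biases, and this difference is at most `2`. -/
theorem abs_bias_succ_sub_le (t : ℕ) {n : ℕ} (ht : t + 1 ≤ n) (y : Vec n) :
    |bias (t + 1) y - meanSign y * bias t y| ≤ 2 * t / n := by
  have hn : 0 < (n : ℝ) := by
    have : 0 < n := by omega
    positivity
  rw [le_div_iff₀ hn]
  cases t with
  | zero => simp [bias_zero, bias_one (show 0 < n by omega)]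
  | succ t =>
    have h := bias_recurrence t (by omega) y
    have e : (bias (t + 2) y - meanSign y * bias (t + 1) y) * n
        = (t + 1) * bias (t + 2) y - (t + 1) * bias t y := by linarith
    have e' : |bias (t + 2) y - meanSign y * bias (t + 1) y| * n
        = |(bias (t + 2) y - meanSign y * bias (t + 1) y) * n| := by rw [abs_mul, abs_of_pos hn]
    rw [show t + 1 + 1 = t + 2 by ring, e', e, ← mul_sub, abs_mul,
      abs_of_nonneg (show (0 : ℝ) ≤ t + 1 by positivity)]
    have h1 := abs_le.1 (abs_bias_le_one (t + 2) y)
    have h2 := abs_le.1 (abs_bias_le_one t y)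
    have h3 : |bias (t + 2) y - bias t y| ≤ 2 := by rw [abs_le]; constructor <;> linarith
    push_cast
    nlinarith

/-- With `t` coordinates drawn independently, the mean sign of the sum would be exactly the `t`-th
power. Drawing without replacement changes it by `2s/n` in the step from `s` to `s + 1`, and these
errors add up to at most `t²/n`. -/
theorem abs_bias_sub_pow_le (t : ℕ) {n : ℕ} (ht : t ≤ n) (y : Vec n) :
    |bias t y - meanSign y ^ t| ≤ t ^ 2 / n := by
  induction t with
  | zero => simp [bias_zero]
  | succ t ih =>
    have hn : 0 < (n : ℝ) := by
      have : 0 < n := by omega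
      positivity
    have h1 := abs_bias_succ_sub_le t ht y
    have h2 := ih (by omega)
    have e : bias (t + 1) y - meanSign y ^ (t + 1)
        = (bias (t + 1) y - meanSign y * bias t y) + meanSign y * (bias t y - meanSign y ^ t) := by
      ring
    rw [e]
    refine (abs_add_le _ _).trans ?_
    rw [abs_mul]
    have h3 : |meanSign y| * |bias t y - meanSign y ^ t| ≤ 1 * (t ^ 2 / n) := by
      gcongr; exact abs_meanSign_le_one y
    refine (add_le_add h1 h3).trans ?_
    rw [one_mul, ← add_div]
    gcongr
    push_cast; nlinarith


/-! ### Adding one random parity check -/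

section parityCheck
variable {n g : ℕ}

/-- Whether `u` is orthogonal to `W`, as a real number. -/
noncomputable def delta (u : Vec n) (W : Finset (Vec n)) : ℝ :=
  if ∀ w ∈ W, u ⬝ᵥ w = 0 then 1 else 0

theorem delta_eq_zero_or_one (u : Vec n) (W : Finset (Vec n)) :
    delta u W = 0 ∨ delta u W = 1 := by
  unfold delta; split_ifs <;> simp

/-- If some `w₀` in `W` has character `-1`, translation by `w₀` permutes `W` and changes the sign of
the sum, which must vanish. -/
theorem sum_chi_eq_delta {W : Finset (Vec n)} (hW : ∀ a ∈ W, ∀ b ∈ W, a + b ∈ W) (u : Vec n) :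
    ∑ w ∈ W, chi u w = W.card * delta u W := by
  by_cases h : ∀ w ∈ W, u ⬝ᵥ w = 0
  · rw [delta, if_pos h, Finset.sum_congr rfl fun w hw => by rw [chi, h w hw, sgn_zero]]
    simp
  · rw [delta, if_neg h, mul_zero]
    push Not at h
    obtain ⟨w₀, h₀, h1⟩ := h
    have hc : chi u w₀ = -1 := by
      rw [chi, (F2.eq_zero_or_one (u ⬝ᵥ w₀)).resolve_left h1, sgn_one]
    have hinv : ∀ w : Vec n, w + w₀ + w₀ = w := fun w => by
      rw [add_assoc]; ext i; simp [F2.add_self]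
    have : ∑ w ∈ W, chi u w = ∑ w ∈ W, chi u (w + w₀) :=
      Finset.sum_nbij' (fun w => w + w₀) (fun w => w + w₀) (fun w hw => hW w hw _ h₀)
        (fun w hw => hW w hw _ h₀) (fun w _ => hinv w) (fun w _ => hinv w)
        (fun w _ => by rw [hinv])
    simp only [chi_add_right, hc, ← Finset.sum_mul] at this
    linarith

/-- The part of `W` orthogonal to `x`. -/
def orth (W : Finset (Vec n)) (x : Vec n) : Finset (Vec n) := W.filter fun w => x ⬝ᵥ w = 0

theorem orth_ind (x w : Vec n) : (if x ⬝ᵥ w = 0 then (1 : ℝ) else 0) = (1 + chi x w) / 2 := by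
  rw [chi]
  rcases F2.eq_zero_or_one (x ⬝ᵥ w) with h | h <;> simp [h]

theorem card_orth {W : Finset (Vec n)} (hW : ∀ a ∈ W, ∀ b ∈ W, a + b ∈ W) (x : Vec n) :
    ((orth W x).card : ℝ) = W.card * (1 + delta x W) / 2 := by
  rw [orth, Finset.card_filter]
  push_cast
  simp only [orth_ind]
  rw [← Finset.sum_div, Finset.sum_add_distrib, sum_chi_eq_delta hW]
  simp; ring

theorem card_orth_inter {W : Finset (Vec n)} (hW : ∀ a ∈ W, ∀ b ∈ W, a + b ∈ W) (x x' : Vec n) :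
    ((orth W x ∩ orth W x').card : ℝ)
      = W.card * (1 + delta x W + delta x' W + delta (x + x') W) / 4 := by
  rw [orth, orth, ← Finset.filter_and, Finset.card_filter]
  push_cast
  have : ∀ w, (if x ⬝ᵥ w = 0 ∧ x' ⬝ᵥ w = 0 then (1 : ℝ) else 0)
      = (1 + chi x w + chi x' w + chi (x + x') w) / 4 := by
    intro w
    rw [ite_and, chi_add_left]
    have h1 := orth_ind x w
    have h2 := orth_ind x' w
    split_ifs at h1 h2 ⊢ <;> nlinarith
  simp only [this]
  rw [← Finset.sum_div]
  simp only [Finset.sum_add_distrib, sum_chi_eq_delta hW]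
  simp; ring

/-- For a uniform vector from `W`, orthogonality to `x` and orthogonality to `x'` are independent
events unless the two conditions coincide on `W`, that is, `x + x'` is orthogonal to `W`. In that
case a factor `2` is lost at most. -/
theorem card_mul_card_orth_inter_le {W : Finset (Vec n)} (hW : ∀ a ∈ W, ∀ b ∈ W, a + b ∈ W)
    (x x' : Vec n) :
    (W.card : ℝ) * (orth W x ∩ orth W x').card
      ≤ (1 + delta (x + x') W) * ((orth W x).card * (orth W x').card) := by
  rw [card_orth hW, card_orth hW, card_orth_inter hW]
  have key : 1 + delta x W + delta x' W + delta (x + x') W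
      ≤ (1 + delta (x + x') W) * ((1 + delta x W) * (1 + delta x' W)) := by
    rcases delta_eq_zero_or_one x W with h | h <;> rcases delta_eq_zero_or_one x' W with h' | h' <;>
      rcases delta_eq_zero_or_one (x + x') W with h'' | h'' <;> rw [h, h', h''] <;> norm_num
  have hc : (0 : ℝ) ≤ (W.card : ℝ) ^ 2 / 4 := by positivity
  nlinarith [mul_le_mul_of_nonneg_left key hc]

/-- The matrices with columns in `W`. -/
def colMatrices (W : Finset (Vec n)) (g : ℕ) : Finset (Matrix (Fin n) (Fin g) F2) :=
  Finset.univ.filter fun G => ∀ c, (fun i => G i c) ∈ W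

theorem mem_colMatrices {W : Finset (Vec n)} {G : Matrix (Fin n) (Fin g) F2} :
    G ∈ colMatrices W g ↔ ∀ c, (fun i => G i c) ∈ W := by simp [colMatrices]

theorem card_colMatrices (W : Finset (Vec n)) (g : ℕ) : (colMatrices W g).card = W.card ^ g := by
  have : (Fintype.piFinset fun _ : Fin g => W).card = W.card ^ g := by
    simp
  rw [← this]
  refine Finset.card_nbij' (fun G c i => G i c) (fun f => Matrix.of fun i c => f c i) ?_ ?_ ?_ ?_
  · intro G hG
    simpa [Fintype.mem_piFinset, colMatrices] using hG
  · intro f hf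
    simpa [Fintype.mem_piFinset, colMatrices] using hf
  · intro G _; rfl
  · intro f _; rfl

theorem colMatrices_inter (W W' : Finset (Vec n)) :
    colMatrices W g ∩ colMatrices W' g = colMatrices (W ∩ W') g := by
  ext G; simp [colMatrices, forall_and]

theorem colMatrices_nonempty {W : Finset (Vec n)} (h : 0 ∈ W) (g : ℕ) :
    (colMatrices W g).Nonempty := ⟨0, by rw [mem_colMatrices]; intro c; exact h⟩

theorem zero_mem_orth {W : Finset (Vec n)} (h : 0 ∈ W) (x : Vec n) : 0 ∈ orth W x := by
  simp [orth, h]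

theorem toReal_uniformOfFinset {α : Type} {s : Finset α} (hs : s.Nonempty) (a : α) [Decidable (a ∈ s)] :
    (PMF.uniformOfFinset s hs a).toReal = if a ∈ s then (s.card : ℝ)⁻¹ else 0 := by
  rw [PMF.uniformOfFinset_apply]
  by_cases h : a ∈ s <;> simp [h]

theorem toReal_uniform_bind {α β : Type} {s : Finset α} (hs : s.Nonempty) (Y : α → PMF β) (b : β) :
    (((PMF.uniformOfFinset s hs).bind Y) b).toReal = (∑ a ∈ s, (Y a b).toReal) / s.card := by
  classical
  rw [PMF.bind_apply, tsum_eq_sum (s := s), ENNReal.toReal_sum]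
  · rw [Finset.sum_div]
    refine Finset.sum_congr rfl fun a ha => ?_
    rw [ENNReal.toReal_mul, toReal_uniformOfFinset, if_pos ha]
    ring
  · intro a _
    exact ENNReal.mul_ne_top (PMF.apply_ne_top _ _) (PMF.apply_ne_top _ _)
  · intro a ha
    simp [ha]

/-- A pointwise substitute for the Cauchy–Schwarz inequality. It bounds the `ℓ¹` distance by an
expression that is linear in the second moment, so that the bound can later be averaged over the
earlier rows; `l` is chosen at the very end. -/
theorem one_sub_abs_le {l : ℝ} (hl : 0 < l) (a : ℝ) : |1 - a| ≤ (l + (1 - a) ^ 2 / l) / 2 := by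
  have h : 0 ≤ (|1 - a| - l) ^ 2 / l := by positivity
  rw [sub_sq, sq_abs] at h
  have : ((1 - a) ^ 2 - 2 * |1 - a| * l + l ^ 2) / l = (1 - a) ^ 2 / l - 2 * |1 - a| + l := by
    field_simp
  linarith

/-- The distance between matrices with columns in `W` and matrices with columns in `W` orthogonal to
a random vector from `s`. -/
theorem dist_orth {W : Finset (Vec n)} (hW : ∀ a ∈ W, ∀ b ∈ W, a + b ∈ W) (h0 : 0 ∈ W)
    {s : Finset (Vec n)} (hs : s.Nonempty) {l : ℝ} (hl : 0 < l) :
    Dist ((PMF.uniformOfFinset s hs).bind fun x =>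
        PMF.uniformOfFinset (colMatrices (orth W x) g) (colMatrices_nonempty (zero_mem_orth h0 x) g))
      (PMF.uniformOfFinset (colMatrices W g) (colMatrices_nonempty h0 g))
      (ENNReal.ofReal (l / 2 + 2 ^ g / (2 * l) *
        ((∑ x ∈ s, ∑ x' ∈ s, delta (x + x') W) / s.card ^ 2))) := by
  classical
  apply Dist.of_sum_abs
  set V := colMatrices W g with hV
  set v : ℝ := (V.card : ℝ) with hv
  have hv0 : 0 < v := by
    rw [hv]; exact_mod_cast Finset.card_pos.2 (colMatrices_nonempty h0 g)
  set N : ℝ := (s.card : ℝ) with hN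
  have hN0 : 0 < N := by rw [hN]; exact_mod_cast Finset.card_pos.2 hs
  set c : Vec n → ℝ := fun x => ((colMatrices (orth W x) g).card : ℝ) with hc
  have hc0 : ∀ x, 0 < c x := fun x => by
    simp only [hc]
    exact_mod_cast Finset.card_pos.2 (colMatrices_nonempty (zero_mem_orth h0 x) g)
  -- `I x` is the density for a fixed new row `x`, and `M` is the mixture over the new row. Thus `v
  -- * M` is the density of the mixture relative to the uniform distribution on `V`.
  set I : Vec n → Matrix (Fin n) (Fin g) F2 → ℝ :=
    fun x G => if G ∈ colMatrices (orth W x) g then (c x)⁻¹ else 0 with hI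
  set M : Matrix (Fin n) (Fin g) F2 → ℝ := fun G => (∑ x ∈ s, I x G) / N with hM
  have hsub : ∀ x, colMatrices (orth W x) g ⊆ V := fun x G hG => by
    rw [mem_colMatrices] at hG ⊢
    exact fun c => (Finset.mem_filter.1 (hG c)).1
  have hI0 : ∀ x G, G ∉ V → I x G = 0 := fun x G hG => by
    simp only [hI]; rw [if_neg fun h => hG (hsub x h)]
  simp only [toReal_uniform_bind, toReal_uniformOfFinset]
  have e1 : ∀ G, |(∑ x ∈ s, I x G) / N - if G ∈ V then v⁻¹ else 0|
      = if G ∈ V then v⁻¹ * |1 - v * M G| else 0 := by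
    intro G
    by_cases hG : G ∈ V
    · rw [if_pos hG, if_pos hG, ← abs_of_pos (inv_pos.2 hv0), ← abs_mul, abs_sub_comm,
        abs_of_pos (inv_pos.2 hv0), mul_sub, ← mul_assoc, inv_mul_cancel₀ hv0.ne']
      simp [hM]
    · rw [if_neg hG, if_neg hG, Finset.sum_eq_zero fun x _ => hI0 x G hG]
      simp
  have hsumI : ∀ x, ∑ G ∈ V, I x G = 1 := by
    intro x
    simp only [hI]
    rw [← Finset.sum_filter, Finset.sum_const, Finset.filter_mem_eq_inter,
      Finset.inter_eq_right.2 (hsub x), nsmul_eq_mul]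
    exact mul_inv_cancel₀ (hc0 x).ne'
  have hsumM : ∑ G ∈ V, M G = 1 := by
    simp only [hM]
    rw [← Finset.sum_div, Finset.sum_comm]
    simp only [hsumI]
    simp [← hN, hN0.ne']
  -- The columns are independent, so the overlap of two components is the `g`-th power of the ratio
  -- for a single column. This ratio exceeds `1` only if `x + x'` is orthogonal to `W`, and then it
  -- is at most `2`.
  have hII : ∀ x x', v * ∑ G ∈ V, I x G * I x' G ≤ 1 + 2 ^ g * delta (x + x') W := by
    intro x x'
    have e : ∑ G ∈ V, I x G * I x' G
        = ((orth W x ∩ orth W x').card : ℝ) ^ g * ((c x)⁻¹ * (c x')⁻¹) := by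
      have : ∀ G, I x G * I x' G = if G ∈ colMatrices (orth W x ∩ orth W x') g then
          (c x)⁻¹ * (c x')⁻¹ else 0 := by
        intro G
        rw [← colMatrices_inter]
        by_cases h : G ∈ colMatrices (orth W x) g <;> by_cases h' : G ∈ colMatrices (orth W x') g <;>
          simp [hI, h, h']
      simp only [this]
      rw [← Finset.sum_filter, Finset.sum_const, Finset.filter_mem_eq_inter,
        Finset.inter_eq_right.2, card_colMatrices, nsmul_eq_mul]
      · push_cast; rfl
      · rw [← colMatrices_inter]; exact Finset.inter_subset_left.trans (hsub x)
    rw [e, ← mul_assoc, ← mul_inv, ← div_eq_mul_inv, div_le_iff₀ (mul_pos (hc0 x) (hc0 x')), hv,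
      card_colMatrices]
    simp only [hc]
    rw [card_colMatrices, card_colMatrices]
    push_cast
    rw [← mul_pow, ← mul_pow]
    calc _ ≤ ((1 + delta (x + x') W) * ((orth W x).card * (orth W x').card)) ^ g := by
          exact pow_le_pow_left₀ (by positivity) (card_mul_card_orth_inter_le hW x x') g
      _ ≤ _ := by
          rw [mul_pow]
          gcongr
          rcases delta_eq_zero_or_one (x + x') W with h | h <;> rw [h] <;> norm_num
  -- The second moment of the relative density, minus `1`, is the chi-square distance from uniform.
  -- Expanding the square turns it into an average of overlaps over pairs of possible new rows.
  have hMM : v * ∑ G ∈ V, M G ^ 2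
      ≤ 1 + 2 ^ g * ((∑ x ∈ s, ∑ x' ∈ s, delta (x + x') W) / N ^ 2) := by
    have e : v * ∑ G ∈ V, M G ^ 2
        = (∑ x ∈ s, ∑ x' ∈ s, v * ∑ G ∈ V, I x G * I x' G) / N ^ 2 := by
      simp only [hM, div_pow, sq (∑ x ∈ s, I x _), Finset.sum_mul_sum]
      rw [← Finset.sum_div, Finset.sum_comm]
      simp only [fun x => Finset.sum_comm (s := V) (t := s) (f := fun G x' => I x G * I x' G),
        Finset.mul_sum, ← mul_div_assoc]
    rw [e, div_le_iff₀ (by positivity)]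
    calc _ ≤ ∑ x ∈ s, ∑ x' ∈ s, (1 + 2 ^ g * delta (x + x') W) :=
          Finset.sum_le_sum fun x _ => Finset.sum_le_sum fun x' _ => hII x x'
      _ = _ := by
          simp only [Finset.sum_add_distrib, ← Finset.mul_sum, Finset.sum_const, nsmul_eq_mul,
            mul_one]
          rw [← hN]; field_simp
  calc _ = ∑ G, |(∑ x ∈ s, I x G) / N - if G ∈ V then v⁻¹ else 0| := rfl
    _ = ∑ G ∈ V, v⁻¹ * |1 - v * M G| := by
      simp only [e1]
      rw [← Finset.sum_filter, Finset.filter_mem_eq_inter, Finset.univ_inter]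
    _ ≤ ∑ G ∈ V, v⁻¹ * ((l + (1 - v * M G) ^ 2 / l) / 2) := by
      gcongr with G _
      exact one_sub_abs_le hl _
    _ = l / 2 + (v * ∑ G ∈ V, M G ^ 2 - 1) / (2 * l) := by
      have : ∀ G, v⁻¹ * ((l + (1 - v * M G) ^ 2 / l) / 2)
          = v⁻¹ * (l / 2 + 1 / (2 * l)) - M G / l + v * M G ^ 2 / (2 * l) := by
        intro G; field_simp; ring
      simp only [this, Finset.sum_add_distrib, Finset.sum_sub_distrib, ← Finset.sum_div, hsumM,
        ← Finset.mul_sum, Finset.sum_const, nsmul_eq_mul]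
      rw [← hv]; field_simp; ring
    _ ≤ l / 2 + (2 ^ g * ((∑ x ∈ s, ∑ x' ∈ s, delta (x + x') W) / N ^ 2)) / (2 * l) := by
      gcongr; linarith
    _ = _ := by ring

end parityCheck

/-! ### The marginal distribution of the generator matrix -/

section generator
variable {n g : ℕ}

/-- The vectors `w` with `P w = 0`. -/
def kerVec {j : ℕ} (P : Fin j → Vec n) : Finset (Vec n) :=
  Finset.univ.filter fun w => ∀ i, P i ⬝ᵥ w = 0

theorem mem_kerVec {j : ℕ} {P : Fin j → Vec n} {w : Vec n} :
    w ∈ kerVec P ↔ ∀ i, P i ⬝ᵥ w = 0 := by simp [kerVec]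

theorem kerVec_add {j : ℕ} (P : Fin j → Vec n) : ∀ a ∈ kerVec P, ∀ b ∈ kerVec P, a + b ∈ kerVec P := by
  intro a ha b hb
  rw [mem_kerVec] at *
  intro i; rw [dotProduct_add, ha, hb, add_zero]

theorem zero_mem_kerVec {j : ℕ} (P : Fin j → Vec n) : 0 ∈ kerVec P := by simp [kerVec]

theorem kerVec_cons {j : ℕ} (x : Vec n) (P : Fin j → Vec n) :
    kerVec (Fin.cons x P : Fin (j + 1) → Vec n) = orth (kerVec P) x := by
  ext w
  rw [orth, Finset.mem_filter, mem_kerVec, mem_kerVec, Fin.forall_fin_succ]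
  simp [and_comm]

theorem kernelMatrices_eq {j : ℕ} (P : Fin j → Vec n) (g : ℕ) :
    kernelMatrices (Matrix.of P) g = colMatrices (kerVec P) g := by
  ext G
  rw [mem_colMatrices, kernelMatrices, Finset.mem_filter]
  constructor
  · intro h c
    rw [mem_kerVec]
    intro i
    exact congrFun (congrFun h.2 i) c
  · intro h
    refine ⟨Finset.mem_univ _, ?_⟩
    ext i c
    exact mem_kerVec.1 (h c) i

/-- Every fibre of the syndrome map is a translate of a subset of the kernel, and there are at most
`2 ^ j` syndromes. -/
theorem card_kerVec_ge {j : ℕ} (P : Fin j → Vec n) : (2 : ℝ) ^ n ≤ 2 ^ j * (kerVec P).card := by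
  have h := Finset.card_le_mul_card_image (f := fun (w : Vec n) i => P i ⬝ᵥ w)
    (Finset.univ : Finset (Vec n)) (kerVec P).card (by
      intro a ha
      obtain ⟨w₀, -, rfl⟩ := Finset.mem_image.1 ha
      refine Finset.card_le_card_of_injOn (fun w => w + w₀) ?_ ?_
      · intro w hw
        have hw' := (Finset.mem_filter.1 hw).2
        simp only [Finset.mem_coe, mem_kerVec]
        intro i
        rw [dotProduct_add, congrFun hw' i, F2.add_self]
      · intro w _ w' _ h
        exact add_right_cancel h)
  have h2 : (Finset.univ.image fun (w : Vec n) i => P i ⬝ᵥ w).card ≤ 2 ^ j :=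
    (Finset.card_le_univ _).trans (by simp)
  have h3 : (Finset.univ : Finset (Vec n)).card = 2 ^ n := by simp
  rw [h3] at h
  have := h.trans (Nat.mul_le_mul_left _ h2)
  rw [mul_comm] at this
  exact_mod_cast this

theorem prod_one_add_chi {j : ℕ} (P : Fin j → Vec n) (w : Vec n) :
    ∏ i, (1 + chi (P i) w) = if w ∈ kerVec P then (2 : ℝ) ^ j else 0 := by
  by_cases h : w ∈ kerVec P
  · rw [if_pos h, Finset.prod_congr rfl fun i _ => by rw [chi, mem_kerVec.1 h i, sgn_zero]]
    norm_num
  · rw [if_neg h]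
    rw [mem_kerVec] at h
    push Not at h
    obtain ⟨i, hi⟩ := h
    refine Finset.prod_eq_zero (Finset.mem_univ i) ?_
    rw [chi, (F2.eq_zero_or_one _).resolve_left hi]; simp

/-- After expanding the product, the right-hand side counts the subsets of the rows with sum `u`; it
is positive as soon as `u` lies in the row span. Replacing the indicator by this count makes the
bound multilinear in the rows, so that it can be averaged row by row. -/
theorem delta_kerVec_le {j : ℕ} (P : Fin j → Vec n) (u : Vec n) :
    delta u (kerVec P) ≤ (∑ w, chi u w * ∏ i, (1 + chi (P i) w)) / 2 ^ n := by
  rw [le_div_iff₀ (by positivity)]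
  have h : ∑ w, chi u w * ∏ i, (1 + chi (P i) w) = 2 ^ j * ((kerVec P).card * delta u (kerVec P)) := by
    simp only [prod_one_add_chi, mul_ite, mul_zero]
    rw [← Finset.sum_filter, Finset.filter_mem_eq_inter, Finset.univ_inter, ← Finset.sum_mul,
      sum_chi_eq_delta (kerVec_add P)]
    ring
  have h0 : 0 ≤ delta u (kerVec P) := by
    rcases delta_eq_zero_or_one u (kerVec P) with h | h <;> rw [h]; norm_num
  rw [h]
  nlinarith [card_kerVec_ge P]

theorem sum_rotate {α β γ : Type} (s : Finset α) (t : Finset β) (u : Finset γ) (F : α → β → γ → ℝ) :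
    ∑ x ∈ s, ∑ y ∈ t, ∑ z ∈ u, F x y z = ∑ z ∈ u, ∑ x ∈ s, ∑ y ∈ t, F x y z := by
  rw [Finset.sum_congr rfl fun x _ => Finset.sum_comm, Finset.sum_comm]

theorem expect_ofReal {α : Type} [Fintype α] (X : PMF α) {F : α → ℝ} (hF : ∀ a, 0 ≤ F a) :
    (expect X fun a => ENNReal.ofReal (F a)) = ENNReal.ofReal (∑ a, (X a).toReal * F a) := by
  rw [expect_fintype, ENNReal.ofReal_sum_of_nonneg fun a _ => mul_nonneg ENNReal.toReal_nonneg (hF a)]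
  refine Finset.sum_congr rfl fun a _ => ?_
  rw [ENNReal.ofReal_mul ENNReal.toReal_nonneg, ENNReal.ofReal_toReal (X.apply_ne_top a)]

/-- A uniformly random vector of weight `t`. -/
noncomputable def rowDist {t n : ℕ} (ht : t ≤ n) : PMF (Vec n) :=
  PMF.uniformOfFinset (wtSet t n) (wtSet_nonempty ht)

theorem sum_rowDist_mul {t : ℕ} (ht : t ≤ n) (F : Vec n → ℝ) :
    ∑ x, (rowDist ht x).toReal * F x = (∑ x ∈ wtSet t n, F x) / (wtSet t n).card := by
  simp only [rowDist, toReal_uniformOfFinset, ite_mul, zero_mul]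
  rw [← Finset.sum_filter, Finset.filter_mem_eq_inter, Finset.univ_inter, ← Finset.mul_sum]
  ring

theorem sum_toReal_pmf {α : Type} [Fintype α] (X : PMF α) : ∑ a, (X a).toReal = 1 := by
  rw [← ENNReal.toReal_sum fun a _ => X.apply_ne_top a, ← tsum_fintype (L := .unconditional _), X.tsum_coe]; simp

/-- The mean of `b ^ 2 * (1 + b) ^ j` for the bias `b` of a uniformly random vector. -/
noncomputable def biasMean (n t j : ℕ) : ℝ :=
  (∑ w : Vec n, bias t w ^ 2 * (1 + bias t w) ^ j) / 2 ^ n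

/-- After the Fourier expansion, everything factors for a fixed `w`: the two new rows contribute the
square of the bias, and each of the `j` independent old rows contributes the factor `1 + bias`. -/
theorem sum_iid_delta_le {t : ℕ} (ht : t ≤ n) (j : ℕ) :
    ∑ P : Fin j → Vec n, (iid (rowDist ht) j P).toReal *
      ((∑ x ∈ wtSet t n, ∑ x' ∈ wtSet t n, delta (x + x') (kerVec P)) / (wtSet t n).card ^ 2)
      ≤ biasMean n t j := by
  set N : ℝ := ((wtSet t n).card : ℝ) with hN
  have hN0 : 0 < N := by rw [hN]; exact_mod_cast Finset.card_pos.2 (wtSet_nonempty ht)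
  have h1 : ∀ P : Fin j → Vec n,
      (∑ x ∈ wtSet t n, ∑ x' ∈ wtSet t n, delta (x + x') (kerVec P)) / N ^ 2
        ≤ (∑ w, bias t w ^ 2 * ∏ i, (1 + chi (P i) w)) / 2 ^ n := by
    intro P
    calc _ ≤ (∑ x ∈ wtSet t n, ∑ x' ∈ wtSet t n,
          (∑ w, chi (x + x') w * ∏ i, (1 + chi (P i) w)) / 2 ^ n) / N ^ 2 := by
          gcongr with x _ x' _
          exact delta_kerVec_le P _
      _ = (∑ w, (∑ x ∈ wtSet t n, ∑ x' ∈ wtSet t n, chi (x + x') w) / N ^ 2 *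
            ∏ i, (1 + chi (P i) w)) / 2 ^ n := by
          simp only [Finset.sum_div, Finset.sum_mul]
          rw [sum_rotate]
          refine Finset.sum_congr rfl fun w _ => Finset.sum_congr rfl fun x _ =>
            Finset.sum_congr rfl fun x' _ => by ring
      _ = _ := by
          congr 1
          refine Finset.sum_congr rfl fun w _ => ?_
          congr 1
          simp only [chi_add_left]
          rw [← Finset.sum_mul_sum, bias, div_pow, sq (∑ x ∈ wtSet t n, chi x w)]
  have h2 : ∀ w : Vec n, ∑ P : Fin j → Vec n, (iid (rowDist ht) j P).toReal * ∏ i, (1 + chi (P i) w)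
      = (1 + bias t w) ^ j := by
    intro w
    have : 1 + bias t w = ∑ x, (rowDist ht x).toReal * (1 + chi x w) := by
      simp only [mul_add, mul_one, Finset.sum_add_distrib, sum_toReal_pmf, sum_rowDist_mul, bias]
    rw [this, Fintype.sum_pow]
    refine Finset.sum_congr rfl fun P _ => ?_
    rw [iid_apply, ENNReal.toReal_prod, Finset.prod_mul_distrib]
  calc _ ≤ ∑ P : Fin j → Vec n, (iid (rowDist ht) j P).toReal *
        ((∑ w, bias t w ^ 2 * ∏ i, (1 + chi (P i) w)) / 2 ^ n) := by
        exact Finset.sum_le_sum fun P _ => mul_le_mul_of_nonneg_left (h1 P) ENNReal.toReal_nonneg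
    _ = _ := by
        rw [biasMean]
        simp only [← h2, Finset.mul_sum, Finset.sum_div]
        rw [Finset.sum_comm]
        refine Finset.sum_congr rfl fun w _ => Finset.sum_congr rfl fun P _ => by ring

/-- The distribution of the matrix `G` with `P G = 0`, for a matrix `P` with `j` random rows. -/
noncomputable def genDist {t : ℕ} (ht : t ≤ n) (g j : ℕ) : PMF (Matrix (Fin n) (Fin g) F2) :=
  (iid (rowDist ht) j).bind fun P =>
    PMF.uniformOfFinset (colMatrices (kerVec P) g) (colMatrices_nonempty (zero_mem_kerVec P) g)

theorem uniformOfFinset_congr {α : Type} {s s' : Finset α} (h : s = s') (hs : s.Nonempty)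
    (hs' : s'.Nonempty) : PMF.uniformOfFinset s hs = PMF.uniformOfFinset s' hs' := by
  subst h; rfl

theorem genDist_zero {t : ℕ} (ht : t ≤ n) (g : ℕ) :
    genDist ht g 0 = PMF.uniformOfFintype (Matrix (Fin n) (Fin g) F2) := by
  rw [genDist, iid, PMF.pure_bind, PMF.uniformOfFintype]
  apply uniformOfFinset_congr
  ext G
  simp [mem_colMatrices, mem_kerVec]

/-- The additional row is sampled last, so that `dist_orth` applies with the other rows fixed. Its
bound is linear in the number of bad pairs and may be replaced by its mean over these rows. -/
theorem dist_genDist_succ {t : ℕ} (ht : t ≤ n) (g j : ℕ) {l : ℝ} (hl : 0 < l) :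
    Dist (genDist ht g (j + 1)) (genDist ht g j)
      (ENNReal.ofReal (l / 2 + 2 ^ g / (2 * l) * biasMean n t j)) := by
  have e : genDist ht g (j + 1) = (iid (rowDist ht) j).bind fun P => (rowDist ht).bind fun x =>
      PMF.uniformOfFinset (colMatrices (orth (kerVec P) x) g)
        (colMatrices_nonempty (zero_mem_orth (zero_mem_kerVec P) x) g) := by
    rw [genDist, iid, PMF.bind_bind]
    simp only [← PMF.bind_pure_comp, PMF.bind_bind, Function.comp_apply, PMF.pure_bind]
    rw [PMF.bind_comm]
    refine congrArg _ (funext fun P => congrArg _ (funext fun x => ?_))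
    exact uniformOfFinset_congr (by rw [kerVec_cons]) _ _
  rw [e]
  refine (Dist.bind_expect _ fun P => dist_orth (kerVec_add P) (zero_mem_kerVec P) _ hl).mono ?_
  have hd : ∀ P : Fin j → Vec n, 0 ≤ (∑ x ∈ wtSet t n, ∑ x' ∈ wtSet t n, delta (x + x') (kerVec P)) /
      ((wtSet t n).card : ℝ) ^ 2 := by
    intro P
    refine div_nonneg (Finset.sum_nonneg fun x _ => Finset.sum_nonneg fun x' _ => ?_) (by positivity)
    rcases delta_eq_zero_or_one (x + x') (kerVec P) with h | h <;> rw [h]; norm_num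
  rw [expect_ofReal _ fun P => by have := hd P; positivity]
  refine ENNReal.ofReal_le_ofReal ?_
  simp only [mul_add, Finset.sum_add_distrib, ← Finset.sum_mul, sum_toReal_pmf, one_mul]
  have := sum_iid_delta_le ht j
  gcongr
  simp only [mul_left_comm _ ((2 : ℝ) ^ g / (2 * l)), ← Finset.mul_sum]
  gcongr

/-- The rows are removed one by one; without rows there is no condition on the matrix. -/
theorem dist_genDist_uniform {t : ℕ} (ht : t ≤ n) (g r : ℕ) {l ε : ℝ} (hl : 0 < l) (hε0 : 0 ≤ ε)
    (hε : ∀ j < r, biasMean n t j ≤ ε) :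
    Dist (genDist ht g r) (PMF.uniformOfFintype (Matrix (Fin n) (Fin g) F2))
      (ENNReal.ofReal (r * (l / 2 + 2 ^ g / (2 * l) * ε))) := by
  have hc : 0 ≤ l / 2 + 2 ^ g / (2 * l) * ε := by positivity
  induction r with
  | zero => rw [genDist_zero]; simpa using Dist.refl _
  | succ r ih =>
    have h1 := ih fun j hj => hε j (by omega)
    have h2 := (dist_genDist_succ ht g r hl).mono (δ := ENNReal.ofReal (l / 2 + 2 ^ g / (2 * l) * ε))
      (ENNReal.ofReal_le_ofReal (by have := hε r (by omega); gcongr))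
    refine (h2.trans h1).mono ?_
    · rw [← ENNReal.ofReal_add hc (by positivity)]
      refine ENNReal.ofReal_le_ofReal ?_
      push_cast; linarith

/-! ### The distribution `LDPC` -/

theorem mem_sparseMatrices {t r : ℕ} {P : Matrix (Fin r) (Fin n) F2} :
    P ∈ sparseMatrices t r n ↔ ∀ i, Matrix.of.symm P i ∈ wtSet t n := by
  simp only [mem_wtSet, sparseMatrices, Finset.mem_filter, Finset.mem_univ, true_and]
  rfl

theorem card_sparseMatrices (t r : ℕ) : (sparseMatrices t r n).card = (wtSet t n).card ^ r := by
  have h : (Fintype.piFinset fun _ : Fin r => wtSet t n).card = (wtSet t n).card ^ r := by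
    simp
  rw [← h]
  refine Finset.card_nbij' (fun P => Matrix.of.symm P) (fun P => Matrix.of P) ?_ ?_ ?_ ?_
  · intro P hP
    exact Finset.mem_coe.2 (Fintype.mem_piFinset.2 (mem_sparseMatrices.1 hP))
  · intro P hP
    exact Finset.mem_coe.2 (mem_sparseMatrices.2 (Fintype.mem_piFinset.1 hP))
  · intro P _; rfl
  · intro P _; rfl

theorem uniform_sparseMatrices {t : ℕ} (ht : t ≤ n) (r : ℕ) :
    PMF.uniformOfFinset (sparseMatrices t r n) (sparseMatrices_nonempty ht r)
      = (iid (rowDist ht) r).map fun P => Matrix.of P := by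
  classical
  ext P
  rw [PMF.map_apply, tsum_eq_single (Matrix.of.symm P)]
  swap
  · intro Q hQ
    rw [if_neg]
    rintro rfl
    exact hQ rfl
  rw [if_pos (Matrix.of.apply_symm_apply P).symm, iid_apply, PMF.uniformOfFinset_apply]
  simp only [mem_sparseMatrices, rowDist, PMF.uniformOfFinset_apply]
  by_cases h : ∀ i, Matrix.of.symm P i ∈ wtSet t n
  · simp only [h, card_sparseMatrices]
    simp [ENNReal.inv_pow]
  · rw [if_neg h]
    push Not at h
    obtain ⟨i, hi⟩ := h
    exact (Finset.prod_eq_zero (Finset.mem_univ i) (if_neg hi)).symm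

theorem ldpc_eq {t : ℕ} (ht : t ≤ n) (g r : ℕ) :
    ldpc n g t r ht = (iid (rowDist ht) r).bind fun P =>
      (PMF.uniformOfFinset (kernelMatrices (Matrix.of P) g)
        (kernelMatrices_nonempty _ g)).map fun G => (Matrix.of P, G) := by
  rw [ldpc, uniform_sparseMatrices ht, ← PMF.bind_pure_comp, PMF.bind_bind]
  simp only [Function.comp_apply, PMF.pure_bind]

theorem ldpc_map_snd {t : ℕ} (ht : t ≤ n) (g r : ℕ) :
    (ldpc n g t r ht).map Prod.snd = genDist ht g r := by
  rw [ldpc_eq, PMF.map_bind, genDist]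
  refine congrArg _ (funext fun P => ?_)
  rw [PMF.map_comp]
  refine (PMF.map_id _).trans ?_
  exact uniformOfFinset_congr (kernelMatrices_eq _ _) _ _

theorem ldpc_map_fst {t : ℕ} (ht : t ≤ n) (g r : ℕ) :
    (ldpc n g t r ht).map Prod.fst = (iid (rowDist ht) r).map fun P => Matrix.of P := by
  rw [← uniform_sparseMatrices, ldpc, PMF.map_bind]
  simp only [PMF.map_comp]
  refine Eq.trans ?_ (PMF.bind_pure _)
  refine congrArg _ (funext fun P => ?_)
  exact PMF.map_const _ _

end generator

/-! ### The weight of a uniformly random vector -/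

theorem hammingNorm_eq_sum {n : ℕ} (y : Vec n) :
    (hammingNorm y : ℝ) = ∑ i, ({1} : Set F2).indicator 1 (y i) := by
  rw [hammingNorm, Finset.card_filter]
  push_cast
  refine Finset.sum_congr rfl fun i _ => ?_
  rcases F2.eq_zero_or_one (y i) with h | h <;> simp [h]

theorem sub_hammingNorm_eq_sum {n : ℕ} (y : Vec n) :
    (n - hammingNorm y : ℝ) = ∑ i, ({0} : Set F2).indicator 1 (y i) := by
  have : (n : ℝ) = ∑ i : Fin n, 1 := by simp
  rw [hammingNorm_eq_sum, this, ← Finset.sum_sub_distrib]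
  refine Finset.sum_congr rfl fun i _ => ?_
  rcases F2.eq_zero_or_one (y i) with h | h <;> simp [h]

theorem pr_uniform_F2 (a : F2) : pr (PMF.uniformOfFintype F2) {a} = 1 / 2 := by
  rw [pr_eq, prob, expect, tsum_eq_single a] <;> simp +contextual

theorem pr_mono {α : Type} {X : PMF α} {S S' : Set α} (h : ∀ a ∈ X.support, a ∈ S → a ∈ S') :
    pr X S ≤ pr X S' := by
  rw [pr_eq, pr_eq]
  exact ENNReal.toReal_mono (prob_ne_top _ _) (prob_mono h)

theorem pr_union_le {α : Type} (X : PMF α) (S S' : Set α) : pr X (S ∪ S') ≤ pr X S + pr X S' := by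
  rw [pr_eq, pr_eq, pr_eq, ← ENNReal.toReal_add (prob_ne_top _ _) (prob_ne_top _ _)]
  exact ENNReal.toReal_mono (by simp [prob_ne_top]) (prob_union_le _ _ _)

/-- A mean sign of absolute value `a` forces the zeros or the ones to exceed `n/2` by `a n / 2`; the
Chernoff bound is applied to both. -/
theorem pr_abs_meanSign_ge {n : ℕ} (hn : 0 < n) {a : ℝ} (h0 : 0 ≤ a) (h1 : a ≤ 1) :
    pr (PMF.uniformOfFintype (Vec n)) {y | a ≤ |meanSign y|} ≤ 2 * Real.exp (-(a ^ 2 * n / 16)) := by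
  have hn' : (0 : ℝ) < n := by exact_mod_cast hn
  have key : ∀ b : F2, pr (PMF.uniformOfFintype (Vec n))
      {y | (n : ℝ) / 2 + a / 2 * n ≤ ∑ i, ({b} : Set F2).indicator (1 : F2 → ℝ) (y i)}
        ≤ Real.exp (-(a ^ 2 * n / 16)) := by
    intro b
    have h := iid_tail (PMF.uniformOfFintype F2) n (fun _ => {b}) (fun _ => 1 / 2)
      (fun _ => (pr_uniform_F2 b).le) (by simp; linarith) (δ := a / 2) (by linarith) (by linarith)
    rw [iid_uniform] at h
    convert h using 2
    · simp; ring_nf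
    · ring_nf
  calc _ ≤ pr (PMF.uniformOfFintype (Vec n))
        ({y | (n : ℝ) / 2 + a / 2 * n ≤ ∑ i, ({0} : Set F2).indicator (1 : F2 → ℝ) (y i)} ∪
         {y | (n : ℝ) / 2 + a / 2 * n ≤ ∑ i, ({1} : Set F2).indicator (1 : F2 → ℝ) (y i)}) := by
        refine pr_mono fun y _ hy => ?_
        simp only [Set.mem_ofPred_eq, Set.mem_union, ← hammingNorm_eq_sum,
          ← sub_hammingNorm_eq_sum] at hy ⊢
        rw [meanSign] at hy
        rcases le_abs.1 hy with h | h
        · left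
          have : 2 * (hammingNorm y : ℝ) / n ≤ 1 - a := by linarith
          rw [div_le_iff₀ hn'] at this
          linarith
        · right
          have : 1 + a ≤ 2 * (hammingNorm y : ℝ) / n := by linarith
          rw [le_div_iff₀ hn'] at this
          linarith
    _ ≤ _ := (pr_union_le _ _ _).trans (by linarith [key 0, key 1])

/-- A probability close to `2^(-n)` is needed here, which the quadratic Chernoff bound cannot give.
Hence the exponential moment is kept with a free parameter `z`. -/
theorem pr_abs_meanSign_ge_one_sub {n : ℕ} (hn : 0 < n) {a z : ℝ} (hz : 0 < z) (hz1 : z ≤ 1) :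
    pr (PMF.uniformOfFintype (Vec n)) {y | 1 - a ≤ |meanSign y|}
      ≤ 2 * (((1 + z) / 2) ^ n * z ^ (-(a / 2 * n))) := by
  have hn' : (0 : ℝ) < n := by exact_mod_cast hn
  have key : ∀ b : F2, pr (PMF.uniformOfFintype (Vec n))
      {y | ∑ i, ({b} : Set F2).indicator (1 : F2 → ℝ) (y i) ≤ a / 2 * n}
        ≤ ((1 + z) / 2) ^ n * z ^ (-(a / 2 * n)) := by
    intro b
    have h := iid_tail_exp (PMF.uniformOfFintype F2) n {b} hz hz1 (a / 2 * n)
    rw [iid_uniform, pr_uniform_F2, show 1 - (1 - z) * (1 / 2) = (1 + z) / 2 by ring] at h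
    exact h
  calc _ ≤ pr (PMF.uniformOfFintype (Vec n))
        ({y | ∑ i, ({0} : Set F2).indicator (1 : F2 → ℝ) (y i) ≤ a / 2 * n} ∪
         {y | ∑ i, ({1} : Set F2).indicator (1 : F2 → ℝ) (y i) ≤ a / 2 * n}) := by
        refine pr_mono fun y _ hy => ?_
        simp only [Set.mem_ofPred_eq, Set.mem_union, ← hammingNorm_eq_sum,
          ← sub_hammingNorm_eq_sum] at hy ⊢
        rw [meanSign] at hy
        rcases le_abs.1 hy with h | h
        · right
          have : 2 * (hammingNorm y : ℝ) / n ≤ a := by linarith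
          rw [div_le_iff₀ hn'] at this
          linarith
        · left
          have : 2 - a ≤ 2 * (hammingNorm y : ℝ) / n := by linarith
          rw [le_div_iff₀ hn'] at this
          linarith
    _ ≤ _ := (pr_union_le _ _ _).trans (by linarith [key 0, key 1])

/-! ### Averages of the bias over uniformly random vectors. -/

theorem pr_uniform_eq_sum {n : ℕ} (S : Set (Vec n)) :
    pr (PMF.uniformOfFintype (Vec n)) S = (∑ w, S.indicator (1 : Vec n → ℝ) w) / 2 ^ n := by
  rw [pr_eq, prob, expect_fintype, ENNReal.toReal_sum, Finset.sum_div]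
  · refine Finset.sum_congr rfl fun w _ => ?_
    by_cases h : w ∈ S <;> simp [h]
  · intro w _
    by_cases h : w ∈ S <;> simp [h]

/-- Parseval's identity. -/
theorem sum_bias_sq {t n : ℕ} (ht : t ≤ n) :
    (∑ w : Vec n, bias t w ^ 2) / 2 ^ n = 1 / n.choose t := by
  have hN0 : (0 : ℝ) < n.choose t := by exact_mod_cast Nat.choose_pos ht
  have huniv : ∀ u : Vec n, ∑ w, chi u w = if u = 0 then (2 : ℝ) ^ n else 0 := by
    intro u
    have h := sum_chi_eq_delta (W := Finset.univ) (fun a _ b _ => Finset.mem_univ _) u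
    rw [h, delta]
    have : (∀ w ∈ (Finset.univ : Finset (Vec n)), u ⬝ᵥ w = 0) ↔ u = 0 := by
      constructor
      · intro h
        exact dotProduct_eq_zero u fun w => h w (Finset.mem_univ _)
      · rintro rfl; simp
    by_cases hu : u = 0
    · rw [if_pos (this.2 hu), if_pos hu]; simp
    · rw [if_neg fun h => hu (this.1 h), if_neg hu, mul_zero]
  have hz : ∀ x x' : Vec n, x + x' = 0 ↔ x' = x := by
    intro x x'
    have : -x = x := by ext i; simp [ZMod.neg_eq_self_mod_two]
    rw [add_eq_zero_iff_neg_eq, this, eq_comm]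
  have : ∑ w : Vec n, bias t w ^ 2 = 2 ^ n / n.choose t := by
    simp only [bias, div_pow, sq (∑ x ∈ wtSet t n, chi x _), Finset.sum_mul_sum, ← chi_add_left,
      card_wtSet]
    rw [← Finset.sum_div, ← sum_rotate]
    simp only [huniv, hz, Finset.sum_ite_eq']
    rw [Finset.sum_congr rfl fun x hx => if_pos hx]
    simp [card_wtSet]
    field_simp
  rw [this]; field_simp
where
  dotProduct_eq_zero {n : ℕ} (u : Vec n) (h : ∀ w, u ⬝ᵥ w = 0) : u = 0 := by
    ext i
    have := h (Pi.single i 1)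
    simpa using this

/-- A bound on the mean of `b ^ 2 * (1 + b) ^ j`, by the size of the mean sign. -/
theorem biasMean_le {n t j : ℕ} (hn : 0 < n) (ht1 : 1 ≤ t) (ht : t ≤ n) (hj : j ≤ n) {x₀ a z : ℝ}
    (hx0 : 0 ≤ x₀) (hx1 : x₀ ≤ 1) (hx : x₀ ^ t * n ≤ 1) (hz : 0 < z) (hz1 : z ≤ 1) :
    biasMean n t j ≤ Real.exp (2 * t ^ 2) / n.choose t
      + 2 * Real.exp (-(x₀ ^ 2 * n / 16)) * Real.exp (n * (1 - a) ^ t + t ^ 2)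
      + 2 * (((1 + z) / 2) ^ n * z ^ (-(a / 2 * n))) * 2 ^ j := by
  have hn' : (0 : ℝ) < n := by exact_mod_cast hn
  set S₁ : Set (Vec n) := {y | x₀ ≤ |meanSign y|}
  set S₂ : Set (Vec n) := {y | 1 - a ≤ |meanSign y|}
  -- Outside `S₁` the bias is at most `(1 + t²)/n`, so the power is bounded by `e^(2t²)` and the
  -- square is kept for Parseval's identity. Between `S₂` and `S₁` the square is bounded by `1` and
  -- only the power is estimated. In `S₂` the trivial bound `2 ^ j` is used.
  have hw : ∀ w : Vec n, bias t w ^ 2 * (1 + bias t w) ^ j ≤ Real.exp (2 * t ^ 2) * bias t w ^ 2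
      + Real.exp (n * (1 - a) ^ t + t ^ 2) * S₁.indicator 1 w + 2 ^ j * S₂.indicator 1 w := by
    intro w
    set b := bias t w
    have hb1 : |b| ≤ 1 := abs_bias_le_one t w
    have hbl := abs_le.1 hb1
    have hb2 : b ^ 2 ≤ 1 := by rw [← sq_abs]; exact pow_le_one₀ (abs_nonneg _) hb1
    have hbx : |b| ≤ |meanSign w| ^ t + t ^ 2 / n := by
      have := abs_bias_sub_pow_le t ht w
      have h2 := abs_sub_abs_le_abs_sub b (meanSign w ^ t)
      rw [abs_pow] at h2
      linarith
    have hpow : ∀ c : ℝ, |b| * n ≤ c → (1 + b) ^ j ≤ Real.exp c := by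
      intro c hc
      calc (1 + b) ^ j ≤ Real.exp b ^ j := by
            gcongr
            · linarith
            · linarith [Real.add_one_le_exp b]
        _ = Real.exp (j * b) := by rw [← Real.exp_nat_mul]
        _ ≤ _ := by
            refine Real.exp_le_exp.2 (le_trans ?_ hc)
            have : (j : ℝ) ≤ n := by exact_mod_cast hj
            nlinarith [le_abs_self b, abs_nonneg b, (Nat.cast_nonneg j : (0 : ℝ) ≤ j)]
    have hnn : 0 ≤ (1 + b) ^ j := pow_nonneg (by linarith) _
    have t1 : 0 ≤ Real.exp (2 * t ^ 2) * b ^ 2 := by positivity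
    have t2 : 0 ≤ Real.exp (n * (1 - a) ^ t + t ^ 2) * S₁.indicator (1 : Vec n → ℝ) w :=
      mul_nonneg (Real.exp_pos _).le (Set.indicator_nonneg (fun _ _ => zero_le_one) _)
    have t3 : 0 ≤ (2 : ℝ) ^ j * S₂.indicator (1 : Vec n → ℝ) w :=
      mul_nonneg (by positivity) (Set.indicator_nonneg (fun _ _ => zero_le_one) _)
    by_cases h2 : w ∈ S₂
    · have : b ^ 2 * (1 + b) ^ j ≤ 1 * 2 ^ j := by
        gcongr
        · linarith
        · linarith
      rw [Set.indicator_of_mem h2, Pi.one_apply]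
      linarith
    · have h2' : |meanSign w| < 1 - a := not_le.1 h2
      by_cases h1 : w ∈ S₁
      · have e : (1 + b) ^ j ≤ Real.exp (n * (1 - a) ^ t + t ^ 2) := by
          apply hpow
          calc |b| * n ≤ (|meanSign w| ^ t + t ^ 2 / n) * n := by gcongr
            _ ≤ ((1 - a) ^ t + t ^ 2 / n) * n := by gcongr
            _ = _ := by field_simp
        rw [Set.indicator_of_mem h1, Pi.one_apply]
        nlinarith
      · have h1' : |meanSign w| < x₀ := not_le.1 h1
        have e : (1 + b) ^ j ≤ Real.exp (2 * t ^ 2) := by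
          apply hpow
          have ht1' : (1 : ℝ) ≤ t := by exact_mod_cast ht1
          calc |b| * n ≤ (|meanSign w| ^ t + t ^ 2 / n) * n := by gcongr
            _ ≤ (x₀ ^ t + t ^ 2 / n) * n := by gcongr
            _ = x₀ ^ t * n + t ^ 2 := by field_simp
            _ ≤ _ := by nlinarith
        nlinarith [sq_nonneg b]
  calc biasMean n t j ≤ (∑ w : Vec n, (Real.exp (2 * t ^ 2) * bias t w ^ 2
      + Real.exp (n * (1 - a) ^ t + t ^ 2) * S₁.indicator 1 w + 2 ^ j * S₂.indicator 1 w)) / 2 ^ n := by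
        rw [biasMean]
        gcongr with w _
        exact hw w
    _ = Real.exp (2 * t ^ 2) * ((∑ w : Vec n, bias t w ^ 2) / 2 ^ n)
        + pr (PMF.uniformOfFintype (Vec n)) S₁ * Real.exp (n * (1 - a) ^ t + t ^ 2)
        + pr (PMF.uniformOfFintype (Vec n)) S₂ * 2 ^ j := by
        rw [pr_uniform_eq_sum, pr_uniform_eq_sum, Finset.sum_add_distrib, Finset.sum_add_distrib,
          ← Finset.mul_sum, ← Finset.mul_sum, ← Finset.mul_sum]
        ring
    _ ≤ _ := by
        rw [sum_bias_sq ht, mul_one_div]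
        gcongr
        · exact pr_abs_meanSign_ge hn hx0 hx1
        · exact pr_abs_meanSign_ge_one_sub hn hz hz1


/-! ### Negligible functions -/

theorem Negligible.of_eventually_le {μ ν : ℕ → ℝ} (hν : Negligible ν) (h : ∀ᶠ n in atTop, |μ n| ≤ ν n) :
    Negligible μ :=
  SuperpolynomialDecay.trans_eventually_abs_le hν
    (h.mono fun _ hn => hn.trans (le_abs_self _))

theorem Negligible.add {μ ν : ℕ → ℝ} (hμ : Negligible μ) (hν : Negligible ν) :
    Negligible fun n => μ n + ν n := SuperpolynomialDecay.add hμ hν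

theorem Negligible.const_mul {μ : ℕ → ℝ} (hμ : Negligible μ) (c : ℝ) :
    Negligible fun n => c * μ n := SuperpolynomialDecay.const_mul hμ c

theorem Negligible.pow_mul {μ : ℕ → ℝ} (hμ : Negligible μ) (c : ℕ) :
    Negligible fun n => (n : ℝ) ^ c * μ n := SuperpolynomialDecay.param_pow_mul hμ c

/-! ### The row weight -/

/-- The row weight `⌊log n / K⌋`. -/
def rowWt (K n : ℕ) : ℕ := Nat.log (2 ^ K) n

theorem rowWt_le (K n : ℕ) : rowWt K n ≤ n := Nat.log_le_self _ _

theorem two_pow_rowWt_le (K : ℕ) {n : ℕ} (hn : n ≠ 0) : 2 ^ (K * rowWt K n) ≤ n := by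
  rw [pow_mul]; exact Nat.pow_log_le_self _ hn

theorem lt_two_pow_rowWt {K : ℕ} (hK : K ≠ 0) (n : ℕ) : n < 2 ^ (K * (rowWt K n + 1)) := by
  rw [pow_mul]; exact Nat.lt_pow_succ_log_self (Nat.one_lt_two_pow hK) _

theorem tendsto_rowWt {K : ℕ} (hK : K ≠ 0) : Tendsto (rowWt K) atTop atTop := by
  refine tendsto_atTop.2 fun b => ?_
  filter_upwards [eventually_ge_atTop ((2 ^ K) ^ b)] with n hn
  exact Nat.le_log_of_pow_le (Nat.one_lt_two_pow hK) hn

theorem eventually_sq_le_two_pow {c : ℝ} (hc : 0 < c) : ∀ᶠ t : ℕ in atTop, (t : ℝ) ^ 2 ≤ c * 2 ^ t := by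
  have h := tendsto_pow_const_div_const_pow_of_one_lt 2 (one_lt_two (α := ℝ))
  filter_upwards [h.eventually (gt_mem_nhds hc)] with t ht
  rw [div_lt_iff₀ (by positivity)] at ht
  exact ht.le

theorem eventually_rowWt_sq_le_sqrt {K : ℕ} (hK : 2 ≤ K) {c : ℝ} (hc : 0 < c) :
    ∀ᶠ n : ℕ in atTop, (rowWt K n : ℝ) ^ 2 ≤ c * √n := by
  filter_upwards [(tendsto_rowWt (show K ≠ 0 by omega)).eventually (eventually_sq_le_two_pow hc),
    eventually_ne_atTop 0] with n h hn
  refine h.trans ?_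
  gcongr
  refine Real.le_sqrt_of_sq_le ?_
  rw [← pow_mul]
  have h2 : (2 : ℕ) ^ (rowWt K n * 2) ≤ n :=
    (Nat.pow_le_pow_right two_pos (by nlinarith)).trans (two_pow_rowWt_le K hn)
  exact_mod_cast h2

theorem sqrt_natCast_le_self {n : ℕ} (hn : 1 ≤ n) : √(n : ℝ) ≤ n := by
  have : (1 : ℝ) ≤ n := by exact_mod_cast hn
  exact Real.sqrt_le_iff.2 ⟨by positivity, by nlinarith⟩

theorem eventually_rowWt_sq_le {K : ℕ} (hK : 2 ≤ K) {c : ℝ} (hc : 0 < c) :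
    ∀ᶠ n : ℕ in atTop, (rowWt K n : ℝ) ^ 2 ≤ c * n := by
  filter_upwards [eventually_rowWt_sq_le_sqrt hK hc, eventually_ge_atTop 1] with n h hn
  refine h.trans ?_
  gcongr
  exact sqrt_natCast_le_self hn

/-- The negligible function `2 ^ (-t ^ 2)` for the row weight `t`. -/
noncomputable def negl (K n : ℕ) : ℝ := (1 / 2) ^ (rowWt K n ^ 2)

theorem negl_pos (K n : ℕ) : 0 < negl K n := by unfold negl; positivity

/-- Since `n < 2^(K(t+1))`, a power `n^c` has an exponent of base `2` that is only linear in `t`,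
whereas `negl` has the exponent `-t²`. -/
theorem negligible_negl {K : ℕ} (hK : K ≠ 0) : Negligible (negl K) := by
  intro c
  have ht := tendsto_rowWt hK
  have h1 : Tendsto (fun n => (1 / 2 : ℝ) ^ rowWt K n) atTop (𝓝 0) :=
    (tendsto_pow_atTop_nhds_zero_of_lt_one (by norm_num) (by norm_num)).comp ht
  refine squeeze_zero' (Eventually.of_forall fun n => by have := negl_pos K n; positivity) ?_ h1
  filter_upwards [ht.eventually_ge_atTop (K * c * 2 + 1)] with n hn
  set t := rowWt K n
  have hlt : (n : ℝ) ≤ 2 ^ (K * (t + 1)) := by exact_mod_cast (lt_two_pow_rowWt hK n).le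
  calc (n : ℝ) ^ c * negl K n ≤ (2 ^ (K * (t + 1))) ^ c * (1 / 2) ^ (t ^ 2) := by
        unfold negl; gcongr
    _ ≤ (2 ^ (K * (t + 1))) ^ c * (1 / 2) ^ (K * (t + 1) * c + t) := by
        refine mul_le_mul_of_nonneg_left ?_ (by positivity)
        refine pow_le_pow_of_le_one (by norm_num) (by norm_num) ?_
        have h2 : K * c * (t + 1) ≤ K * c * (2 * t) := by gcongr; omega
        nlinarith
    _ = _ := by
        rw [pow_add, ← pow_mul, ← mul_assoc, ← mul_pow]; norm_num

/-- The weight `t` is logarithmic, so `t²` is far below `√n`. In this way all exponentially small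
errors are absorbed in powers of `negl`. -/
theorem eventually_exp_neg_le {K : ℕ} (hK : 2 ≤ K) (m : ℕ) {c : ℝ} (hc : 0 < c) :
    ∀ᶠ n : ℕ in atTop, Real.exp (-(c * √n)) ≤ (1 / 2) ^ (m * rowWt K n ^ 2) := by
  filter_upwards [eventually_rowWt_sq_le_sqrt hK (c := c / (m + 1)) (by positivity)] with n h
  rw [show (1 / 2 : ℝ) = Real.exp (-Real.log 2) by
    rw [Real.exp_neg, Real.exp_log two_pos, one_div], ← Real.exp_nat_mul, Real.exp_le_exp]
  have hl : Real.log 2 ≤ 1 := by linarith [Real.log_two_lt_d9]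
  have hl0 : 0 ≤ Real.log 2 := by positivity
  have h1 : (m + 1) * (rowWt K n : ℝ) ^ 2 ≤ c * √n := by
    calc _ ≤ (m + 1) * (c / (m + 1) * √n) := by gcongr
      _ = _ := by field_simp
  push_cast
  nlinarith [mul_nonneg (Nat.cast_nonneg (α := ℝ) m) (sq_nonneg (rowWt K n : ℝ)),
    sq_nonneg (rowWt K n : ℝ)]

theorem eventually_exp_neg_le' {K : ℕ} (hK : 2 ≤ K) (m : ℕ) {c : ℝ} (hc : 0 < c) :
    ∀ᶠ n : ℕ in atTop, Real.exp (-(c * n)) ≤ (1 / 2) ^ (m * rowWt K n ^ 2) := by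
  filter_upwards [eventually_exp_neg_le hK m hc, eventually_ge_atTop 1] with n h hn
  refine le_trans ?_ h
  rw [Real.exp_le_exp]
  have := sqrt_natCast_le_self hn
  nlinarith

/-! ### The generator matrix is close to uniform -/

/-- The binomial coefficient is at least `(n + 1 - t)^t / t!`. Of the exponent `(K + 1) t`, one part
`2^t ≥ 2t` pays for passing from `n` to `n + 1 - t` and for the division by `t! ≤ t^t`. -/
theorem two_pow_le_choose {K n t : ℕ} (ht1 : 1 ≤ t) (h : 2 ^ ((K + 1) * t) ≤ n) (htn : 2 * t ≤ n) :
    2 ^ (K * t ^ 2) ≤ n.choose t := by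
  have h1 : (n + 1 - t) ^ t ≤ t.factorial * n.choose t := by
    have := Nat.pow_le_choose (α := ℚ) t n
    rw [div_le_iff₀ (by positivity)] at this
    rw [mul_comm]
    exact_mod_cast this
  have h2 : t.factorial ≤ t ^ t := Nat.factorial_le_pow t
  have h3 : 2 ^ (K * t) * t ≤ n + 1 - t := by
    have h4 : 2 * t ≤ 2 ^ t := by
      clear h h1 h2 htn
      induction t, ht1 using Nat.le_induction with
      | base => norm_num
      | succ t ht ih => rw [pow_succ]; omega
    have h5 : 2 ^ (K * t) * (2 * t) ≤ n := by
      refine le_trans ?_ h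
      rw [add_mul, one_mul, pow_add]
      gcongr
    have : 2 * (2 ^ (K * t) * t) ≤ n := by linarith
    omega
  have h6 : (2 ^ (K * t) * t) ^ t ≤ t ^ t * n.choose t :=
    (Nat.pow_le_pow_left h3 t).trans (h1.trans (Nat.mul_le_mul_right _ h2))
  rw [mul_pow, mul_comm] at h6
  have := Nat.le_of_mul_le_mul_left h6 (by positivity)
  rwa [← pow_mul, mul_assoc, ← sq] at this

/-- Each of the three summands of `biasMean_le` is at most `2 · 2^(-7t²)`. The exponent `5t²` leaves
enough room for the factor `2^g = 2^(t²)` and for the second-moment method, which loses a square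
root. -/
theorem eventually_biasMean_le {K : ℕ} (hK : 11 ≤ K) : ∀ᶠ n : ℕ in atTop, ∀ j ≤ 99 * n / 100,
    biasMean n (rowWt K n) j ≤ (1 / 2) ^ (5 * rowWt K n ^ 2) := by
  have hK0 : K ≠ 0 := by omega
  have hK2 : 2 ≤ K := by omega
  -- A constant suffices for `x₀ ^ t * n ≤ 1`, because `n < 2^(K(t+1))` and `t + 1 ≤ 2t`.
  set x₀ : ℝ := (1 / 2) ^ (2 * K) with hx0
  have hx0p : 0 < x₀ := by positivity
  have ha : Tendsto (fun n => (1 - 1 / 1000 : ℝ) ^ rowWt K n) atTop (𝓝 0) :=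
    (tendsto_pow_atTop_nhds_zero_of_lt_one (by norm_num) (by norm_num)).comp (tendsto_rowWt hK0)
  filter_upwards [eventually_gt_atTop 0, (tendsto_rowWt hK0).eventually_ge_atTop 2,
    ha.eventually (gt_mem_nhds (show 0 < x₀ ^ 2 / 64 by positivity)),
    eventually_rowWt_sq_le hK2 (show 0 < x₀ ^ 2 / 64 by positivity),
    eventually_exp_neg_le' hK2 7 (show 0 < x₀ ^ 2 / 32 by positivity),
    eventually_exp_neg_le' hK2 7 (show (0 : ℝ) < 1 / 500 by norm_num)] with n hn ht2 h1 h2 h3 h4 j hj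
  have ht1 := one_le_two.trans ht2
  set t := rowWt K n with ht
  have hn' : (0 : ℝ) < n := by exact_mod_cast hn
  have htn : t ≤ n := rowWt_le K n
  have hlow : 2 ^ (K * t) ≤ n := two_pow_rowWt_le K hn.ne'
  have hx : x₀ ^ t * n ≤ 1 := by
    have hlt : (n : ℝ) ≤ 2 ^ (K * (t + 1)) := by exact_mod_cast (lt_two_pow_rowWt hK0 n).le
    calc x₀ ^ t * n ≤ (1 / 2) ^ (K * (t + 1)) * 2 ^ (K * (t + 1)) := by
          gcongr
          rw [hx0, ← pow_mul]
          exact pow_le_pow_of_le_one (by norm_num) (by norm_num) (by nlinarith)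
      _ = 1 := by rw [← mul_pow]; norm_num
  -- With `a = 1/1000` and `z = 1/1024`, the factor `z^(-an/2)` is `2^(n/200)`. Together with `2^j ≤
  -- 2^(99n/100)` and `((1+z)/2)^n`, the exponent is `n (1/1024 - (log 2)/200)`, which is below
  -- `-n/500`.
  have key := biasMean_le hn ht1 htn (show j ≤ n by omega) hx0p.le
    (pow_le_one₀ (by norm_num) (by norm_num)) hx (a := 1 / 1000) (z := 1 / 1024) (by norm_num)
    (by norm_num)
  have T1 : Real.exp (2 * t ^ 2) / n.choose t ≤ (1 / 2) ^ (7 * t ^ 2) := by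
    -- This is where `K ≥ 11` enters: one multiple of `t` in the exponent is spent in
    -- `two_pow_le_choose`, and ten remain.
    have hc : (2 : ℝ) ^ (10 * t ^ 2) ≤ n.choose t := by
      have := two_pow_le_choose (K := 10) ht1 ((Nat.pow_le_pow_right two_pos
        (Nat.mul_le_mul_right t hK)).trans hlow) (by
          have : 2 * t ≤ 2 ^ (K * t) := by
            have h5 : K * t < 2 ^ (K * t) := Nat.lt_two_pow_self
            nlinarith
          omega)
      exact_mod_cast this
    have he : Real.exp (2 * t ^ 2) ≤ 2 ^ (3 * t ^ 2) := by
      have h5 : Real.exp 1 ^ 2 ≤ 2 ^ 3 := by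
        have := Real.exp_one_lt_d9
        have := Real.exp_pos 1
        nlinarith
      calc Real.exp (2 * t ^ 2) = (Real.exp 1 ^ 2) ^ (t ^ 2) := by
            rw [← pow_mul, ← Real.exp_nat_mul]; push_cast; ring_nf
        _ ≤ (2 ^ 3) ^ (t ^ 2) := by gcongr
        _ = _ := by rw [← pow_mul]
    calc _ ≤ (2 : ℝ) ^ (3 * t ^ 2) / 2 ^ (10 * t ^ 2) := by gcongr
      _ = _ := by
        rw [show 10 * t ^ 2 = 3 * t ^ 2 + 7 * t ^ 2 by ring, pow_add, one_div_pow]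
        field_simp
  have T2 : 2 * Real.exp (-(x₀ ^ 2 * n / 16)) * Real.exp (n * (1 - 1 / 1000) ^ t + t ^ 2)
      ≤ 2 * (1 / 2) ^ (7 * t ^ 2) := by
    rw [mul_assoc, ← Real.exp_add]
    refine mul_le_mul_of_nonneg_left (le_trans ?_ h3) two_pos.le
    rw [Real.exp_le_exp]
    have : n * (1 - 1 / 1000 : ℝ) ^ t ≤ n * (x₀ ^ 2 / 64) := by gcongr
    nlinarith
  have T3 : 2 * (((1 + 1 / 1024 : ℝ) / 2) ^ n * (1 / 1024) ^ (-((1 / 1000 : ℝ) / 2 * n))) * 2 ^ j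
      ≤ 2 * (1 / 2) ^ (7 * t ^ 2) := by
    rw [mul_assoc]
    refine mul_le_mul_of_nonneg_left (le_trans ?_ h4) two_pos.le
    have e2 : (2 : ℝ) = Real.exp (Real.log 2) := (Real.exp_log two_pos).symm
    have l2 := Real.log_two_gt_d9
    have hj' : (j : ℝ) ≤ 99 / 100 * n := by
      have : 100 * j ≤ 99 * n := by omega
      have : (100 : ℝ) * j ≤ 99 * n := by exact_mod_cast this
      linarith
    have A : ((1 + 1 / 1024 : ℝ) / 2) ^ n ≤ Real.exp (n * (1 / 1024 - Real.log 2)) := by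
      rw [Real.exp_nat_mul, Real.exp_sub, Real.exp_log two_pos]
      gcongr
      linarith [Real.add_one_le_exp (1 / 1024 : ℝ)]
    have B : (1 / 1024 : ℝ) ^ (-((1 / 1000 : ℝ) / 2 * n)) = Real.exp (Real.log 2 * (n / 200)) := by
      rw [Real.rpow_def_of_pos (by norm_num), show (1 / 1024 : ℝ) = 2⁻¹ ^ 10 by norm_num,
        Real.log_pow, Real.log_inv]
      congr 1; push_cast; ring
    have C : (2 : ℝ) ^ j ≤ Real.exp (99 / 100 * n * Real.log 2) := by
      calc (2 : ℝ) ^ j = Real.exp (j * Real.log 2) := by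
            rw [Real.exp_nat_mul, Real.exp_log two_pos]
        _ ≤ _ := by
            rw [Real.exp_le_exp]; gcongr
    rw [B]
    calc _ ≤ Real.exp (n * (1 / 1024 - Real.log 2)) * Real.exp (Real.log 2 * (n / 200))
          * Real.exp (99 / 100 * n * Real.log 2) := by gcongr
      _ ≤ _ := by
        rw [← Real.exp_add, ← Real.exp_add, Real.exp_le_exp]
        nlinarith
  have hfin : 5 * (1 / 2 : ℝ) ^ (7 * t ^ 2) ≤ (1 / 2) ^ (5 * t ^ 2) := by
    rw [show 7 * t ^ 2 = 5 * t ^ 2 + 2 * t ^ 2 by ring, pow_add]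
    have h5 : (1 / 2 : ℝ) ^ (2 * t ^ 2) ≤ 1 / 8 := by
      calc (1 / 2 : ℝ) ^ (2 * t ^ 2) ≤ (1 / 2) ^ 3 :=
            pow_le_pow_of_le_one (by norm_num) (by norm_num) (by nlinarith)
        _ = _ := by norm_num
    have h6 : (0 : ℝ) < (1 / 2) ^ (5 * t ^ 2) := by positivity
    nlinarith
  linarith

/-- The choice `l = 2^(-2t²)` balances the two terms for one row: both are `l/2`, because `2^(t²) ·
2^(-5t²) = l²`. The number of rows is at most `n ≤ 2^(t²)`, so the total is at most `2^(-t²)`. -/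
theorem eventually_dist_genDist {K : ℕ} (hK : 11 ≤ K) : ∀ᶠ n : ℕ in atTop,
    Dist (genDist (rowWt_le K n) (rowWt K n * rowWt K n) (99 * n / 100))
      (PMF.uniformOfFintype _) (ENNReal.ofReal (negl K n)) := by
  have hK0 : K ≠ 0 := by omega
  filter_upwards [eventually_biasMean_le hK,
    (tendsto_rowWt hK0).eventually_ge_atTop (2 * K)] with n h ht
  set t := rowWt K n with htdef
  refine (dist_genDist_uniform (rowWt_le K n) (t * t) (99 * n / 100)
    (l := (1 / 2) ^ (2 * t ^ 2)) (by positivity) (ε := (1 / 2) ^ (5 * t ^ 2)) (by positivity)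
    fun j hj => h j hj.le).mono (ENNReal.ofReal_le_ofReal ?_)
  have e : (1 / 2 : ℝ) ^ (2 * t ^ 2) / 2 + 2 ^ (t * t) / (2 * (1 / 2) ^ (2 * t ^ 2)) * (1 / 2) ^ (5 * t ^ 2)
      = (1 / 2 : ℝ) ^ (2 * t ^ 2) := by
    rw [show 5 * t ^ 2 = t ^ 2 + (2 * t ^ 2 + 2 * t ^ 2) by ring, pow_add, pow_add, ← sq t]
    have : (2 : ℝ) ^ t ^ 2 * (1 / 2) ^ t ^ 2 = 1 := by rw [← mul_pow]; norm_num
    field_simp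
    linear_combination this
  rw [e]
  have hn : ((99 * n / 100 : ℕ) : ℝ) ≤ 2 ^ (t ^ 2) := by
    have h1 : 99 * n / 100 ≤ n := by omega
    have h2 : n ≤ 2 ^ (t ^ 2) := (lt_two_pow_rowWt hK0 n).le.trans
      (Nat.pow_le_pow_right two_pos (by rw [← htdef]; nlinarith))
    exact_mod_cast h1.trans h2
  calc _ ≤ (2 : ℝ) ^ (t ^ 2) * (1 / 2) ^ (2 * t ^ 2) := by gcongr
    _ = _ := by
      rw [two_mul, pow_add, ← mul_assoc, ← mul_pow, negl, ← htdef]; norm_num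


/-! ### The weight of the syndrome -/

section syndrome
variable {n t : ℕ}

theorem pr_rowDist_eq (ht : t ≤ n) (S : Set (Vec n)) :
    pr (rowDist ht) S = (∑ x ∈ wtSet t n, S.indicator (1 : Vec n → ℝ) x) / (wtSet t n).card := by
  rw [pr_eq, prob, expect_fintype, ENNReal.toReal_sum, ← sum_rowDist_mul ht]
  · refine Finset.sum_congr rfl fun x _ => ?_
    rw [ENNReal.toReal_mul]
    congr 1
    by_cases h : x ∈ S <;> simp [h]
  · intro x _
    refine ENNReal.mul_ne_top (PMF.apply_ne_top _ _) ?_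
    by_cases h : x ∈ S <;> simp [h]

theorem pr_rowDist_zero (ht : t ≤ n) (y : Vec n) :
    pr (rowDist ht) {x | x ⬝ᵥ y = 0} = (1 + bias t y) / 2 := by
  have hN0 : ((wtSet t n).card : ℝ) ≠ 0 := by
    exact_mod_cast (Finset.card_pos.2 (wtSet_nonempty ht)).ne'
  have h : ∀ x : Vec n, ({x | x ⬝ᵥ y = 0} : Set (Vec n)).indicator (1 : Vec n → ℝ) x
      = (1 + chi x y) / 2 := by
    intro x
    rw [← orth_ind]
    by_cases h : x ⬝ᵥ y = 0 <;> simp [h]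
  rw [pr_rowDist_eq]
  simp only [h]
  rw [← Finset.sum_div, Finset.sum_add_distrib, bias]
  simp
  field_simp

theorem pr_rowDist_one (ht : t ≤ n) (y : Vec n) :
    pr (rowDist ht) {x | x ⬝ᵥ y = 1} = (1 - bias t y) / 2 := by
  have h : ({x | x ⬝ᵥ y = 1} : Set (Vec n)) = {x | x ⬝ᵥ y = 0}ᶜ := by
    ext x
    rcases F2.eq_zero_or_one (x ⬝ᵥ y) with h | h <;> simp [h]
  rw [h, pr_compl, pr_rowDist_zero]; ring

theorem syndrome_weight {r : ℕ} (P : Fin r → Vec n) (y : Vec n) :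
    (hammingNorm ((Matrix.of P).mulVec y) : ℝ)
      = ∑ i, ({x | x ⬝ᵥ y = 1} : Set (Vec n)).indicator (1 : Vec n → ℝ) (P i) := by
  rw [hammingNorm_eq_sum]; rfl

theorem sub_syndrome_weight {r : ℕ} (P : Fin r → Vec n) (y : Vec n) :
    (r - hammingNorm ((Matrix.of P).mulVec y) : ℝ)
      = ∑ i, ({x | x ⬝ᵥ y = 0} : Set (Vec n)).indicator (1 : Vec n → ℝ) (P i) := by
  rw [sub_hammingNorm_eq_sum]; rfl

theorem pr_syndrome_light (ht : t ≤ n) (r : ℕ) {z : ℝ} (h0 : 0 ≤ z) (h1 : z ≤ 1) {y : Vec n}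
    (hy : bias t y ≤ z) :
    pr (iid (rowDist ht) r) {P | (hammingNorm ((Matrix.of P).mulVec y) : ℝ) < (1 / 2 - z) * r}
      ≤ Real.exp (-(z ^ 2 * r / 16)) := by
  -- A satisfied check has probability at most `1/2 + z/2`, while acceptance requires a fraction
  -- above `1/2 + z`. The gap is `z/2`.
  have h := iid_tail (rowDist ht) r (fun _ => {x | x ⬝ᵥ y = 0}) (fun _ => 1 / 2 + z / 2)
    (fun _ => by rw [pr_rowDist_zero]; linarith)
    (by
      simp only [Finset.sum_const, Finset.card_univ, Fintype.card_fin, nsmul_eq_mul]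
      nlinarith [(Nat.cast_nonneg r : (0 : ℝ) ≤ r)]) (δ := z / 2) (by linarith) (by linarith)
  refine (pr_mono fun P _ hP => ?_).trans (h.trans_eq (by ring_nf))
  simp only [Set.mem_ofPred_eq, ← sub_syndrome_weight] at hP ⊢
  simp only [Finset.sum_const, Finset.card_univ, Fintype.card_fin, nsmul_eq_mul]
  linarith

theorem pr_syndrome_heavy (ht : t ≤ n) (r : ℕ) {z : ℝ} (h0 : 0 ≤ z) (h1 : z ≤ 1 / 4) {y : Vec n}
    (hy : 4 * z ≤ bias t y) :
    pr (iid (rowDist ht) r) {P | ¬ (hammingNorm ((Matrix.of P).mulVec y) : ℝ) < (1 / 2 - z) * r}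
      ≤ Real.exp (-(z ^ 2 * r / 4)) := by
  -- A violated check has probability at most `1/2 - 2z`, while rejection requires a fraction of at
  -- least `1/2 - z`. The gap is `z`.
  have h := iid_tail (rowDist ht) r (fun _ => {x | x ⬝ᵥ y = 1}) (fun _ => 1 / 2 - 2 * z)
    (fun _ => by rw [pr_rowDist_one]; linarith)
    (by
      simp only [Finset.sum_const, Finset.card_univ, Fintype.card_fin, nsmul_eq_mul]
      nlinarith [(Nat.cast_nonneg r : (0 : ℝ) ≤ r)]) (δ := z) (by linarith) (by linarith)
  refine (pr_mono fun P _ hP => ?_).trans h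
  simp only [Set.mem_ofPred_eq, ← syndrome_weight, not_lt] at hP ⊢
  simp only [Finset.sum_const, Finset.card_univ, Fintype.card_fin, nsmul_eq_mul]
  linarith

end syndrome

/-! ### Parameters -/

/-- The number of rows. -/
noncomputable def rowNum (n : ℕ) : ℕ := ⌊(0.99 : ℝ) * n⌋₊

theorem rowNum_eq (n : ℕ) : rowNum n = 99 * n / 100 := by
  rw [rowNum, ← Nat.floor_div_eq_div (K := ℝ)]
  congr 1
  push_cast; ring

/-- The slack in the threshold of the decoder. -/
noncomputable def slack (n : ℕ) : ℝ := ((0.99 : ℝ) * n) ^ (-(1 / 4) : ℝ)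

theorem slack_eq (n : ℕ) : slack n = (√√(0.99 * n))⁻¹ := by
  rw [slack, Real.sqrt_eq_rpow, Real.sqrt_eq_rpow, ← Real.rpow_mul (by positivity),
    Real.rpow_neg (by positivity)]
  norm_num

theorem slack_nonneg (n : ℕ) : 0 ≤ slack n := by rw [slack_eq]; positivity

theorem sqrt_sqrt_le {n : ℕ} : √√(n : ℝ) ≤ 2 * √√(0.99 * n) := by
  have h : (2 : ℝ) * √√(0.99 * n) = √√(16 * (0.99 * n)) := by
    have h16 : √(16 : ℝ) = 4 := by
      rw [show (16 : ℝ) = 4 ^ 2 by norm_num, Real.sqrt_sq (by norm_num)]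
    have h4 : √(4 : ℝ) = 2 := by
      rw [show (4 : ℝ) = 2 ^ 2 by norm_num, Real.sqrt_sq (by norm_num)]
    rw [Real.sqrt_mul (show (0 : ℝ) ≤ 16 by norm_num) (0.99 * n), h16,
      Real.sqrt_mul (show (0 : ℝ) ≤ 4 by norm_num), h4]
  rw [h]
  gcongr
  linarith [(Nat.cast_nonneg n : (0 : ℝ) ≤ n)]

theorem slack_le {n : ℕ} (hn : 0 < n) : slack n ≤ 2 / √√n := by
  have : (0 : ℝ) < n := by exact_mod_cast hn
  have h1 : 0 < √√(n : ℝ) := by positivity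
  have h2 : 0 < √√(0.99 * n : ℝ) := by positivity
  rw [slack_eq, inv_eq_one_div, div_le_div_iff₀ h2 h1]
  linarith [sqrt_sqrt_le (n := n)]

theorem le_slack {n : ℕ} (hn : 0 < n) : 1 / √√(n : ℝ) ≤ slack n := by
  have : (0 : ℝ) < n := by exact_mod_cast hn
  rw [slack_eq, inv_eq_one_div]
  gcongr
  linarith

/-- The exponent in the Chernoff bounds for the syndrome is a constant times this product, so the
slack `n^(-1/4)` leads to errors `exp(-Ω(√n))`. -/
theorem slack_sq_mul_ge {n : ℕ} (hn : 4 ≤ n) : √n / 4 ≤ slack n ^ 2 * rowNum n := by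
  have hn' : (4 : ℝ) ≤ n := by exact_mod_cast hn
  have hr : (n : ℝ) / 2 ≤ rowNum n := by
    rw [rowNum_eq]
    have : n ≤ 2 * (99 * n / 100) := by omega
    have : (n : ℝ) ≤ 2 * ((99 * n / 100 : ℕ) : ℝ) := by exact_mod_cast this
    linarith
  have hs : 1 / √(n : ℝ) ≤ slack n ^ 2 := by
    have h := le_slack (show 0 < n by omega)
    have h2 := pow_le_pow_left₀ (by positivity) h 2
    rwa [div_pow, Real.sq_sqrt (by positivity), one_pow] at h2
  calc √(n : ℝ) / 4 ≤ 1 / √n * (n / 2) := by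
        have : 0 < √(n : ℝ) := by positivity
        have h2 := Real.mul_self_sqrt (show (0 : ℝ) ≤ n by positivity)
        rw [div_mul_div_comm, one_mul, div_le_div_iff₀ (by norm_num) (by positivity)]
        nlinarith
    _ ≤ _ := by gcongr

section uniform
variable {n : ℕ}

/-- The one-time pad. It makes `c + z` uniform in the proof of soundness and the transmitted word
uniform in the proof of robustness. -/
theorem expect_uniform_add (a : Vec n) (f : Vec n → ℝ≥0∞) :
    (expect (PMF.uniformOfFintype (Vec n)) fun z => f (a + z))
      = expect (PMF.uniformOfFintype (Vec n)) f := by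
  simp only [expect_fintype, PMF.uniformOfFintype_apply]
  exact Equiv.sum_comp (Equiv.addLeft a) fun z => (_ : ℝ≥0∞) * f z

end uniform

/-- The scheme with row weight `⌊log n / K⌋`. -/
noncomputable def code (K : ℕ) (η : ℝ) (hη : η ∈ Set.Ico (0 : ℝ) (1 / 2)) : ZeroBitScheme :=
  ldpcPRC (fun n => rowWt K n * rowWt K n) (rowWt K) rowNum η hη slack (rowWt_le K)

/-- Whether the decoder accepts the syndrome of `v`. -/
def Accepts {r n : ℕ} (P : Fin r → Vec n) (v : Vec n) : Prop :=
  (hammingNorm ((Matrix.of P).mulVec v) : ℝ) < (1 / 2 - slack n) * r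

/-! ### Soundness -/

/-- Outside an event of probability `2 exp(-√n/16)`, the mean sign of `y` is below `n^(-1/4)`. As `t
≥ 2`, the bias is then at most `n^(-1/2) + t²/n ≤ 2 n^(-1/2) ≤ n^(-1/4)`, which is below the slack.
-/
theorem eventually_sound {K : ℕ} (hK : 2 ≤ K) : ∀ᶠ n : ℕ in atTop, ∀ r, r = rowNum n →
    (expect (PMF.uniformOfFintype (Vec n)) fun y =>
      prob (iid (rowDist (rowWt_le K n)) r) {P | Accepts P y})
      ≤ ENNReal.ofReal (3 * negl K n) := by
  have hK0 : K ≠ 0 := by omega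
  filter_upwards [eventually_ge_atTop 16, (tendsto_rowWt hK0).eventually_ge_atTop 2,
    eventually_rowWt_sq_le_sqrt hK (show (0 : ℝ) < 1 by norm_num),
    eventually_exp_neg_le hK 1 (show (0 : ℝ) < 1 / 64 by norm_num)] with n hn ht hts hexp r hr
  subst hr
  set t := rowWt K n with htdef
  have hn' : (16 : ℝ) ≤ n := by exact_mod_cast hn
  have hs4 : 4 ≤ √(n : ℝ) := Real.le_sqrt_of_sq_le (by linarith)
  have hss2 : 2 ≤ √√(n : ℝ) := Real.le_sqrt_of_sq_le (by linarith)
  have hsq : √√(n : ℝ) * √√(n : ℝ) = √n := Real.mul_self_sqrt (by positivity)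
  have hsqn : √(n : ℝ) * √(n : ℝ) = n := Real.mul_self_sqrt (by positivity)
  have hz := le_slack (show 0 < n by omega)
  have hz1 : slack n ≤ 1 := (slack_le (show 0 < n by omega)).trans
    (by rw [div_le_one (by positivity)]; exact hss2)
  have hexp' : Real.exp (-(1 / 64 * √n)) ≤ negl K n := by
    rw [negl]; simpa using hexp
  refine (expect_le_prob_add {y : Vec n | 1 / √√(n : ℝ) ≤ |meanSign y|} (fun y => prob_le_one _ _)
    (c := ENNReal.ofReal (negl K n)) ?_).trans ?_
  · intro y hy
    have hy' : |meanSign y| < 1 / √√(n : ℝ) := not_le.1 hy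
    rw [← pr_le_iff _ _ (negl_pos K n).le]
    refine (pr_syndrome_light (rowWt_le K n) _ (slack_nonneg n) hz1 ?_).trans (le_trans ?_ hexp')
    · have h1 := (le_abs_self _).trans (abs_bias_sub_pow_le t (rowWt_le K n) y)
      have h2 : meanSign y ^ t ≤ 1 / √n := by
        calc meanSign y ^ t ≤ |meanSign y| ^ t := by rw [← abs_pow]; exact le_abs_self _
          _ ≤ |meanSign y| ^ 2 := pow_le_pow_of_le_one (abs_nonneg _) (abs_meanSign_le_one y) ht
          _ ≤ (1 / √√(n : ℝ)) ^ 2 := by gcongr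
          _ = _ := by rw [div_pow, sq √√(n : ℝ), hsq, one_pow]
      have h3 : (t : ℝ) ^ 2 / n ≤ 1 / √n := by
        rw [div_le_div_iff₀ (by positivity) (by positivity)]
        nlinarith
      have h4 : 2 / √(n : ℝ) ≤ 1 / √√n := by
        rw [div_le_div_iff₀ (by positivity) (by positivity)]
        nlinarith
      have h5 : 2 / √(n : ℝ) = 1 / √n + 1 / √n := by ring
      linarith
    · rw [Real.exp_le_exp]
      linarith [slack_sq_mul_ge (show 4 ≤ n by omega)]
  · have h := pr_abs_meanSign_ge (n := n) (by omega) (a := 1 / √√(n : ℝ)) (by positivity)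
      (by rw [div_le_one (by positivity)]; linarith)
    rw [prob_eq_ofReal, ← ENNReal.ofReal_add (pr_nonneg _ _) (negl_pos K n).le]
    refine ENNReal.ofReal_le_ofReal ?_
    have h2 : Real.exp (-((1 / √√(n : ℝ)) ^ 2 * n / 16)) ≤ negl K n := by
      refine le_trans ?_ hexp'
      rw [Real.exp_le_exp, div_pow, sq √√(n : ℝ), hsq, one_pow]
      have : 1 / √(n : ℝ) * n = √n := by
        rw [one_div_mul_eq_div, div_eq_iff (by positivity), hsqn]
      rw [this]; linarith
    linarith

/-- The syndrome depends on `c` only through `c + z`, which is uniform and independent of `P`.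
Strings of the wrong length are never accepted and only help. -/
theorem code_sound {K : ℕ} (hK : 2 ≤ K) (η : ℝ) (hη : η ∈ Set.Ico (0 : ℝ) (1 / 2)) :
    (code K η hη).Sound := by
  classical
  obtain ⟨n₀, hn₀⟩ := eventually_atTop.1 (eventually_sound hK)
  -- The bound must hold for every `n`; for the finitely many small ones the trivial error `1` is
  -- used.
  refine ⟨fun n => if n₀ ≤ n then 3 * negl K n else 1,
    ((negligible_negl (show K ≠ 0 by omega)).const_mul 3).of_eventually_le ?_, fun n c => ?_⟩
  · filter_upwards [eventually_ge_atTop n₀] with n hn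
    have := negl_pos K n
    rw [if_pos hn, abs_of_pos (by positivity)]
  · set X := ((code K η hη).keyGen n).bind fun k => (code K η hη).decode n k.1 c with hX
    beta_reduce
    split_ifs with hn
    swap
    · simpa using pr_nonneg X _
    suffices h : pr X {none}ᶜ ≤ 3 * negl K n by
      rw [pr_compl] at h; linarith
    have := negl_pos K n
    rw [pr_le_iff _ _ (by positivity)]
    refine le_trans ?_ (hn₀ n hn (rowNum n) rfl)
    set c' : Vec n := fun i => c.getD i 0 with hc'
    calc prob X {none}ᶜ ≤ expect (ldpc n (rowWt K n * rowWt K n) (rowWt K n) (rowNum n) (rowWt_le K n))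
          fun PG => expect (PMF.uniformOfFintype (Vec n)) fun z =>
            ({P | Accepts P (c' + z)} : Set _).indicator 1 (Matrix.of.symm PG.1) := by
          rw [hX, prob_bind]
          simp only [code, ldpcPRC, expect_bind, expect_map, prob_pure, pairMatrix_packPair,
            pairVec_packPair]
          refine expect_mono fun PG => expect_mono fun z => ?_
          split_ifs with h
          · rw [Set.indicator_of_mem (by simp), Set.indicator_of_mem]
            · simp
            · have h2 := h.2
              rw [← Matrix.mulVec_add] at h2
              exact h2
          · simp
      _ = expect ((ldpc n (rowWt K n * rowWt K n) (rowWt K n) (rowNum n) (rowWt_le K n)).map Prod.fst)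
          fun P => expect (PMF.uniformOfFintype (Vec n)) fun z =>
            ({P | Accepts P (c' + z)} : Set _).indicator 1 (Matrix.of.symm P) := by
          rw [expect_map]
      _ = _ := by
          rw [ldpc_map_fst, expect_map, expect_comm,
            ← expect_uniform_add c' fun y => prob (iid (rowDist (rowWt_le K n)) _) {P | Accepts P y}]
          rfl


/-! ### Robustness -/

/-- A mean sign of at least `2^(-m)` gives a bias of about `2^(-mt)`. With `K = 8m` this is at least
`n^(-1/8)`, well above the slack of order `n^(-1/4)`. -/
theorem eventually_accepts {m : ℕ} (hm : 1 ≤ m) : ∀ᶠ n : ℕ in atTop, ∀ r, r = rowNum n →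
    ∀ v : Vec n, (1 / 2) ^ m ≤ meanSign v →
    prob (iid (rowDist (rowWt_le (8 * m) n)) r) {P | ¬ Accepts P v}
      ≤ ENNReal.ofReal (negl (8 * m) n) := by
  have hK0 : 8 * m ≠ 0 := by omega
  have hK2 : 2 ≤ 8 * m := by omega
  filter_upwards [eventually_ge_atTop 16, (tendsto_rowWt hK0).eventually_ge_atTop 4,
    eventually_rowWt_sq_le_sqrt hK2 (show (0 : ℝ) < 1 by norm_num),
    eventually_exp_neg_le hK2 1 (show (0 : ℝ) < 1 / 16 by norm_num)] with n hn ht hts hexp r hr v hv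
  subst hr
  set t := rowWt (8 * m) n with htdef
  have hn' : (16 : ℝ) ≤ n := by exact_mod_cast hn
  have hs4 : 4 ≤ √(n : ℝ) := Real.le_sqrt_of_sq_le (by linarith)
  have hss2 : 2 ≤ √√(n : ℝ) := Real.le_sqrt_of_sq_le (by linarith)
  have hsq : √√(n : ℝ) * √√(n : ℝ) = √n := Real.mul_self_sqrt (by positivity)
  have hsqn : √(n : ℝ) * √(n : ℝ) = n := Real.mul_self_sqrt (by positivity)
  have hz0 := slack_nonneg n
  have hz := le_slack (show 0 < n by omega)
  have hz' := slack_le (show 0 < n by omega)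
  set A : ℝ := 2 ^ (m * t) with hA
  have hA10 : 10 ≤ A := by
    calc (10 : ℝ) ≤ 2 ^ 4 := by norm_num
      _ ≤ _ := pow_le_pow_right₀ (by norm_num) (by nlinarith)
  -- That is, `A^8 = 2^(8mt) ≤ n`. The factor `8` in the definition of the row weight is used here.
  have hAn : A ^ 2 ≤ √√(n : ℝ) := by
    refine Real.le_sqrt_of_sq_le (Real.le_sqrt_of_sq_le ?_)
    rw [hA, ← pow_mul, ← pow_mul, ← pow_mul]
    have := two_pow_rowWt_le (8 * m) (n := n) (by omega)
    have h2 : m * t * (2 * (2 * 2)) = 8 * m * t := by ring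
    rw [h2]; exact_mod_cast this
  -- Four multiples of the slack are required by `pr_syndrome_heavy`, and the fifth pays for the
  -- error `t²/n` in the approximation of the bias.
  have h5 : 5 * slack n ≤ 1 / A := by
    calc 5 * slack n ≤ 5 * (2 / √√(n : ℝ)) := by gcongr
      _ ≤ 5 * (2 / A ^ 2) := by gcongr
      _ = 10 / A ^ 2 := by ring
      _ ≤ 1 / A := by
        rw [div_le_div_iff₀ (by positivity) (by positivity)]
        nlinarith
  have h14 : slack n ≤ 1 / 4 := by
    have : 1 / A ≤ 1 / 10 := by gcongr
    linarith
  rw [← pr_le_iff _ _ (negl_pos _ n).le]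
  refine (pr_syndrome_heavy (rowWt_le _ n) _ hz0 h14 ?_).trans ?_
  · have h1 := (abs_le.1 (abs_bias_sub_pow_le t (rowWt_le _ n) v)).1
    have h2 : 1 / A ≤ meanSign v ^ t := by
      calc 1 / A = ((1 / 2) ^ m) ^ t := by rw [hA, ← pow_mul, one_div_pow]
        _ ≤ _ := by gcongr
    have h3 : (t : ℝ) ^ 2 / n ≤ 1 / √n := by
      rw [div_le_div_iff₀ (by positivity) (by positivity)]
      nlinarith
    have h4 : 1 / √(n : ℝ) ≤ 1 / √√n := by
      rw [div_le_div_iff₀ (by positivity) (by positivity)]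
      nlinarith
    linarith
  · have : Real.exp (-(1 / 16 * √n)) ≤ negl (8 * m) n := by rw [negl]; simpa using hexp
    refine le_trans ?_ this
    rw [Real.exp_le_exp]
    linarith [slack_sq_mul_ge (show 4 ≤ n by omega)]

theorem pr_ber_one (η : ℝ) (hη : η ∈ Set.Ico (0 : ℝ) (1 / 2)) : pr (ber η hη) {1} = η := by
  rw [pr_eq, prob, expect, tsum_eq_single 1]
  · simp [ber, PMF.ofFintype_apply, hη.1]
  · intro b hb; simp [hb]

theorem pr_ber_zero (η : ℝ) (hη : η ∈ Set.Ico (0 : ℝ) (1 / 2)) : pr (ber η hη) {0} = 1 - η := by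
  have : ({0} : Set F2) = {1}ᶜ := by
    ext b; rcases F2.eq_zero_or_one b with rfl | rfl <;> simp
  rw [this, pr_compl, pr_ber_one]

/-- A coordinate of `e' + e` is `1` with probability `η` or `1 - η`, according to `e'`. The expected
weight is therefore at most `(1/2 - θ/2) n` with `θ = (1 - 2η)(1 - 2p)`, and the event requires a
deviation of `θ n / 4`. -/
theorem pr_meanSign_add_lt {n : ℕ} (hn : 0 < n) {p η : ℝ} (hp : p ∈ Set.Ioo (0 : ℝ) (1 / 2))
    (hη : η ∈ Set.Ico (0 : ℝ) (1 / 2)) {e' : Vec n} (he : (hammingNorm e' : ℝ) ≤ p * n) :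
    pr (iid (ber η hη) n) {e | meanSign (e' + e) < (1 - 2 * η) * (1 - 2 * p) / 2}
      ≤ Real.exp (-(((1 - 2 * η) * (1 - 2 * p)) ^ 2 / 64 * n)) := by
  obtain ⟨hp0, hp1⟩ := hp
  have hη0 := hη.1
  have hη1 := hη.2
  have hn' : (0 : ℝ) < n := by exact_mod_cast hn
  set θ := (1 - 2 * η) * (1 - 2 * p) with hθ
  have hθ0 : 0 ≤ θ := mul_nonneg (by linarith) (by linarith)
  have hθ1 : θ ≤ 1 := by nlinarith
  set β : Fin n → ℝ := fun i => η + (1 - 2 * η) * ({1} : Set F2).indicator 1 (e' i) with hβ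
  have hsum : ∑ i, β i = η * n + (1 - 2 * η) * hammingNorm e' := by
    simp only [hβ, Finset.sum_add_distrib, ← Finset.mul_sum, ← hammingNorm_eq_sum]
    simp; ring
  have hsum' : ∑ i, β i ≤ (1 / 2 - θ / 2) * n := by
    rw [hsum, hθ]; nlinarith
  have h := iid_tail (ber η hη) n (fun i => {b | e' i + b = 1}) β (fun i => by
      simp only [hβ]
      rcases F2.eq_zero_or_one (e' i) with h | h
      · have : ({b | e' i + b = 1} : Set F2) = {1} := by ext b; simp [h]
        rw [this, pr_ber_one]; simp [h]
      · have : ({b | e' i + b = 1} : Set F2) = {0} := by ext b; simp [h]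
        rw [this, pr_ber_zero]; simp [h]; linarith)
    (by nlinarith) (δ := θ / 4) (by linarith) (by linarith)
  refine (pr_mono fun e _ he => ?_).trans (h.trans_eq (by ring_nf))
  have hw : ∑ i, ({b | e' i + b = 1} : Set F2).indicator (1 : F2 → ℝ) (e i) = hammingNorm (e' + e) := by
    rw [hammingNorm_eq_sum]; rfl
  simp only [Set.mem_ofPred_eq, hw] at he ⊢
  rw [meanSign] at he
  have h1 : 1 - θ / 2 < 2 * (hammingNorm (e' + e) : ℝ) / n := by linarith
  rw [lt_div_iff₀ hn'] at h1
  linarith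

/-- For the received word `y` and the sent word `x = Gu + z + e`, the relation `PG = 0` gives `P(y +
z) = P((y + x) + e)`. For fixed `P`, `G`, `u` and `e`, the word `x` is uniform because of `z`, so
the error `y + x` has the distribution for uniform inputs that appears in the definition of a
bounded channel. -/
theorem prob_transmit {K : ℕ} {η : ℝ} (hη : η ∈ Set.Ico (0 : ℝ) (1 / 2)) (E : Channel) (n : ℕ) :
    prob ((code K η hη).transmit E n) {some ()}ᶜ
      ≤ expect ((PMF.uniformOfFintype (Vec n)).bind fun x => (E n x).map fun y => y + x) fun e' =>
        expect (iid (ber η hη) n) fun e =>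
          prob (iid (rowDist (rowWt_le K n)) (rowNum n)) {P | ¬ Accepts P (e' + e)} := by
  classical
  set D := (PMF.uniformOfFintype (Vec n)).bind fun x => (E n x).map fun y => y + x with hD
  set F : Matrix (Fin (rowNum n)) (Fin n) F2 → Vec n → ℝ≥0∞ := fun P v =>
    ({v | ¬ Accepts (Matrix.of.symm P) v} : Set _).indicator 1 v with hF
  have hself : ∀ a : Vec n, a + a = 0 := fun a => by ext i; simp [F2.add_self]
  calc prob ((code K η hη).transmit E n) {some ()}ᶜ
      ≤ expect (ldpc n (rowWt K n * rowWt K n) (rowWt K n) (rowNum n) (rowWt_le K n)) fun PG =>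
        expect (PMF.uniformOfFintype (Vec n)) fun z =>
        expect (PMF.uniformOfFintype (Vec (rowWt K n * rowWt K n))) fun u =>
        expect (iid (ber η hη) n) fun e =>
        expect (E n ((PG.2.mulVec u + e) + z)) fun y => F PG.1 ((y + ((PG.2.mulVec u + e) + z)) + e) := by
        rw [ZeroBitScheme.transmit, prob_bind]
        simp only [code, ldpcPRC, expect_bind, expect_map, prob_pure, prob_bind, pairMatrix_packPair,
          pairVec_packPair]
        refine expect_mono_support fun PG hPG => expect_mono fun z => expect_mono fun u =>
          expect_mono fun e => ?_
        have hk : PG.1 * PG.2 = 0 := by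
          rw [ldpc, PMF.mem_support_bind_iff] at hPG
          obtain ⟨P, -, hP⟩ := hPG
          rw [PMF.mem_support_map_iff] at hP
          obtain ⟨G, hG, rfl⟩ := hP
          rw [PMF.mem_support_uniformOfFinset_iff, kernelMatrices, Finset.mem_filter] at hG
          exact hG.2
        have e1 : PG.2.mulVec u + z + e = PG.2.mulVec u + e + z := by abel
        rw [e1]
        refine expect_mono fun y => ?_
        split_ifs with h
        · simp
        · simp only [hF]
          refine (indicator_one_le _ _).trans ?_
          rw [Set.indicator_of_mem]
          · simp
          · intro hacc
            refine h ⟨by simp, ?_⟩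
            have e2 : (fun i : Fin n => (List.ofFn y).getD i 0) = y := by
              ext i; simp
            rw [e2]
            have e3 : (y + (PG.2.mulVec u + e + z) + e) = y + z + PG.2.mulVec u := by
              have := hself e
              calc _ = y + z + PG.2.mulVec u + (e + e) := by abel
                _ = _ := by rw [this, add_zero]
            rw [e3] at hacc
            have e4 : PG.1.mulVec (y + z + PG.2.mulVec u) = PG.1.mulVec y + PG.1.mulVec z := by
              rw [Matrix.mulVec_add, Matrix.mulVec_add, Matrix.mulVec_mulVec, hk, Matrix.zero_mulVec,
                add_zero]
            rw [← e4]
            exact hacc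
    _ = expect (ldpc n (rowWt K n * rowWt K n) (rowWt K n) (rowNum n) (rowWt_le K n)) fun PG =>
        expect D fun e' => expect (iid (ber η hη) n) fun e => F PG.1 (e' + e) := by
        congr 1; funext PG
        -- The mean over `z` is moved to the inside, where `u` and `e` are fixed and the word sent
        -- is a translate of `z`. Afterwards nothing depends on `u` any more.
        rw [expect_comm]
        simp only [expect_comm (PMF.uniformOfFintype (Vec n)) (iid (ber η hη) n)]
        simp only [fun (u : Vec (rowWt K n * rowWt K n)) (e : Vec n) => expect_uniform_add (PG.2.mulVec u + e)
          fun x => expect (E n x) fun y => F PG.1 (y + x + e)]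
        rw [expect_const, expect_comm D]
        simp only [hD, expect_bind, expect_map]
    _ = expect ((ldpc n (rowWt K n * rowWt K n) (rowWt K n) (rowNum n) (rowWt_le K n)).map Prod.fst)
        fun P => expect D fun e' => expect (iid (ber η hη) n) fun e => F P (e' + e) := by
        rw [expect_map]
    _ = _ := by
        rw [ldpc_map_fst, expect_map, expect_comm]
        congr 1; funext e'
        rw [expect_comm]
        congr 1

theorem code_robust {m : ℕ} (hm : 1 ≤ m) {p η : ℝ} (hp : p ∈ Set.Ioo (0 : ℝ) (1 / 2))
    (hη : η ∈ Set.Ico (0 : ℝ) (1 / 2)) (hmp : (1 / 2) ^ m ≤ (1 - 2 * η) * (1 - 2 * p) / 2)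
    (E : Channel) (hE : IsBounded p E) : (code (8 * m) η hη).RobustTo E := by
  obtain ⟨μ, hμ, hE⟩ := hE
  have hK0 : 8 * m ≠ 0 := by omega
  have hK2 : 2 ≤ 8 * m := by omega
  have hθ : 0 < (1 - 2 * η) * (1 - 2 * p) := mul_pos (by linarith [hη.2]) (by linarith [hp.2])
  refine ⟨fun n => pr ((code (8 * m) η hη).transmit E n) {some ()}ᶜ, ?_, fun n => by
    beta_reduce; rw [pr_compl]; linarith⟩
  refine (hμ.add ((negligible_negl hK0).const_mul 2)).of_eventually_le ?_
  filter_upwards [eventually_accepts hm, eventually_gt_atTop 0,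
    eventually_exp_neg_le' hK2 1 (c := ((1 - 2 * η) * (1 - 2 * p)) ^ 2 / 64) (by positivity)]
    with n hacc hn hexp
  have hneg := negl_pos (8 * m) n
  have hμ0 : 0 ≤ μ n := (pr_nonneg _ _).trans (hE n)
  rw [abs_of_nonneg (pr_nonneg _ _), pr_le_iff _ _ (by positivity)]
  refine (prob_transmit hη E n).trans ?_
  refine (expect_le_prob_add {e' : Vec n | p * n < (hammingNorm e' : ℝ)}
    (fun e' => expect_le_const fun e _ => prob_le_one _ _)
    (c := ENNReal.ofReal (2 * negl (8 * m) n)) ?_).trans ?_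
  · intro e' he'
    have he : (hammingNorm e' : ℝ) ≤ p * n := not_lt.1 he'
    refine (expect_le_prob_add {e : Vec n | meanSign (e' + e) < (1 - 2 * η) * (1 - 2 * p) / 2}
      (fun e => prob_le_one _ _) (c := ENNReal.ofReal (negl (8 * m) n)) ?_).trans ?_
    · intro e he
      exact hacc _ rfl _ (hmp.trans (not_lt.1 he))
    · rw [prob_eq_ofReal, ← ENNReal.ofReal_add (pr_nonneg _ _) hneg.le]
      refine ENNReal.ofReal_le_ofReal ?_
      have h1 := pr_meanSign_add_lt hn hp hη he
      have h2 : Real.exp (-(((1 - 2 * η) * (1 - 2 * p)) ^ 2 / 64 * n)) ≤ negl (8 * m) n := by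
        rw [negl]; simpa using hexp
      linarith
  · rw [prob_eq_ofReal, ← ENNReal.ofReal_add (pr_nonneg _ _) (by positivity)]
    exact ENNReal.ofReal_le_ofReal (by linarith [hE n])


/-! ### Runs that halt -/

section runs
variable {O : PMF (List F2)}

theorem bind_congr_support {α β : Type} {X : PMF α} {Y Y' : α → PMF β}
    (h : ∀ a ∈ X.support, Y a = Y' a) : X.bind Y = X.bind Y' := by
  ext b
  rw [PMF.bind_apply, PMF.bind_apply]
  refine tsum_congr fun a => ?_
  by_cases ha : a ∈ X.support
  · rw [h a ha]
  · rw [PMF.mem_support_iff, not_not] at ha; simp [ha]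

/-- From the commands `L` and the memory `m`, the machine halts within `T` steps, with memory
distributed as `D`. -/
def Final (O : PMF (List F2)) (L : List Cmd) (m : Mem) (T : ℕ) (D : PMF Mem) : Prop :=
  ∀ T', T ≤ T' → run O T' (L, m) = D.map fun m' => ([], m')

theorem run_nil (T : ℕ) (m : Mem) : run O T ([], m) = PMF.pure ([], m) := by
  induction T with
  | zero => rfl
  | succ T ih => rw [run, step, PMF.pure_bind, ih]

theorem run_add (T k : ℕ) (s : Cfg) : run O (T + k) s = (run O T s).bind (run O k) := by
  induction T generalizing s with
  | zero => rw [Nat.zero_add, run, PMF.pure_bind]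
  | succ T ih =>
    rw [Nat.succ_add, run, run, PMF.bind_bind]
    congr 1; funext s'; exact ih s'

theorem final_of_halts {L : List Cmd} {m : Mem} {T : ℕ}
    (h : ∀ s ∈ (run O T (L, m)).support, s.1 = []) :
    Final O L m T ((run O T (L, m)).map Prod.snd) := by
  intro T' hT
  obtain ⟨k, rfl⟩ := Nat.exists_eq_add_of_le hT
  rw [run_add, PMF.map_comp, ← PMF.bind_pure_comp]
  refine bind_congr_support fun s hs => ?_
  obtain ⟨L', m'⟩ := s
  have : L' = [] := h _ hs
  subst this
  rw [run_nil]; rfl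

theorem Final.halts {L : List Cmd} {m : Mem} {T : ℕ} {D : PMF Mem} (h : Final O L m T D) :
    ∀ s ∈ (run O T (L, m)).support, s.1 = [] := by
  intro s hs
  rw [h T le_rfl, PMF.mem_support_map_iff] at hs
  obtain ⟨m', -, rfl⟩ := hs
  rfl

theorem Final.map_snd {L : List Cmd} {m : Mem} {T T' : ℕ} {D : PMF Mem} (h : Final O L m T D)
    (hT : T ≤ T') : (run O T' (L, m)).map Prod.snd = D := by
  rw [h T' hT, PMF.map_comp]; exact PMF.map_id _

theorem Final.unique {L : List Cmd} {m : Mem} {T : ℕ} {D D' : PMF Mem} (h : Final O L m T D)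
    (h' : Final O L m T D') : D = D' := by
  rw [← h.map_snd le_rfl, h'.map_snd le_rfl]

theorem Final.mono {L : List Cmd} {m : Mem} {T T' : ℕ} {D : PMF Mem} (h : Final O L m T D)
    (hT : T ≤ T') : Final O L m T' D := fun k hk => h k (hT.trans hk)

theorem final_nil (m : Mem) : Final O [] m 0 (PMF.pure m) := fun T _ => by
  rw [run_nil, PMF.pure_map]

theorem Final.cons {c : Cmd} {L : List Cmd} {m : Mem} {T : ℕ} {F : Cfg → PMF Mem}
    (h : ∀ s ∈ (step O (c :: L, m)).support, Final O s.1 s.2 T (F s)) :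
    Final O (c :: L) m (T + 1) ((step O (c :: L, m)).bind F) := by
  intro T' hT
  obtain ⟨k, rfl⟩ := Nat.exists_eq_add_of_le hT
  rw [show T + 1 + k = (T + k) + 1 by ring, run, PMF.map_bind]
  exact bind_congr_support fun s hs => h s hs _ (by omega)

theorem step_append (c : Cmd) (L L' : List Cmd) (m : Mem) :
    step O (c :: L ++ L', m) = (step O (c :: L, m)).map fun s => (s.1 ++ L', s.2) := by
  cases c <;> simp [step, PMF.pure_map, PMF.map_comp, Function.comp_def] <;> split_ifs <;> simp

/-- The commands in `L'` are untouched until those in `L` are used up, so the claim follows by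
induction on the number of steps. The continuation `F` may depend on the memory only. -/
theorem Final.append {L L' : List Cmd} {m : Mem} {T T' : ℕ} {D : PMF Mem} {F : Mem → PMF Mem}
    (h : Final O L m T D) (h' : ∀ m' ∈ D.support, Final O L' m' T' (F m')) :
    Final O (L ++ L') m (T + T') (D.bind F) := by
  induction T generalizing L m D with
  | zero =>
    have h0 := h.halts
    simp only [run, PMF.support_pure, Set.mem_singleton_iff, forall_eq] at h0
    subst h0
    have : D = PMF.pure m := h.unique (final_nil m)
    subst this
    rw [PMF.pure_bind]
    exact (h' m (by simp)).mono (by omega)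
  | succ T ih =>
    cases L with
    | nil =>
      have : D = PMF.pure m := h.unique ((final_nil m).mono (by omega))
      subst this
      rw [PMF.pure_bind]
      exact (h' m (by simp)).mono (by omega)
    | cons c L =>
      have hs : ∀ s ∈ (step O (c :: L, m)).support,
          Final O s.1 s.2 T ((run O T s).map Prod.snd) := fun s hs => by
        refine final_of_halts fun s' hs' => h.halts s' ?_
        rw [run, PMF.mem_support_bind_iff]
        exact ⟨s, hs, hs'⟩
      have hD := h.unique (Final.cons hs)
      have hsub : ∀ s ∈ (step O (c :: L, m)).support, ∀ m' ∈ ((run O T s).map Prod.snd).support,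
          m' ∈ D.support := fun s hs m' hm' => by
        rw [hD, PMF.mem_support_bind_iff]; exact ⟨s, hs, hm'⟩
      have key : Final O (c :: (L ++ L')) m (T + T' + 1) ((step O (c :: (L ++ L'), m)).bind
          fun s => (run O (T + T') s).map Prod.snd) := by
        refine Final.cons fun s hs' => ?_
        rw [← List.cons_append, step_append, PMF.mem_support_map_iff] at hs'
        obtain ⟨s', hs', rfl⟩ := hs'
        have := ih (hs s' hs') fun m' hm' => h' m' (hsub s' hs' m' hm')
        rw [this.map_snd le_rfl]
        exact this
      have e : (step O (c :: (L ++ L'), m)).bind (fun s => (run O (T + T') s).map Prod.snd)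
          = D.bind F := by
        rw [← List.cons_append, step_append, ← PMF.bind_pure_comp, PMF.bind_bind, hD, PMF.bind_bind]
        refine bind_congr_support fun s' hs' => ?_
        have := ih (hs s' hs') fun m' hm' => h' m' (hsub s' hs' m' hm')
        rw [Function.comp_apply, PMF.pure_bind, this.map_snd le_rfl]
      rw [e] at key
      exact key.mono (by omega)

/-! ### Specifications of programs -/

/-- From the commands `L` and the memory `m`, the machine halts within `T` steps, and the final
memory can be coupled with a random variable of distribution `X` so that `Q` holds. -/
def Spec {α : Type} (O : PMF (List F2)) (L : List Cmd) (m : Mem) (T : ℕ) (X : PMF α)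
    (Q : α → Mem → Prop) : Prop :=
  ∃ D : PMF (α × Mem), D.map Prod.fst = X ∧ Final O L m T (D.map Prod.snd) ∧
    ∀ p ∈ D.support, Q p.1 p.2

/-- A specification of a deterministic program. -/
def Det (O : PMF (List F2)) (L : List Cmd) (m : Mem) (T : ℕ) (Q : Mem → Prop) : Prop :=
  Spec O L m T (PMF.pure ()) fun _ => Q

variable {α β : Type} {L L' : List Cmd} {m : Mem} {T T' : ℕ} {X : PMF α} {Q Q' : α → Mem → Prop}

theorem Spec.mono (h : Spec O L m T X Q) (hT : T ≤ T') (hQ : ∀ a m', Q a m' → Q' a m') :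
    Spec O L m T' X Q' := by
  obtain ⟨D, h1, h2, h3⟩ := h
  exact ⟨D, h1, h2.mono hT, fun p hp => hQ _ _ (h3 p hp)⟩

theorem Spec.time (h : Spec O L m T X Q) (hT : T ≤ T') : Spec O L m T' X Q :=
  h.mono hT fun _ _ h => h

theorem Spec.imp (h : Spec O L m T X Q) (hQ : ∀ a m', Q a m' → Q' a m') : Spec O L m T X Q' :=
  h.mono le_rfl hQ

theorem Spec.imp_support (h : Spec O L m T X Q) (hQ : ∀ a ∈ X.support, ∀ m', Q a m' → Q' a m') :
    Spec O L m T X Q' := by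
  obtain ⟨D, h1, h2, h3⟩ := h
  refine ⟨D, h1, h2, fun p hp => hQ _ ?_ _ (h3 p hp)⟩
  rw [← h1, PMF.mem_support_map_iff]
  exact ⟨p, hp, rfl⟩

theorem Spec.map {R : β → Mem → Prop} (f : α → β) (h : Spec O L m T X Q)
    (hQ : ∀ a m', Q a m' → R (f a) m') : Spec O L m T (X.map f) R := by
  obtain ⟨D, h1, h2, h3⟩ := h
  refine ⟨D.map fun p => (f p.1, p.2), ?_, ?_, ?_⟩
  · rw [← h1, PMF.map_comp, PMF.map_comp]; rfl
  · rw [PMF.map_comp]; exact h2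
  · intro p hp
    rw [PMF.mem_support_map_iff] at hp
    obtain ⟨p', hp', rfl⟩ := hp
    exact hQ _ _ (h3 p' hp')

theorem Spec.nil {a : α} (h : Q a m) : Spec O [] m 0 (PMF.pure a) Q :=
  ⟨PMF.pure (a, m), PMF.pure_map _ _, by rw [PMF.pure_map]; exact final_nil m, by simpa using h⟩

theorem Det.nil {Q : Mem → Prop} (h : Q m) : Det O [] m 0 Q := Spec.nil h

theorem Spec.step {c : Cmd} {Y : Cfg → PMF α}
    (h : ∀ s ∈ (step O (c :: L, m)).support, Spec O s.1 s.2 T (Y s) Q) :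
    Spec O (c :: L) m (T + 1) ((PRC.step O (c :: L, m)).bind Y) Q := by
  have h' : ∀ s, ∃ D : PMF (α × Mem), s ∈ (PRC.step O (c :: L, m)).support →
      (D.map Prod.fst = Y s ∧ Final O s.1 s.2 T (D.map Prod.snd) ∧ ∀ p ∈ D.support, Q p.1 p.2) := by
    intro s
    by_cases hs : s ∈ (PRC.step O (c :: L, m)).support
    · obtain ⟨D, hD⟩ := h s hs
      exact ⟨D, fun _ => hD⟩
    · obtain ⟨a, -⟩ := (Y s).support_nonempty
      exact ⟨PMF.pure (a, m), fun h => absurd h hs⟩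
  choose D hD using h'
  refine ⟨(PRC.step O (c :: L, m)).bind D, ?_, ?_, ?_⟩
  · rw [PMF.map_bind]; exact bind_congr_support fun s hs => (hD s hs).1
  · rw [PMF.map_bind]; exact Final.cons fun s hs => (hD s hs).2.1
  · intro p hp
    rw [PMF.mem_support_bind_iff] at hp
    obtain ⟨s, hs, hp⟩ := hp
    exact (hD s hs).2.2 p hp

theorem Spec.step_pure {c : Cmd} {s : Cfg} (hs : PRC.step O (c :: L, m) = PMF.pure s)
    (h : Spec O s.1 s.2 T X Q) : Spec O (c :: L) m (T + 1) X Q := by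
  have := Spec.step (O := O) (c := c) (L := L) (m := m) (T := T) (Y := fun _ => X) (Q := Q) (by
    intro s' hs'
    rw [hs, PMF.support_pure, Set.mem_singleton_iff] at hs'
    subst hs'; exact h)
  rwa [PMF.bind_const] at this

theorem Spec.skip (h : Spec O L m T X Q) : Spec O (.skip :: L) m (T + 1) X Q :=
  Spec.step_pure rfl h

theorem Spec.set {a : ℕ} {i j e : Expr}
    (h : Spec O L (store m a (i.eval m) (j.eval m) (e.eval m)) T X Q) :
    Spec O (.set a i j e :: L) m (T + 1) X Q := Spec.step_pure rfl h

theorem Spec.seq {c₁ c₂ : Cmd} (h : Spec O (c₁ :: c₂ :: L) m T X Q) :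
    Spec O (.seq c₁ c₂ :: L) m (T + 1) X Q := Spec.step_pure rfl h

theorem Spec.ite_true {e : Expr} {c₁ c₂ : Cmd} (he : e.eval m ≠ 0) (h : Spec O (c₁ :: L) m T X Q) :
    Spec O (.ite e c₁ c₂ :: L) m (T + 1) X Q := Spec.step_pure (by rw [PRC.step, if_pos he]) h

theorem Spec.ite_false {e : Expr} {c₁ c₂ : Cmd} (he : e.eval m = 0) (h : Spec O (c₂ :: L) m T X Q) :
    Spec O (.ite e c₁ c₂ :: L) m (T + 1) X Q :=
  Spec.step_pure (by rw [PRC.step, if_neg (by simpa using he)]) h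

theorem Spec.loop_true {e : Expr} {c : Cmd} (he : e.eval m ≠ 0)
    (h : Spec O (c :: .loop e c :: L) m T X Q) :
    Spec O (.loop e c :: L) m (T + 1) X Q := Spec.step_pure (by rw [PRC.step, if_pos he]) h

theorem Spec.loop_false {e : Expr} {c : Cmd} (he : e.eval m = 0) (h : Spec O L m T X Q) :
    Spec O (.loop e c :: L) m (T + 1) X Q :=
  Spec.step_pure (by rw [PRC.step, if_neg (by simpa using he)]) h

/-- Different coins lead to different memories. The coin can therefore be recovered from the next
configuration, on which the continuation in `Spec.step` has to depend. -/
theorem Spec.coin {a : ℕ} {i j : Expr} {Y : F2 → PMF α}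
    (h : ∀ b : F2, Spec O L (store m a (i.eval m) (j.eval m) b.val) T (Y b) Q) :
    Spec O (.coin a i j :: L) m (T + 1) ((PMF.uniformOfFintype F2).bind Y) Q := by
  have hstep : PRC.step O (.coin a i j :: L, m)
      = (PMF.uniformOfFintype F2).map fun b => (L, store m a (i.eval m) (j.eval m) b.val) := rfl
  set f : F2 → Cfg := fun b => (L, store m a (i.eval m) (j.eval m) b.val) with hf
  have hinj : Function.Injective f := fun b b' hb => by
    have := congrFun (congrFun (congrFun (congrArg Prod.snd hb) a) (i.eval m)) (j.eval m)
    simp [hf, store] at this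
    exact ZMod.val_injective 2 this
  have key := Spec.step (O := O) (c := .coin a i j) (L := L) (m := m) (T := T)
    (Y := fun s => Y (Function.invFun f s)) (Q := Q) (by
      intro s hs
      rw [hstep, PMF.mem_support_map_iff] at hs
      obtain ⟨b, -, rfl⟩ := hs
      have : Function.invFun f (f b) = b := Function.leftInverse_invFun hinj b
      have h2 : Spec O (f b).1 (f b).2 T (Y (Function.invFun f (f b))) Q := by rw [this]; exact h b
      exact h2)
  rw [hstep, ← PMF.bind_pure_comp, PMF.bind_bind] at key
  simp only [Function.comp_apply, PMF.pure_bind] at key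
  have e : ∀ b, Function.invFun f (f b) = b := fun b => Function.leftInverse_invFun hinj b
  have e2 : (fun b => Y (Function.invFun f (f b))) = Y := by funext b; rw [e]
  rw [← e2]
  exact key

theorem Spec.append {Y : α → PMF β} {R : β → Mem → Prop} (h : Spec O L m T X Q)
    (h' : ∀ a ∈ X.support, ∀ m', Q a m' → Spec O L' m' T' (Y a) R) :
    Spec O (L ++ L') m (T + T') (X.bind Y) R := by
  classical
  obtain ⟨D₁, h1, h2, h3⟩ := h
  have hsup : ∀ p ∈ D₁.support, p.1 ∈ X.support := fun p hp => by
    rw [← h1, PMF.mem_support_map_iff]; exact ⟨p, hp, rfl⟩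
  have hex : ∀ p, ∃ D : PMF (β × Mem), p ∈ D₁.support →
      (D.map Prod.fst = Y p.1 ∧ Final O L' p.2 T' (D.map Prod.snd) ∧ ∀ q ∈ D.support, R q.1 q.2) := by
    intro p
    by_cases hp : p ∈ D₁.support
    · obtain ⟨D, hD⟩ := h' p.1 (hsup p hp) p.2 (h3 p hp)
      exact ⟨D, fun _ => hD⟩
    · obtain ⟨b, -⟩ := (Y p.1).support_nonempty
      exact ⟨PMF.pure (b, m), fun h => absurd h hp⟩
  choose D hD using hex
  -- The second program sees only the memory, not the value that is coupled with it. By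
  -- `Final.unique` its final distribution is determined by the memory, so it can be selected as a
  -- function of the memory alone.
  set F : Mem → PMF Mem := fun m' =>
    if h : ∃ E, Final O L' m' T' E then h.choose else PMF.pure m' with hF
  have hFD : ∀ p ∈ D₁.support, F p.2 = (D p).map Prod.snd := by
    intro p hp
    have hex : ∃ E, Final O L' p.2 T' E := ⟨_, (hD p hp).2.1⟩
    simp only [hF]
    rw [dif_pos hex]
    exact hex.choose_spec.unique (hD p hp).2.1
  refine ⟨D₁.bind D, ?_, ?_, ?_⟩
  · rw [PMF.map_bind, ← h1, ← PMF.bind_pure_comp, PMF.bind_bind]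
    simp only [Function.comp_apply, PMF.pure_bind]
    exact bind_congr_support fun p hp => (hD p hp).1
  · have e : (D₁.bind D).map Prod.snd = (D₁.map Prod.snd).bind F := by
      rw [PMF.map_bind, ← PMF.bind_pure_comp, PMF.bind_bind]
      simp only [Function.comp_apply, PMF.pure_bind]
      exact bind_congr_support fun p hp => (hFD p hp).symm
    rw [e]
    refine h2.append fun m' hm' => ?_
    rw [PMF.mem_support_map_iff] at hm'
    obtain ⟨p, hp, rfl⟩ := hm'
    rw [hFD p hp]
    exact (hD p hp).2.1
  · intro q hq
    rw [PMF.mem_support_bind_iff] at hq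
    obtain ⟨p, hp, hq⟩ := hq
    exact (hD p hp).2.2 q hq

theorem Spec.cons {c : Cmd} {Y : α → PMF β} {R : β → Mem → Prop} (h : Spec O [c] m T X Q)
    (h' : ∀ a m', Q a m' → Spec O L' m' T' (Y a) R) :
    Spec O (c :: L') m (T + T') (X.bind Y) R := h.append fun a _ => h' a

/-- A deterministic command, followed by other commands. -/
theorem Det.cons {c : Cmd} {Y : PMF β} {P : Mem → Prop} {R : β → Mem → Prop} (h : Det O [c] m T P)
    (h' : ∀ m', P m' → Spec O L' m' T' Y R) : Spec O (c :: L') m (T + T') Y R := by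
  have := Spec.cons (Y := fun _ : Unit => Y) h fun _ => h'
  rwa [PMF.pure_bind] at this

end runs

/-! ### Runs with an oracle that changes from query to query -/

/-- One step of the machine with a query counter; the `k`-th query is answered by `O k`. -/
noncomputable def stepS (O : ℕ → PMF (List F2)) (k : ℕ) : Cfg → PMF (ℕ × Cfg)
  | (.query a :: K, m) => (O k).map fun w => (k + 1, (K, storeAnswer m a w))
  | s => (step noOracle s).map fun s' => (k, s')

/-- The distribution of the query counter and the configuration after `T` steps. -/
noncomputable def runS (O : ℕ → PMF (List F2)) : ℕ → ℕ → Cfg → PMF (ℕ × Cfg)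
  | 0, k, s => PMF.pure (k, s)
  | T + 1, k, s => (stepS O k s).bind fun p => runS O T p.1 p.2

section runS

theorem runS_nil (O : ℕ → PMF (List F2)) (T k : ℕ) (m : Mem) :
    runS O T k ([], m) = PMF.pure (k, ([], m)) := by
  induction T with
  | zero => rfl
  | succ T ih => rw [runS, stepS, step, PMF.pure_map, PMF.pure_bind, ih]; simp

theorem stepS_const (O : PMF (List F2)) (k : ℕ) (s : Cfg) :
    (stepS (fun _ => O) k s).map Prod.snd = step O s := by
  obtain ⟨L, m⟩ := s
  rcases L with _ | ⟨c, L⟩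
  · simp [stepS, PRC.step, PMF.pure_map]
  · cases c <;> simp [stepS, PRC.step, PMF.pure_map, PMF.map_comp, Function.comp_def]

theorem runS_const (O : PMF (List F2)) (T k : ℕ) (s : Cfg) :
    (runS (fun _ => O) T k s).map Prod.snd = run O T s := by
  induction T generalizing k s with
  | zero => simp [runS, run, PMF.pure_map]
  | succ T ih =>
    rw [runS, run, PMF.map_bind, ← stepS_const O k s, ← PMF.bind_pure_comp, PMF.bind_bind]
    simp only [ih, Function.comp_apply, PMF.pure_bind]

theorem mem_support_stepS {O : ℕ → PMF (List F2)} {k : ℕ} {s : Cfg} :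
    ∀ p ∈ (stepS O k s).support, k ≤ p.1 ∧ p.1 ≤ k + 1 := by
  intro p hp
  obtain ⟨L, m⟩ := s
  rcases L with _ | ⟨c, L⟩
  · rw [stepS, PMF.mem_support_map_iff] at hp
    · obtain ⟨_, -, rfl⟩ := hp; simp
    · simp
  · cases c <;> simp only [stepS, PMF.mem_support_map_iff] at hp <;> obtain ⟨_, -, rfl⟩ := hp <;> simp

theorem stepS_congr {O O' : ℕ → PMF (List F2)} {k : ℕ} (s : Cfg)
    (h : (∃ a L, s.1 = Cmd.query a :: L) → O k = O' k) : stepS O k s = stepS O' k s := by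
  obtain ⟨L, m⟩ := s
  rcases L with _ | ⟨c, L⟩
  · rfl
  · cases c
    case query a => simp only [stepS, h ⟨a, L, rfl⟩]
    all_goals rfl

theorem runS_congr {O O' : ℕ → PMF (List F2)} {T k : ℕ} (h : ∀ i, k ≤ i → i < k + T → O i = O' i)
    (s : Cfg) : runS O T k s = runS O' T k s := by
  induction T generalizing k s with
  | zero => rfl
  | succ T ih =>
    rw [runS, runS, stepS_congr s fun _ => h k le_rfl (by omega)]
    refine bind_congr_support fun p hp => ih (fun i hi hi' => h i ?_ ?_) _
    · exact (mem_support_stepS p hp).1.trans hi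
    · have := (mem_support_stepS p hp).2; omega

theorem stepS_bind {α : Type} {O : ℕ → PMF (List F2)} {X : PMF α} {Y : α → PMF (List F2)} {k : ℕ}
    (s : Cfg) : X.bind (fun x => stepS (Function.update O k (Y x)) k s)
      = stepS (Function.update O k (X.bind Y)) k s := by
  obtain ⟨L, m⟩ := s
  rcases L with _ | ⟨c, L⟩
  · exact PMF.bind_const _ _
  · cases c
    case query a => simp only [stepS, Function.update_self, PMF.map_bind]
    all_goals exact PMF.bind_const _ _

/-- One of the answers may be sampled in advance. -/
theorem runS_bind {α : Type} {O : ℕ → PMF (List F2)} {X : PMF α} {Y : α → PMF (List F2)} {j : ℕ}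
    (T k : ℕ) (s : Cfg) : X.bind (fun x => runS (Function.update O j (Y x)) T k s)
      = runS (Function.update O j (X.bind Y)) T k s := by
  induction T generalizing k s with
  | zero => exact PMF.bind_const _ _
  | succ T ih =>
    simp only [runS]
    -- If the special query is made now, the counter passes `j` and the special answer plays no role
    -- later. Otherwise the present step does not depend on `x`, and the sampling of `x` is
    -- postponed.
    by_cases h : k = j ∧ ∃ a L, s.1 = Cmd.query a :: L
    · obtain ⟨rfl, a, L, hL⟩ := h
      rw [← stepS_bind, PMF.bind_bind]
      refine congrArg _ (funext fun x => bind_congr_support fun p hp => runS_congr (fun i hi _ => ?_) _)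
      obtain ⟨L', m⟩ := s
      obtain rfl : L' = Cmd.query a :: L := hL
      rw [stepS, PMF.mem_support_map_iff] at hp
      obtain ⟨_, -, rfl⟩ := hp
      simp only at hi
      rw [Function.update_of_ne (by omega), Function.update_of_ne (by omega)]
    · have : ∀ x, stepS (Function.update O j (Y x)) k s = stepS (Function.update O j (X.bind Y)) k s :=
        fun x => stepS_congr s fun hq => by
          have hk : k ≠ j := fun hk => h ⟨hk, hq⟩
          rw [Function.update_of_ne hk, Function.update_of_ne hk]
      simp only [this]
      rw [PMF.bind_comm]
      simp only [ih]

/-- Halting is assumed for stateless oracles only. Because the uniform oracle can give every answer,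
the assumption carries over to the oracles of the hybrid argument. -/
theorem mem_support_runS {O : ℕ → PMF (List F2)} {U : PMF (List F2)}
    (h : ∀ k, (O k).support ⊆ U.support) (T k : ℕ) (s : Cfg) :
    ∀ p ∈ (runS O T k s).support, p.2 ∈ (run U T s).support := by
  induction T generalizing k s with
  | zero => intro p hp; simp [runS] at hp; simp [run, hp]
  | succ T ih =>
    intro p hp
    rw [runS, PMF.mem_support_bind_iff] at hp
    obtain ⟨q, hq, hp⟩ := hp
    rw [run, PMF.mem_support_bind_iff]
    refine ⟨q.2, ?_, ih _ _ p hp⟩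
    obtain ⟨L, m⟩ := s
    rcases L with _ | ⟨c, L⟩
    · simp [stepS, PRC.step, PMF.pure_map] at hq; simp [hq, step]
    · cases c
      case query a =>
        simp only [stepS, PMF.mem_support_map_iff] at hq
        obtain ⟨w, hw, rfl⟩ := hq
        simp only [step, PMF.mem_support_map_iff]
        exact ⟨w, h k hw, rfl⟩
      all_goals
        simp only [stepS, PMF.mem_support_map_iff] at hq
        obtain ⟨s', hs', rfl⟩ := hq
        exact hs'

/-- Each step makes at most one query, so the number of steps bounds the number of times the oracles
can be told apart. -/
theorem dist_runS {O O' : ℕ → PMF (List F2)} {ε : ℝ≥0∞} (h : ∀ k, Dist (O k) (O' k) ε) (T k : ℕ)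
    (s : Cfg) : Dist (runS O T k s) (runS O' T k s) (T * ε) := by
  induction T generalizing k s with
  | zero => simpa [runS] using Dist.refl _
  | succ T ih =>
    have hs : Dist (stepS O k s) (stepS O' k s) ε := by
      obtain ⟨L, m⟩ := s
      rcases L with _ | ⟨c, L⟩
      · exact (Dist.refl _).mono zero_le
      · cases c
        case query a => exact (h k).map _
        all_goals exact (Dist.refl _).mono zero_le
    refine (hs.bind fun p _ => ih p.1 p.2).mono (le_of_eq ?_)
    push_cast; ring

end runS

/-! ### Programs as subroutines -/

/-- Rename the arrays of an expression. -/
def Expr.rename (f : ℕ → ℕ) : Expr → Expr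
  | .const c => .const c
  | .get a i j => .get (f a) (i.rename f) (j.rename f)
  | .add e₁ e₂ => .add (e₁.rename f) (e₂.rename f)
  | .sub e₁ e₂ => .sub (e₁.rename f) (e₂.rename f)

/-- Rename the arrays of a program and replace queries by a subroutine. -/
def Cmd.compile (f : ℕ → ℕ) (sub : ℕ → Cmd) : Cmd → Cmd
  | .skip => .skip
  | .set a i j e => .set (f a) (i.rename f) (j.rename f) (e.rename f)
  | .coin a i j => .coin (f a) (i.rename f) (j.rename f)
  | .query a => sub a
  | .seq c₁ c₂ => .seq (c₁.compile f sub) (c₂.compile f sub)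
  | .ite e c₁ c₂ => .ite (e.rename f) (c₁.compile f sub) (c₂.compile f sub)
  | .loop e c => .loop (e.rename f) (c.compile f sub)

theorem Expr.eval_rename {f : ℕ → ℕ} {m m' : Mem} (h : ∀ a, m' (f a) = m a) (e : Expr) :
    (e.rename f).eval m' = e.eval m := by
  induction e with
  | const c => rfl
  | get a i j hi hj => simp only [Expr.rename, Expr.eval, hi, hj, h]
  | add e₁ e₂ h₁ h₂ => simp only [Expr.rename, Expr.eval, h₁, h₂]
  | sub e₁ e₂ h₁ h₂ => simp only [Expr.rename, Expr.eval, h₁, h₂]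

theorem store_ne {m : Mem} {a b i j v : ℕ} (h : b ≠ a) : store m a i j v b = m b := by
  funext i' j'; simp [store, h]

theorem store_same {m : Mem} {a i j v : ℕ} : store m a i j v a i j = v := by simp [store]

theorem store_apply (m : Mem) (a i j v i' j' : ℕ) :
    store m a i j v a i' j' = if i' = i ∧ j' = j then v else m a i' j' := by simp [store]

/-- The arrays `f a` of `m'` hold the memory `m`. -/
def Holds (f : ℕ → ℕ) (m m' : Mem) : Prop := ∀ a, m' (f a) = m a

theorem Holds.store {f : ℕ → ℕ} (hf : Function.Injective f) {m m' : Mem} (h : Holds f m m')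
    (a i j v : ℕ) : Holds f (PRC.store m a i j v) (PRC.store m' (f a) i j v) := by
  intro b
  by_cases hb : b = a
  · subst hb; funext i' j'; simp only [store_apply, h b]
  · rw [store_ne hb, store_ne (fun h => hb (hf h)), h b]

/-- Running a compiled program simulates the program. -/
theorem Spec.compile {O : PMF (List F2)} {f : ℕ → ℕ} (hf : Function.Injective f) {sub : ℕ → Cmd}
    {A : ℕ → PMF (List F2)} {Inv : ℕ → Mem → Prop} {τ : ℕ}
    (hInv : ∀ k m m', (∀ a, (∀ b, a ≠ f b) → m' a = m a) → Inv k m → Inv k m')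
    (hsub : ∀ k a m m', Holds f m m' → Inv k m' → Spec O [sub a] m' τ (A k)
      fun w m'' => Holds f (storeAnswer m a w) m'' ∧ Inv (k + 1) m'') (T k : ℕ) (L : List Cmd)
    (m m' : Mem) (hm : Holds f m m') (hk : Inv k m')
    (hT : ∀ p ∈ (runS A T k (L, m)).support, p.2.1 = []) :
    Spec O (L.map (Cmd.compile f sub)) m' (T * (τ + 1)) (runS A T k (L, m))
      fun p m'' => Holds f p.2.2 m'' ∧ Inv p.1 m'' := by
  induction T generalizing k L m m' with
  | zero =>
    simp only [runS, PMF.support_pure, Set.mem_singleton_iff, forall_eq] at hT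
    subst hT
    rw [Nat.zero_mul]
    exact Spec.nil ⟨hm, hk⟩
  | succ T ih =>
    -- A simulated assignment or coin touches only an array in the range of `f`, and the invariant
    -- is insensitive to these arrays.
    have hstore : ∀ a i j v, Inv k (store m' (f a) i j v) := fun a i j v =>
      hInv k m' _ (fun b hb => store_ne (hb a)) hk
    have htime : T * (τ + 1) + 1 ≤ (T + 1) * (τ + 1) := by nlinarith
    rcases L with _ | ⟨c, L⟩
    · rw [runS_nil]
      exact (Spec.nil ⟨hm, hk⟩).time (by positivity)
    · have hev := Expr.eval_rename hm
      have hpure : ∀ s : Cfg, stepS A k (c :: L, m) = PMF.pure (k, s) →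
          runS A (T + 1) k (c :: L, m) = runS A T k s := fun s hs => by
        rw [runS, hs, PMF.pure_bind]
      have hdet : ∀ s : Cfg, stepS A k (c :: L, m) = PMF.pure (k, s) → Holds f s.2 m' →
          Spec O (s.1.map (Cmd.compile f sub)) m' (T * (τ + 1)) (runS A (T + 1) k (c :: L, m))
            fun p m'' => Holds f p.2.2 m'' ∧ Inv p.1 m'' := by
        intro s hs hs2
        rw [hpure s hs] at hT ⊢
        exact ih k s.1 s.2 m' hs2 hk hT
      cases c with
      | skip =>
        exact (Spec.skip (hdet (L, m) (by simp [stepS, PRC.step, PMF.pure_map]) hm)).time htime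
      | set a i j e =>
        have hs : stepS A k (.set a i j e :: L, m)
            = PMF.pure (k, (L, store m a (i.eval m) (j.eval m) (e.eval m))) := by
          simp [stepS, PRC.step, PMF.pure_map]
        rw [hpure _ hs] at hT ⊢
        refine (Spec.set ?_).time htime
        rw [hev, hev, hev]
        exact ih _ _ _ _ (hm.store hf _ _ _ _) (hstore _ _ _ _) hT
      | coin a i j =>
        have hs : runS A (T + 1) k (.coin a i j :: L, m) = (PMF.uniformOfFintype F2).bind fun b =>
            runS A T k (L, store m a (i.eval m) (j.eval m) b.val) := by
          rw [runS, stepS]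
          · simp only [PRC.step, ← PMF.bind_pure_comp, PMF.bind_bind, Function.comp_apply,
              PMF.pure_bind]
          · simp
        rw [hs] at hT ⊢
        refine (Spec.coin fun b => ?_).time htime
        rw [hev, hev]
        refine ih _ _ _ _ (hm.store hf _ _ _ _) (hstore _ _ _ _) fun p hp => hT p ?_
        rw [PMF.mem_support_bind_iff]
        exact ⟨b, by simp, hp⟩
      | query a =>
        have hs : runS A (T + 1) k (.query a :: L, m) = (A k).bind fun w =>
            runS A T (k + 1) (L, storeAnswer m a w) := by
          rw [runS, stepS]
          simp only [← PMF.bind_pure_comp, PMF.bind_bind, Function.comp_apply, PMF.pure_bind]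
        rw [hs] at hT ⊢
        have := Spec.append (hsub k a m m' hm hk) (L' := L.map (Cmd.compile f sub))
          (T' := T * (τ + 1)) (Y := fun w => runS A T (k + 1) (L, storeAnswer m a w))
          (R := fun p m'' => Holds f p.2.2 m'' ∧ Inv p.1 m'') fun w hw m'' h =>
            ih _ _ _ _ h.1 h.2 fun p hp => hT p (by
              rw [PMF.mem_support_bind_iff]; exact ⟨w, hw, hp⟩)
        exact this.time (by nlinarith)
      | seq c₁ c₂ =>
        exact (Spec.seq (hdet (c₁ :: c₂ :: L, m) (by simp [stepS, PRC.step, PMF.pure_map]) hm)).time htime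
      | ite e c₁ c₂ =>
        by_cases he : e.eval m = 0
        · exact (Spec.ite_false (by rw [hev, he]) (hdet (c₂ :: L, m)
            (by simp [stepS, PRC.step, PMF.pure_map, he]) hm)).time htime
        · exact (Spec.ite_true (by rwa [hev]) (hdet (c₁ :: L, m)
            (by simp [stepS, PRC.step, PMF.pure_map, he]) hm)).time htime
      | loop e c =>
        by_cases he : e.eval m = 0
        · exact (Spec.loop_false (by rw [hev, he]) (hdet (L, m)
            (by simp [stepS, PRC.step, PMF.pure_map, he]) hm)).time htime
        · exact (Spec.loop_true (by rwa [hev]) (hdet (c :: .loop e c :: L, m)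
            (by simp [stepS, PRC.step, PMF.pure_map, he]) hm)).time htime

/-! ### The growth of the memory -/

/-- A bound for the growth of values in an expression. -/
def Expr.size : Expr → ℕ
  | .const c => c
  | .get _ _ _ => 1
  | .add e₁ e₂ => e₁.size + e₂.size
  | .sub e₁ _ => e₁.size

/-- A bound for the growth of values in a program. -/
def Cmd.size : Cmd → ℕ
  | .set _ _ _ e => e.size + 1
  | .seq c₁ c₂ => c₁.size + c₂.size
  | .ite _ c₁ c₂ => c₁.size + c₂.size
  | .loop _ c => c.size
  | _ => 1

theorem Cmd.size_pos (c : Cmd) : 1 ≤ c.size := by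
  induction c <;> simp [Cmd.size] <;> omega

theorem Expr.eval_le {m : Mem} {B : ℕ} (hB : 1 ≤ B) (h : ∀ a i j, m a i j ≤ B) (e : Expr) :
    e.eval m ≤ e.size * B := by
  induction e with
  | const c => simp only [Expr.eval, Expr.size]; nlinarith
  | get a i j => simp only [Expr.eval, Expr.size, one_mul]; exact h _ _ _
  | add e₁ e₂ h₁ h₂ => simp only [Expr.eval, Expr.size]; nlinarith
  | sub e₁ e₂ h₁ h₂ => simp only [Expr.eval, Expr.size]; omega

theorem store_le {m : Mem} {B a i j v : ℕ} (h : ∀ a i j, m a i j ≤ B) (hv : v ≤ B) :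
    ∀ a' i' j', store m a i j v a' i' j' ≤ B := by
  intro a' i' j'; unfold store; split_ifs
  · exact hv
  · exact h _ _ _

/-- A step multiplies the largest value by a constant at most. The values may be exponential, but
their bit lengths stay polynomial, and these determine the time needed to read a parity. -/
theorem memory_le {S : ℕ} (hS : 1 ≤ S) {T : ℕ} {L : List Cmd} {m : Mem} {B : ℕ} (hB : 1 ≤ B)
    (hL : ∀ c ∈ L, c.size ≤ S) (hm : ∀ a i j, m a i j ≤ B) :
    ∀ s ∈ (run noOracle T (L, m)).support, ∀ a i j, s.2 a i j ≤ S ^ T * B := by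
  induction T generalizing L m B with
  | zero => intro s hs; simp [run] at hs; subst hs; simpa using hm
  | succ T ih =>
    intro s hs
    rw [run, PMF.mem_support_bind_iff] at hs
    obtain ⟨⟨L', m'⟩, hs', hs⟩ := hs
    have hSB : B ≤ S * B := by nlinarith
    have key : (∀ c ∈ L', c.size ≤ S) ∧ ∀ a i j, m' a i j ≤ S * B := by
      have hm' : ∀ a i j, m a i j ≤ S * B := fun a i j => (hm a i j).trans hSB
      rcases L with _ | ⟨c, L⟩
      · simp [step] at hs'
        rw [hs'.1, hs'.2]; exact ⟨by simp, hm'⟩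
      have hc := hL c (by simp)
      have hL' : ∀ c ∈ L, c.size ≤ S := fun c hc => hL c (by simp [hc])
      cases c with
      | skip => simp [step] at hs'; rw [hs'.1, hs'.2]; exact ⟨hL', hm'⟩
      | set a i j e =>
        simp [step] at hs'; rw [hs'.1, hs'.2]
        refine ⟨hL', store_le hm' ((Expr.eval_le hB hm e).trans ?_)⟩
        simp only [Cmd.size] at hc
        exact Nat.mul_le_mul_right _ (by omega)
      | coin a i j =>
        simp only [step, PMF.mem_support_map_iff, Prod.mk.injEq] at hs'
        obtain ⟨b, -, rfl, rfl⟩ := hs'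
        refine ⟨hL', store_le hm' ?_⟩
        have := ZMod.val_lt b
        nlinarith
      | query a =>
        simp only [step, PMF.mem_support_map_iff, Prod.mk.injEq, noOracle, PMF.support_pure,
          Set.mem_singleton_iff] at hs'
        obtain ⟨w, rfl, rfl, rfl⟩ := hs'
        refine ⟨hL', fun a' i' j' => ?_⟩
        simp only [storeAnswer]
        split_ifs <;> simp_all
      | seq c₁ c₂ =>
        simp [step] at hs'; rw [hs'.1, hs'.2]
        simp only [Cmd.size] at hc
        refine ⟨?_, hm'⟩
        intro c hc'
        rcases List.mem_cons.1 hc' with rfl | hc'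
        · omega
        rcases List.mem_cons.1 hc' with rfl | hc'
        · omega
        · exact hL' c hc'
      | ite e c₁ c₂ =>
        simp only [Cmd.size] at hc
        by_cases he : e.eval m = 0 <;> simp [step, he] at hs' <;> rw [hs'.1, hs'.2] <;>
          refine ⟨?_, hm'⟩ <;> intro c hc' <;> rcases List.mem_cons.1 hc' with rfl | hc'
        · omega
        · exact hL' c hc'
        · omega
        · exact hL' c hc'
      | loop e c =>
        have hc2 := hc
        simp only [Cmd.size] at hc
        by_cases he : e.eval m = 0 <;> simp [step, he] at hs' <;> rw [hs'.1, hs'.2]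
        · exact ⟨hL', hm'⟩
        · refine ⟨?_, hm'⟩
          intro c' hc'
          rcases List.mem_cons.1 hc' with rfl | hc'
          · exact hc
          rcases List.mem_cons.1 hc' with rfl | hc'
          · exact hc2
          · exact hL' c' hc'
    have := ih (by nlinarith) key.1 key.2 s hs
    intro a i j
    refine (this a i j).trans (le_of_eq ?_)
    rw [pow_succ]; ring

/-! ### From specifications to polynomial-time algorithms -/

theorem polyTimeAlgorithm_of_spec {I α : Type} {sec : I → ℕ} {inp : I → List (List F2)} {K : ℕ}
    {out : I → PMF (List (List F2))} (c : Cmd) (q : Polynomial ℕ) {μ : ℕ → ℝ} (hμ : Negligible μ)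
    (X : I → PMF α) (o : I → α → List (List F2))
    (h : ∀ i, Spec noOracle [c] (load (inp i)) (q.eval (inputLength (inp i))) (X i)
      fun a m => readStrings K (q.eval (inputLength (inp i))) m = o i a)
    (hd : ∀ i, StatClose ((X i).map (o i)) (out i) (μ (sec i))) :
    PolyTimeAlgorithm sec inp K out := by
  refine ⟨c, q, μ, hμ, fun i => ?_⟩
  obtain ⟨D, h1, h2, h3⟩ := h i
  refine ⟨h2.halts, ?_⟩
  have e : (runOn noOracle c (q.eval (inputLength (inp i))) (inp i)).map
      (fun s => readStrings K (q.eval (inputLength (inp i))) s.2) = (X i).map (o i) := by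
    rw [runOn, h2 _ le_rfl, PMF.map_comp, PMF.map_comp, ← h1, PMF.map_comp]
    rw [← PMF.bind_pure_comp, ← PMF.bind_pure_comp]
    refine bind_congr_support fun p hp => ?_
    simp only [Function.comp_apply]
    rw [h3 p hp]
  rw [e]; exact hd i

theorem outBit_of_spec {α : Type} {O : PMF (List F2)} {c : Cmd} {T T' : ℕ} {inp : List (List F2)}
    {X : PMF α} {f : α → Bool} (h : Spec O [c] (load inp) T X fun a m => readBit m = f a)
    (hT : T ≤ T') : outBit O c T' inp = X.map f := by
  obtain ⟨D, h1, h2, h3⟩ := h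
  rw [outBit, runOn, h2 _ hT, PMF.map_comp, PMF.map_comp, ← h1, PMF.map_comp]
  rw [← PMF.bind_pure_comp, ← PMF.bind_pure_comp]
  refine bind_congr_support fun p hp => ?_
  simp only [Function.comp_apply]
  rw [h3 p hp]


/-! ### Variables, frames, bounded loops -/

/-- The variable `x`, which is cell `(0, 0)` of array `x`. -/
def var (x : ℕ) : Expr := .get x (.const 0) (.const 0)

/-- Assignment to a variable. -/
def assign (x : ℕ) (e : Expr) : Cmd := .set x (.const 0) (.const 0) e

/-- `for x < N do c`. -/
def forLoop (x : ℕ) (N : Expr) (c : Cmd) : Cmd :=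
  .seq (assign x (.const 0))
    (.loop (.sub N (var x)) (.seq c (assign x (.add (var x) (.const 1)))))

/-- Sequential composition of a list of commands. -/
def block : List Cmd → Cmd
  | [] => .skip
  | [c] => c
  | c :: d :: L => .seq c (block (d :: L))

@[simp] theorem eval_var (m : Mem) (x : ℕ) : (var x).eval m = m x 0 0 := rfl

/-- The memories `m` and `m'` differ in the arrays of `S` only. -/
def Frame (S : Set ℕ) (m m' : Mem) : Prop := ∀ a, a ∉ S → m' a = m a

theorem Frame.refl (S : Set ℕ) (m : Mem) : Frame S m m := fun _ _ => rfl

theorem Frame.trans {S : Set ℕ} {m m' m'' : Mem} (h : Frame S m m') (h' : Frame S m' m'') :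
    Frame S m m'' := fun a ha => (h' a ha).trans (h a ha)

theorem Frame.mono {S S' : Set ℕ} {m m' : Mem} (h : Frame S m m') (hS : S ⊆ S') :
    Frame S' m m' := fun a ha => h a fun h' => ha (hS h')

theorem Frame.store {S : Set ℕ} {m m' : Mem} (h : Frame S m m') {a : ℕ} (ha : a ∈ S)
    (i j v : ℕ) : Frame S m (store m' a i j v) := fun b hb => by
  rw [store_ne (by rintro rfl; exact hb ha), h b hb]

/-- The distribution of the state after the `k` iterations `j, ..., j + k - 1` of a loop. -/
noncomputable def iterFrom {σ : Type} (B : ℕ → σ → PMF σ) : ℕ → ℕ → σ → PMF σ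
  | _, 0, s => PMF.pure s
  | j, k + 1, s => (B j s).bind (iterFrom B (j + 1) k)

/-- The distribution of a list that is obtained from `l` by appending `k` random entries, which
depend on what is there already. -/
noncomputable def extend {α : Type} (D : List α → PMF α) : ℕ → List α → PMF (List α)
  | 0, l => PMF.pure l
  | k + 1, l => (D l).bind fun a => extend D k (l ++ [a])

theorem extend_const {α : Type} (D : PMF α) (k : ℕ) (l : List α) :
    extend (fun _ => D) k l = (iid D k).map fun v => l ++ List.ofFn v := by
  induction k generalizing l with
  | zero => simp [extend, iid, PMF.pure_map]
  | succ k ih =>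
    rw [extend, iid, PMF.map_bind]
    congr 1; funext a
    rw [ih, PMF.map_comp]
    congr 1; funext v
    simp [List.ofFn_succ]

theorem iterFrom_extend {α : Type} (D : List α → PMF α) (j k : ℕ) (l : List α) :
    iterFrom (fun _ l => (D l).map fun a => l ++ [a]) j k l = extend D k l := by
  induction k generalizing j l with
  | zero => rfl
  | succ k ih =>
    rw [iterFrom, extend, ← PMF.bind_pure_comp, PMF.bind_bind]
    congr 1; funext a
    rw [Function.comp_apply, PMF.pure_bind, ih]

/-! ### Proof rules for loops. -/

section rules
variable {O : PMF (List F2)} {m : Mem} {L : List Cmd} {T : ℕ}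

theorem Spec.assign {α : Type} {X : PMF α} {Q : α → Mem → Prop} {x : ℕ} {e : Expr}
    (h : Spec O L (PRC.store m x 0 0 (e.eval m)) T X Q) :
    Spec O (PRC.assign x e :: L) m (T + 1) X Q := Spec.set h

theorem Spec.block_cons {α : Type} {X : PMF α} {Q : α → Mem → Prop} {c d : Cmd} {L' : List Cmd}
    (h : Spec O (c :: block (d :: L') :: L) m T X Q) :
    Spec O (block (c :: d :: L') :: L) m (T + 1) X Q := Spec.seq h

theorem Spec.block_last {α : Type} {X : PMF α} {Q : α → Mem → Prop} {c : Cmd}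
    (h : Spec O (c :: L) m T X Q) : Spec O (block [c] :: L) m T X Q := h

theorem Spec.forLoop {σ : Type} {x : ℕ} {N : Expr} {c : Cmd} {n τ : ℕ} {B : ℕ → σ → PMF σ}
    {Inv : ℕ → σ → Mem → Prop} {s : σ} (h0 : Inv 0 s m)
    (hN : ∀ k s m', Inv k s m' → N.eval m' = n)
    (hx : ∀ k s m' v, Inv k s m' → Inv k s (PRC.store m' x 0 0 v))
    (hc : ∀ k < n, ∀ s m', Inv k s m' → m' x 0 0 = k → Spec O [c] m' τ (B k s)
      fun s' m'' => Inv (k + 1) s' m'' ∧ m'' x 0 0 = k) :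
    Spec O [PRC.forLoop x N c] m (n * (τ + 3) + 3) (iterFrom B 0 n s) (Inv n) := by
  have key : ∀ k j s m', j + k = n → Inv j s m' → m' x 0 0 = j →
      Spec O [Cmd.loop (.sub N (var x)) (.seq c (PRC.assign x (.add (var x) (.const 1))))] m'
        (k * (τ + 3) + 1) (iterFrom B j k s) (Inv n) := by
    intro k
    induction k with
    | zero =>
      intro j s m' hj hI hm'
      have : j = n := by omega
      subst this
      rw [iterFrom]
      refine (Spec.loop_false ?_ (Spec.nil hI)).time (by omega)
      simp [Expr.eval, hN _ _ _ hI, hm']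
    | succ k ih =>
      intro j s m' hj hI hm'
      rw [iterFrom]
      have h1 := Spec.cons (L' := [PRC.assign x (.add (var x) (.const 1)),
        Cmd.loop (.sub N (var x)) (.seq c (PRC.assign x (.add (var x) (.const 1))))])
        (hc j (by omega) s m' hI hm') (Y := iterFrom B (j + 1) k) (R := Inv n)
        (T' := k * (τ + 3) + 1 + 1) (by
          rintro s' m'' ⟨h, h'⟩
          refine Spec.assign ?_
          refine ih (j + 1) s' _ (by omega) (hx _ _ _ _ h) ?_
          simp [store_same, Expr.eval, h'])
      -- Besides the body, an iteration takes three steps: the test, the splitting of the sequence,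
      -- and the increment of the counter.
      refine (Spec.loop_true ?_ (Spec.seq h1)).time (le_of_eq (by ring))
      simp [Expr.eval, hN _ _ _ hI, hm']; omega
  exact (Spec.seq (Spec.assign (key n 0 s _ (by omega) (hx _ _ _ _ h0)
    (by simp [store_same, Expr.eval])))).time (by omega)

theorem iterFrom_unit (j k : ℕ) :
    iterFrom (fun _ (_ : Unit) => PMF.pure ()) j k () = PMF.pure () := by
  induction k generalizing j with
  | zero => rfl
  | succ k ih => rw [iterFrom, PMF.pure_bind, ih]

theorem Det.forLoop {x : ℕ} {N : Expr} {c : Cmd} {n τ : ℕ} {Inv : ℕ → Mem → Prop} (h0 : Inv 0 m)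
    (hN : ∀ k m', Inv k m' → N.eval m' = n)
    (hx : ∀ k m' v, Inv k m' → Inv k (PRC.store m' x 0 0 v))
    (hc : ∀ k < n, ∀ m', Inv k m' → m' x 0 0 = k → Det O [c] m' τ
      fun m'' => Inv (k + 1) m'' ∧ m'' x 0 0 = k) :
    Det O [PRC.forLoop x N c] m (n * (τ + 3) + 3) (Inv n) := by
  have := Spec.forLoop (O := O) (x := x) (N := N) (c := c) (n := n) (τ := τ)
    (B := fun _ (_ : Unit) => PMF.pure ()) (Inv := fun k _ => Inv k) (s := ()) h0
    (fun k _ => hN k) (fun k _ => hx k) (fun k hk _ => hc k hk)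
  rwa [iterFrom_unit] at this

/-- A loop that appends to a list in every iteration. -/
theorem Spec.forLoop_extend {α : Type} {x : ℕ} {N : Expr} {c : Cmd} {n τ : ℕ} {D : List α → PMF α}
    {Inv : List α → Mem → Prop} (h0 : Inv [] m) (hN : ∀ l m', Inv l m' → N.eval m' = n)
    (hx : ∀ l m' v, Inv l m' → Inv l (PRC.store m' x 0 0 v))
    (hc : ∀ l m', l.length < n → Inv l m' → m' x 0 0 = l.length → Spec O [c] m' τ (D l)
      fun a m'' => Inv (l ++ [a]) m'' ∧ m'' x 0 0 = l.length) :
    Spec O [PRC.forLoop x N c] m (n * (τ + 3) + 3) (extend D n []) fun l m' =>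
      l.length = n ∧ Inv l m' := by
  rw [← iterFrom_extend D 0]
  refine Spec.forLoop (B := fun _ l => (D l).map fun a => l ++ [a])
    (Inv := fun k l m' => l.length = k ∧ Inv l m') ⟨rfl, h0⟩
    (fun k l m' h => hN l m' h.2) (fun k l m' v h => ⟨h.1, hx l m' v h.2⟩) ?_
  rintro k hk l m' ⟨rfl, h⟩ hm'
  refine (hc l m' hk h hm').map (fun a => l ++ [a]) fun a m'' h' => ⟨⟨by simp, h'.1⟩, h'.2⟩

/-- A loop that adds an independent sample in every iteration. -/
theorem Spec.forLoop_iid {α : Type} {x : ℕ} {N : Expr} {c : Cmd} {n τ : ℕ} {D : PMF α}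
    {Inv : List α → Mem → Prop} (h0 : Inv [] m) (hN : ∀ l m', Inv l m' → N.eval m' = n)
    (hx : ∀ l m' v, Inv l m' → Inv l (PRC.store m' x 0 0 v))
    (hc : ∀ l m', l.length < n → Inv l m' → m' x 0 0 = l.length → Spec O [c] m' τ D
      fun a m'' => Inv (l ++ [a]) m'' ∧ m'' x 0 0 = l.length) :
    Spec O [PRC.forLoop x N c] m (n * (τ + 3) + 3) (iid D n) fun w m' => Inv (List.ofFn w) m' := by
  classical
  have h := Spec.forLoop_extend (D := fun _ => D) h0 hN hx hc
  rw [extend_const] at h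
  simp only [List.nil_append] at h
  obtain ⟨E, h1, h2, h3⟩ := h
  -- The value `d` is only a default that permits reading a list as a tuple; on lists of length `n`
  -- it is never used.
  obtain ⟨d, -⟩ := D.support_nonempty
  set F : List α → Fin n → α := fun l i => l.getD i d with hF
  have hFo : ∀ w : Fin n → α, F (List.ofFn w) = w := fun w => by funext i; simp [hF]
  refine ⟨E.map fun p => (F p.1, p.2), ?_, ?_, ?_⟩
  · have : (E.map Prod.fst).map F = iid D n := by
      rw [h1, PMF.map_comp]
      have : F ∘ (fun v => List.ofFn v) = id := by funext w; exact hFo w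
      rw [this, PMF.map_id]
    rw [← this, PMF.map_comp, PMF.map_comp]; rfl
  · rw [PMF.map_comp]; exact h2
  · intro p hp
    rw [PMF.mem_support_map_iff] at hp
    obtain ⟨⟨l, m'⟩, hp, rfl⟩ := hp
    have hl : l ∈ (E.map Prod.fst).support := by
      rw [PMF.mem_support_map_iff]; exact ⟨_, hp, rfl⟩
    rw [h1, PMF.mem_support_map_iff] at hl
    obtain ⟨w, -, rfl⟩ := hl
    have := (h3 _ hp).2
    simp only [hFo]
    exact this

/-- A loop for which a bound for the number of iterations is known. -/
theorem Det.loop {e : Expr} {c : Cmd} {τ : ℕ} {Inv : ℕ → Mem → Prop}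
    (hc : ∀ k m', Inv k m' → e.eval m' ≠ 0 →
      ∃ k', k = k' + 1 ∧ Det O [c] m' τ (Inv k')) (k : ℕ) (h0 : Inv k m) :
    Det O [Cmd.loop e c] m (k * (τ + 1) + 1) fun m' => e.eval m' = 0 ∧ ∃ k', Inv k' m' := by
  induction k generalizing m with
  | zero =>
    have he : e.eval m = 0 := by
      by_contra he
      obtain ⟨k', h, -⟩ := hc 0 m h0 he
      omega
    exact (Spec.loop_false he (Det.nil ⟨he, 0, h0⟩)).time (by omega)
  | succ k ih =>
    by_cases he : e.eval m = 0
    · exact (Spec.loop_false he (Det.nil ⟨he, _, h0⟩)).time (by omega)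
    · obtain ⟨k', hk, h⟩ := hc _ m h0 he
      obtain rfl : k = k' := by omega
      exact (Spec.loop_true he (Det.cons h fun m' h' => ih h')).time (le_of_eq (by ring))

end rules

/-! ### Arithmetic -/

/-- The exclusive or of two bits. -/
def Expr.xor (e f : Expr) : Expr := .add (.sub e f) (.sub f e)

/-- The product of two bits. -/
def Expr.and (e f : Expr) : Expr := .sub (.add e f) (.const 1)

theorem Expr.eval_xor {m : Mem} {e f : Expr} {a b : F2} (he : e.eval m = a.val)
    (hf : f.eval m = b.val) : (e.xor f).eval m = (a + b).val := by
  simp only [Expr.xor, Expr.eval, he, hf]; clear he hf; revert a b; decide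

theorem Expr.eval_and {m : Mem} {e f : Expr} {a b : F2} (he : e.eval m = a.val)
    (hf : f.eval m = b.val) : (e.and f).eval m = (a * b).val := by
  simp only [Expr.and, Expr.eval, he, hf]; clear he hf; revert a b; decide

/-- A constant multiple. -/
def Expr.smul : ℕ → Expr → Expr
  | 0, _ => .const 0
  | k + 1, e => .add e (Expr.smul k e)

theorem Expr.eval_smul (m : Mem) (k : ℕ) (e : Expr) : (e.smul k).eval m = k * e.eval m := by
  induction k with
  | zero => simp [Expr.smul, Expr.eval]
  | succ k ih => rw [Expr.smul, Expr.eval, ih]; ring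

/-- The minimum. -/
def Expr.min (e f : Expr) : Expr := .sub e (.sub e f)

theorem Expr.eval_min (m : Mem) (e f : Expr) : (e.min f).eval m = Min.min (e.eval m) (f.eval m) := by
  simp only [Expr.min, Expr.eval]; omega

/-- `d := e * f`, with the counter `x`. -/
def mul (x d : ℕ) (e f : Expr) : Cmd :=
  .seq (assign d (.const 0)) (forLoop x e (assign d (.add (var d) f)))

theorem det_mul {O : PMF (List F2)} {m : Mem} {x d : ℕ} (hxd : x ≠ d) {e f : Expr} {a b : ℕ}
    (he : ∀ m', Frame {x, d} m m' → e.eval m' = a) (hf : ∀ m', Frame {x, d} m m' → f.eval m' = b) :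
    Det O [mul x d e f] m (a * 4 + 5) fun m' => m' d 0 0 = a * b ∧ Frame {x, d} m m' := by
  refine (Spec.seq (Spec.assign (Det.forLoop (τ := 1) (n := a)
    (Inv := fun k m' => m' d 0 0 = k * b ∧ Frame {x, d} m m') ?_ ?_ ?_ ?_))).time (by omega)
  · exact ⟨by simp [store, Expr.eval], (Frame.refl _ _).store (by simp) _ _ _⟩
  · exact fun k m' h => he m' h.2
  · exact fun k m' v h => ⟨by rw [store_ne hxd.symm]; exact h.1, h.2.store (by simp) _ _ _⟩
  · rintro k hk m' ⟨h1, h2⟩ hx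
    refine Spec.assign (Det.nil ⟨⟨?_, h2.store (by simp) _ _ _⟩, ?_⟩)
    · rw [store_same, Expr.eval, eval_var, h1, hf m' h2]; ring
    · rw [store_ne hxd]; exact hx

/-- The inner product over `F2`: `y := ∑ x < N, e * f`. -/
def dot (x y : ℕ) (N e f : Expr) : Cmd :=
  .seq (assign y (.const 0)) (forLoop x N (assign y ((var y).xor (e.and f))))

theorem det_dot {O : PMF (List F2)} {m : Mem} {x y : ℕ} (hxy : x ≠ y) {N e f : Expr} {n : ℕ}
    {a b : Fin n → F2} (hN : ∀ m', Frame {x, y} m m' → N.eval m' = n)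
    (he : ∀ (k : Fin n) m', Frame {x, y} m m' → m' x 0 0 = k → e.eval m' = (a k).val)
    (hf : ∀ (k : Fin n) m', Frame {x, y} m m' → m' x 0 0 = k → f.eval m' = (b k).val) :
    Det O [dot x y N e f] m (n * 4 + 5) fun m' =>
      m' y 0 0 = (∑ k, a k * b k).val ∧ Frame {x, y} m m' := by
  set c : ℕ → F2 := fun k => if h : k < n then a ⟨k, h⟩ * b ⟨k, h⟩ else 0 with hc
  have hsum : ∑ k, a k * b k = ∑ k ∈ Finset.range n, c k := by
    rw [Finset.sum_range]; exact Finset.sum_congr rfl fun k _ => by simp [hc]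
  rw [hsum]
  refine (Spec.seq (Spec.assign (Det.forLoop (τ := 1) (n := n)
    (Inv := fun k m' => m' y 0 0 = (∑ k ∈ Finset.range k, c k).val ∧ Frame {x, y} m m')
    ?_ ?_ ?_ ?_))).time (by omega)
  · exact ⟨by simp [store, Expr.eval], (Frame.refl _ _).store (by simp) _ _ _⟩
  · exact fun k m' h => hN m' h.2
  · exact fun k m' v h => ⟨by rw [store_ne hxy.symm]; exact h.1, h.2.store (by simp) _ _ _⟩
  · rintro k hk m' ⟨h1, h2⟩ hx
    refine Spec.assign (Det.nil ⟨⟨?_, h2.store (by simp) _ _ _⟩, ?_⟩)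
    · rw [store_same, Finset.sum_range_succ]
      refine Expr.eval_xor h1 ?_
      simp only [hc, hk, dif_pos]
      exact Expr.eval_and (he ⟨k, hk⟩ m' h2 hx) (hf ⟨k, hk⟩ m' h2 hx)
    · rw [store_ne hxy]; exact hx


/-! ### Bit strings in memory -/

/-- Row `i` of array `a` starts with the bits `l`. -/
def Row (m : Mem) (a i : ℕ) (l : List F2) : Prop := ∀ j < l.length, m a i j = (l.getD j 0).val

theorem Row.congr {m m' : Mem} {a i : ℕ} {l : List F2} (h : Row m a i l) (h' : m' a i = m a i) :
    Row m' a i l := fun j hj => by rw [h']; exact h j hj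

theorem Row.frame {m m' : Mem} {a i : ℕ} {l : List F2} {S : Set ℕ} (h : Row m a i l)
    (h' : Frame S m m') (ha : a ∉ S) : Row m' a i l := h.congr (by rw [h' a ha])

theorem Row.nil (m : Mem) (a i : ℕ) : Row m a i [] := fun j hj => by simp at hj

theorem Row.append {m : Mem} {a i : ℕ} {l : List F2} (h : Row m a i l) (b : F2) :
    Row (store m a i l.length b.val) a i (l ++ [b]) := by
  intro j hj
  rw [store_apply]
  rw [List.length_append, List.length_singleton] at hj
  by_cases h' : j = l.length
  · subst h'; simp
  · rw [if_neg (by simp [h']), h j (by omega), List.getD_append _ _ _ _ (by omega)]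

theorem Row.get {m : Mem} {a i n : ℕ} {w : Vec n} (h : Row m a i (List.ofFn w)) (j : Fin n) :
    m a i j = (w j).val := by
  rw [h j (by simp)]; simp

theorem Row.get_append {m : Mem} {a i n : ℕ} {l l' : List F2} {w : Vec n}
    (h : Row m a i (l ++ (List.ofFn w ++ l'))) (j : Fin n) :
    m a i (l.length + j) = (w j).val := by
  rw [h _ (by simp; omega), List.getD_append_right _ _ _ _ (by omega), Nat.add_sub_cancel_left,
    List.getD_append _ _ _ _ (by simp)]
  simp

theorem row_load (inp : List (List F2)) (k : ℕ) : Row (load inp) 0 k (inp.getD k []) :=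
  fun j _ => by simp [load]

/-- Matrices are stored row after row: the first `k` rows occupy `k * n` cells. The trailing `l'`
allows for the vector that follows the matrix in a key. -/
theorem row_flatten_get {m : Mem} {a i r n : ℕ} {l' : List F2} {M : Fin r → Vec n}
    (h : Row m a i ((List.ofFn fun k => List.ofFn (M k)).flatten ++ l')) (k : Fin r) (j : Fin n) :
    m a i (k * n + j) = (M k j).val := by
  have e : ∀ (L : List (List F2)), (∀ l ∈ L, l.length = n) → L.flatten.length = L.length * n := by
    intro L hL
    induction L with
    | nil => simp
    | cons l L ih =>
      rw [List.flatten_cons, List.length_append, ih fun l hl => hL l (by simp [hl]), hL l (by simp)]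
      simp; ring
  set L := List.ofFn fun k => List.ofFn (M k) with hL
  have hsplit : L = L.take k ++ (List.ofFn (M k) :: L.drop (k + 1)) := by
    have : L.drop k = L[(k : ℕ)]'(by simp [hL]) :: L.drop (k + 1) := List.drop_eq_getElem_cons _
    conv_lhs => rw [← List.take_append_drop k L, this]
    simp [hL]
  have hlen : (L.take k).flatten.length = k * n := by
    rw [e]
    · simp [hL]
    · intro l hl
      obtain ⟨i, rfl⟩ := (List.mem_ofFn' _ _).1 (List.mem_of_mem_take hl)
      simp
  rw [hsplit, List.flatten_append, List.flatten_cons, List.append_assoc, List.append_assoc] at h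
  rw [← hlen]
  exact h.get_append j

theorem ofFn_flat {r n : ℕ} (M : Matrix (Fin r) (Fin n) F2) :
    List.ofFn (flat M) = (List.ofFn fun k => List.ofFn (M k)).flatten := by
  rw [List.ofFn_mul]
  congr 2; funext i
  congr 1; funext j
  simp only [flat]
  have e : (⟨i * n + j, by nlinarith [i.2, j.2]⟩ : Fin (r * n)) = finProdFinEquiv (i, j) := by
    ext; simp [finProdFinEquiv]; ring
  rw [e, Equiv.symm_apply_apply]

theorem ofFn_packPair {r k n : ℕ} (M : Matrix (Fin r) (Fin k) F2) (z : Vec n) :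
    List.ofFn (packPair M z) = (List.ofFn fun k => List.ofFn (M k)).flatten ++ List.ofFn z := by
  rw [packPair, List.ofFn_fin_append, ofFn_flat]

/-! ### Loops that write bit strings. -/

section emit
variable {O : PMF (List F2)} {m : Mem}

/-- A deterministic loop that appends to a list in every iteration. -/
theorem Det.forLoop_list {α : Type} {x : ℕ} {N : Expr} {c : Cmd} {n τ : ℕ} {w : Fin n → α}
    {Inv : List α → Mem → Prop} (h0 : Inv [] m) (hN : ∀ l m', Inv l m' → N.eval m' = n)
    (hx : ∀ l m' v, Inv l m' → Inv l (PRC.store m' x 0 0 v))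
    (hc : ∀ (k : Fin n) (l : List α) m', l.length = k → Inv l m' → m' x 0 0 = k → Det O [c] m' τ
      fun m'' => Inv (l ++ [w k]) m'' ∧ m'' x 0 0 = k) :
    Det O [PRC.forLoop x N c] m (n * (τ + 3) + 3) (Inv (List.ofFn w)) := by
  have := Det.forLoop (O := O) (x := x) (N := N) (c := c) (n := n) (τ := τ) (m := m)
    (Inv := fun k m' => Inv ((List.ofFn w).take k) m') (by simpa using h0) (fun k => hN _)
    (fun k => hx _) (by
      intro k hk m' h h'
      refine Spec.imp (hc ⟨k, hk⟩ _ m' (by simp; omega) h h') fun _ m'' h'' => ⟨?_, h''.2⟩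
      have e : (List.ofFn w).take (k + 1) = (List.ofFn w).take k ++ [w ⟨k, hk⟩] := by
        rw [List.take_add_one]; simp [hk]
      rw [e]; exact h''.1)
  rwa [List.take_of_length_le (by simp)] at this

/-- Fill row `i` of array `a` from position `p` on: `N` times, execute `c` and append the bit `y`
to the row. -/
def emit (x : ℕ) (N : Expr) (c : Cmd) (y a i p : ℕ) : Cmd :=
  forLoop x N (.seq c (.seq (.set a (.const i) (var p) (var y)) (assign p (.add (var p) (.const 1)))))

/-- Appending a bit to a row. -/
theorem Det.push {x y a i p : ℕ} {J : Mem → Prop} {l : List F2} {b : F2} {Q : Mem → Prop}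
    (hxp : x ≠ p) (hxa : x ≠ a) (hpa : p ≠ a) (hrow : Row m a i l) (hp : m p 0 0 = l.length)
    (hy : m y 0 0 = b.val) (hJ : ∀ m', Frame {x, p, a} m m' → (∀ i', i' ≠ i → m' a i' = m a i') →
      J m') (hQ : ∀ m', J m' → Row m' a i (l ++ [b]) → m' p 0 0 = l.length + 1 →
      m' x 0 0 = m x 0 0 → Q m') :
    Det O [.seq (.set a (.const i) (var p) (var y)) (assign p (.add (var p) (.const 1)))] m 3 Q := by
  refine Spec.seq (Spec.set (Spec.assign (Det.nil (hQ _ (hJ _ ?_ ?_) ?_ ?_ ?_))))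
  · exact ((Frame.refl _ _).store (by simp) _ _ _).store (by simp) _ _ _
  · intro i' hi'
    rw [store_ne hpa.symm]; funext j'; simp [store_apply, hi', Expr.eval]
  · simp only [Expr.eval, eval_var, hp, hy]
    exact Row.congr (Row.append hrow b) (by rw [store_ne hpa.symm])
  · simp only [Expr.eval, eval_var]
    rw [store_same, store_ne hpa, hp]
  · rw [store_ne hxp, store_ne hxa]

/-- The assertion `J l` collects what the body `c` needs after the bits `l` have been written. It
must not depend on the counter, the position, or the row that is being filled, since these change
outside the body. -/
theorem Spec.emit {x y a i p n τ : ℕ} {N : Expr} {c : Cmd} {D : List F2 → PMF F2}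
    {J : List F2 → Mem → Prop} {l₀ : List F2} (hxp : x ≠ p) (hxa : x ≠ a) (hpa : p ≠ a)
    (hrow : Row m a i l₀) (hp : m p 0 0 = l₀.length) (h0 : J [] m)
    (hN : ∀ l m', J l m' → N.eval m' = n)
    (hJ : ∀ l m' m'', Frame {x, p, a} m' m'' → (∀ i', i' ≠ i → m'' a i' = m' a i') →
      J l m' → J l m'')
    (hc : ∀ l m', l.length < n → J l m' → m' x 0 0 = l.length → Spec O [c] m' τ (D l)
      fun b m'' => J (l ++ [b]) m'' ∧ m'' y 0 0 = b.val ∧ m'' x = m' x ∧ m'' p = m' p ∧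
        m'' a = m' a) :
    Spec O [PRC.emit x N c y a i p] m (n * (τ + 7) + 3) (extend D n []) fun l m' =>
      l.length = n ∧ Row m' a i (l₀ ++ l) ∧ m' p 0 0 = l₀.length + n ∧ J l m' := by
  have := Spec.forLoop_extend (O := O) (x := x) (N := N) (n := n) (τ := τ + 4) (D := D) (m := m)
    (c := .seq c (.seq (.set a (.const i) (var p) (var y)) (PRC.assign p (.add (var p) (.const 1)))))
    (Inv := fun l m' => J l m' ∧ Row m' a i (l₀ ++ l) ∧ m' p 0 0 = l₀.length + l.length)
    ⟨h0, by simpa using hrow, by simpa using hp⟩ (fun l m' h => hN l m' h.1) (by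
      rintro l m' v ⟨h1, h2, h3⟩
      refine ⟨hJ l m' _ ((Frame.refl _ _).store (by simp) _ _ _) (fun i' _ => ?_) h1,
        h2.congr ?_, ?_⟩
      · rw [store_ne hxa.symm]
      · rw [store_ne hxa.symm]
      · rw [store_ne hxp.symm, h3]) (by
      rintro l m' hl ⟨h1, h2, h3⟩ hx
      have := Spec.cons (O := O) (L' := [.seq (.set a (.const i) (var p) (var y))
        (PRC.assign p (.add (var p) (.const 1)))]) (T' := 3)
        (Y := fun b => PMF.pure b) (R := fun b m'' => (J (l ++ [b]) m'' ∧
          Row m'' a i (l₀ ++ (l ++ [b])) ∧ m'' p 0 0 = l₀.length + (l ++ [b]).length)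
          ∧ m'' x 0 0 = l.length) (hc l m' hl h1 hx) (by
        rintro b m'' ⟨g1, g2, g3, g4, g5⟩
        refine Spec.map (fun _ => b) (X := PMF.pure ()) (Det.push (J := J (l ++ [b])) hxp hxa hpa
          (h2.congr (by rw [g5])) (by rw [g4, h3]; simp) g2 (fun m3 h h' => hJ _ m'' m3 h h' g1)
          (Q := fun m3 => (J (l ++ [b]) m3 ∧ Row m3 a i (l₀ ++ (l ++ [b])) ∧
            m3 p 0 0 = l₀.length + (l ++ [b]).length) ∧ m3 x 0 0 = l.length) ?_)
          (fun _ _ h => h) |> fun h => by rwa [PMF.pure_map] at h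
        intro m3 k1 k2 k3 k4
        refine ⟨⟨k1, by rwa [← List.append_assoc], by rw [k3]; simp; ring⟩, by rw [k4, g3, hx]⟩)
      rw [PMF.bind_pure] at this
      exact (Spec.seq this).time (by omega))
  refine this.mono (le_of_eq (by ring)) ?_
  rintro l m' ⟨h1, h2, h3, h4⟩
  exact ⟨h1, h3, by rw [h4, h1], h2⟩

theorem Spec.emit_iid {x y a i p n τ : ℕ} {N : Expr} {c : Cmd} {D : PMF F2} {J : Mem → Prop}
    {l₀ : List F2} (hxp : x ≠ p) (hxa : x ≠ a) (hpa : p ≠ a)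
    (hrow : Row m a i l₀) (hp : m p 0 0 = l₀.length) (h0 : J m) (hN : ∀ m', J m' → N.eval m' = n)
    (hJ : ∀ m' m'', Frame {x, p, a} m' m'' → (∀ i', i' ≠ i → m'' a i' = m' a i') → J m' → J m'')
    (hc : ∀ m', J m' → Spec O [c] m' τ D fun b m'' => J m'' ∧ m'' y 0 0 = b.val ∧ m'' x = m' x ∧
      m'' p = m' p ∧ m'' a = m' a) :
    Spec O [PRC.emit x N c y a i p] m (n * (τ + 7) + 3) (iid D n) fun w m' =>
      Row m' a i (l₀ ++ List.ofFn w) ∧ m' p 0 0 = l₀.length + n ∧ J m' := by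
  have := Spec.emit (D := fun _ => D) (J := fun _ => J) hxp hxa hpa hrow hp h0 (fun _ => hN)
    (fun _ => hJ) (fun l m' _ h _ => hc m' h)
  rw [extend_const] at this
  simp only [List.nil_append] at this
  have := this.map (R := fun (w : Fin n → F2) m' => Row m' a i (l₀ ++ List.ofFn w) ∧
    m' p 0 0 = l₀.length + n ∧ J m') (fun l j => l.getD j 0) (by
      rintro l m' ⟨rfl, h2, h3, h4⟩
      refine ⟨?_, h3, h4⟩
      have : (List.ofFn fun j : Fin l.length => l.getD j 0) = l := by
        refine List.ext_getElem (by simp) fun k h1 h2 => by simp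
      rwa [this])
  rw [PMF.map_comp] at this
  have e : (fun (l : List F2) (j : Fin n) => l.getD j 0) ∘ (fun v : Fin n → F2 => List.ofFn v) = id := by
    funext v j; simp
  rwa [e, PMF.map_id] at this

theorem Det.emit_list {x y a i p n τ : ℕ} {N : Expr} {c : Cmd} {w : Vec n}
    {J : List F2 → Mem → Prop} {l₀ : List F2} (hxp : x ≠ p) (hxa : x ≠ a) (hpa : p ≠ a)
    (hrow : Row m a i l₀) (hp : m p 0 0 = l₀.length) (h0 : J [] m)
    (hN : ∀ l m', J l m' → N.eval m' = n)
    (hJ : ∀ l m' m'', Frame {x, p, a} m' m'' → (∀ i', i' ≠ i → m'' a i' = m' a i') →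
      J l m' → J l m'')
    (hc : ∀ (k : Fin n) (l : List F2) m', l.length = k → J l m' → m' x 0 0 = k →
      Det O [c] m' τ fun m'' => J (l ++ [w k]) m'' ∧ m'' y 0 0 = (w k).val ∧ m'' x = m' x ∧
        m'' p = m' p ∧ m'' a = m' a) :
    Det O [PRC.emit x N c y a i p] m (n * (τ + 7) + 3) fun m' =>
      Row m' a i (l₀ ++ List.ofFn w) ∧ m' p 0 0 = l₀.length + n ∧ J (List.ofFn w) m' := by
  have := Det.forLoop_list (O := O) (x := x) (N := N) (n := n) (τ := τ + 4) (w := w) (m := m)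
    (c := .seq c (.seq (.set a (.const i) (var p) (var y)) (assign p (.add (var p) (.const 1)))))
    (Inv := fun l m' => J l m' ∧ Row m' a i (l₀ ++ l) ∧ m' p 0 0 = l₀.length + l.length)
    ⟨h0, by simpa using hrow, by simpa using hp⟩ (fun l m' h => hN l m' h.1) (by
      rintro l m' v ⟨h1, h2, h3⟩
      refine ⟨hJ l m' _ ((Frame.refl _ _).store (by simp) _ _ _) (fun i' _ => ?_) h1,
        h2.congr ?_, ?_⟩
      · rw [store_ne hxa.symm]
      · rw [store_ne hxa.symm]
      · rw [store_ne hxp.symm, h3]) (by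
      rintro k l m' hl ⟨h1, h2, h3⟩ hx
      refine (Spec.seq (Det.cons (hc k l m' hl h1 hx) (T' := 3) ?_)).time (by omega)
      rintro m'' ⟨g1, g2, g3, g4, g5⟩
      refine Det.push (J := J (l ++ [w k])) hxp hxa hpa (h2.congr (by rw [g5]))
        (by rw [g4, h3]; simp) g2 (fun m3 h h' => hJ _ m'' m3 h h' g1) fun m3 k1 k2 k3 k4 => ?_
      exact ⟨⟨k1, by rwa [← List.append_assoc], by rw [k3]; simp; ring⟩, by rw [k4, g3, hx]⟩)
  refine this.mono (le_of_eq (by ring)) ?_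
  rintro _ m' ⟨h1, h2, h3⟩
  exact ⟨h2, by simpa using h3, h1⟩

/-- The memories differ in the arrays of `S` and in row `i` of array `a` only. -/
def RowFrame (S : Set ℕ) (a i : ℕ) (m m' : Mem) : Prop :=
  Frame (insert a S) m m' ∧ ∀ i', i' ≠ i → m' a i' = m a i'

theorem RowFrame.refl (S : Set ℕ) (a i : ℕ) (m : Mem) : RowFrame S a i m m :=
  ⟨Frame.refl _ _, fun _ _ => rfl⟩

/-- A loop that evaluates a bit in every iteration and appends it to a row. -/
theorem det_emit_expr {a i p n : ℕ} {N e : Expr} {w : Vec n} {l₀ : List F2} (hp11 : 11 ≠ p)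
    (ha11 : 11 ≠ a) (hp16 : 16 ≠ p) (ha16 : 16 ≠ a) (hpa : p ≠ a) (hrow : Row m a i l₀)
    (hp : m p 0 0 = l₀.length) (hN : ∀ m', RowFrame {11, 16, p} a i m m' → N.eval m' = n)
    (he : ∀ (k : Fin n) m', RowFrame {11, 16, p} a i m m' → m' 11 0 0 = k →
      e.eval m' = (w k).val) :
    Det O [PRC.emit 11 N (assign 16 e) 16 a i p] m (n * 8 + 3) fun m' =>
      Row m' a i (l₀ ++ List.ofFn w) ∧ m' p 0 0 = l₀.length + n ∧
        RowFrame {11, 16, p} a i m m' := by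
  refine Det.emit_list (τ := 1) (J := fun _ m' => RowFrame {11, 16, p} a i m m') hp11 ha11 hpa hrow
    hp (RowFrame.refl _ _ _ _) (fun _ => hN) ?_ ?_
  · rintro _ m' m'' h h' ⟨h1, h2⟩
    refine ⟨h1.trans (h.mono ?_), fun i' hi' => (h' i' hi').trans (h2 i' hi')⟩
    rintro b (rfl | rfl | rfl) <;> simp
  · rintro k _ m' _ h hx
    refine Spec.assign (Spec.nil ⟨⟨h.1.store (by simp) _ _ _, ?_⟩, ?_, ?_, ?_, ?_⟩)
    · intro i' hi'; rw [store_ne ha16.symm]; exact h.2 i' hi'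
    · rw [store_same]; exact he k m' h hx
    · rw [store_ne (by norm_num)]
    · rw [store_ne hp16.symm]
    · rw [store_ne ha16.symm]

/-- A loop that appends coins to a row. -/
theorem spec_emit_coin {a i p n : ℕ} {N : Expr} {l₀ : List F2} (hp11 : 11 ≠ p)
    (ha11 : 11 ≠ a) (hp16 : 16 ≠ p) (ha16 : 16 ≠ a) (hpa : p ≠ a) (hrow : Row m a i l₀)
    (hp : m p 0 0 = l₀.length) (hN : ∀ m', RowFrame {11, 16, p} a i m m' → N.eval m' = n) :
    Spec O [PRC.emit 11 N (.coin 16 (.const 0) (.const 0)) 16 a i p] m (n * 8 + 3)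
      (PMF.uniformOfFintype (Vec n)) fun w m' =>
      Row m' a i (l₀ ++ List.ofFn w) ∧ m' p 0 0 = l₀.length + n ∧
        RowFrame {11, 16, p} a i m m' := by
  rw [← iid_uniform]
  refine Spec.emit_iid (τ := 1) (J := fun m' => RowFrame {11, 16, p} a i m m') hp11 ha11 hpa hrow
    hp (RowFrame.refl _ _ _ _) hN ?_ ?_
  · rintro m' m'' h h' ⟨h1, h2⟩
    refine ⟨h1.trans (h.mono ?_), fun i' hi' => (h' i' hi').trans (h2 i' hi')⟩
    rintro b (rfl | rfl | rfl) <;> simp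
  · rintro m' h
    have := Spec.coin (O := O) (a := 16) (i := .const 0) (j := .const 0) (m := m') (L := [])
      (Y := PMF.pure) (Q := fun b m'' => RowFrame {11, 16, p} a i m m'' ∧ m'' 16 0 0 = b.val ∧
        m'' 11 = m' 11 ∧ m'' p = m' p ∧ m'' a = m' a) (T := 0) fun b => Spec.nil (by
        refine ⟨⟨h.1.store (by simp) _ _ _, ?_⟩, store_same, ?_, ?_, ?_⟩
        · intro i' hi'; rw [store_ne ha16.symm]; exact h.2 i' hi'
        · rw [store_ne (by norm_num)]
        · rw [store_ne hp16.symm]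
        · rw [store_ne ha16.symm])
    rwa [PMF.bind_pure] at this

end emit


/-! ### The parameters of the code

The programs use array `4` for `n`, array `5` for the row weight `t`, array `6` for `g = t * t`,
array `7` for the number of rows and array `8` for `n * g`. -/

/-- Computes the parameters. -/
def params (K : ℕ) : Cmd :=
  block [assign 4 (.get 1 (.const 0) (.const 0)), assign 5 (.const 0), assign 13 (.const (2 ^ K)),
    forLoop 9 (var 4) (.ite (.sub (.add (var 4) (.const 1)) (var 13))
      (.seq (assign 5 (.add (var 5) (.const 1))) (assign 13 (.smul (2 ^ K) (var 13)))) .skip),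
    mul 9 6 (var 5) (var 5), assign 7 (.const 0),
    forLoop 9 (var 4) (.ite (.sub (.add (.smul 99 (var 4)) (.const 1))
      (.smul 100 (.add (var 7) (.const 1)))) (assign 7 (.add (var 7) (.const 1))) .skip),
    mul 9 8 (var 4) (var 6)]

/-- The variables hold the parameters. -/
structure Params (K n : ℕ) (m : Mem) : Prop where
  eq_n : m 4 0 0 = n
  eq_t : m 5 0 0 = rowWt K n
  eq_g : m 6 0 0 = rowWt K n * rowWt K n
  eq_r : m 7 0 0 = rowNum n
  eq_ng : m 8 0 0 = n * (rowWt K n * rowWt K n)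

theorem Params.frame {K n : ℕ} {m m' : Mem} {S : Set ℕ} (h : Params K n m) (h' : Frame S m m')
    (hS : ∀ a, 4 ≤ a → a ≤ 8 → a ∉ S) : Params K n m' := by
  constructor
  · rw [h' 4 (hS _ (by norm_num) (by norm_num)), h.eq_n]
  · rw [h' 5 (hS _ (by norm_num) (by norm_num)), h.eq_t]
  · rw [h' 6 (hS _ (by norm_num) (by norm_num)), h.eq_g]
  · rw [h' 7 (hS _ (by norm_num) (by norm_num)), h.eq_r]
  · rw [h' 8 (hS _ (by norm_num) (by norm_num)), h.eq_ng]

/-- Without multiplication and division, the logarithm is found by comparing `n` with successive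
powers of `2 ^ K`, and the number of rows by counting. Both loops run `n` times and stop counting at
the right value, hence the minima in the invariants. -/
theorem det_params {O : PMF (List F2)} {K n : ℕ} (hK : K ≠ 0) {m : Mem} (hn : m 1 0 0 = n) :
    Det O [params K] m (20 * n + 50) fun m' =>
      Params K n m' ∧ Frame {4, 5, 6, 7, 8, 9, 13} m m' := by
  have hlog : ∀ k, n ≠ 0 → ((2 ^ K) ^ (k + 1) ≤ n ↔ k + 1 ≤ rowWt K n) := fun k hn =>
    (Nat.le_log_iff_pow_le (Nat.one_lt_two_pow hK) hn).symm
  set S : Set ℕ := {4, 5, 6, 7, 8, 9, 13} with hS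
  have ht := rowWt_le K n
  refine (Spec.block_cons (Spec.assign (Spec.block_cons (Spec.assign (Spec.block_cons
    (Spec.assign (Spec.block_cons (Det.cons (Det.forLoop (τ := 4) (n := n)
      (Inv := fun k m' => Frame S m m' ∧ m' 4 0 0 = n ∧ m' 5 0 0 = min k (rowWt K n) ∧
        m' 13 0 0 = (2 ^ K) ^ (min k (rowWt K n) + 1)) ?_ ?_ ?_ ?_) (T' := n * 13 + 30)
        ?_)))))))).time (by omega)
  · refine ⟨?_, ?_, ?_, ?_⟩
    · exact (((Frame.refl _ _).store (by simp [hS]) _ _ _).store (by simp [hS]) _ _ _).store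
        (by simp [hS]) _ _ _
    all_goals simp [store, Expr.eval, hn]
  · exact fun k m' h => h.2.1
  · exact fun k m' v h => ⟨h.1.store (by simp [hS]) _ _ _, by simpa [store] using h.2⟩
  · rintro k hk m' ⟨h1, h2, h3, h4⟩ hx
    by_cases hle : k + 1 ≤ rowWt K n
    · have e : min k (rowWt K n) = k := by omega
      have e' : min (k + 1) (rowWt K n) = k + 1 := by omega
      rw [e] at h3 h4
      rw [e']
      have := (hlog k (by omega)).2 hle
      refine Spec.ite_true ?_ ?_
      · simp only [Expr.eval, eval_var, h2, h4]; omega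
      refine Spec.seq (Spec.assign (Spec.assign (Spec.nil ?_)))
      refine ⟨⟨?_, ?_, ?_, ?_⟩, ?_⟩
      · exact (h1.store (by simp [hS]) _ _ _).store (by simp [hS]) _ _ _
      · simp [store, h2]
      · simp [store, h3, Expr.eval]
      · simp [store, Expr.eval_smul, h4]; ring
      · simp [store, hx]
    · have e : min k (rowWt K n) = rowWt K n := by omega
      have e' : min (k + 1) (rowWt K n) = rowWt K n := by omega
      rw [e] at h3 h4
      rw [e']
      have := (hlog (rowWt K n) (by omega)).not.2 (by omega)
      refine (Spec.ite_false ?_ (Spec.skip (Spec.nil ⟨⟨h1, h2, h3, h4⟩, hx⟩))).time (by omega)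
      simp only [Expr.eval, eval_var, h2, h4]; omega
  rintro m1 ⟨f1, n1, t1, -⟩
  rw [min_eq_right ht] at t1
  refine (Spec.block_cons (Det.cons (det_mul (a := rowWt K n) (b := rowWt K n) (by norm_num)
    (fun m' h => by rw [eval_var, h 5 (by simp), t1])
    (fun m' h => by rw [eval_var, h 5 (by simp), t1]))
    (T' := n * 9 + 18) ?_)).time (by omega)
  rintro m2 ⟨g2, f2⟩
  have f2 : Frame S m m2 := f1.trans (f2.mono (by simp [hS, Set.insert_subset_iff]))
  have n2 : m2 4 0 0 = n := by rw [‹Frame {9, 6} m1 m2› 4 (by simp), n1]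
  have t2 : m2 5 0 0 = rowWt K n := by rw [‹Frame {9, 6} m1 m2› 5 (by simp), t1]
  refine (Spec.block_cons (Spec.assign (Spec.block_cons (Det.cons (Det.forLoop (τ := 2) (n := n)
      (Inv := fun k m' => Frame S m m' ∧ m' 4 0 0 = n ∧ m' 5 0 0 = rowWt K n ∧
        m' 6 0 0 = rowWt K n * rowWt K n ∧ m' 7 0 0 = min k (rowNum n)) ?_ ?_ ?_ ?_)
        (T' := n * 4 + 10) ?_)))).time (by omega)
  · refine ⟨f2.store (by simp [hS]) _ _ _, ?_⟩
    simp [store, n2, t2, g2, Expr.eval]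
  · exact fun k m' h => h.2.1
  · exact fun k m' v h => ⟨h.1.store (by simp [hS]) _ _ _, by simpa [store] using h.2⟩
  · rintro k hk m' ⟨h1, h2, h3, h4, h5⟩ hx
    have hr := rowNum_eq n
    by_cases hle : k + 1 ≤ rowNum n
    · refine Spec.ite_true ?_ (Spec.assign (Spec.nil ⟨⟨h1.store (by simp [hS]) _ _ _, ?_⟩, ?_⟩))
      · simp only [Expr.eval, eval_var, Expr.eval_smul, h2, h5]; omega
      · simp [store, h2, h3, h4, Expr.eval, h5]; omega
      · simp [store, hx]
    · refine Spec.ite_false ?_ (Spec.skip (Spec.nil ⟨⟨h1, h2, h3, h4, ?_⟩, hx⟩))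
      · simp only [Expr.eval, eval_var, Expr.eval_smul, h2, h5]; omega
      · omega
  rintro m3 ⟨f3, n3, t3, g3, r3⟩
  have hr := rowNum_eq n
  rw [min_eq_right (by omega)] at r3
  refine (Spec.block_last (Spec.imp (det_mul (a := n) (b := rowWt K n * rowWt K n) (by norm_num)
    (fun m' h => by rw [eval_var, h 4 (by simp), n3])
    (fun m' h => by rw [eval_var, h 6 (by simp), g3])) ?_)).time (by omega)
  rintro _ m4 ⟨g4, f4⟩
  refine ⟨⟨?_, ?_, ?_, ?_, g4⟩, f3.trans (f4.mono ?_)⟩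
  · rw [f4 4 (by simp), n3]
  · rw [f4 5 (by simp), t3]
  · rw [f4 6 (by simp), g3]
  · rw [f4 7 (by simp), r3]
  · simp [hS, Set.insert_subset_iff]

/-! ### Random numbers -/

/-- Sets variable `14` to `a * 2 ^ l` and variable `15` to `b * V` for a uniformly random number
`V < 2 ^ l`, where `a`, `b` and `l` are given in the variables `18`, `19` and `17`. -/
def randNum : Cmd :=
  block [assign 14 (var 18), assign 13 (var 19), assign 15 (.const 0),
    forLoop 12 (var 17) (block [.coin 16 (.const 0) (.const 0),
      .ite (var 16) (assign 15 (.add (var 15) (var 13))) .skip,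
      assign 13 (.add (var 13) (var 13)), assign 14 (.add (var 14) (var 14))])]

theorem uniformOfFintype_map_equiv {α β : Type} [Fintype α] [Nonempty α] [Fintype β] [Nonempty β]
    (e : α ≃ β) : (PMF.uniformOfFintype α).map e = PMF.uniformOfFintype β := by
  classical
  ext b
  rw [PMF.map_apply, tsum_eq_single (e.symm b)]
  · simp [Fintype.card_congr e]
  · intro a ha
    rw [if_neg]
    rintro rfl; simp at ha

/-- The bits of a number, the least significant one first. -/
def bitsEquiv (l : ℕ) : Vec l ≃ Fin (2 ^ l) :=
  (Equiv.arrowCongr (Equiv.refl _) (ZMod.finEquiv 2).symm.toEquiv).trans finFunctionFinEquiv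

theorem bitsEquiv_apply {l : ℕ} (w : Vec l) :
    (bitsEquiv l w : ℕ) = ∑ i : Fin l, (w i).val * 2 ^ (i : ℕ) := by
  have h : ∀ b : F2, ((ZMod.finEquiv 2).symm b : ℕ) = b.val := by decide
  simp only [bitsEquiv, Equiv.trans_apply, finFunctionFinEquiv_apply]
  exact Finset.sum_congr rfl fun i _ => by rw [← h]; rfl

theorem ofDigits_ofFn {l : ℕ} (w : Vec l) :
    Nat.ofDigits 2 ((List.ofFn w).map ZMod.val) = (bitsEquiv l w : ℕ) := by
  rw [bitsEquiv_apply]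
  induction l with
  | zero => simp
  | succ l ih =>
    rw [List.ofFn_succ, List.map_cons, Nat.ofDigits_cons, ih fun i => w i.succ,
      Fin.sum_univ_succ, Finset.mul_sum]
    congr 1
    · simp
    · refine Finset.sum_congr rfl fun i _ => ?_
      rw [Fin.val_succ, pow_succ]; ring

/-- The product `b * V` is built up directly, by adding `b * 2 ^ i` when the `i`-th coin is `1`.
Thus no multiplication of exponentially large numbers, which would take too long by repeated
addition, is necessary. -/
theorem spec_randNum {O : PMF (List F2)} {m : Mem} {a b l : ℕ} (ha : m 18 0 0 = a)
    (hb : m 19 0 0 = b) (hl : m 17 0 0 = l) :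
    Spec O [randNum] m (12 * l + 20) (PMF.uniformOfFintype (Fin (2 ^ l))) fun V m' =>
      m' 14 0 0 = a * 2 ^ l ∧ m' 15 0 0 = b * V ∧ Frame {12, 13, 14, 15, 16} m m' := by
  set S : Set ℕ := {12, 13, 14, 15, 16} with hS
  rw [← uniformOfFintype_map_equiv (bitsEquiv l)]
  have h0 : Spec O [randNum] m (12 * l + 20) (iid (PMF.uniformOfFintype F2) l) fun w m' =>
      Frame S m m' ∧ m' 14 0 0 = a * 2 ^ (List.ofFn w).length ∧
      m' 15 0 0 = b * Nat.ofDigits 2 ((List.ofFn w).map ZMod.val) ∧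
      m' 13 0 0 = b * 2 ^ (List.ofFn w).length := by
    refine (Spec.block_cons (Spec.assign (Spec.block_cons (Spec.assign (Spec.block_cons
      (Spec.assign (Spec.block_last (Spec.forLoop_iid (τ := 9) (Inv := fun w m' => Frame S m m' ∧
      m' 14 0 0 = a * 2 ^ w.length ∧ m' 15 0 0 = b * Nat.ofDigits 2 (w.map ZMod.val) ∧
      m' 13 0 0 = b * 2 ^ w.length) ?_ ?_ ?_ ?_)))))))).time (by omega)
    · refine ⟨(((Frame.refl _ _).store (by simp [hS]) _ _ _).store (by simp [hS]) _ _ _).store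
        (by simp [hS]) _ _ _, ?_⟩
      simp [store, Expr.eval, ha, hb]
    · rintro w m' ⟨h1, -⟩
      rw [eval_var, h1 17 (by simp [hS]), hl]
    · rintro w m' v ⟨h1, h2⟩
      exact ⟨h1.store (by simp [hS]) _ _ _, by simpa [store] using h2⟩
    · rintro w m' hw ⟨h1, h2, h3, h4⟩ hx
      have key : ∀ c : F2, Spec O [Cmd.ite (var 16) (assign 15 (.add (var 15) (var 13))) .skip,
          block [assign 13 (.add (var 13) (var 13)), assign 14 (.add (var 14) (var 14))]]
          (store m' 16 0 0 c.val) 5 (PMF.pure c) fun a' m'' => (Frame S m m'' ∧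
          m'' 14 0 0 = a * 2 ^ (w ++ [a']).length ∧
          m'' 15 0 0 = b * Nat.ofDigits 2 ((w ++ [a']).map ZMod.val) ∧
          m'' 13 0 0 = b * 2 ^ (w ++ [a']).length) ∧ m'' 12 0 0 = w.length := by
        intro c
        have h1' := h1.store (a := 16) (by simp [hS]) 0 0 c.val
        rcases F2.eq_zero_or_one c with rfl | rfl
        · refine (Spec.ite_false (by simp [store]) (Spec.skip (Spec.block_cons (Spec.assign
            (Spec.block_last (Spec.assign (Spec.nil ⟨⟨?_, ?_⟩, ?_⟩))))))).time (by omega)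
          · exact (h1'.store (by simp [hS]) _ _ _).store (by simp [hS]) _ _ _
          · simp [store, Expr.eval, h2, h3, h4, Nat.ofDigits_append]
            constructor <;> ring
          · simp [store, hx]
        · refine (Spec.ite_true (by simp [store]) (Spec.assign (Spec.block_cons (Spec.assign
            (Spec.block_last (Spec.assign (Spec.nil ⟨⟨?_, ?_⟩, ?_⟩))))))).time (by omega)
          · exact ((h1'.store (by simp [hS]) _ _ _).store (by simp [hS]) _ _ _).store
              (by simp [hS]) _ _ _
          · have v1 : ZMod.val (1 : F2) = 1 := rfl
            simp [store, Expr.eval, h2, h3, h4, Nat.ofDigits_append, v1]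
            refine ⟨?_, ?_, ?_⟩ <;> ring
          · simp [store, hx]
      have := Spec.coin (O := O) (a := 16) (i := .const 0) (j := .const 0) (m := m') (T := 7)
        (L := [block [Cmd.ite (var 16) (assign 15 (.add (var 15) (var 13))) .skip,
          assign 13 (.add (var 13) (var 13)), assign 14 (.add (var 14) (var 14))]])
        fun c => (Spec.block_cons (key c)).time (by omega)
      rw [PMF.bind_pure] at this
      exact (Spec.block_cons this).time (by omega)
  rw [iid_uniform] at h0
  refine h0.map (bitsEquiv l) fun w m' h => ⟨?_, ?_, h.1⟩
  · rw [h.2.1]; simp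
  · rw [h.2.2.1, ofDigits_ofFn]


/-! ### Approximate Bernoulli samples -/

/-- Sets variable `16` to a random bit with expectation about `a / b`, where `a` and `b` are given
in the variables `18` and `19`, and the number of coins in variable `17`. -/
def bern : Cmd :=
  block [randNum, .ite (.sub (var 14) (var 15)) (assign 16 (.const 1)) (assign 16 (.const 0))]

/-- The approximation, with `s` coins, of a Bernoulli distribution with expectation `a / b`. -/
noncomputable def bernApprox (a b s : ℕ) : PMF F2 :=
  (PMF.uniformOfFintype (Fin (2 ^ s))).map fun V : Fin (2 ^ s) => if b * V < a * 2 ^ s then 1 else 0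

theorem spec_bern {O : PMF (List F2)} {m : Mem} {a b s : ℕ} (ha : m 18 0 0 = a)
    (hb : m 19 0 0 = b) (hs : m 17 0 0 = s) :
    Spec O [bern] m (12 * s + 23) (bernApprox a b s) fun c m' =>
      m' 16 0 0 = c.val ∧ Frame {12, 13, 14, 15, 16} m m' := by
  have h := Spec.cons (O := O) (L' := [block [Cmd.ite (.sub (var 14) (var 15)) (assign 16 (.const 1))
    (assign 16 (.const 0))]]) (T' := 2) (Y := fun V : Fin (2 ^ s) => PMF.pure (if b * V < a * 2 ^ s then 1 else 0))
    (R := fun (c : F2) m' => m' 16 0 0 = c.val ∧ Frame {12, 13, 14, 15, 16} m m')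
    (spec_randNum ha hb hs) (by
      rintro V m' ⟨h1, h2, h3⟩
      have h3' := fun v => h3.store (a := 16) (by simp) 0 0 v
      split_ifs with h
      · refine Spec.block_last (Spec.ite_true ?_ (Spec.assign (Spec.nil ⟨?_, h3' _⟩)))
        · simp only [Expr.eval, eval_var, h1, h2]; omega
        · rw [store_same]; rfl
      · refine Spec.block_last (Spec.ite_false ?_ (Spec.assign (Spec.nil ⟨?_, h3' _⟩)))
        · simp only [Expr.eval, eval_var, h1, h2]; omega
        · rw [store_same]; rfl)
  rw [show (PMF.uniformOfFintype (Fin (2 ^ s))).bind (fun V : Fin (2 ^ s) => PMF.pure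
    (if b * V < a * 2 ^ s then (1 : F2) else 0)) = bernApprox a b s from PMF.bind_pure_comp _ _] at h
  exact (Spec.block_cons h).time (by omega)

theorem toReal_uniform_map_ite {N c : ℕ} [NeZero N] (hc : c ≤ N) :
    ((PMF.uniformOfFintype (Fin N)).map (fun V : Fin N => if (V : ℕ) < c then (1 : F2) else 0) 1).toReal
      = c / N := by
  rw [PMF.map_apply, tsum_fintype]
  have e : ∀ V : Fin N, (if (1 : F2) = (if (V : ℕ) < c then (1 : F2) else 0) then
      PMF.uniformOfFintype (Fin N) V else 0) = if (V : ℕ) < c then (N : ℝ≥0∞)⁻¹ else 0 := by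
    intro V
    by_cases h : (V : ℕ) < c <;> simp [h]
  have e' : ∑ V : Fin N, (if (V : ℕ) < c then (N : ℝ≥0∞)⁻¹ else 0) = c * (N : ℝ≥0∞)⁻¹ := by
    rw [← Finset.sum_filter, Finset.sum_const, Fin.card_filter_val_lt, min_eq_right hc, nsmul_eq_mul]
  refine (congrArg ENNReal.toReal (Eq.trans (Finset.sum_congr rfl fun V _ => ?_) e')).trans ?_
  · rw [← e V]; congr
  · simp [div_eq_mul_inv]

theorem abs_bernApprox_sub_le {a b s : ℕ} (hb : 0 < b) (hab : a ≤ b) :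
    |(bernApprox a b s 1).toReal - a / b| ≤ 1 / 2 ^ s := by
  -- The number of accepted values `V` is the quotient `a * 2 ^ s / b` rounded up; rounding changes
  -- the probability by at most `2^(-s)`.
  set c := (a * 2 ^ s + (b - 1)) / b with hc
  have hc1 : c ≤ 2 ^ s := by
    rw [hc, ← Nat.lt_succ_iff, Nat.div_lt_iff_lt_mul hb]
    have := Nat.mul_le_mul_right (2 ^ s) hab
    rw [Nat.succ_mul, Nat.mul_comm (2 ^ s)]; omega
  have e : bernApprox a b s = (PMF.uniformOfFintype (Fin (2 ^ s))).map
      fun V : Fin (2 ^ s) => if (V : ℕ) < c then (1 : F2) else 0 := by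
    rw [bernApprox]; congr 1; funext V
    have : b * V < a * 2 ^ s ↔ (V : ℕ) < c := by
      rw [hc, Nat.lt_iff_add_one_le, Nat.lt_iff_add_one_le, Nat.le_div_iff_mul_le hb, add_mul,
        Nat.mul_comm b]
      omega
    simp only [this]
  rw [e, toReal_uniform_map_ite hc1]
  have h1 : c * b ≤ a * 2 ^ s + (b - 1) := Nat.div_mul_le_self _ _
  have h2 : a * 2 ^ s ≤ c * b := by
    have := Nat.lt_div_mul_add (a := a * 2 ^ s + (b - 1)) hb
    rw [← hc] at this; omega
  have h1' : (c : ℝ) * b ≤ a * 2 ^ s + b := by exact_mod_cast h1.trans (by omega)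
  have h2' : (a : ℝ) * 2 ^ s ≤ c * b := by exact_mod_cast h2
  have hb' : (0 : ℝ) < b := by exact_mod_cast hb
  have hs : (0 : ℝ) < 2 ^ s := by positivity
  push_cast
  rw [div_sub_div _ _ hs.ne' hb'.ne', abs_of_nonneg (by apply div_nonneg <;> nlinarith),
    div_le_div_iff₀ (by positivity) hs]
  nlinarith

/-- In spite of the approximation, the extreme probabilities `0` and `1` are exact. Selection
sampling therefore never puts out more ones than wanted, and never so few that the remaining
positions cannot make up for them. -/
theorem mem_support_bernApprox {a b s : ℕ} {c : F2} (h : c ∈ (bernApprox a b s).support) :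
    (c = 1 → 0 < a) ∧ (c = 0 → 0 < b → a < b) := by
  rw [bernApprox, PMF.mem_support_map_iff] at h
  obtain ⟨V, -, h⟩ := h
  split_ifs at h with h'
  · subst h
    refine ⟨fun _ => Nat.pos_of_ne_zero ?_, fun h => absurd h (by decide)⟩
    rintro rfl; simp at h'
  · subst h
    refine ⟨fun h => absurd h (by decide), fun _ hb => ?_⟩
    by_contra hab
    have := Nat.mul_le_mul_right (2 ^ s) (not_lt.1 hab)
    have := Nat.mul_lt_mul_of_pos_left V.2 hb
    omega

theorem toReal_apply_zero (X : PMF F2) : (X 0).toReal = 1 - (X 1).toReal := by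
  have := sum_toReal_pmf X
  rw [show (Finset.univ : Finset F2) = {0, 1} by decide, Finset.sum_pair (by decide)] at this
  linarith

theorem dist_bits {X Y : PMF F2} {ε : ℝ} (h : |(X 1).toReal - (Y 1).toReal| ≤ ε) :
    Dist X Y (ENNReal.ofReal (2 * ε)) := by
  refine Dist.of_sum_abs ?_
  rw [show (Finset.univ : Finset F2) = {0, 1} by decide, Finset.sum_pair (by decide),
    toReal_apply_zero, toReal_apply_zero, abs_sub_comm (X 1).toReal] at *
  rw [show 1 - (X 1).toReal - (1 - (Y 1).toReal) = (Y 1).toReal - (X 1).toReal by ring]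
  linarith

/-! ### Selection sampling -/

/-- The uniform distribution on the vectors of weight `w`, for `w ≤ k`. -/
noncomputable def unifWt (w k : ℕ) : PMF (Vec k) :=
  if h : w ≤ k then rowDist h else PMF.pure 0

theorem toReal_unifWt {w k : ℕ} (h : w ≤ k) (v : Vec k) :
    (unifWt w k v).toReal = if hammingNorm v = w then ((k.choose w : ℕ) : ℝ)⁻¹ else 0 := by
  rw [unifWt, dif_pos h, rowDist, toReal_uniformOfFinset, card_wtSet]
  simp only [mem_wtSet]

theorem hammingNorm_eq_sum_val {n : ℕ} (v : Vec n) : hammingNorm v = ∑ i, (v i).val := by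
  rw [hammingNorm, Finset.card_filter]
  refine Finset.sum_congr rfl fun i _ => ?_
  rcases F2.eq_zero_or_one (v i) with h | h <;> simp [h]; rfl

theorem toReal_bind_cons {k : ℕ} (D : PMF F2) (Y : F2 → PMF (Vec k)) (v : Vec (k + 1)) :
    ((D.bind fun b => (Y b).map fun w => (Fin.cons b w : Vec (k + 1))) v).toReal
      = (D (v 0)).toReal * (Y (v 0) (Fin.tail v)).toReal := by
  have h : ∀ b, ((Y b).map fun w => (Fin.cons b w : Vec (k + 1))) v
      = if b = v 0 then Y b (Fin.tail v) else 0 := by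
    intro b
    rw [PMF.map_apply, tsum_eq_single (Fin.tail v)]
    · by_cases hb : b = v 0
      · subst hb; simp
      · rw [if_neg hb, if_neg]
        intro h; exact hb (by rw [h]; rfl)
    · intro w hw
      rw [if_neg]
      rintro rfl; simp at hw
  rw [PMF.bind_apply, tsum_eq_single (v 0), h, if_pos rfl, ENNReal.toReal_mul]
  intro b hb
  rw [h, if_neg hb, mul_zero]

/-- Among the vectors of length `k + 1` and weight `w`, a fraction `w / (k + 1)` starts with `1`,
and the rest of the vector is again uniform of the remaining weight. The two cases are the two
standard relations between neighbouring binomial coefficients. -/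
theorem unifWt_succ {w k : ℕ} (h : w ≤ k + 1) :
    unifWt w (k + 1) = ((PMF.uniformOfFintype (Fin (k + 1))).map fun V : Fin (k + 1) =>
      if (V : ℕ) < w then (1 : F2) else 0).bind fun b =>
        (unifWt (w - b.val) k).map fun v => (Fin.cons b v : Vec (k + 1)) := by
  ext v
  rw [← ENNReal.toReal_eq_toReal_iff' (PMF.apply_ne_top _ _) (PMF.apply_ne_top _ _),
    toReal_bind_cons, toReal_unifWt h]
  have hv : hammingNorm v = (v 0).val + hammingNorm (Fin.tail v) := by
    rw [hammingNorm_eq_sum_val, hammingNorm_eq_sum_val, Fin.sum_univ_succ]; rfl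
  have htail : hammingNorm (Fin.tail v) ≤ k := by simpa using hammingNorm_le_card_fintype (x := Fin.tail v)
  have hk : (0 : ℝ) < k + 1 := by positivity
  rcases F2.eq_zero_or_one (v 0) with h0 | h0
  · rw [h0] at hv ⊢
    rw [toReal_apply_zero, toReal_uniform_map_ite h]
    simp only [ZMod.val_zero, zero_add, Nat.sub_zero] at hv ⊢
    by_cases hw : w ≤ k
    · rw [toReal_unifWt hw, hv]
      split_ifs
      · have h1 : (0 : ℝ) < (k.choose w : ℕ) := by exact_mod_cast Nat.choose_pos hw
        have h2 : (0 : ℝ) < ((k + 1).choose w : ℕ) := by exact_mod_cast Nat.choose_pos h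
        have h3 := Nat.choose_mul_succ_eq k w
        have h3' : ((k.choose w : ℕ) : ℝ) * (k + 1) = ((k + 1).choose w : ℕ) * (k + 1 - w) := by
          have := congrArg (Nat.cast : ℕ → ℝ) h3
          push_cast [Nat.cast_sub h] at this
          exact this
        push_cast
        field_simp
        linarith
      · ring
    · have : w = k + 1 := by omega
      subst this
      rw [if_neg (by omega)]
      push_cast
      rw [div_self hk.ne']; ring
  · rw [h0] at hv ⊢
    rw [toReal_uniform_map_ite h]
    have v1 : (1 : F2).val = 1 := rfl
    rw [v1] at hv ⊢
    rcases w with _ | w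
    · rw [if_neg (by omega)]; simp
    · rw [Nat.add_sub_cancel, toReal_unifWt (by omega)]
      by_cases hw : hammingNorm (Fin.tail v) = w
      · rw [if_pos (by omega), if_pos hw]
        have h1 : (0 : ℝ) < (k.choose w : ℕ) := by exact_mod_cast Nat.choose_pos (by omega)
        have h2 : (0 : ℝ) < ((k + 1).choose (w + 1) : ℕ) := by exact_mod_cast Nat.choose_pos h
        have h3' : ((k : ℝ) + 1) * (k.choose w : ℕ) = ((k + 1).choose (w + 1) : ℕ) * (w + 1) := by
          exact_mod_cast Nat.add_one_mul_choose_eq k w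
        push_cast
        field_simp
        linarith
      · rw [if_neg (by omega), if_neg hw, mul_zero]

/-- The weight of a list. -/
def listWt (l : List F2) : ℕ := (l.map ZMod.val).sum

/-- Selection sampling: the distribution of the next bit of a vector of length `n` and weight `t`
that starts with `l`, approximated with `s` coins. -/
noncomputable def selectBit (n t s : ℕ) (l : List F2) : PMF F2 :=
  bernApprox (t - listWt l) (n - l.length) s

/-- The errors of the individual bits add up. Whatever bit is put out, `mem_support_bernApprox`
guarantees that the remaining weight still fits into the remaining positions, so the induction can
continue. -/
theorem dist_extend_selectBit (n t s : ℕ) (k : ℕ) (l : List F2) (hl : l.length + k = n)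
    (ht : listWt l ≤ t) (hk : t - listWt l ≤ k) :
    Dist (extend (selectBit n t s) k l) ((unifWt (t - listWt l) k).map fun v => l ++ List.ofFn v)
      (k * ENNReal.ofReal (2 * (1 / 2 ^ s))) := by
  induction k generalizing l with
  | zero =>
    refine (Dist.of_eq ?_).mono zero_le
    have : (fun v : Vec 0 => l ++ List.ofFn v) = Function.const _ l := by funext v; simp
    rw [this, PMF.map_const]; rfl
  | succ k ih =>
    rw [extend, unifWt_succ hk, PMF.map_bind]
    have e : n - l.length = k + 1 := by omega
    refine (Dist.bind (ε := ENNReal.ofReal (2 * (1 / 2 ^ s)))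
      (δ := k * ENNReal.ofReal (2 * (1 / 2 ^ s))) ?_ ?_).mono (le_of_eq ?_)
    · refine dist_bits ?_
      rw [toReal_uniform_map_ite hk, selectBit, e]
      exact abs_bernApprox_sub_le (Nat.succ_pos _) hk
    · intro b hb
      have hs := mem_support_bernApprox hb
      have hwt : listWt (l ++ [b]) = listWt l + b.val := by simp [listWt]
      have v1 : (1 : F2).val = 1 := rfl
      have hb' : listWt (l ++ [b]) ≤ t ∧ t - listWt (l ++ [b]) ≤ k := by
        rw [hwt]
        rcases F2.eq_zero_or_one b with rfl | rfl
        · have := hs.2 rfl (by omega)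
          simp; omega
        · have := hs.1 rfl
          rw [v1]; omega
      have := ih (l ++ [b]) (by simp; omega) hb'.1 hb'.2
      rw [PMF.map_comp]
      rw [hwt, ← Nat.sub_sub] at this
      have e2 : ((fun v : Vec (k + 1) => l ++ List.ofFn v) ∘ fun v : Vec k => (Fin.cons b v : Vec (k + 1)))
          = fun v => l ++ [b] ++ List.ofFn v := by
        funext v; simp [List.ofFn_succ]
      rw [e2]; exact this
    · push_cast; ring


/-! ### Uniform samples from the kernel of a matrix -/

/-- The image distribution is invariant under translation by elements of the image, hence constant
there. -/
theorem uniformOfFintype_map_hom {A A' : Type} [AddGroup A] [Fintype A] [AddGroup A']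
    (f : A →+ A') (S : Finset A') (hS : S.Nonempty) (h : ∀ b, b ∈ S ↔ ∃ a, f a = b) :
    (PMF.uniformOfFintype A).map f = PMF.uniformOfFinset S hS := by
  classical
  set X := (PMF.uniformOfFintype A).map f with hX
  have hinv : ∀ a b, X (f a + b) = X b := by
    intro a b
    have e : X.map (fun b => f a + b) = X := by
      rw [hX, PMF.map_comp]
      have : (fun b => f a + b) ∘ f = f ∘ (Equiv.addLeft a) := by funext c; simp
      rw [this, ← PMF.map_comp, uniformOfFintype_map_equiv]
    conv_lhs => rw [← e]
    rw [PMF.map_apply, tsum_eq_single b]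
    · simp
    · intro c hc
      rw [if_neg]
      intro h; exact hc (add_left_cancel h).symm
  have h0 : ∀ b ∉ S, X b = 0 := by
    intro b hb
    by_contra hne
    rw [← ne_eq, ← PMF.mem_support_iff, hX, PMF.mem_support_map_iff] at hne
    obtain ⟨a, -, rfl⟩ := hne
    exact hb ((h _).2 ⟨a, rfl⟩)
  have hc : ∀ b ∈ S, X b = X 0 := by
    intro b hb
    obtain ⟨a, rfl⟩ := (h b).1 hb
    have := hinv a 0
    rwa [add_zero] at this
  have hsum : (S.card : ℝ≥0∞) * X 0 = 1 := by
    rw [← X.tsum_coe, tsum_eq_sum (s := S) fun b hb => h0 b hb, Finset.sum_congr rfl hc,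
      Finset.sum_const, nsmul_eq_mul]
  ext b
  rw [PMF.uniformOfFinset_apply]
  split_ifs with hb
  · rw [hc b hb]
    exact ENNReal.eq_inv_of_mul_eq_one_left (by rwa [mul_comm])
  · exact h0 b hb

/-- The columns of `B` span the space of vectors that are orthogonal to the first `k` rows of
`P`. -/
def Spans {r n : ℕ} (P : Fin r → Vec n) (k : ℕ) (B : Matrix (Fin n) (Fin n) F2) : Prop :=
  ∀ x, (∃ y, B.mulVec y = x) ↔ ∀ i : Fin r, (i : ℕ) < k → P i ⬝ᵥ x = 0

theorem spans_zero {r n : ℕ} (P : Fin r → Vec n) : Spans P 0 1 := fun x => by simp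

/-- Here `d j` is the product of the new row with column `j` of `B`, and `p` is a pivot with `d p =
1`. Adding column `p` to all columns with `d j = 1` makes every column orthogonal to the new row.
The pivot column becomes zero, so `B` stays square; its columns need not be independent. If `d = 0`,
nothing changes, whatever `p` is. -/
theorem Spans.succ {r n : ℕ} {P : Fin r → Vec n} {k : Fin r} {B : Matrix (Fin n) (Fin n) F2}
    (h : Spans P k B) (d : Vec n) (hd : ∀ j, d j = ∑ i, P k i * B i j) (p : Fin n)
    (hp : (∃ j, d j = 1) → d p = 1) :
    Spans P (k + 1) (Matrix.of fun i j => B i j + B i p * d j) := by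
  have h1 : ∀ y, (Matrix.of fun i j => B i j + B i p * d j).mulVec y
      = B.mulVec (y + (d ⬝ᵥ y) • Pi.single p 1) := by
    intro y; funext i
    rw [Matrix.mulVec_add, Matrix.mulVec_smul]
    simp [Matrix.mulVec, dotProduct, add_mul, Finset.sum_add_distrib, Finset.sum_mul]
    refine Finset.sum_congr rfl fun j _ => by ring
  have h2 : ∀ y, P k ⬝ᵥ B.mulVec y = d ⬝ᵥ y := by
    intro y
    rw [Matrix.dotProduct_mulVec]
    congr 1; funext j; rw [hd]; rfl
  have h3 : ∀ y, (d ⬝ᵥ y) * (1 + d p) = 0 := by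
    intro y
    by_cases hj : ∃ j, d j = 1
    · rw [hp hj, F2.add_self, mul_zero]
    · push Not at hj
      have : d = 0 := by funext j; exact (F2.eq_zero_or_one _).resolve_right (hj j)
      rw [this, zero_dotProduct, zero_mul]
  intro x
  constructor
  · rintro ⟨y, rfl⟩ i hi
    rw [h1]
    rcases Nat.lt_succ_iff_lt_or_eq.1 hi with hi | hi
    · exact (h _).1 ⟨_, rfl⟩ i hi
    · obtain rfl : i = k := Fin.ext hi
      rw [h2, dotProduct_add, dotProduct_smul, dotProduct_single, mul_one, smul_eq_mul, ← h3 y]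
      ring
  · intro hx
    -- The same coefficients `y` work for the new matrix: orthogonality to the new row says `d ⬝ᵥ y
    -- = 0`, so the correction vanishes.
    obtain ⟨y, rfl⟩ := (h x).2 fun i hi => hx i (by omega)
    refine ⟨y, ?_⟩
    rw [h1, ← h2, hx k (by omega), zero_smul, add_zero]

/-- Kernel matrices can thus be sampled from fair coins alone, without any error, although the
dimension of the kernel is not known in advance. -/
theorem Spans.uniform_mul {r n : ℕ} {P : Fin r → Vec n} {B : Matrix (Fin n) (Fin n) F2}
    (h : Spans P r B) (g : ℕ) :
    (PMF.uniformOfFintype (Matrix (Fin n) (Fin g) F2)).map (fun C => B * C)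
      = PMF.uniformOfFinset (kernelMatrices (Matrix.of P) g) (kernelMatrices_nonempty _ g) := by
  refine uniformOfFintype_map_hom (AddMonoidHom.mk' (fun C => B * C) fun C C' => Matrix.mul_add _ _ _)
    _ _ fun G => ?_
  simp only [kernelMatrices, Finset.mem_filter, Finset.mem_univ, true_and, AddMonoidHom.mk'_apply]
  have h' : ∀ x, (∃ y, B.mulVec y = x) ↔ ∀ i : Fin r, P i ⬝ᵥ x = 0 := fun x =>
    (h x).trans ⟨fun h i => h i i.2, fun h i _ => h i⟩
  constructor
  · intro hG
    have hcol : ∀ j, ∃ y, B.mulVec y = fun i => G i j := fun j => by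
      rw [h']; intro i; exact congrFun (congrFun hG i) j
    choose Y hY using hcol
    refine ⟨Matrix.of fun i j => Y j i, ?_⟩
    ext i j
    exact congrFun (hY j) i
  · rintro ⟨C, rfl⟩
    ext i j
    exact (h' _).1 ⟨fun k => C k j, rfl⟩ i

/-! ### Gaussian elimination -/

/-- One step of the elimination, for the row of the matrix in row `0` of array `2` that starts at
the position in variable `26`. The basis is in array `25`. -/
def elimStep : Cmd :=
  block [assign 29 (.const 0),
    emit 11 (var 4) (dot 12 20 (var 4) (.get 2 (.const 0) (.add (var 26) (var 12)))
      (.get 25 (var 12) (var 11))) 20 27 0 29,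
    forLoop 11 (var 4) (.ite (.get 27 (.const 0) (var 11)) (assign 28 (var 11)) .skip),
    forLoop 11 (var 4) (block [assign 23 (.get 25 (var 11) (var 28)),
      forLoop 12 (var 4) (.set 25 (var 11) (var 12) (.xor (.get 25 (var 11) (var 12))
        (.and (var 23) (.get 27 (.const 0) (var 12)))))]),
    assign 26 (.add (var 26) (var 4))]

/-- Computes a matrix whose columns span the kernel of the matrix in row `0` of array `2`. -/
def elim : Cmd :=
  block [forLoop 11 (var 4) (.set 25 (var 11) (var 11) (.const 1)), assign 26 (.const 0),
    assign 28 (.const 0), forLoop 10 (var 7) elimStep]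

/-- Array `a` holds the matrix `M`. -/
def HoldsMat {r n : ℕ} (m : Mem) (a : ℕ) (M : Matrix (Fin r) (Fin n) F2) : Prop :=
  ∀ (i : Fin r) (j : Fin n), m a i j = (M i j).val

theorem det_elimStep {O : PMF (List F2)} {m : Mem} {r n : ℕ} {P : Fin r → Vec n} {k : Fin r}
    {B : Matrix (Fin n) (Fin n) F2} (hn : m 4 0 0 = n) (hk : m 26 0 0 = k * n)
    (hP : ∀ (i : Fin r) (j : Fin n), m 2 0 (i * n + j) = (P i j).val) (hB : HoldsMat m 25 B)
    (hp : 0 < n → m 28 0 0 < n) (hs : Spans P k B) :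
    Det O [elimStep] m (8 * n * n + 30 * n + 30) fun m' =>
      (∃ B', HoldsMat m' 25 B' ∧ Spans P (k + 1) B') ∧ m' 26 0 0 = (k + 1) * n ∧
      (0 < n → m' 28 0 0 < n) ∧ Frame {11, 12, 20, 23, 25, 26, 27, 28, 29} m m' := by
  set S : Set ℕ := {11, 12, 20, 23, 25, 26, 27, 28, 29} with hS
  set d : Vec n := fun j => ∑ i, P k i * B i j with hd
  refine (Spec.block_cons (Spec.assign (Spec.block_cons (Det.cons (Det.emit_list (w := d) (l₀ := [])
    (τ := n * 4 + 5) (n := n) (J := fun _ m' => Frame {11, 12, 20, 27, 29} m m')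
    (by norm_num) (by norm_num) (by norm_num) (Row.nil _ _ _) ?_ ?_ ?_ ?_ ?_)
    (T' := 4 * n * n + 18 * n + 14) ?_)))).time (by ring_nf; omega)
  · simp [store, Expr.eval]
  · exact (Frame.refl _ _).store (by simp) _ _ _
  · intro _ m' h; rw [eval_var, h 4 (by simp), hn]
  · intro _ m' m'' h _ h'
    exact h'.trans (h.mono (by simp [Set.insert_subset_iff]))
  · intro j _ m' _ h hx
    refine Spec.imp (det_dot (a := P k) (b := fun i => B i j) (by norm_num) ?_ ?_ ?_) ?_
    · intro m'' h'; rw [eval_var, h' 4 (by simp), h 4 (by simp), hn]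
    · intro i m'' h' hi
      simp only [Expr.eval, eval_var, hi]
      rw [h' 26 (by simp), h' 2 (by simp), h 26 (by simp), h 2 (by simp), hk, hP]
    · intro i m'' h' hi
      simp only [Expr.eval, eval_var, hi]
      rw [h' 11 (by simp), h' 25 (by simp), h 25 (by simp), hx, hB]
    · rintro _ m'' ⟨h1, h2⟩
      refine ⟨h.trans (h2.mono (by simp [Set.insert_subset_iff])), h1, ?_, ?_, ?_⟩
      · rw [h2 11 (by simp)]
      · rw [h2 29 (by simp)]
      · rw [h2 27 (by simp)]
  rintro m1 ⟨r1, -, f1⟩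
  rw [List.nil_append] at r1
  have r1 := r1.get
  -- The pivot is the last index at which `d` is `1`. If there is none, the old value remains; it
  -- only has to be a valid index, because the update is then trivial.
  refine (Spec.block_cons (Det.cons (Det.forLoop (τ := 2) (n := n)
    (Inv := fun k m' => Frame {11, 28} m1 m' ∧ (0 < n → m' 28 0 0 < n) ∧
      ((∃ j : Fin n, j < k ∧ d j = 1) → ∃ p : Fin n, m' 28 0 0 = p ∧ d p = 1)) ?_ ?_ ?_ ?_)
    (T' := 4 * n * n + 9 * n + 10) ?_)).time (by ring_nf; omega)
  · refine ⟨Frame.refl _ _, fun h => ?_, ?_⟩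
    · rw [f1 28 (by simp)]; exact hp h
    · rintro ⟨j, h, -⟩; exact absurd h (by simp)
  · intro _ m' h; rw [eval_var, h.1 4 (by simp), f1 4 (by simp), hn]
  · intro _ m' v h; exact ⟨h.1.store (by simp) _ _ _, by simpa [store] using h.2⟩
  · rintro j hj m' ⟨h1, h2, h3⟩ hx
    have e : m' 27 0 j = (d ⟨j, hj⟩).val := by rw [h1 27 (by simp)]; exact r1 ⟨j, hj⟩
    rcases F2.eq_zero_or_one (d ⟨j, hj⟩) with h0 | h0
    · refine Spec.ite_false ?_ (Spec.skip (Spec.nil ⟨⟨h1, h2, ?_⟩, hx⟩))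
      · simp only [Expr.eval, eval_var, hx, e, h0]; rfl
      · rintro ⟨i, hi, hi'⟩
        refine h3 ⟨i, ?_, hi'⟩
        rcases Nat.lt_succ_iff_lt_or_eq.1 hi with hi | hi
        · exact hi
        · obtain rfl : i = ⟨j, hj⟩ := Fin.ext hi
          rw [h0] at hi'; exact absurd hi' (by decide)
    · refine Spec.ite_true ?_ (Spec.assign (Spec.nil ⟨⟨h1.store (by simp) _ _ _, ?_, ?_⟩, ?_⟩))
      · simp only [Expr.eval, eval_var, hx, e, h0]; decide
      · intro _; rw [store_same, eval_var, hx]; exact hj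
      · intro _; exact ⟨⟨j, hj⟩, by rw [store_same, eval_var, hx], h0⟩
      · rw [store_ne (by norm_num), hx]
  rintro m2 ⟨f2, hp2, hpd⟩
  have hpd' : ∃ B', Spans P (k + 1) B' ∧ ∀ i j : Fin n, ∃ h : m2 28 0 0 < n,
      B' i j = B i j + B i ⟨_, h⟩ * d j := by
    -- For `n = 0` there is no valid pivot index, but all matrices are empty.
    rcases Nat.eq_zero_or_pos n with h0 | h0
    · refine ⟨B, ?_, fun i => by have := i.2; omega⟩
      subst h0
      intro x
      exact ⟨fun _ i _ => by simp [dotProduct], fun _ => ⟨x, funext fun i => i.elim0⟩⟩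
    · refine ⟨_, hs.succ d (fun j => rfl) ⟨_, hp2 h0⟩ fun ⟨j, hj⟩ => ?_, fun i j => ⟨hp2 h0, rfl⟩⟩
      obtain ⟨p, h, h'⟩ := hpd ⟨j, j.2, hj⟩
      have : (⟨_, hp2 h0⟩ : Fin n) = p := Fin.ext h
      rw [this]; exact h'
  obtain ⟨B', hs', hB'⟩ := hpd'
  have hB2 : HoldsMat m2 25 B := fun i j => by
    rw [f2 25 (by simp), f1 25 (by simp), hB]
  have hn2 : m2 4 0 0 = n := by rw [f2 4 (by simp), f1 4 (by simp), hn]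
  have hd2 : ∀ j : Fin n, m2 27 0 j = (d j).val := fun j => by rw [f2 27 (by simp), r1]
  refine (Spec.block_cons (Det.cons (Det.forLoop (τ := n * 4 + 5) (n := n)
    (Inv := fun i m' => Frame {11, 12, 23, 25} m2 m' ∧ ∀ i' j' : Fin n,
      m' 25 i' j' = (if (i' : ℕ) < i then B' i' j' else B i' j').val) ?_ ?_ ?_ ?_)
    (T' := 2) ?_)).time (by ring_nf; omega)
  · exact ⟨Frame.refl _ _, fun i' j' => by simp [hB2 i' j']⟩
  · intro _ m' h; rw [eval_var, h.1 4 (by simp), hn2]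
  · intro _ m' v h
    exact ⟨h.1.store (by simp) _ _ _, fun i' j' => by rw [store_ne (by norm_num)]; exact h.2 i' j'⟩
  · rintro i hi m' ⟨h1, h2⟩ hx
    have hpos : 0 < n := by omega
    have e28 : m' 28 0 0 = m2 28 0 0 := by rw [h1 28 (by simp)]
    have e23 : m' 25 i (m' 28 0 0) = (B ⟨i, hi⟩ ⟨_, hp2 hpos⟩).val := by
      rw [e28]
      have := h2 ⟨i, hi⟩ ⟨_, hp2 hpos⟩
      simpa using this
    -- The entry in the pivot column is saved in variable `23` first, because the loop over the row
    -- overwrites it.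
    refine (Spec.block_cons (Spec.assign (Spec.block_last (Spec.imp (Det.forLoop (τ := 1) (n := n)
      (Inv := fun j m'' => Frame {11, 12, 23, 25} m2 m'' ∧ m'' 11 0 0 = i ∧
        m'' 23 0 0 = (B ⟨i, hi⟩ ⟨_, hp2 hpos⟩).val ∧
        ∀ i' j' : Fin n, m'' 25 i' j' =
          (if (i' : ℕ) < i ∨ ((i' : ℕ) = i ∧ (j' : ℕ) < j) then B' i' j' else B i' j').val)
      ?_ ?_ ?_ ?_) ?_)))).time (by omega)
    · refine ⟨h1.store (by simp) _ _ _, by simp [store, hx], ?_, fun i' j' => ?_⟩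
      · rw [store_same]; simp only [Expr.eval, eval_var, hx]; exact e23
      · rw [store_ne (by norm_num), h2]; simp
    · intro _ m'' h; rw [eval_var, h.1 4 (by simp), hn2]
    · rintro _ m'' v ⟨g1, g2, g3, g4⟩
      exact ⟨g1.store (by simp) _ _ _, by simp [store, g2], by simp [store, g3],
        fun i' j' => by rw [store_ne (by norm_num)]; exact g4 i' j'⟩
    · rintro j hj m'' ⟨g1, g2, g3, g4⟩ hy
      have e25 : m'' 25 i j = (B ⟨i, hi⟩ ⟨j, hj⟩).val := by
        have := g4 ⟨i, hi⟩ ⟨j, hj⟩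
        simpa using this
      have e27 : m'' 27 0 j = (d ⟨j, hj⟩).val := by rw [g1 27 (by simp)]; exact hd2 ⟨j, hj⟩
      have ev : (Expr.xor (.get 25 (var 11) (var 12)) (.and (var 23) (.get 27 (.const 0) (var 12)))).eval m''
          = (B' ⟨i, hi⟩ ⟨j, hj⟩).val := by
        obtain ⟨h, hB⟩ := hB' ⟨i, hi⟩ ⟨j, hj⟩
        rw [hB]
        refine Expr.eval_xor ?_ (Expr.eval_and ?_ ?_)
        · simp only [Expr.eval, eval_var, g2, hy]; exact e25
        · exact g3
        · simp only [Expr.eval, eval_var, hy]; exact e27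
      refine Spec.set (Spec.nil ?_)
      rw [ev]
      simp only [eval_var, g2, hy]
      refine ⟨⟨g1.store (by simp) _ _ _, by simp [store, g2], by simp [store, g3],
        fun i' j' => ?_⟩, by simp [store, hy]⟩
      rw [store_apply]
      by_cases hij : (i' : ℕ) = i ∧ (j' : ℕ) = j
      · obtain rfl : i' = ⟨i, hi⟩ := Fin.ext hij.1
        obtain rfl : j' = ⟨j, hj⟩ := Fin.ext hij.2
        simp
      · rw [if_neg hij, g4]
        congr 1
        refine if_congr ?_ rfl rfl
        omega
    · rintro _ m'' ⟨g1, g2, g3, g4⟩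
      refine ⟨⟨g1, fun i' j' => ?_⟩, g2⟩
      rw [g4]
      congr 1
      refine if_congr ?_ rfl rfl
      have := j'.2
      omega
  rintro m3 ⟨f3, h3⟩
  have f3' : Frame S m m3 := (f1.mono (by simp [hS, Set.insert_subset_iff])).trans
    ((f2.mono (by simp [hS, Set.insert_subset_iff])).trans
      (f3.mono (by simp [hS, Set.insert_subset_iff])))
  refine Spec.block_last (Spec.assign (T := 1) (Spec.time (Spec.nil ⟨⟨B', fun i j => ?_, hs'⟩, ?_, ?_,
    f3'.store (by simp [hS]) _ _ _⟩) (by omega)))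
  · rw [store_ne (by norm_num), h3, if_pos i.2]
  · rw [store_same]
    simp only [Expr.eval, eval_var]
    rw [f3 26 (by simp), f2 26 (by simp), f1 26 (by simp), hk, f3 4 (by simp), hn2]; ring
  · intro h
    rw [store_ne (by norm_num), f3 28 (by simp)]; exact hp2 h

theorem det_elim {O : PMF (List F2)} {m : Mem} {r n : ℕ} {P : Fin r → Vec n}
    (hn : m 4 0 0 = n) (hr : m 7 0 0 = r) (h0 : m 25 = 0)
    (hP : ∀ (i : Fin r) (j : Fin n), m 2 0 (i * n + j) = (P i j).val) :
    Det O [elim] m (r * (8 * n * n + 30 * n + 33) + 4 * n + 12) fun m' =>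
      (∃ B, HoldsMat m' 25 B ∧ Spans P r B) ∧
      Frame {10, 11, 12, 20, 23, 25, 26, 27, 28, 29} m m' := by
  set S : Set ℕ := {10, 11, 12, 20, 23, 25, 26, 27, 28, 29} with hS
  refine (Spec.block_cons (Det.cons (Det.forLoop (τ := 1) (n := n)
    (Inv := fun k m' => Frame S m m' ∧ ∀ i j : Fin n, m' 25 i j =
      if i = j ∧ (i : ℕ) < k then 1 else 0) ?_ ?_ ?_ ?_)
    (T' := r * (8 * n * n + 30 * n + 33) + 8) ?_)).time (by omega)
  · exact ⟨Frame.refl _ _, fun i j => by rw [h0]; simp⟩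
  · intro _ m' h; rw [eval_var, h.1 4 (by simp [hS]), hn]
  · intro _ m' v h
    exact ⟨h.1.store (by simp [hS]) _ _ _,
      fun i' j' => by rw [store_ne (by norm_num)]; exact h.2 i' j'⟩
  · rintro k hk m' ⟨h1, h2⟩ hx
    refine Spec.set (Spec.nil ⟨⟨h1.store (by simp [hS]) _ _ _, fun i j => ?_⟩, by simp [store, hx]⟩)
    simp only [eval_var, hx, store_apply, Expr.eval, h2, Fin.ext_iff]
    split_ifs <;> omega
  rintro m1 ⟨f1, h1⟩
  refine (Spec.block_cons (Spec.assign (Spec.block_cons (Spec.assign (Spec.block_last (Spec.imp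
    (Det.forLoop (τ := 8 * n * n + 30 * n + 30) (n := r)
      (Inv := fun k m' => Frame S m m' ∧ m' 26 0 0 = k * n ∧ (0 < n → m' 28 0 0 < n) ∧
        ∃ B, HoldsMat m' 25 B ∧ Spans P k B) ?_ ?_ ?_ ?_) ?_)))))).time (by ring_nf; omega)
  · refine ⟨(f1.store (by simp [hS]) _ _ _).store (by simp [hS]) _ _ _, ?_, ?_, 1, ?_, spans_zero P⟩
    · simp [store, Expr.eval]
    · simp [store, Expr.eval]
    · intro i j
      rw [store_ne (by norm_num), store_ne (by norm_num), h1, Matrix.one_apply]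
      by_cases h : i = j
      · subst h; simp; rfl
      · simp [h]
  · intro _ m' h; rw [eval_var, h.1 7 (by simp [hS]), hr]
  · rintro _ m' v ⟨g1, g2, g3, B, g4, g5⟩
    exact ⟨g1.store (by simp [hS]) _ _ _, by simpa [store] using g2, by simpa [store] using g3,
      B, fun i j => by rw [store_ne (by norm_num)]; exact g4 i j, g5⟩
  · rintro k hk m' ⟨g1, g2, g3, B, g4, g5⟩ hx
    refine Spec.imp (det_elimStep (k := ⟨k, hk⟩) (by rw [g1 4 (by simp [hS]), hn]) g2
      (fun i j => by rw [g1 2 (by simp [hS]), hP]) g4 g3 g5) ?_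
    rintro _ m'' ⟨k1, k2, k3, k4⟩
    exact ⟨⟨g1.trans (k4.mono (by simp [hS])), k2, k3, k1⟩,
      by rw [k4 10 (by simp), hx]⟩
  · rintro _ m' ⟨g1, -, -, g4⟩
    exact ⟨g4, g1⟩


/-! ### Key generation -/

/-- The output strings are in the rows of array `2`, and their lengths in array `3`. -/
def Outputs (m : Mem) (o : List (List F2)) : Prop :=
  ∀ k < o.length, Row m 2 k (o.getD k []) ∧ m 3 k 0 = (o.getD k []).length

theorem Outputs.readStrings {m : Mem} {o : List (List F2)} {K T : ℕ} (h : Outputs m o)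
    (hK : o.length = K) (hT : ∀ l ∈ o, l.length ≤ T) : readStrings K T m = o := by
  subst hK
  refine List.ext_getElem (by simp [PRC.readStrings]) fun k h1 h2 => ?_
  obtain ⟨hr, hl⟩ := h k h2
  rw [List.getD_eq_getElem _ _ h2] at hr hl
  have hT' := hT _ (List.getElem_mem h2)
  simp only [PRC.readStrings, List.getElem_ofFn]
  refine List.ext_getElem (by simp [hl, hT']) fun j h3 h4 => ?_
  simp only [List.getElem_ofFn]
  rw [hr j h4, List.getD_eq_getElem _ _ h4, ZMod.natCast_zmod_val]

/-- Samples the rows of the parity check matrix into row `0` of array `2`. -/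
def sampleRows : Cmd :=
  forLoop 10 (var 7) (block [assign 18 (var 5), assign 19 (var 4),
    emit 11 (var 4) (block [bern, assign 18 (.sub (var 18) (var 16)),
      assign 19 (.sub (var 19) (.const 1))]) 16 2 0 30])

/-- The approximation of the uniform distribution on the vectors of length `n` and weight `t`. -/
noncomputable def rowApprox (n t : ℕ) : PMF (Vec n) :=
  (extend (selectBit n t n) n []).map fun l j => l.getD j 0

theorem dist_rowApprox {n t : ℕ} (ht : t ≤ n) :
    Dist (rowApprox n t) (rowDist ht) (n * ENNReal.ofReal (2 * (1 / 2 ^ n))) := by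
  have := (dist_extend_selectBit n t n n [] (by simp) (by simp [listWt]) (by simpa [listWt])).map
    fun (l : List F2) (j : Fin n) => l.getD j 0
  rw [PMF.map_comp] at this
  have e : (fun (l : List F2) (j : Fin n) => l.getD j 0) ∘ (fun v : Vec n => [] ++ List.ofFn v)
      = id := by
    funext v j; simp
  rw [e, PMF.map_id] at this
  simpa [listWt, unifWt, dif_pos ht, rowApprox] using this

theorem length_flatten_ofFn {n : ℕ} (L : List (Vec n)) :
    (L.map List.ofFn).flatten.length = L.length * n := by
  simp [List.length_flatten, Function.comp_def]

theorem spec_sampleRows {O : PMF (List F2)} {m : Mem} {n t r : ℕ} (hn : m 4 0 0 = n)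
    (ht : m 5 0 0 = t) (hr : m 7 0 0 = r) (hs : m 17 0 0 = n) (hp : m 30 0 0 = 0) :
    Spec O [sampleRows] m (r * (n * (12 * n + 34) + 10) + 3) (iid (rowApprox n t) r) fun P m' =>
      Row m' 2 0 (List.ofFn fun k => List.ofFn (P k)).flatten ∧ m' 30 0 0 = r * n ∧
      Frame {2, 10, 11, 12, 13, 14, 15, 16, 18, 19, 30} m m' := by
  set S : Set ℕ := {2, 10, 11, 12, 13, 14, 15, 16, 18, 19, 30} with hS
  refine ((Spec.forLoop_iid (α := Vec n) (n := r) (τ := n * (12 * n + 34) + 7) (Inv := fun L m' =>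
    Frame S m m' ∧ Row m' 2 0 (L.map List.ofFn).flatten ∧ m' 30 0 0 = L.length * n) ?_ ?_ ?_ ?_).time
    (by ring_nf; omega)).imp ?_
  · exact ⟨Frame.refl _ _, Row.nil _ _ _, by simp [hp]⟩
  · intro _ m' h; rw [eval_var, h.1 7 (by simp [hS]), hr]
  · rintro _ m' v ⟨h1, h2, h3⟩
    exact ⟨h1.store (by simp [hS]) _ _ _, h2.congr (by rw [store_ne (by norm_num)]),
      by rw [store_ne (by norm_num)]; exact h3⟩
  · rintro L m' hL ⟨h1, h2, h3⟩ hx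
    have hlen := length_flatten_ofFn L
    -- Variables `18` and `19` hold the number of ones still to be placed and the number of free
    -- positions; their quotient is the probability of a one in selection sampling.
    have key := Spec.emit (O := O) (x := 11) (y := 16) (a := 2) (i := 0) (p := 30) (n := n)
      (τ := 12 * n + 27) (N := var 4)
      (c := block [bern, assign 18 (.sub (var 18) (var 16)), assign 19 (.sub (var 19) (.const 1))])
      (m := store (store m' 18 0 0 t) 19 0 0 n)
      (D := selectBit n t n) (J := fun l m'' => Frame S m m'' ∧ m'' 10 0 0 = L.length ∧
        m'' 18 0 0 = t - listWt l ∧ m'' 19 0 0 = n - l.length)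
      (l₀ := (L.map List.ofFn).flatten) (by norm_num) (by norm_num) (by norm_num)
      (h2.congr (by rw [store_ne (by norm_num), store_ne (by norm_num)]))
      (by rw [store_ne (by norm_num), store_ne (by norm_num), h3, hlen])
      ⟨(h1.store (by simp [hS]) _ _ _).store (by simp [hS]) _ _ _, by simp [store, hx],
        by simp [store, listWt], by simp [store]⟩
      (fun l m'' h => by rw [eval_var, h.1 4 (by simp [hS]), hn])
      (by
        rintro l m₁ m₂ h - ⟨g1, g2, g3, g4⟩
        refine ⟨g1.trans (h.mono (by simp [hS, Set.insert_subset_iff])), ?_, ?_, ?_⟩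
        · rw [h 10 (by simp), g2]
        · rw [h 18 (by simp), g3]
        · rw [h 19 (by simp), g4])
      (by
        rintro l m₁ hl ⟨g1, g2, g3, g4⟩ -
        have := Spec.cons (O := O) (L' := [block [assign 18 (.sub (var 18) (var 16)),
          assign 19 (.sub (var 19) (.const 1))]]) (T' := 3) (Y := fun b => PMF.pure b)
          (R := fun b m'' => (Frame S m m'' ∧ m'' 10 0 0 = L.length ∧
            m'' 18 0 0 = t - listWt (l ++ [b]) ∧ m'' 19 0 0 = n - (l ++ [b]).length) ∧
            m'' 16 0 0 = b.val ∧ m'' 11 = m₁ 11 ∧ m'' 30 = m₁ 30 ∧ m'' 2 = m₁ 2)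
          (spec_bern g3 g4 (by rw [g1 17 (by simp [hS]), hs])) (by
            rintro b m₂ ⟨k1, k2⟩
            have k3 : m₂ 18 0 0 = t - listWt l := by rw [k2 18 (by simp), g3]
            have k4 : m₂ 19 0 0 = n - l.length := by rw [k2 19 (by simp), g4]
            have k5 : m₂ 10 0 0 = L.length := by rw [k2 10 (by simp), g2]
            refine Spec.block_cons (Spec.assign (Spec.block_last (Spec.assign (Spec.nil
              ⟨⟨?_, ?_, ?_, ?_⟩, ?_, ?_, ?_, ?_⟩))))
            · exact ((g1.trans (k2.mono (by simp [hS, Set.insert_subset_iff]))).store (by simp [hS])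
                _ _ _).store (by simp [hS]) _ _ _
            · simp [store, k5]
            · simp [store, Expr.eval, k3, k1, listWt]; omega
            · simp [store, Expr.eval, k4]; omega
            · simp [store, k1]
            · rw [store_ne (by norm_num), store_ne (by norm_num), k2 11 (by simp)]
            · rw [store_ne (by norm_num), store_ne (by norm_num), k2 30 (by simp)]
            · rw [store_ne (by norm_num), store_ne (by norm_num), k2 2 (by simp)])
        rw [PMF.bind_pure] at this
        exact (Spec.block_cons this).time (by omega))
    have key' := key.map (R := fun (v : Vec n) m'' => (Frame S m m'' ∧
      Row m'' 2 0 ((L ++ [v]).map List.ofFn).flatten ∧ m'' 30 0 0 = (L ++ [v]).length * n) ∧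
      m'' 10 0 0 = L.length) (fun l j => l.getD j 0) (by
        rintro l m'' ⟨rfl, k1, k2, k3⟩
        refine ⟨⟨k3.1, ?_, ?_⟩, k3.2.1⟩
        · have : (List.ofFn fun j : Fin l.length => l.getD j 0) = l :=
            List.ext_getElem (by simp) fun k h1 h2 => by simp
          rw [List.map_append, List.flatten_append, List.map_singleton, List.flatten_singleton, this]
          exact k1
        · rw [k2, hlen]; simp; ring)
      |>.time (T' := n * (12 * n + 34) + 3) (le_of_eq (by ring))
    refine (Spec.block_cons (Spec.assign (Spec.block_cons (Spec.assign (Spec.block_last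
      ?_))))).time (T := n * (12 * n + 34) + 7) (by omega)
    simpa [Expr.eval, store, h1 5 (by simp [hS] : (5 : ℕ) ∉ S), h1 4 (by simp [hS] : (4 : ℕ) ∉ S), ht, hn, rowApprox] using key'
  · rintro P m' ⟨h1, h2, h3⟩
    rw [List.map_ofFn] at h2
    exact ⟨h2, by simpa using h3, h1⟩

/-- Writes the product of the matrices in the arrays `25` and `32` into row `1` of array `2`. The
second matrix is stored column by column. -/
def mulRows : Cmd :=
  forLoop 10 (var 4) (block [assign 26 (.const 0),
    emit 11 (var 6) (block [dot 12 20 (var 4) (.get 25 (var 10) (var 12))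
      (.get 32 (.const 0) (.add (var 26) (var 12))), assign 26 (.add (var 26) (var 4))]) 20 2 1 34])

theorem det_mulRows {O : PMF (List F2)} {m : Mem} {n g : ℕ} {B : Matrix (Fin n) (Fin n) F2}
    {C : Matrix (Fin n) (Fin g) F2} (hn : m 4 0 0 = n) (hg : m 6 0 0 = g) (hB : HoldsMat m 25 B)
    (hC : ∀ (j : Fin g) (k : Fin n), m 32 0 (j * n + k) = (C k j).val) (hp : m 34 0 0 = 0) :
    Det O [mulRows] m (n * (g * (4 * n + 14) + 10) + 3) fun m' =>
      Row m' 2 1 (List.ofFn fun i => List.ofFn ((B * C) i)).flatten ∧ m' 34 0 0 = n * g ∧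
      m' 2 0 = m 2 0 ∧ Frame {2, 10, 11, 12, 20, 26, 34} m m' := by
  set S : Set ℕ := {2, 10, 11, 12, 20, 26, 34} with hS
  refine ((Det.forLoop_list (w := fun i => List.ofFn ((B * C) i)) (n := n)
    (τ := g * (4 * n + 14) + 7) (Inv := fun L m' =>
    Frame S m m' ∧ m' 2 0 = m 2 0 ∧ Row m' 2 1 L.flatten ∧ m' 34 0 0 = L.length * g ∧
      L.flatten.length = L.length * g) ?_ ?_ ?_ ?_).time
    (by ring_nf; omega)).imp ?_
  · exact ⟨Frame.refl _ _, rfl, Row.nil _ _ _, by simp [hp]⟩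
  · intro _ m' h; rw [eval_var, h.1 4 (by simp [hS]), hn]
  · rintro _ m' v ⟨h1, h2, h3, h4⟩
    exact ⟨h1.store (by simp [hS]) _ _ _, by rw [store_ne (by norm_num)]; exact h2,
      h3.congr (by rw [store_ne (by norm_num)]), by rw [store_ne (by norm_num)]; exact h4⟩
  · rintro i L m' hL ⟨h1, h2, h3, h4, h5⟩ hx
    refine (Spec.block_cons (Spec.assign (Spec.block_last (Spec.imp (Det.emit_list
      (w := fun j => (B * C) i j) (l₀ := L.flatten) (n := g) (τ := 4 * n + 7)
      (J := fun l m'' => Frame S m m'' ∧ m'' 2 0 = m 2 0 ∧ m'' 10 0 0 = i ∧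
        m'' 26 0 0 = l.length * n) (by norm_num) (by norm_num) (by norm_num) ?_ ?_ ?_ ?_ ?_ ?_)
        ?_)))).time (by ring_nf; omega)
    · exact h3.congr (by rw [store_ne (by norm_num)])
    · rw [store_ne (by norm_num), h4, h5]
    · exact ⟨h1.store (by simp [hS]) _ _ _, by rw [store_ne (by norm_num)]; exact h2,
        by simp [store, hx], by simp [store, Expr.eval]⟩
    · rintro _ m'' ⟨g1, -⟩; rw [eval_var, g1 6 (by simp [hS]), hg]
    · rintro l m₁ m₂ h h' ⟨g1, g2, g3, g4⟩
      refine ⟨g1.trans (h.mono (by simp [hS, Set.insert_subset_iff])), ?_, ?_, ?_⟩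
      · rw [h' 0 (by norm_num), g2]
      · rw [h 10 (by simp), g3]
      · rw [h 26 (by simp), g4]
    · rintro j l m₁ hl ⟨g1, g2, g3, g4⟩ -
      refine (Spec.block_cons (Det.cons (det_dot (a := fun k => B i k) (b := fun k => C k j)
        (by norm_num) ?_ ?_ ?_) (T' := 1) ?_)).time (by omega)
      · intro m₂ h; rw [eval_var, h 4 (by simp), g1 4 (by simp [hS]), hn]
      · intro k m₂ h hk
        simp only [Expr.eval, eval_var, hk]
        rw [h 25 (by simp), h 10 (by simp), g1 25 (by simp [hS]), g3, hB]
      · intro k m₂ h hk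
        simp only [Expr.eval, eval_var, hk]
        rw [h 32 (by simp), h 26 (by simp), g1 32 (by simp [hS]), g4, hl, hC]
      · rintro m₂ ⟨k1, k2⟩
        refine Spec.block_last (Spec.assign (Spec.nil ⟨⟨?_, ?_, ?_, ?_⟩, ?_, ?_, ?_, ?_⟩))
        · exact (g1.trans (k2.mono (by simp [hS, Set.insert_subset_iff]))).store (by simp [hS]) _ _ _
        · rw [store_ne (by norm_num), k2 2 (by simp), g2]
        · rw [store_ne (by norm_num), k2 10 (by simp), g3]
        · rw [store_same]; simp only [Expr.eval, eval_var]
          rw [k2 26 (by simp), k2 4 (by simp), g4, g1 4 (by simp [hS]), hn]; simp; ring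
        · rw [store_ne (by norm_num), k1]; rfl
        · rw [store_ne (by norm_num), k2 11 (by simp)]
        · rw [store_ne (by norm_num), k2 34 (by simp)]
        · rw [store_ne (by norm_num), k2 2 (by simp)]
    · rintro _ m'' ⟨k1, k2, k3, k4, k5, -⟩
      refine ⟨⟨k3, k4, ?_, ?_, ?_⟩, by rw [k5]⟩
      · rw [List.flatten_append, List.flatten_singleton]; exact k1
      · rw [k2, h5]; simp; ring
      · rw [List.flatten_append, List.flatten_singleton, List.length_append, h5]; simp; ring
  · rintro _ m' ⟨h1, h2, h3, h4, -⟩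
    exact ⟨h3, by simpa using h4, h2, h1⟩


/-- The program for key generation. -/
def keyGenCmd (K : ℕ) : Cmd :=
  block [params K, assign 17 (var 4), sampleRows,
    emit 11 (var 4) (.coin 16 (.const 0) (.const 0)) 16 24 0 31, elim,
    emit 11 (var 8) (.coin 16 (.const 0) (.const 0)) 16 32 0 33, mulRows,
    emit 11 (var 4) (assign 16 (.get 24 (.const 0) (var 11))) 16 2 0 30,
    emit 11 (var 4) (assign 16 (.get 24 (.const 0) (var 11))) 16 2 1 34,
    .set 3 (.const 0) (.const 0) (var 30), .set 3 (.const 1) (.const 0) (var 34)]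

/-- The strings that the key generation puts out. -/
def keyStrings {n g r : ℕ} (P : Fin r → Vec n) (z : Vec n) (G : Matrix (Fin n) (Fin g) F2) :
    List (List F2) :=
  [List.ofFn (packPair (Matrix.of P) z), List.ofFn (packPair G z)]

/-- The output distribution of the program for key generation. -/
noncomputable def keyGenApprox (K n : ℕ) : PMF (List (List F2)) :=
  (iid (rowApprox n (rowWt K n)) (rowNum n)).bind fun P =>
    (PMF.uniformOfFintype (Vec n)).bind fun z =>
      (PMF.uniformOfFinset (kernelMatrices (Matrix.of P) (rowWt K n * rowWt K n))
        (kernelMatrices_nonempty _ _)).map fun G => keyStrings P z G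

/-- The running time of the key generation. -/
def keyGenTime (n g r : ℕ) : ℕ :=
  20 * n + 50 + (r * (n * (12 * n + 34) + 10) + 3) + (n * 8 + 3) +
    (r * (8 * n * n + 30 * n + 33) + 4 * n + 12) + (g * n * 8 + 3) +
    (n * (g * (4 * n + 14) + 10) + 3) + (n * 8 + 3) + (n * 8 + 3) + 13

theorem load_eq_zero {inp : List (List F2)} {a : ℕ} (ha : 2 ≤ a) : load inp a = 0 := by
  funext i j
  simp only [load]
  rw [if_neg (by omega), if_neg (by omega)]; rfl

/-- The columns of the matrix in a string. -/
def colEquiv (n g : ℕ) : Vec (g * n) ≃ Matrix (Fin n) (Fin g) F2 where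
  toFun w := (unflat w).transpose
  invFun C := flat C.transpose
  left_inv w := by
    funext i
    exact congrArg w (finProdFinEquiv.apply_symm_apply i)
  right_inv C := by ext i j; simp [flat, unflat]

theorem spec_keyGenCmd {K : ℕ} (hK : K ≠ 0) (n : ℕ) :
    Spec noOracle [keyGenCmd K] (load [ones n])
      (keyGenTime n (rowWt K n * rowWt K n) (rowNum n)) (keyGenApprox K n)
      fun o m => Outputs m o := by
  set g := rowWt K n * rowWt K n with hg
  set r := rowNum n with hr
  set m0 := load [ones n] with hm0
  have z0 : ∀ a, 2 ≤ a → m0 a = 0 := fun a ha => load_eq_zero ha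
  rw [keyGenTime, keyGenApprox]
  refine (Spec.block_cons (Det.cons (det_params hK (n := n) (by simp [hm0, load, ones]))
    (T' := (r * (n * (12 * n + 34) + 10) + 3) + (n * 8 + 3) +
    (r * (8 * n * n + 30 * n + 33) + 4 * n + 12) + (g * n * 8 + 3) +
    (n * (g * (4 * n + 14) + 10) + 3) + (n * 8 + 3) + (n * 8 + 3) + 12) ?_)).time (by omega)
  rintro m1 ⟨p1, f1⟩
  refine (Spec.block_cons (Spec.assign (Spec.block_cons (Spec.cons (spec_sampleRows (n := n)
    (t := rowWt K n) (r := r) ?_ ?_ ?_ ?_ ?_) (T' := (n * 8 + 3) +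
    (r * (8 * n * n + 30 * n + 33) + 4 * n + 12) + (g * n * 8 + 3) +
    (n * (g * (4 * n + 14) + 10) + 3) + (n * 8 + 3) + (n * 8 + 3) + 9) ?_)))).time (by omega)
  · rw [store_ne (by norm_num), p1.eq_n]
  · rw [store_ne (by norm_num), p1.eq_t]
  · rw [store_ne (by norm_num), p1.eq_r]
  · rw [store_same, eval_var, p1.eq_n]
  · rw [store_ne (by norm_num), f1 30 (by simp), z0 30 (by norm_num)]; rfl
  rintro P m2 ⟨r2, l2, f2⟩
  have f2 : Frame {2, 4, 5, 6, 7, 8, 9, 10, 11, 12, 13, 14, 15, 16, 17, 18, 19, 30} m0 m2 :=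
    ((f1.mono (by simp [Set.insert_subset_iff])).store (by simp) _ _ _).trans
      (f2.mono (by simp [Set.insert_subset_iff]))
  have p2 : Params K n m2 := (p1.frame (S := {17}) ((Frame.refl {17} m1).store (a := 17) (by simp) 0 0 _)
    (by intro a h1 h2; simp; omega)).frame ‹Frame {2, 10, 11, 12, 13, 14, 15, 16, 18, 19, 30} _ m2›
    (by intro a h1 h2; simp; omega)
  refine (Spec.block_cons (Spec.cons (spec_emit_coin (l₀ := []) (n := n) (by norm_num) (by norm_num)
    (by norm_num) (by norm_num) (by norm_num) (Row.nil _ _ _) ?_ ?_) (T' := 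
    (r * (8 * n * n + 30 * n + 33) + 4 * n + 12) + (g * n * 8 + 3) +
    (n * (g * (4 * n + 14) + 10) + 3) + (n * 8 + 3) + (n * 8 + 3) + 8) ?_)).time (by omega)
  · rw [f2 31 (by simp), z0 31 (by norm_num)]; rfl
  · intro m' h; rw [eval_var, h.1 4 (by simp), p2.eq_n]
  rintro z m3 ⟨r3, -, f3⟩
  rw [List.nil_append] at r3
  have f3 := f3.1
  have p3 := p2.frame f3 (by intro a h1 h2; simp; omega)
  have r2' : Row m3 2 0 ((List.ofFn fun k => List.ofFn (P k)).flatten ++ []) := by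
    rw [List.append_nil]; exact r2.frame f3 (by simp)
  refine (Spec.block_cons (Det.cons (det_elim p3.eq_n p3.eq_r ?_ (row_flatten_get r2'))
    (T' := (g * n * 8 + 3) +
    (n * (g * (4 * n + 14) + 10) + 3) + (n * 8 + 3) + (n * 8 + 3) + 7) ?_)).time
    (by simp only [← hr]; omega)
  · rw [f3 25 (by simp), f2 25 (by simp), z0 25 (by norm_num)]
  rintro m4 ⟨⟨B, hB, hs⟩, f4⟩
  have p4 := p3.frame f4 (by intro a h1 h2; simp; omega)
  -- The generator matrix is now represented as `B * C`, where the columns of `C` are read one after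
  -- another from a string of fresh coins.
  rw [← hs.uniform_mul g, ← uniformOfFintype_map_equiv (colEquiv n g), PMF.map_comp, PMF.map_comp,
    ← PMF.bind_pure_comp]
  refine (Spec.block_cons (Spec.cons (spec_emit_coin (l₀ := []) (n := g * n) (by norm_num)
    (by norm_num) (by norm_num) (by norm_num) (by norm_num) (Row.nil _ _ _) ?_ ?_) (T' := 
    (n * (g * (4 * n + 14) + 10) + 3) + (n * 8 + 3) + (n * 8 + 3) + 6) ?_)).time (by omega)
  · rw [f4 33 (by simp), f3 33 (by simp), f2 33 (by simp), z0 33 (by norm_num)]; rfl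
  · intro m' h; rw [eval_var, h.1 8 (by simp), p4.eq_ng, ← hg, Nat.mul_comm]
  rintro w m5 ⟨r5, -, f5⟩
  rw [List.nil_append] at r5
  have f5 := f5.1
  have p5 := p4.frame f5 (by intro a h1 h2; simp; omega)
  set C := colEquiv n g w with hC
  have hC' : ∀ (j : Fin g) (k : Fin n), m5 32 0 (j * n + k) = (C k j).val := by
    intro j k
    have := r5.get (finProdFinEquiv (j, k))
    simp only [finProdFinEquiv_apply_val] at this
    rw [Nat.add_comm, Nat.mul_comm, this]; rfl
  refine (Spec.block_cons (Det.cons (det_mulRows p5.eq_n p5.eq_g (B := B)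
    (fun i j => by rw [f5 25 (by simp), hB]) hC' ?_) (T' := 
    (n * 8 + 3) + (n * 8 + 3) + 5) ?_)).time (by simp only [← hg]; omega)
  · rw [f5 34 (by simp), f4 34 (by simp), f3 34 (by simp), f2 34 (by simp), z0 34 (by norm_num)]; rfl
  rintro m6 ⟨r6, l6, e6, f6⟩
  have p6 := p5.frame f6 (by intro a h1 h2; simp; omega)
  have hlen : ∀ {k l : ℕ} (M : Fin k → Vec l),
      (List.ofFn fun i => List.ofFn (M i)).flatten.length = k * l := fun M => by
    have := length_flatten_ofFn (List.ofFn M)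
    rwa [List.map_ofFn, List.length_ofFn] at this
  have hlenP := hlen P
  have hlenG := hlen fun i => (B * C) i
  have rP6 : Row m6 2 0 (List.ofFn fun k => List.ofFn (P k)).flatten := by
    rw [List.append_nil] at r2'
    refine ((r2'.frame f4 (by simp)).frame f5 (by simp)).congr ?_
    rw [e6]
  have z6 : ∀ k : Fin n, m6 24 0 k = (z k).val := fun k => by
    rw [f6 24 (by simp), f5 24 (by simp), f4 24 (by simp), r3.get]
  refine (Spec.block_cons (Det.cons (det_emit_expr (w := z) (by norm_num) (by norm_num) (by norm_num)
    (by norm_num) (by norm_num) rP6 ?_ ?_ ?_) (T' := (n * 8 + 3) + 4) ?_)).time (by omega)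
  · rw [f6 30 (by simp), f5 30 (by simp), f4 30 (by simp), f3 30 (by simp), l2, hlenP]
  · intro m' h; rw [eval_var, h.1 4 (by simp), p6.eq_n]
  · intro k m' h hk; simp only [Expr.eval, eval_var, hk]; rw [h.1 24 (by simp), z6]
  rintro m7 ⟨r7, l7, f7, e7⟩
  refine (Spec.block_cons (Det.cons (det_emit_expr (w := z) (by norm_num) (by norm_num) (by norm_num)
    (by norm_num) (by norm_num) (r6.congr (e7 1 (by norm_num))) ?_ ?_ ?_) (T' := 3) ?_)).time
    (by omega)
  · rw [f7 34 (by simp), l6, hlenG]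
  · intro m' h; rw [eval_var, h.1 4 (by simp), f7 4 (by simp), p6.eq_n]
  · intro k m' h hk; simp only [Expr.eval, eval_var, hk]; rw [h.1 24 (by simp), f7 24 (by simp), z6]
  rintro m8 ⟨r8, l8, f8, e8⟩
  refine Spec.block_cons (Spec.set (Spec.block_last (Spec.set (Spec.nil ?_))))
  have hl1 : m8 30 0 0 = (List.ofFn (packPair (Matrix.of P) z)).length := by
    rw [f8 30 (by simp), l7, hlenP]; simp
  have hl2 : m8 34 0 0 = (List.ofFn (packPair (B * C) z)).length := by
    rw [l8, hlenG]; simp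
  have h20 : m8 2 0 = m7 2 0 := e8 0 (by norm_num)
  intro k hk
  simp only [keyStrings, List.length_cons, List.length_nil, Function.comp_apply] at hk ⊢
  interval_cases k
  · refine ⟨Row.congr (m := m8) ?_ ?_, ?_⟩
    · rw [List.getD_cons_zero, ofFn_packPair]
      exact r7.congr h20
    · rw [store_ne (by norm_num), store_ne (by norm_num)]
    · simp [store, Expr.eval, hl1]; exact Or.inl rfl
  · refine ⟨Row.congr (m := m8) ?_ ?_, ?_⟩
    · rw [List.getD_cons_succ, List.getD_cons_zero, ofFn_packPair]
      exact r8
    · rw [store_ne (by norm_num), store_ne (by norm_num)]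
    · simp [store, Expr.eval, hl2]; exact Or.inl rfl


/-! ### Polynomial bounds -/

/-- The function `f` is bounded by a polynomial in `s`. -/
def PolyBounded {I : Type} (s f : I → ℕ) : Prop := ∃ q : Polynomial ℕ, ∀ i, f i ≤ q.eval (s i)

namespace PolyBounded
variable {I : Type} {s f f' : I → ℕ}

theorem self (s : I → ℕ) : PolyBounded s s := ⟨.X, fun i => by simp⟩

theorem const (s : I → ℕ) (c : ℕ) : PolyBounded s fun _ => c := ⟨.C c, fun i => by simp⟩

theorem mono (h : PolyBounded s f) (h' : ∀ i, f' i ≤ f i) : PolyBounded s f' :=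
  h.imp fun _ hq i => (h' i).trans (hq i)

theorem add (h : PolyBounded s f) (h' : PolyBounded s f') : PolyBounded s fun i => f i + f' i := by
  obtain ⟨q, hq⟩ := h
  obtain ⟨q', hq'⟩ := h'
  exact ⟨q + q', fun i => by rw [Polynomial.eval_add]; exact add_le_add (hq i) (hq' i)⟩

theorem mul (h : PolyBounded s f) (h' : PolyBounded s f') : PolyBounded s fun i => f i * f' i := by
  obtain ⟨q, hq⟩ := h
  obtain ⟨q', hq'⟩ := h'
  exact ⟨q * q', fun i => by rw [Polynomial.eval_mul]; exact Nat.mul_le_mul (hq i) (hq' i)⟩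

theorem eval_mono (p : Polynomial ℕ) {a b : ℕ} (h : a ≤ b) : p.eval a ≤ p.eval b := by
  rw [Polynomial.eval_eq_sum_range, Polynomial.eval_eq_sum_range]
  exact Finset.sum_le_sum fun i _ => Nat.mul_le_mul_left _ (Nat.pow_le_pow_left h i)

theorem eval (p : Polynomial ℕ) (h : PolyBounded s f) : PolyBounded s fun i => p.eval (f i) := by
  obtain ⟨q, hq⟩ := h
  exact ⟨p.comp q, fun i => by rw [Polynomial.eval_comp]; exact eval_mono p (hq i)⟩

theorem of_le_self (h : ∀ i, f i ≤ s i) : PolyBounded s f := (self s).mono h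

end PolyBounded

theorem polyTimeAlgorithm_of_polyBounded {I : Type} {sec : I → ℕ} {inp : I → List (List F2)}
    {K : ℕ} {out : I → PMF (List (List F2))} (c : Cmd) {T L : I → ℕ}
    (hT : PolyBounded (fun i => inputLength (inp i)) T)
    (hL : PolyBounded (fun i => inputLength (inp i)) L) {μ : ℕ → ℝ} (hμ : Negligible μ)
    (X : I → PMF (List (List F2))) (hlen : ∀ i, ∀ o ∈ (X i).support,
      o.length = K ∧ ∀ l ∈ o, l.length ≤ L i)
    (h : ∀ i, Spec noOracle [c] (load (inp i)) (T i) (X i) fun o m => Outputs m o)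
    (hd : ∀ i, StatClose (X i) (out i) (μ (sec i))) : PolyTimeAlgorithm sec inp K out := by
  obtain ⟨q, hq⟩ := hT.add hL
  refine polyTimeAlgorithm_of_spec c q hμ X (fun _ o => o) (fun i => ?_) fun i => ?_
  · refine ((h i).time ((Nat.le_add_right _ _).trans (hq i))).imp_support fun o ho m hm => ?_
    obtain ⟨h1, h2⟩ := hlen i o ho
    exact hm.readStrings h1 fun l hl => (h2 l hl).trans ((Nat.le_add_left _ _).trans (hq i))
  · rw [show (fun o : List (List F2) => o) = id from rfl, PMF.map_id]; exact hd i

theorem inputLength_ones (n : ℕ) : inputLength [ones n] = n := by simp [inputLength, ones]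

theorem rowNum_le (n : ℕ) : rowNum n ≤ n := by rw [rowNum_eq]; omega

theorem negligible_pow_mul_half_pow (c : ℕ) (C : ℝ) :
    Negligible fun n => C * ((n : ℝ) ^ c * (1 / 2) ^ n) := by
  refine Negligible.const_mul (Negligible.pow_mul ?_ c) C
  refine Negligible.of_eventually_le (negligible_negl (K := 2) (by norm_num)) ?_
  filter_upwards [eventually_exp_neg_le' (K := 2) le_rfl 1 (Real.log_pos one_lt_two)] with n hn
  rw [abs_of_pos (by positivity), negl]
  rw [one_mul] at hn
  refine le_trans (le_of_eq ?_) hn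
  rw [mul_comm, Real.exp_neg, Real.exp_nat_mul, Real.exp_log two_pos, one_div, inv_pow]

/-- Only the rows of the parity check matrix are approximated; the pad and the kernel matrix are
exact. There are at most `n` rows of `n` bits, each with an error of order `2^(-n)`. -/
theorem dist_keyGenApprox (K : ℕ) (η : ℝ) (hη : η ∈ Set.Ico (0 : ℝ) (1 / 2)) (n : ℕ) :
    Dist (keyGenApprox K n)
      (((code K η hη).keyGen n).map fun k => [List.ofFn k.1, List.ofFn k.2])
      (ENNReal.ofReal (2 * ((n : ℝ) ^ 2 * (1 / 2) ^ n))) := by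
  have h1 := ((dist_rowApprox (rowWt_le K n)).iid (rowNum n)).bind_left fun P =>
    (PMF.uniformOfFintype (Vec n)).bind fun z =>
      (PMF.uniformOfFinset (kernelMatrices (Matrix.of P) (rowWt K n * rowWt K n))
        (kernelMatrices_nonempty _ _)).map fun G => keyStrings P z G
  have e : ((iid (rowDist (rowWt_le K n)) (rowNum n)).bind fun P =>
      (PMF.uniformOfFintype (Vec n)).bind fun z =>
      (PMF.uniformOfFinset (kernelMatrices (Matrix.of P) (rowWt K n * rowWt K n))
        (kernelMatrices_nonempty _ _)).map fun G => keyStrings P z G)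
      = ((code K η hη).keyGen n).map fun k => [List.ofFn k.1, List.ofFn k.2] := by
    simp only [code, ldpcPRC, ldpc_eq, ← PMF.bind_pure_comp, PMF.bind_bind, Function.comp_apply,
      PMF.pure_bind]
    congr 1; funext P
    rw [PMF.bind_comm]; rfl
  rw [e] at h1
  refine h1.mono ?_
  have hr : (rowNum n : ℝ≥0∞) ≤ n := by exact_mod_cast rowNum_le n
  calc (rowNum n : ℝ≥0∞) * (n * ENNReal.ofReal (2 * (1 / 2 ^ n)))
      ≤ n * (n * ENNReal.ofReal (2 * (1 / 2 ^ n))) := by gcongr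
    _ = ENNReal.ofReal (2 * ((n : ℝ) ^ 2 * (1 / 2) ^ n)) := by
        rw [← ENNReal.ofReal_natCast, ← ENNReal.ofReal_mul (by positivity),
          ← ENNReal.ofReal_mul (by positivity)]
        congr 1
        rw [one_div_pow]; ring

theorem polyTime_keyGen {K : ℕ} (hK : K ≠ 0) (η : ℝ) (hη : η ∈ Set.Ico (0 : ℝ) (1 / 2)) :
    PolyTimeAlgorithm (I := ℕ) (fun n => n) (fun n => [ones n]) 2
      (fun n => ((code K η hη).keyGen n).map fun k => [List.ofFn k.1, List.ofFn k.2]) := by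
  have hn : PolyBounded (fun n => inputLength [ones n]) fun n => n :=
    PolyBounded.of_le_self fun n => (inputLength_ones n).ge
  have hr : PolyBounded (fun n => inputLength [ones n]) rowNum := hn.mono rowNum_le
  have hg : PolyBounded (fun n => inputLength [ones n]) fun n => rowWt K n * rowWt K n :=
    (hn.mul hn).mono fun n => Nat.mul_le_mul (rowWt_le K n) (rowWt_le K n)
  refine polyTimeAlgorithm_of_polyBounded (keyGenCmd K)
    (T := fun n => keyGenTime n (rowWt K n * rowWt K n) (rowNum n))
    (L := fun n => rowNum n * n + n * (rowWt K n * rowWt K n) + n) ?_ ?_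
    (negligible_pow_mul_half_pow 2 2) (keyGenApprox K) ?_ (spec_keyGenCmd hK) fun n =>
      (dist_keyGenApprox K η hη n).statClose (by positivity)
  · unfold keyGenTime
    repeat' first | exact PolyBounded.const _ _ | exact hn | exact hr | exact hg | apply PolyBounded.mul | apply PolyBounded.add
  · repeat' first | exact PolyBounded.const _ _ | exact hn | exact hr | exact hg | apply PolyBounded.mul | apply PolyBounded.add
  · intro n o ho
    simp only [keyGenApprox, PMF.mem_support_bind_iff, PMF.mem_support_map_iff] at ho
    obtain ⟨P, -, z, -, G, -, rfl⟩ := ho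
    refine ⟨rfl, ?_⟩
    simp only [keyStrings, List.mem_cons, List.not_mem_nil, or_false, forall_eq_or_imp, forall_eq,
      List.length_ofFn]
    omega


/-! ### Decoding -/

/-- The program for decoding. -/
def decodeCmd (K : ℕ) : Cmd :=
  block [params K, mul 9 27 (var 7) (var 4),
    emit 11 (var 4) (assign 16 (.xor (.get 0 (.const 2) (var 11))
      (.get 0 (.const 1) (.add (var 27) (var 11))))) 16 24 0 31,
    forLoop 10 (var 7) (block [dot 12 20 (var 4) (.get 0 (.const 1) (.add (var 26) (var 12)))
      (.get 24 (.const 0) (var 12)), assign 21 (.add (var 21) (var 20)),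
      assign 26 (.add (var 26) (var 4))]),
    assign 22 (.sub (.sub (var 7) (var 21)) (var 21)),
    mul 9 23 (var 22) (var 22), mul 9 28 (var 23) (var 23), mul 9 29 (var 4) (var 28),
    mul 9 30 (var 7) (var 7), mul 9 32 (var 30) (var 30),
    .ite (.add (.sub (.get 1 (.const 2) (.const 0)) (var 4)) (.sub (var 4) (.get 1 (.const 2) (.const 0))))
      .skip (.ite (.sub (.smul 99 (var 29)) (.smul 1600 (var 32)))
        (block [.set 2 (.const 0) (.const 0) (.const 1), .set 3 (.const 0) (.const 0) (.const 1)]) .skip)]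

theorem slack_pow_four (n : ℕ) : slack n ^ 4 = ((0.99 : ℝ) * n)⁻¹ := by
  have h : (0 : ℝ) ≤ (0.99 : ℝ) * n := by positivity
  rw [slack, ← Real.rpow_natCast, ← Real.rpow_mul h]
  norm_num [Real.rpow_neg_one]

/-- The threshold is irrational in general, but its fourth power is rational: the condition is `16
r⁴ / (0.99 n) < (r - 2w)⁴` for `2w < r`. If `2w ≥ r`, both sides are false; on the right the
truncated subtraction gives `0`. The decoder therefore decides exactly, with integers of polynomial
size. -/
theorem lt_threshold_iff {n w : ℕ} :
    (w : ℝ) < (1 / 2 - slack n) * rowNum n ↔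
      1600 * (rowNum n ^ 2) ^ 2 < 99 * (n * ((rowNum n - w - w) ^ 2) ^ 2) := by
  have hs : 0 ≤ slack n := by rw [slack]; positivity
  have hr := rowNum_eq n
  rcases Nat.eq_zero_or_pos (rowNum n) with h0 | h0
  · simp [h0]
  have hn : (0 : ℝ) < n := by
    have : 0 < n := by omega
    exact_mod_cast this
  have hr0 : (0 : ℝ) < rowNum n := by exact_mod_cast h0
  rcases le_or_gt (rowNum n) (2 * w) with h | h
  · have h' : (rowNum n : ℝ) ≤ 2 * w := by exact_mod_cast h
    rw [show rowNum n - w - w = 0 by omega]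
    constructor
    · intro h2; nlinarith
    · intro h2; simp at h2
  · have hd : ((rowNum n - w - w : ℕ) : ℝ) = rowNum n - 2 * w := by
      rw [Nat.sub_sub, Nat.cast_sub (by omega)]; push_cast; ring
    have hpos : (0 : ℝ) < rowNum n - 2 * w := by
      have : (2 * w : ℝ) < rowNum n := by exact_mod_cast h
      linarith
    have e1 : (w : ℝ) < (1 / 2 - slack n) * rowNum n ↔ 2 * slack n * rowNum n < rowNum n - 2 * w := by
      constructor <;> intro h <;> linarith
    have e2 : 2 * slack n * rowNum n < rowNum n - 2 * w ↔
        (2 * slack n * rowNum n) ^ 4 < ((rowNum n : ℝ) - 2 * w) ^ 4 :=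
      (pow_lt_pow_iff_left₀ (by positivity) hpos.le (by norm_num)).symm
    rw [e1, e2, mul_pow, mul_pow, slack_pow_four]
    have e3 : (2 : ℝ) ^ 4 * ((0.99 : ℝ) * n)⁻¹ * (rowNum n : ℝ) ^ 4 = 16 * rowNum n ^ 4 / (0.99 * n) := by
      ring
    rw [e3, div_lt_iff₀ (by positivity), ← Nat.cast_lt (α := ℝ)]
    push_cast
    rw [hd]
    constructor <;> intro h <;> nlinarith

/-- The running time of the decoding. -/
def decodeTime (n r : ℕ) : ℕ :=
  20 * n + 50 + (r * 4 + 5) + (n * 8 + 3) + (r * (4 * n + 13) + 3) + (r * 4 + 5) +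
    (r * r * 4 + 5) + (n * 4 + 5) + (r * 4 + 5) + (r * r * 4 + 5) + 20

open Classical in
theorem spec_decodeCmd {K : ℕ} (hK : K ≠ 0) (n : ℕ) (sk : Vec (rowNum n * n + n)) (x : List F2) :
    Spec noOracle [decodeCmd K] (load [ones n, List.ofFn sk, x]) (decodeTime n (rowNum n))
      (PMF.pure [if x.length = n ∧ (hammingNorm ((pairMatrix sk).mulVec (fun i : Fin n => x.getD i 0) +
        (pairMatrix sk).mulVec (pairVec sk)) : ℝ) < (1 / 2 - slack n) * rowNum n then [1] else []])
      fun o m => Outputs m o := by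
  obtain ⟨r, hr⟩ : ∃ r, r = rowNum n := ⟨_, rfl⟩
  set P : Matrix (Fin (rowNum n)) (Fin n) F2 := pairMatrix sk with hPdef
  set z : Vec n := pairVec sk with hz
  set x' : Vec n := fun i => x.getD i 0 with hx'
  rw [← Matrix.mulVec_add]
  set w := hammingNorm (P.mulVec (x' + z)) with hw
  have hwr : w ≤ rowNum n := by
    simpa using hammingNorm_le_card_fintype (x := P.mulVec (x' + z))
  set m0 := load [ones n, List.ofFn sk, x] with hm0
  have z0 : ∀ a, 2 ≤ a → m0 a = 0 := fun a ha => load_eq_zero ha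
  have hsk : Row m0 0 1 (List.ofFn sk) := row_load _ 1
  have hP0 : ∀ (i : Fin (rowNum n)) (j : Fin n), m0 0 1 (i * n + j) = (P i j).val := fun i j => by
    have := hsk.get (Fin.castAdd n (finProdFinEquiv (i, j)))
    simp only [Fin.val_castAdd, finProdFinEquiv_apply_val] at this
    rw [Nat.add_comm, Nat.mul_comm, this]; rfl
  have hz0 : ∀ j : Fin n, m0 0 1 (rowNum n * n + j) = (z j).val := fun j => by
    have := hsk.get (Fin.natAdd (rowNum n * n) j)
    simp only [Fin.val_natAdd] at this
    rw [this]; rfl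
  have hx0 : ∀ j : Fin n, m0 0 2 j = (x' j).val := fun j => by simp [hm0, load, hx']
  have hl0 : m0 1 2 0 = x.length := by simp [hm0, load]
  set S : Set ℕ := {4, 5, 6, 7, 8, 9, 10, 11, 12, 13, 16, 20, 21, 22, 23, 24, 26, 27, 28, 29, 30, 31, 32}
    with hS
  rw [decodeTime]
  refine (Spec.block_cons (Det.cons (det_params hK (n := n) (by simp [hm0, load, ones]))
    (T' := (rowNum n * 4 + 5) + (n * 8 + 3) + (rowNum n * (4 * n + 13) + 3) + (rowNum n * 4 + 5) +
    (rowNum n * rowNum n * 4 + 5) + (n * 4 + 5) + (rowNum n * 4 + 5) + (rowNum n * rowNum n * 4 + 5)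
    + 19) ?_)).time (by omega)
  rintro m1 ⟨p1, f1⟩
  have F1 : Frame S m0 m1 := f1.mono (by simp [hS, Set.insert_subset_iff])
  refine (Spec.block_cons (Det.cons (det_mul (a := rowNum n) (b := n) (by norm_num)
    (fun m' h => by rw [eval_var, h 7 (by simp), p1.eq_r])
    (fun m' h => by rw [eval_var, h 4 (by simp), p1.eq_n]))
    (T' := (n * 8 + 3) + (rowNum n * (4 * n + 13) + 3) + (rowNum n * 4 + 5) +
    (rowNum n * rowNum n * 4 + 5) + (n * 4 + 5) + (rowNum n * 4 + 5) + (rowNum n * rowNum n * 4 + 5)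
    + 18) ?_)).time (by omega)
  rintro m2 ⟨e2, f2⟩
  have F2 : Frame S m0 m2 := F1.trans (f2.mono (by simp [hS, Set.insert_subset_iff]))
  have p2 := p1.frame f2 (by intro a h1 h2; simp; omega)
  refine (Spec.block_cons (Det.cons (det_emit_expr (w := x' + z) (by norm_num) (by norm_num)
    (by norm_num) (by norm_num) (by norm_num) (Row.nil _ _ _) ?_ ?_ ?_)
    (T' := (rowNum n * (4 * n + 13) + 3) + (rowNum n * 4 + 5) +
    (rowNum n * rowNum n * 4 + 5) + (n * 4 + 5) + (rowNum n * 4 + 5) + (rowNum n * rowNum n * 4 + 5)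
    + 17) ?_)).time (by omega)
  · rw [f2 31 (by simp), f1 31 (by simp), z0 31 (by norm_num)]; rfl
  · intro m' h; rw [eval_var, h.1 4 (by simp), p2.eq_n]
  · intro k m' h hk
    refine Expr.eval_xor ?_ ?_
    · simp only [Expr.eval, eval_var, hk]
      rw [h.1 0 (by simp), F2 0 (by simp [hS]), hx0]
    · simp only [Expr.eval, eval_var, hk]
      rw [h.1 0 (by simp), h.1 27 (by simp), e2, F2 0 (by simp [hS]), hz0]
  rintro m3 ⟨r3, -, f3, -⟩
  have p3 := p2.frame f3 (by intro a h1 h2; simp; omega)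
  rw [List.nil_append] at r3
  have F3 : Frame S m0 m3 := F2.trans (f3.mono (by simp [hS, Set.insert_subset_iff]))
  set y : ℕ → PRC.F2 := fun k => if h : k < rowNum n then P.mulVec (x' + z) ⟨k, h⟩ else 0 with hy
  have hwsum : w = ∑ k ∈ Finset.range (rowNum n), (y k).val := by
    rw [hw, hammingNorm_eq_sum_val, Finset.sum_range]
    exact Finset.sum_congr rfl fun k _ => by simp [hy]
  refine (Spec.block_cons (Det.cons (Det.forLoop (n := rowNum n) (τ := 4 * n + 10)
    (Inv := fun k m' => Frame {10, 12, 20, 21, 26} m3 m' ∧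
      m' 21 0 0 = ∑ k ∈ Finset.range k, (y k).val ∧ m' 26 0 0 = k * n) ?_ ?_ ?_ ?_)
    (T' := (rowNum n * 4 + 5) +
    (rowNum n * rowNum n * 4 + 5) + (n * 4 + 5) + (rowNum n * 4 + 5) + (rowNum n * rowNum n * 4 + 5)
    + 16) ?_)).time (by ring_nf; omega)
  · refine ⟨Frame.refl _ _, ?_, ?_⟩
    · rw [f3 21 (by simp), f2 21 (by simp), f1 21 (by simp), z0 21 (by norm_num)]; rfl
    · rw [f3 26 (by simp), f2 26 (by simp), f1 26 (by simp), z0 26 (by norm_num)]; simp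
  · intro _ m' h; rw [eval_var, h.1 7 (by simp), p3.eq_r]
  · rintro _ m' v ⟨h1, h2⟩
    exact ⟨h1.store (by simp) _ _ _, by simpa [store] using h2⟩
  · rintro k hk m' ⟨h1, h2, h3⟩ hx
    refine (Spec.block_cons (Det.cons (det_dot (a := fun j => P ⟨k, hk⟩ j) (b := x' + z)
      (by norm_num) ?_ ?_ ?_) (T' := 3) ?_)).time (by omega)
    · intro m'' h; rw [eval_var, h 4 (by simp), h1 4 (by simp), p3.eq_n]
    · intro j m'' h hj
      simp only [Expr.eval, eval_var, hj]
      rw [h 26 (by simp), h3, h 0 (by simp), h1 0 (by simp), F3 0 (by simp [hS]), ← hP0]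
    · intro j m'' h hj
      simp only [Expr.eval, eval_var, hj]
      rw [h 24 (by simp), h1 24 (by simp), r3.get]
    · rintro m'' ⟨g1, g2⟩
      refine Spec.block_cons (Spec.assign (Spec.block_last (Spec.assign (Spec.nil ⟨⟨?_, ?_, ?_⟩, ?_⟩))))
      · exact ((h1.trans (g2.mono (by simp [Set.insert_subset_iff]))).store (by simp) _ _ _).store
          (by simp) _ _ _
      · rw [store_ne (by norm_num), store_same, Finset.sum_range_succ]
        simp only [Expr.eval, eval_var]
        rw [g1, g2 21 (by simp), h2]
        simp only [hy, dif_pos hk]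
        rfl
      · rw [store_same]
        simp only [Expr.eval, eval_var]
        rw [store_ne (by norm_num), store_ne (by norm_num), g2 26 (by simp), h3, g2 4 (by simp),
          h1 4 (by simp), p3.eq_n]
        ring
      · rw [store_ne (by norm_num), store_ne (by norm_num), g2 10 (by simp), hx]
  rintro m4 ⟨f4, w4, -⟩
  rw [← hwsum] at w4
  have F4 : Frame S m0 m4 := F3.trans (f4.mono (by simp [hS, Set.insert_subset_iff]))
  have p4 := p3.frame f4 (by intro a h1 h2; simp; omega)
  set s := rowNum n - w - w with hs
  have hsr : s ≤ rowNum n := by omega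
  have hsr2 : s * s ≤ rowNum n * rowNum n := Nat.mul_le_mul hsr hsr
  refine (Spec.block_cons (Spec.assign (Spec.block_cons (Det.cons (det_mul (a := s) (b := s)
    (by norm_num) ?_ ?_) (T' :=
    (rowNum n * rowNum n * 4 + 5) + (n * 4 + 5) + (rowNum n * 4 + 5) + (rowNum n * rowNum n * 4 + 5)
    + 13) ?_)))).time (by omega)
  · intro m' h; rw [eval_var, h 22 (by simp), store_same]
    simp only [Expr.eval, eval_var, w4, p4.eq_r, hs]
  · intro m' h; rw [eval_var, h 22 (by simp), store_same]
    simp only [Expr.eval, eval_var, w4, p4.eq_r, hs]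
  rintro m5 ⟨e5, f5⟩
  have f5' : Frame {9, 22, 23} m4 m5 := ((Frame.refl _ _).store (by simp) _ _ _).trans
    (f5.mono (by simp [Set.insert_subset_iff]))
  have F5 : Frame S m0 m5 := F4.trans (f5'.mono (by simp [hS, Set.insert_subset_iff]))
  have p5 := p4.frame f5' (by intro a h1 h2; simp; omega)
  refine (Spec.block_cons (Det.cons (det_mul (a := s * s) (b := s * s)
    (by norm_num) (fun m' h => by rw [eval_var, h 23 (by simp), e5])
      (fun m' h => by rw [eval_var, h 23 (by simp), e5])) (T' :=
    (n * 4 + 5) + (rowNum n * 4 + 5) + (rowNum n * rowNum n * 4 + 5) + 12) ?_)).time (by omega)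
  rintro m6 ⟨e6, f6⟩
  have F6 : Frame S m0 m6 := F5.trans (f6.mono (by simp [hS, Set.insert_subset_iff]))
  have p6 := p5.frame f6 (by intro a h1 h2; simp; omega)
  refine (Spec.block_cons (Det.cons (det_mul (a := n) (b := s * s * (s * s))
    (by norm_num) (fun m' h => by rw [eval_var, h 4 (by simp), p6.eq_n])
      (fun m' h => by rw [eval_var, h 28 (by simp), e6])) (T' :=
    (rowNum n * 4 + 5) + (rowNum n * rowNum n * 4 + 5) + 11) ?_)).time (by omega)
  rintro m7 ⟨e7, f7⟩
  have F7 : Frame S m0 m7 := F6.trans (f7.mono (by simp [hS, Set.insert_subset_iff]))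
  have p7 := p6.frame f7 (by intro a h1 h2; simp; omega)
  refine (Spec.block_cons (Det.cons (det_mul (a := rowNum n) (b := rowNum n)
    (by norm_num) (fun m' h => by rw [eval_var, h 7 (by simp), p7.eq_r])
      (fun m' h => by rw [eval_var, h 7 (by simp), p7.eq_r])) (T' :=
    (rowNum n * rowNum n * 4 + 5) + 10) ?_)).time (by omega)
  rintro m8 ⟨e8, f8⟩
  have F8 : Frame S m0 m8 := F7.trans (f8.mono (by simp [hS, Set.insert_subset_iff]))
  have p8 := p7.frame f8 (by intro a h1 h2; simp; omega)
  refine (Spec.block_cons (Det.cons (det_mul (a := rowNum n * rowNum n) (b := rowNum n * rowNum n)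
    (by norm_num) (fun m' h => by rw [eval_var, h 30 (by simp), e8])
      (fun m' h => by rw [eval_var, h 30 (by simp), e8])) (T' := 9) ?_)).time (by omega)
  rintro m9 ⟨e9, f9⟩
  have F9 : Frame S m0 m9 := F8.trans (f9.mono (by simp [hS, Set.insert_subset_iff]))
  have p9 := p8.frame f9 (by intro a h1 h2; simp; omega)
  have e29 : m9 29 0 0 = n * (s * s * (s * s)) := by rw [f9 29 (by simp), f8 29 (by simp), e7]
  have e12 : m9 1 2 0 = x.length := by rw [F9 1 (by simp [hS]), hl0]
  have hiff : (w : ℝ) < (1 / 2 - slack n) * rowNum n ↔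
      1600 * (rowNum n * rowNum n * (rowNum n * rowNum n)) < 99 * (n * (s * s * (s * s))) := by
    rw [lt_threshold_iff]
    simp only [sq, hs]
  have hno : Outputs m9 [[]] := by
    intro k hk
    obtain rfl : k = 0 := by simpa using hk
    refine ⟨Row.nil _ _ _, ?_⟩
    rw [F9 3 (by simp [hS]), z0 3 (by norm_num)]; rfl
  by_cases hlen : x.length = n
  · refine (Spec.block_last (Spec.ite_false (T := 8) ?_ ?_)).time (by omega)
    · simp only [Expr.eval, eval_var, e12, p9.eq_n]; omega
    by_cases hacc : (w : ℝ) < (1 / 2 - slack n) * rowNum n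
    · rw [if_pos ⟨hlen, hacc⟩]
      refine (Spec.ite_true ?_ (Spec.block_cons (Spec.set (Spec.block_last (Spec.set
        (Spec.nil ?_)))))).time (by omega)
      · have := hiff.1 hacc
        simp only [Expr.eval, eval_var, Expr.eval_smul, e29, e9]; omega
      · intro k hk
        obtain rfl : k = 0 := by simpa using hk
        refine ⟨fun j hj => ?_, ?_⟩
        · obtain rfl : j = 0 := by simpa using hj
          simp [store, Expr.eval]; rfl
        · simp [store, Expr.eval]
    · rw [if_neg fun h => hacc h.2]
      refine (Spec.ite_false ?_ (Spec.skip (Spec.nil hno))).time (by omega)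
      have := hiff.not.1 hacc
      simp only [Expr.eval, eval_var, Expr.eval_smul, e29, e9]; omega
  · rw [if_neg fun h => hlen h.1]
    refine (Spec.block_last (Spec.ite_true ?_ (Spec.skip (Spec.nil hno)))).time (by omega)
    simp only [Expr.eval, eval_var, e12, p9.eq_n]; omega

theorem StatClose.rfl_zero {α : Type} {X Y : PMF α} (h : X = Y) : StatClose X Y 0 := fun S => by
  rw [h, sub_self, abs_zero]

theorem negligible_zero : Negligible fun _ => 0 := by
  simpa using negligible_pow_mul_half_pow 0 0

theorem polyTime_decode {K : ℕ} (hK : K ≠ 0) (η : ℝ) (hη : η ∈ Set.Ico (0 : ℝ) (1 / 2)) :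
    PolyTimeAlgorithm (I := (Σ n : ℕ, Vec ((code K η hη).skLen n)) × List F2) (fun i => i.1.1)
      (fun i => [ones i.1.1, List.ofFn i.1.2, i.2]) 1
      (fun i => ((code K η hη).decode i.1.1 i.1.2 i.2).map fun o =>
        [if o = some () then [1] else []]) := by
  classical
  set len : (Σ n : ℕ, Vec ((code K η hη).skLen n)) × List F2 → ℕ :=
    fun i => inputLength [ones i.1.1, List.ofFn i.1.2, i.2] with hlen
  have hn : PolyBounded len fun i => i.1.1 :=
    PolyBounded.of_le_self fun i => by simp only [hlen, inputLength, ones]; simp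
  have hr : PolyBounded len fun i => rowNum i.1.1 := hn.mono fun i => rowNum_le _
  refine polyTimeAlgorithm_of_polyBounded (decodeCmd K)
    (T := fun i => decodeTime i.1.1 (rowNum i.1.1)) (L := fun _ => 1) ?_ (PolyBounded.const _ 1)
    negligible_zero _ ?_ (fun i => spec_decodeCmd hK i.1.1 i.1.2 i.2) fun i => ?_
  · unfold decodeTime
    repeat' first | exact PolyBounded.const _ _ | exact hn | exact hr | apply PolyBounded.mul | apply PolyBounded.add
  · intro i o ho
    rw [PMF.support_pure, Set.mem_singleton_iff] at ho
    subst ho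
    refine ⟨rfl, ?_⟩
    simp only [List.mem_singleton, forall_eq]
    split_ifs <;> simp
  · refine StatClose.rfl_zero ?_
    simp only [code, ldpcPRC, PMF.pure_map]
    congr 2
    split_ifs <;> simp_all


/-! ### Approximation of an efficiently computable number -/

/-- Reduces variable `35` modulo `2`. -/
def parity : Cmd :=
  .loop (.sub (var 35) (.const 1)) (block [assign 36 (.const 2),
    .loop (.sub (.add (var 35) (.const 1)) (.add (var 36) (var 36)))
      (assign 36 (.add (var 36) (var 36))), assign 35 (.sub (var 35) (var 36))])

/-- Subtracting `2` repeatedly would take too long for exponentially large values. Instead the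
largest power of two below the value is found by doubling and subtracted; each round shortens the
value by at least one bit, and all these powers are even. -/
theorem det_parity {O : PMF (List F2)} {m : Mem} {B : ℕ} (h : m 35 0 0 < 2 ^ (B + 1)) :
    Det O [parity] m (B * (2 * B + 6) + 1) fun m' =>
      m' 35 0 0 = m 35 0 0 % 2 ∧ Frame {35, 36} m m' := by
  refine Spec.imp (Det.loop (τ := 2 * B + 5) (Inv := fun k m' => k ≤ B ∧ m' 35 0 0 < 2 ^ (k + 1) ∧
    m' 35 0 0 % 2 = m 35 0 0 % 2 ∧ Frame {35, 36} m m') ?_ B ⟨le_rfl, h, rfl, Frame.refl _ _⟩) ?_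
  · rintro k m' ⟨h1, h2, h3, h4⟩ he
    simp only [Expr.eval, eval_var] at he
    rcases k with _ | k
    · simp at h2; omega
    refine ⟨k, rfl, (Spec.block_cons (Spec.assign (Spec.block_cons (Det.cons
      (Det.loop (O := O) (τ := 1) (Inv := fun j m'' => m'' 35 0 0 = m' 35 0 0 ∧
        m'' 36 0 0 ≤ m' 35 0 0 ∧ m'' 36 0 0 % 2 = 0 ∧ m' 35 0 0 < m'' 36 0 0 * 2 ^ j ∧
        Frame {35, 36} m m'') ?_ (k + 1) ?_) (T' := 1) ?_)))).time (by omega)⟩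
    · rintro j m'' ⟨g1, g2, g3, g4, g5⟩ he'
      simp only [Expr.eval, eval_var, g1] at he'
      rcases j with _ | j
      · simp at g4; omega
      refine ⟨j, rfl, Spec.assign (Det.nil ⟨?_, ?_, ?_, ?_, g5.store (by simp) _ _ _⟩)⟩
      · rw [store_ne (by norm_num), g1]
      · rw [store_same]; simp only [Expr.eval, eval_var]; omega
      · rw [store_same]; simp only [Expr.eval, eval_var]; omega
      · rw [store_same]; simp only [Expr.eval, eval_var]
        rw [pow_succ] at g4; linarith
    · refine ⟨by rw [store_ne (by norm_num)], ?_, ?_, ?_, h4.store (by simp) _ _ _⟩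
      · rw [store_same]; simp only [Expr.eval]; omega
      · rw [store_same]; simp only [Expr.eval]
      · rw [store_same]; simp only [Expr.eval]; rw [pow_succ] at h2; linarith
    · rintro m'' ⟨he', j, g1, g2, g3, g4, g5⟩
      simp only [Expr.eval, eval_var, g1] at he'
      refine Spec.block_last (Spec.assign (Det.nil ⟨by omega, ?_, ?_, g5.store (by simp) _ _ _⟩))
      · rw [store_same]; simp only [Expr.eval, eval_var, g1]
        rw [pow_succ] at h2; omega
      · rw [store_same]; simp only [Expr.eval, eval_var, g1]; omega
  · rintro _ m' ⟨he, k, -, -, h3, h4⟩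
    simp only [Expr.eval, eval_var] at he
    exact ⟨by omega, h4⟩

/-- The number with the first `k` of the binary digits `d`. -/
def binVal (d : ℕ → ℕ) : ℕ → ℕ
  | 0 => 0
  | k + 1 => 2 * binVal d k + d k

/-- The numerator of the truncation, after at most `n` digits, of the number that is represented by
the first output string in the memory, and the number of digits. -/
def etaVal (T n : ℕ) (m : Mem) : ℕ × ℕ :=
  (binVal (fun j => m 2 0 j % 2) (min (m 3 0 0) (min n T)), min (m 3 0 0) (min n T))

/-- Reads the number from the arrays `44` and `46`; the numerator goes to variable `18`, and the
denominator to variable `19`. -/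
def readNum (cap : Expr) : Cmd :=
  block [assign 38 ((var 46).min ((var 4).min cap)), assign 18 (.const 0), assign 19 (.const 1),
    forLoop 37 (var 38) (block [assign 35 (.get 44 (.const 0) (var 37)), parity,
      assign 18 (.add (.add (var 18) (var 18)) (var 35)), assign 19 (.add (var 19) (var 19))])]

theorem det_readNum {O : PMF (List F2)} {m : Mem} {n B T : ℕ} {cap : Expr} (hn : m 4 0 0 = n)
    (hcap : min n (cap.eval m) = min n T) (hB : ∀ j, m 44 0 j < 2 ^ (B + 1)) {mc : Mem}
    (h44 : m 44 = mc 2) (h46 : m 46 = mc 3) :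
    Det O [readNum cap] m (n * (B * (2 * B + 6) + 10) + 10) fun m' =>
      m' 18 0 0 = (etaVal T n mc).1 ∧ m' 19 0 0 = 2 ^ (etaVal T n mc).2 ∧
        Frame {18, 19, 35, 36, 37, 38} m m' := by
  set S : Set ℕ := {18, 19, 35, 36, 37, 38} with hS
  set l := min (mc 3 0 0) (min n T) with hl
  have hln : l ≤ n := by omega
  refine (Spec.block_cons (Spec.assign (Spec.block_cons (Spec.assign (Spec.block_cons (Spec.assign
    -- Digits are appended as in Horner's scheme, and the denominator is doubled with each of them.
    (Spec.block_last (Spec.imp (Det.forLoop (n := l) (τ := B * (2 * B + 6) + 7)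
      (Inv := fun k m' => Frame S m m' ∧ m' 38 0 0 = l ∧
      m' 18 0 0 = binVal (fun j => mc 2 0 j % 2) k ∧ m' 19 0 0 = 2 ^ k) ?_ ?_ ?_ ?_)
      ?_)))))))).time (T := l * (B * (2 * B + 6) + 10) + 9)
    (Nat.add_le_add (Nat.mul_le_mul_right _ hln) (by norm_num))
  · refine ⟨(((Frame.refl _ _).store (by simp [hS]) _ _ _).store (by simp [hS]) _ _ _).store
        (by simp [hS]) _ _ _, ?_, ?_, ?_⟩
    · simp only [store_ne (show 38 ≠ 19 by norm_num), store_ne (show 38 ≠ 18 by norm_num), store_same,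
        Expr.eval_min, eval_var, hn, hcap, h46, hl]
    · simp [store, Expr.eval, binVal]
    · simp [store, Expr.eval]
  · exact fun k m' h => h.2.1
  · exact fun k m' v h => ⟨h.1.store (by simp [hS]) _ _ _, by simpa [store] using h.2⟩
  · rintro k hk m' ⟨h1, h2, h3, h4⟩ hx
    have e44 : m' 44 0 k = mc 2 0 k := by rw [h1 44 (by simp [hS]), h44]
    refine (Spec.block_cons (Spec.assign (Spec.block_cons (Det.cons (det_parity (B := B) ?_)
      (T' := 3) ?_)))).time (by omega)
    · rw [store_same]; simp only [Expr.eval, eval_var, hx, e44]; rw [← h44]; exact hB k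
    · rintro m'' ⟨g1, g2⟩
      rw [store_same] at g1
      simp only [Expr.eval, eval_var, hx, e44] at g1
      have g3 := fun a (ha : a ≠ 35) (ha' : a ≠ 36) =>
        (g2 a (by simp [ha, ha'])).trans (store_ne (i := 0) (j := 0) ha)
      refine Spec.block_cons (Spec.assign (Spec.block_last (Spec.assign (Spec.nil ⟨⟨?_, ?_, ?_, ?_⟩,
        ?_⟩))))
      · exact (((h1.store (by simp [hS]) _ _ _).trans (g2.mono (by simp [hS, Set.insert_subset_iff]))).store
          (by simp [hS]) _ _ _).store (by simp [hS]) _ _ _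
      · simp [store, g3, h2]
      · simp [store, g3, Expr.eval, h3, g1, binVal]; ring
      · simp [store, g3, Expr.eval, h4]; ring
      · simp [store, g3, hx]
  · rintro _ m' ⟨h1, -, h3, h4⟩
    exact ⟨h3, h4, h1⟩

/-- The output of a machine is only read up to its time bound `q n`, so the digits must be cut off
there as well. Only the minimum of `q n` and `n` matters, and it needs no evaluation of `q`: a
nonconstant polynomial with natural coefficients satisfies `n ≤ q n`. -/
theorem exists_cap (q : Polynomial ℕ) :
    ∃ cap : Expr, ∀ m : Mem, min (m 4 0 0) (cap.eval m) = min (m 4 0 0) (q.eval (m 4 0 0)) := by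
  by_cases hq : q.natDegree = 0
  · refine ⟨.const (q.coeff 0), fun m => ?_⟩
    rw [Polynomial.eq_C_of_natDegree_eq_zero hq]; simp [Expr.eval]
  · refine ⟨var 4, fun m => ?_⟩
    have : m 4 0 0 ≤ q.eval (m 4 0 0) := by
      rw [Polynomial.eval_eq_sum_range]
      refine le_trans ?_ (Finset.single_le_sum (fun _ _ => Nat.zero_le _)
        (Finset.self_mem_range_succ q.natDegree))
      have h1 : 0 < q.coeff q.natDegree := Nat.pos_of_ne_zero (by
        rw [Polynomial.coeff_natDegree, Ne, Polynomial.leadingCoeff_eq_zero]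
        rintro rfl; simp at hq)
      calc m 4 0 0 ≤ m 4 0 0 ^ q.natDegree := Nat.le_self_pow hq _
        _ ≤ _ := Nat.le_mul_of_pos_left _ h1
    simp only [eval_var]; omega

/-- The arrays for the approximation. -/
def etaFrame : Set ℕ := {17, 18, 19, 35, 36, 37, 38} ∪ {a | 40 ≤ a ∧ a % 2 = 0}

/-- Runs the program `c` on input `1 ^ n` in the arrays `40, 42, ...` and reads its output. -/
def etaCmd (c : Cmd) (cap : Expr) : Cmd :=
  block [forLoop 37 (var 4) (.set 40 (.const 0) (var 37) (.const 1)), assign 42 (var 4),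
    c.compile (fun a => 40 + 2 * a) (fun a => .set (40 + 2 * a) (.const 1) (.const 0) (.const 0)),
    readNum cap, assign 17 (var 4)]

/-- A bound for the logarithm of the values in the memory of `c`. -/
def logBound (c : Cmd) (T n : ℕ) : ℕ := c.size * T + n

/-- The running time of the approximation. -/
def etaTime (c : Cmd) (T n : ℕ) : ℕ :=
  n * 4 + T * 2 + n * (logBound c T n * (2 * logBound c T n + 6) + 10) + 20

/-- The distribution of the approximation. -/
noncomputable def etaDist (c : Cmd) (T n : ℕ) : PMF (ℕ × ℕ) :=
  (runOn noOracle c T [ones n]).map fun s => etaVal T n s.2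

/-- The program for `η` runs in the even arrays from `40` on, apart from all other data. Queries to
the trivial oracle return the empty string, so its simulation only stores a length `0`. The growth
of the memory bounds the time for reading the digits. -/
theorem spec_etaCmd {O : PMF (List F2)} {c : Cmd} {T n : ℕ} (hc : HaltsWithin noOracle c T [ones n])
    {cap : Expr} (hcap : ∀ m : Mem, m 4 0 0 = n → min n (cap.eval m) = min n T) {m : Mem}
    (hn : m 4 0 0 = n) (hz : ∀ a, 40 ≤ a → a % 2 = 0 → m a = 0) :
    Spec O [etaCmd c cap] m (etaTime c T n) (etaDist c T n) fun r m' =>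
      m' 18 0 0 = r.1 ∧ m' 19 0 0 = 2 ^ r.2 ∧ m' 17 0 0 = n ∧ Frame etaFrame m m' := by
  set f : ℕ → ℕ := fun a => 40 + 2 * a with hf
  have hfi : Function.Injective f := fun a b h => by simp only [hf] at h; omega
  refine (Spec.block_cons (Det.cons (Det.forLoop (n := n) (τ := 1) (Inv := fun k m' =>
    Frame {37, 40} m m' ∧ ∀ i j, m' 40 i j = if i = 0 ∧ j < k then 1 else 0) ?_ ?_ ?_ ?_)
    (T' := T * 2 + n * (logBound c T n * (2 * logBound c T n + 6) + 10) + 15) ?_)).time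
    (by rw [etaTime]; omega)
  · exact ⟨Frame.refl _ _, fun i j => by rw [hz 40 le_rfl rfl]; simp⟩
  · intro k m' h; rw [eval_var, h.1 4 (by simp), hn]
  · exact fun k m' v h => ⟨h.1.store (by simp) _ _ _, by rw [store_ne (by norm_num)]; exact h.2⟩
  · rintro k hk m' ⟨h1, h2⟩ hx
    refine Spec.set (Spec.nil ⟨⟨h1.store (by simp) _ _ _, fun i j => ?_⟩, ?_⟩)
    · simp only [Expr.eval, eval_var, hx, store_apply, h2]
      split_ifs <;> first | rfl | omega
    · rw [store_ne (by norm_num)]; exact hx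
  rintro m1 ⟨f1, h1⟩
  have n1 : m1 4 0 0 = n := by rw [f1 4 (by simp), hn]
  set m2 := store m1 42 0 0 n with hm2
  have f2 : Frame {37, 40, 42} m m2 :=
    (f1.mono (by simp [Set.insert_subset_iff])).store (by simp) _ _ _
  have hold : Holds f (load [ones n]) m2 := by
    intro a
    funext i j
    rcases a with _ | _ | a
    · have e : m2 (f 0) i j = m1 40 i j := by rw [hm2, store_ne (by simp [hf])]
      have v1 : (1 : F2).val = 1 := rfl
      rw [e, h1]
      rcases i with _ | i
      · by_cases hj : j < n <;> simp [load, ones, hj, v1]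
      · simp [load]
    · have e : m2 (f 1) i j = store m1 42 0 0 n 42 i j := rfl
      rw [e, store_apply, f1 42 (by simp), hz 42 (by norm_num) rfl]
      rcases i with _ | i <;> rcases j with _ | j <;> simp [load, ones]
    · rw [load_eq_zero (by omega), f2 _ (by simp [hf]; omega),
        hz _ (by simp only [hf]; omega) (by simp only [hf]; omega)]
  have hrun := runS_const noOracle T 0 ([c], load [ones n])
  have hsup : ∀ p ∈ (runS (fun _ => noOracle) T 0 ([c], load [ones n])).support,
      p.2 ∈ (runOn noOracle c T [ones n]).support := fun p hp => by
    rw [runOn, ← hrun, PMF.mem_support_map_iff]; exact ⟨p, hp, rfl⟩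
  have key := Spec.compile (O := O) hfi
    (sub := fun a => .set (40 + 2 * a) (.const 1) (.const 0) (.const 0)) (A := fun _ => noOracle)
    (Inv := fun _ m' => Frame ({37} ∪ {a | 40 ≤ a ∧ a % 2 = 0}) m m') (τ := 1) (T := T) (k := 0)
    (L := [c]) (m := load [ones n]) (m' := m2)
    (fun k m₁ m₂ h hI a ha => by
      rw [h a ?_, hI a ha]
      rintro b rfl
      exact ha (Or.inr ⟨by simp only [hf]; omega, by simp only [hf]; omega⟩))
    (fun k a m₁ m₂ hh hI => Spec.set (Spec.nil ⟨by
      have : storeAnswer m₁ a [] = store m₁ a 1 0 0 := by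
        funext a' i' j'; simp [storeAnswer, store]
      rw [this]; exact hh.store hfi _ _ _ _,
      hI.store (Or.inr ⟨by omega, by omega⟩) _ _ _⟩))
    hold (f2.mono (by simp [Set.insert_subset_iff])) (fun p hp => hc _ (hsup p hp))
  rw [etaDist, runOn, ← hrun, PMF.map_comp]
  refine Spec.block_cons (Spec.assign ?_)
  rw [eval_var, n1, ← hm2]
  have key2 := Spec.append key (L' := [block [readNum cap, assign 17 (var 4)]])
    (T' := n * (logBound c T n * (2 * logBound c T n + 6) + 10) + 12)
    (Y := fun p => PMF.pure (etaVal T n p.2.2)) (R := fun r m' => m' 18 0 0 = r.1 ∧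
      m' 19 0 0 = 2 ^ r.2 ∧ m' 17 0 0 = n ∧ Frame etaFrame m m') (by
    rintro p hp m3 ⟨h3, f3⟩
    have n3 : m3 4 0 0 = n := by rw [f3 4 (by simp), hn]
    refine (Spec.block_cons (Det.cons (det_readNum (B := logBound c T n) (mc := p.2.2) n3
      (hcap _ n3) ?_ (h3 2) (h3 3)) (T' := 1) ?_)).time (by omega)
    · intro j
      rw [show m3 44 = p.2.2 2 from h3 2]
      have hmem := memory_le (S := c.size) c.size_pos (T := T) (L := [c]) (m := load [ones n])
        (B := 2 ^ n) Nat.one_le_two_pow (by simp) (by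
          intro a i j
          rcases a with _ | _ | a
          · simp only [load, if_pos]
            exact (Nat.lt_succ_iff.1 (ZMod.val_lt _)).trans Nat.one_le_two_pow
          · rcases i with _ | i <;> rcases j with _ | j <;> simp [load, ones, Nat.lt_two_pow_self.le]
          · rw [load_eq_zero (by omega)]; exact Nat.zero_le _) p.2 (hsup p hp) 2 0 j
      refine hmem.trans_lt ?_
      calc c.size ^ T * 2 ^ n ≤ (2 ^ c.size) ^ T * 2 ^ n := by
            gcongr; exact Nat.lt_two_pow_self.le
        _ = 2 ^ logBound c T n := by rw [logBound, pow_add, pow_mul]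
        _ < _ := Nat.pow_lt_pow_right (by norm_num) (by omega)
    · rintro m4 ⟨g1, g2, g3⟩
      refine Spec.block_last (Spec.assign (Spec.nil ⟨?_, ?_, ?_, ?_⟩))
      · rw [store_ne (by norm_num), g1]
      · rw [store_ne (by norm_num), g2]
      · rw [store_same, eval_var, g3 4 (by simp), n3]
      · have h4 : Frame etaFrame m m3 := f3.mono (by
          rintro a (rfl | ha)
          · simp [etaFrame]
          · exact Or.inr ha)
        have h5 : Frame etaFrame m3 m4 := g3.mono (by simp [etaFrame, Set.insert_subset_iff])
        exact (h4.trans h5).store (by simp [etaFrame]) _ _ _)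
  exact (Spec.block_cons key2).time (by omega)

/-! ### Accuracy of the approximation and its effect on the noise. -/

theorem binVal_div (d : ℕ → ℕ) (k : ℕ) :
    (binVal d k : ℝ) / 2 ^ k = ∑ j ∈ Finset.range k, (d j : ℝ) / 2 ^ (j + 1) := by
  induction k with
  | zero => simp [binVal]
  | succ k ih =>
    rw [Finset.sum_range_succ, ← ih, binVal, pow_succ]
    push_cast
    field_simp

theorem binVal_le {d : ℕ → ℕ} (hd : ∀ j, d j ≤ 1) (k : ℕ) : binVal d k + 1 ≤ 2 ^ k := by
  induction k with
  | zero => simp [binVal]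
  | succ k ih => rw [binVal, pow_succ]; have := hd k; omega

theorem sum_digits_le {d : ℕ → ℕ} (hd : ∀ j, d j ≤ 1) (a b : ℕ) :
    |∑ j ∈ Finset.range (a + b), (d j : ℝ) / 2 ^ (j + 1) - ∑ j ∈ Finset.range a, (d j : ℝ) / 2 ^ (j + 1)|
      ≤ 1 / 2 ^ a := by
  rw [Finset.sum_range_add, add_sub_cancel_left, abs_of_nonneg (Finset.sum_nonneg fun _ _ => by positivity)]
  have : ∑ i ∈ Finset.range b, (d (a + i) : ℝ) / 2 ^ (a + i + 1) ≤ 1 / 2 ^ a - 1 / 2 ^ (a + b) := by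
    induction b with
    | zero => simp
    | succ b ih =>
      rw [Finset.sum_range_succ]
      have h1 : (d (a + b) : ℝ) ≤ 1 := by exact_mod_cast hd _
      have h2 : (d (a + b) : ℝ) / 2 ^ (a + b + 1) ≤ 1 / 2 ^ (a + b + 1) := by gcongr
      have h3 : (1 : ℝ) / 2 ^ (a + b) = 2 * (1 / 2 ^ (a + b + 1)) := by rw [pow_succ]; field_simp
      rw [← Nat.add_assoc a b 1]
      linarith
  have h4 : (0 : ℝ) ≤ 1 / 2 ^ (a + b) := by positivity
  linarith

/-- The fraction `r.1 / 2 ^ r.2` is a good approximation of `η`. -/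
def IsApprox (η : ℝ) (n : ℕ) (r : ℕ × ℕ) : Prop :=
  r.1 ≤ 2 ^ r.2 ∧ |(r.1 : ℝ) / 2 ^ r.2 - η| ≤ 2 / 2 ^ n

/-- One half of the error comes from the approximation `w`, the other half from cutting its digits
off after `n` places. -/
theorem isApprox_etaVal {η : ℝ} {T n : ℕ} {w : List F2} (hw : |η - binaryValue w| ≤ 1 / 2 ^ n)
    {m : Mem} (h : readStrings 1 T m = [w]) : IsApprox η n (etaVal T n m) := by
  simp only [readStrings, List.ofFn_succ, List.ofFn_zero, List.cons.injEq, and_true, Fin.val_zero] at h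
  set d : ℕ → ℕ := fun j => m 2 0 j % 2 with hd
  have hd1 : ∀ j, d j ≤ 1 := fun j => by simp only [hd]; omega
  have hwl : w.length = min (m 3 0 0) T := by rw [← h, List.length_ofFn]
  have hwv : binaryValue w = ∑ j ∈ Finset.range w.length, (d j : ℝ) / 2 ^ (j + 1) := by
    rw [binaryValue, Finset.sum_range]
    refine Finset.sum_congr rfl fun i _ => ?_
    congr 2
    have : w.get i = ((m 2 0 i : ℕ) : F2) := by
      simp only [List.get_eq_getElem, ← h, List.getElem_ofFn]
    rw [this, ZMod.val_natCast]
  have hl : (etaVal T n m).2 = min w.length n := by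
    simp only [etaVal, hwl]; omega
  have h1 : (etaVal T n m).1 = binVal d (min w.length n) := by rw [← hl]; rfl
  refine ⟨?_, ?_⟩
  · rw [hl, h1]; have := binVal_le hd1 (min w.length n); omega
  · rw [hl, h1, binVal_div]
    have h2 : |binaryValue w - ∑ j ∈ Finset.range (min w.length n), (d j : ℝ) / 2 ^ (j + 1)|
        ≤ 1 / 2 ^ n := by
      rw [hwv]
      rcases le_total w.length n with hle | hle
      · rw [min_eq_left hle, sub_self, abs_zero]; positivity
      · rw [min_eq_right hle]
        have := sum_digits_le hd1 n (w.length - n)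
        rwa [Nat.add_sub_cancel' hle] at this
    have h3 := abs_sub_le η (binaryValue w)
      (∑ j ∈ Finset.range (min w.length n), (d j : ℝ) / 2 ^ (j + 1))
    rw [abs_sub_comm]
    have h4 : (2 : ℝ) / 2 ^ n = 1 / 2 ^ n + 1 / 2 ^ n := by ring
    linarith

/-- The machine for `η` is correct only up to a small statistical distance. Runs with a wrong output
are charged with distance `1`, and their probability is at most `ε`. -/
theorem dist_etaDist_bind {β : Type} {η : ℝ} {c : Cmd} {T n : ℕ} {w : List F2} {ε : ℝ}
    (hw : |η - binaryValue w| ≤ 1 / 2 ^ n)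
    (h : StatClose ((runOn noOracle c T [ones n]).map fun s => readStrings 1 T s.2)
      (PMF.pure [w]) ε) {F : ℕ × ℕ → PMF β} {Y : PMF β} {δ : ℝ≥0∞}
    (hF : ∀ r, IsApprox η n r → Dist (F r) Y δ) :
    Dist ((etaDist c T n).bind F) Y (ENNReal.ofReal ε + δ) := by
  set S : Set Cfg := {s | readStrings 1 T s.2 ≠ [w]} with hS
  have hp : prob (runOn noOracle c T [ones n]) S ≤ ENNReal.ofReal ε := by
    have h1 := h {[w]}ᶜ
    have h2 : pr (PMF.pure [w]) {[w]}ᶜ = 0 := by rw [pr_eq, prob_pure]; simp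
    rw [h2, sub_zero] at h1
    rw [prob_eq_ofReal]
    refine ENNReal.ofReal_le_ofReal ((le_abs_self _).trans (le_trans (le_of_eq ?_) h1))
    rw [pr_eq, pr_eq, prob_map]; rfl
  have key := Dist.bind_expect (runOn noOracle c T [ones n]) (Y := fun s => F (etaVal T n s.2))
    (Y' := fun _ => Y) (ε := fun s => S.indicator 1 s + δ) fun s => by
      by_cases hs : s ∈ S
      · exact (Dist.one _ _).mono (by simp [hs])
      · exact (hF _ (isApprox_etaVal hw (not_not.1 hs))).mono (by simp)
  rw [PMF.bind_const] at key
  rw [etaDist, ← PMF.bind_pure_comp, PMF.bind_bind]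
  simp only [Function.comp_apply, PMF.pure_bind]
  refine key.mono ?_
  rw [expect_add, expect_const]
  gcongr; exact hp

/-- The expectation is off by `2/2^n` from the fraction and `1/2^n` from the coins; both atoms
change by this amount, which gives the factor `2`. -/
theorem dist_bernApprox_ber {η : ℝ} (hη : η ∈ Set.Ico (0 : ℝ) (1 / 2)) {n : ℕ} {r : ℕ × ℕ}
    (hr : IsApprox η n r) :
    Dist (bernApprox r.1 (2 ^ r.2) n) (ber η hη) (ENNReal.ofReal (6 * (1 / 2) ^ n)) := by
  rw [show 6 * (1 / 2 : ℝ) ^ n = 2 * (3 / 2 ^ n) by rw [one_div_pow]; ring]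
  refine dist_bits ?_
  have h1 := abs_bernApprox_sub_le (s := n) (Nat.two_pow_pos r.2) hr.1
  have h2 := hr.2
  have h3 : (ber η hη 1).toReal = η := by
    rw [ber, PMF.ofFintype_apply, if_pos rfl, ENNReal.toReal_ofReal hη.1]
  push_cast at h1
  rw [h3]
  have h4 := abs_sub_le (bernApprox r.1 (2 ^ r.2) n 1).toReal ((r.1 : ℝ) / 2 ^ r.2) η
  have h5 : (3 : ℝ) / 2 ^ n = 1 / 2 ^ n + 2 / 2 ^ n := by ring
  linarith


/-! ### Encoding -/

/-- The encoding with noise distributed as `D`. -/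
noncomputable def encodeWith {n g : ℕ} (D : PMF F2) (pk : Vec (n * g + n)) : PMF (Vec n) :=
  (PMF.uniformOfFintype (Vec g)).bind fun u =>
    (iid D n).map fun e => (pairMatrix pk).mulVec u + pairVec pk + e

theorem dist_encodeWith {n g : ℕ} {D D' : PMF F2} {ε : ℝ≥0∞} (h : Dist D D' ε)
    (pk : Vec (n * g + n)) : Dist (encodeWith D pk) (encodeWith D' pk) (n * ε) :=
  Dist.bind_right _ fun _ _ => (h.iid n).map _

/-- Writes an encoding to row `0` of array `28`. -/
def encCore : Cmd :=
  block [assign 23 (.const 0), emit 11 (var 6) (.coin 16 (.const 0) (.const 0)) 16 26 0 23,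
    assign 24 (.const 0), emit 11 (var 4) bern 16 29 0 24, assign 25 (.const 0),
    assign 27 (.const 0),
    emit 11 (var 4) (block [dot 12 20 (var 6) (.get 0 (.const 1) (.add (var 27) (var 12)))
      (.get 26 (.const 0) (var 12)),
      assign 20 (((var 20).xor (.get 0 (.const 1) (.add (var 8) (var 11)))).xor
        (.get 29 (.const 0) (var 11))), assign 27 (.add (var 27) (var 6))]) 20 28 0 25]

/-- The running time of the encoding. -/
def encTime (n g s : ℕ) : ℕ := g * 8 + 3 + (n * (12 * s + 30) + 3) + (n * (g * 4 + 16) + 3) + 10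

/-- The arrays that are used by the encoding. -/
def encFrame : Set ℕ := {11, 12, 13, 14, 15, 16, 20, 23, 24, 25, 26, 27, 28, 29}

theorem spec_encCore {O : PMF (List F2)} {m : Mem} {n g a b s : ℕ} {pk : Vec (n * g + n)}
    (hn : m 4 0 0 = n) (hg : m 6 0 0 = g) (hng : m 8 0 0 = n * g) (hpk : Row m 0 1 (List.ofFn pk))
    (ha : m 18 0 0 = a) (hb : m 19 0 0 = b) (hs : m 17 0 0 = s) :
    Spec O [encCore] m (encTime n g s) (encodeWith (bernApprox a b s) pk) fun x m' =>
      Row m' 28 0 (List.ofFn x) ∧ Frame encFrame m m' := by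
  set S := encFrame with hS
  have hG : ∀ (i : Fin n) (k : Fin g), m 0 1 (i * g + k) = (pairMatrix pk i k).val := fun i k => by
    have := hpk.get (Fin.castAdd n (finProdFinEquiv (i, k)))
    simp only [Fin.val_castAdd, finProdFinEquiv_apply_val] at this
    rw [Nat.add_comm, Nat.mul_comm, this]; rfl
  have hz : ∀ j : Fin n, m 0 1 (n * g + j) = (pairVec pk j).val := fun j => by
    have := hpk.get (Fin.natAdd (n * g) j)
    simp only [Fin.val_natAdd] at this
    rw [this]; rfl
  rw [encTime, encodeWith]
  refine (Spec.block_cons (Spec.assign (Spec.block_cons (Spec.cons (spec_emit_coin (l₀ := [])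
    (n := g) (by norm_num) (by norm_num) (by norm_num) (by norm_num) (by norm_num) (Row.nil _ _ _)
    ?_ ?_) (T' := (n * (12 * s + 30) + 3) + (n * (g * 4 + 16) + 3) + 7) ?_)))).time (by omega)
  · rw [store_same]; rfl
  · intro m' h; rw [eval_var, h.1 6 (by simp), store_ne (by norm_num), hg]
  rintro u m1 ⟨r1, -, f1, -⟩
  rw [List.nil_append] at r1
  have F1 : Frame S m m1 := ((Frame.refl _ _).store (by simp [hS, encFrame]) _ _ _).trans
    (f1.mono (by simp [hS, encFrame, Set.insert_subset_iff]))
  rw [← PMF.bind_pure_comp]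
  refine (Spec.block_cons (Spec.assign (Spec.block_cons (Spec.cons (Spec.emit_iid (l₀ := [])
    (n := n) (τ := 12 * s + 23) (D := bernApprox a b s)
    (J := fun m' => Frame {11, 12, 13, 14, 15, 16, 24, 29} m1 m') (by norm_num) (by norm_num)
    (by norm_num) (Row.nil _ _ _) ?_ ?_ ?_ ?_ ?_)
    (T' := (n * (g * 4 + 16) + 3) + 4) ?_)))).time (by ring_nf; omega)
  · rw [store_same]; rfl
  · exact (Frame.refl _ _).store (by simp) _ _ _
  · intro m' h; rw [eval_var, h 4 (by simp), F1 4 (by simp [hS, encFrame]), hn]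
  · intro m' m'' h _ hJ; exact hJ.trans (h.mono (by simp [Set.insert_subset_iff]))
  · intro m' h
    refine (spec_bern (a := a) (b := b) (s := s) ?_ ?_ ?_).imp ?_
    · rw [h 18 (by simp), F1 18 (by simp [hS, encFrame]), ha]
    · rw [h 19 (by simp), F1 19 (by simp [hS, encFrame]), hb]
    · rw [h 17 (by simp), F1 17 (by simp [hS, encFrame]), hs]
    · rintro c m'' ⟨h1, h2⟩
      exact ⟨h.trans (h2.mono (by simp [Set.insert_subset_iff])), h1, h2 11 (by simp),
        h2 24 (by simp), h2 29 (by simp)⟩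
  rintro e m2 ⟨r2, -, f2⟩
  rw [List.nil_append] at r2
  have F2 : Frame S m m2 := F1.trans (f2.mono (by simp [hS, encFrame, Set.insert_subset_iff]))
  have r1' : Row m2 26 0 (List.ofFn u) := r1.frame f2 (by simp)
  refine (Spec.block_cons (Spec.assign (Spec.block_cons (Spec.assign (Spec.block_last
    (Spec.map (X := PMF.pure ()) (fun _ => (pairMatrix pk).mulVec u + pairVec pk + e)
    (Det.emit_list (l₀ := []) (n := n) (τ := g * 4 + 9)
    (w := (pairMatrix pk).mulVec u + pairVec pk + e)
    (J := fun l m' => Frame {11, 12, 20, 25, 27, 28} m2 m' ∧ m' 27 0 0 = l.length * g) (by norm_num)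
    (by norm_num) (by norm_num) (Row.nil _ _ _) ?_ ?_ ?_ ?_ ?_) ?_)))))).time (by ring_nf; omega)
    |> fun h => by rwa [PMF.pure_map] at h
  · rw [store_ne (by norm_num), store_same]; rfl
  · exact ⟨((Frame.refl _ _).store (by simp) _ _ _).store (by simp) _ _ _, by simp [store, Expr.eval]⟩
  · intro _ m' h; rw [eval_var, h.1 4 (by simp), F2 4 (by simp [hS, encFrame]), hn]
  · rintro l m' m'' h - ⟨h1, h2⟩
    exact ⟨h1.trans (h.mono (by simp [Set.insert_subset_iff])), by rw [h 27 (by simp), h2]⟩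
  · rintro i l m' hl ⟨h1, h2⟩ hx
    refine (Spec.block_cons (Det.cons (det_dot (a := fun k => pairMatrix pk i k) (b := u)
        (by norm_num) ?_ ?_ ?_) (T' := 3) ?_)).time (by omega)
    · intro m₂ h; rw [eval_var, h 6 (by simp), h1 6 (by simp), F2 6 (by simp [hS, encFrame]), hg]
    · intro k m₂ h hk
      simp only [Expr.eval, eval_var, hk]
      rw [h 0 (by simp), h 27 (by simp), h1 0 (by simp), h2, hl, F2 0 (by simp [hS, encFrame]), hG]
    · intro k m₂ h hk
      simp only [Expr.eval, eval_var, hk]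
      rw [h 26 (by simp), h1 26 (by simp), r1'.get]
    · rintro m₂ ⟨k1, k2⟩
      have hbit : ((((var 20).xor (.get 0 (.const 1) (.add (var 8) (var 11)))).xor
          (.get 29 (.const 0) (var 11)) : Expr)).eval m₂
          = (((pairMatrix pk).mulVec u + pairVec pk + e) i).val := by
        refine Expr.eval_xor (Expr.eval_xor k1 ?_) ?_
        · simp only [Expr.eval, eval_var]
          rw [k2 0 (by simp), k2 8 (by simp), k2 11 (by simp), h1 0 (by simp), h1 8 (by simp), hx,
            F2 0 (by simp [hS, encFrame]), F2 8 (by simp [hS, encFrame]), hng, hz]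
        · simp only [Expr.eval, eval_var]
          rw [k2 29 (by simp), k2 11 (by simp), h1 29 (by simp), hx, r2.get]
      refine Spec.block_cons (Spec.assign (Spec.block_last (Spec.assign (Spec.nil
        ⟨⟨?_, ?_⟩, ?_, ?_, ?_, ?_⟩))))
      · exact ((h1.trans (k2.mono (by simp [Set.insert_subset_iff]))).store (by simp) _ _ _).store
          (by simp) _ _ _
      · rw [store_same]; simp only [Expr.eval, eval_var]
        rw [store_ne (by norm_num), store_ne (by norm_num), k2 27 (by simp), k2 6 (by simp), h2,
          h1 6 (by simp), F2 6 (by simp [hS, encFrame]), hg]; simp; ring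
      · rw [store_ne (by norm_num), store_same, hbit]
      · rw [store_ne (by norm_num), store_ne (by norm_num), k2 11 (by simp)]
      · rw [store_ne (by norm_num), store_ne (by norm_num), k2 25 (by simp)]
      · rw [store_ne (by norm_num), store_ne (by norm_num), k2 28 (by simp)]
  · rintro _ m' ⟨h1, -, h2, -⟩
    rw [List.nil_append] at h1
    exact ⟨h1, F2.trans (h2.mono (by simp [hS, encFrame, Set.insert_subset_iff]))⟩

/-- The program for the encoding. -/
def encodeCmd (K : ℕ) (c : Cmd) (cap : Expr) : Cmd :=
  block [params K, etaCmd c cap, encCore,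
    emit 11 (var 4) (assign 16 (.get 28 (.const 0) (var 11))) 16 2 0 30,
    .set 3 (.const 0) (.const 0) (var 4)]

/-- The running time of the program for the encoding. -/
def encodeTime (c : Cmd) (T n g : ℕ) : ℕ :=
  20 * n + 50 + etaTime c T n + encTime n g n + (n * 8 + 3) + 5

theorem spec_encodeCmd {K : ℕ} (hK : K ≠ 0) {c : Cmd} {T n : ℕ}
    (hc : HaltsWithin noOracle c T [ones n]) {cap : Expr}
    (hcap : ∀ m : Mem, m 4 0 0 = n → min n (cap.eval m) = min n T)
    (pk : Vec (n * (rowWt K n * rowWt K n) + n)) :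
    Spec noOracle [encodeCmd K c cap] (load [ones n, List.ofFn pk])
      (encodeTime c T n (rowWt K n * rowWt K n))
      ((etaDist c T n).bind fun r => (encodeWith (bernApprox r.1 (2 ^ r.2) n) pk).map
        fun x => [List.ofFn x]) fun o m => Outputs m o := by
  set m0 := load [ones n, List.ofFn pk] with hm0
  have z0 : ∀ a, 2 ≤ a → m0 a = 0 := fun a ha => load_eq_zero ha
  have hpk : Row m0 0 1 (List.ofFn pk) := row_load _ 1
  rw [encodeTime]
  refine (Spec.block_cons (Det.cons (det_params hK (n := n) (by simp [hm0, load, ones]))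
    (T' := etaTime c T n + encTime n (rowWt K n * rowWt K n) n + (n * 8 + 3) + 4) ?_)).time (by omega)
  rintro m1 ⟨p1, f1⟩
  refine (Spec.block_cons (Spec.cons (spec_etaCmd hc hcap p1.eq_n ?_)
    (T' := encTime n (rowWt K n * rowWt K n) n + (n * 8 + 3) + 3) ?_)).time (by omega)
  · intro a ha _; rw [f1 a (by simp; omega), z0 a (by omega)]
  rintro r m2 ⟨h18, h19, h17, f2⟩
  have p2 := p1.frame f2 (by intro a h1 h2; simp [etaFrame]; omega)
  rw [← PMF.bind_pure_comp]
  refine (Spec.block_cons (Spec.cons (spec_encCore p2.eq_n p2.eq_g p2.eq_ng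
    ((hpk.frame f1 (by simp)).frame f2 (by simp [etaFrame])) h18 h19 h17)
    (T' := (n * 8 + 3) + 2) ?_)).time (by omega)
  rintro x m3 ⟨r3, f3⟩
  have p3 := p2.frame f3 (by intro a h1 h2; simp [encFrame]; omega)
  refine (Spec.block_cons (Det.cons (det_emit_expr (w := x) (l₀ := []) (by norm_num) (by norm_num)
    (by norm_num) (by norm_num) (by norm_num) (Row.nil _ _ _) ?_ ?_ ?_) (T' := 1) ?_)).time (by omega)
  · rw [f3 30 (by simp [encFrame]), f2 30 (by simp [etaFrame]), f1 30 (by simp), z0 30 (by norm_num)]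
    rfl
  · intro m' h; rw [eval_var, h.1 4 (by simp), p3.eq_n]
  · intro k m' h hk
    simp only [Expr.eval, eval_var, hk]; rw [h.1 28 (by simp), r3.get]
  rintro m4 ⟨r4, -, f4, -⟩
  rw [List.nil_append] at r4
  refine Spec.block_last (Spec.set (Spec.nil ?_))
  intro k hk
  obtain rfl : k = 0 := by simpa using hk
  refine ⟨r4.congr (by rw [store_ne (by norm_num)]), ?_⟩
  simp only [Expr.eval, eval_var]
  rw [store_same, f4 4 (by simp), p3.eq_n]; simp

theorem polyBounded_encodeTime {I : Type} {s n g : I → ℕ} (c : Cmd) (q : Polynomial ℕ)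
    (hn : PolyBounded s n) (hg : PolyBounded s g) :
    PolyBounded s fun i => encodeTime c (q.eval (n i)) (n i) (g i) := by
  have hT := hn.eval q
  unfold encodeTime etaTime encTime logBound
  repeat' first | exact PolyBounded.const _ _ | exact hn | exact hg | exact hT |
    apply PolyBounded.mul | apply PolyBounded.add

theorem polyTime_encode {K : ℕ} (hK : K ≠ 0) {η : ℝ} (hη : η ∈ Set.Ico (0 : ℝ) (1 / 2))
    (hc : EfficientlyComputable η) :
    PolyTimeAlgorithm (I := Σ n : ℕ, Vec ((code K η hη).pkLen n)) (fun i => i.1)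
      (fun i => [ones i.1, List.ofFn i.2]) 1
      (fun i => ((code K η hη).encode i.1 i.2).map fun x => [List.ofFn x]) := by
  obtain ⟨w, hw, c, q, μ, hμ, hq⟩ := hc
  simp only [inputLength_ones] at hq
  obtain ⟨cap, hcap⟩ := exists_cap q
  have hμ0 : ∀ n, 0 ≤ μ n := fun n => (abs_nonneg _).trans ((hq n).2 ∅)
  have hn : PolyBounded (fun i : Σ n : ℕ, Vec ((code K η hη).pkLen n) =>
      inputLength [ones i.1, List.ofFn i.2]) fun i => i.1 :=
    PolyBounded.of_le_self fun i => by simp [inputLength, ones]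
  have hg : PolyBounded (fun i : Σ n : ℕ, Vec ((code K η hη).pkLen n) =>
      inputLength [ones i.1, List.ofFn i.2]) fun i => rowWt K i.1 * rowWt K i.1 :=
    (hn.mul hn).mono fun i => Nat.mul_le_mul (rowWt_le K i.1) (rowWt_le K i.1)
  refine polyTimeAlgorithm_of_polyBounded (encodeCmd K c cap) (polyBounded_encodeTime c q hn hg) hn
    (μ := fun n => μ n + 6 * ((n : ℝ) ^ 1 * (1 / 2) ^ n)) ?_ _ ?_
    (fun i => spec_encodeCmd hK (hq i.1).1 (fun m hm => by rw [← hm]; exact hcap m) i.2) ?_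
  · exact Negligible.add hμ (negligible_pow_mul_half_pow 1 6)
  · intro i o ho
    simp only [PMF.mem_support_bind_iff, PMF.mem_support_map_iff] at ho
    obtain ⟨_, -, x, -, rfl⟩ := ho
    simp
  · intro i
    have := dist_etaDist_bind (hw i.1) (hq i.1).2 (F := fun r =>
      (encodeWith (bernApprox r.1 (2 ^ r.2) i.1) i.2).map fun x => [List.ofFn x])
      (Y := ((code K η hη).encode i.1 i.2).map fun x => [List.ofFn x])
      fun r hr => (dist_encodeWith (dist_bernApprox_ber hη hr) i.2).map _
    have hμi := hμ0 i.1
    refine (this.mono (le_of_eq ?_)).statClose (by positivity)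
    rw [← ENNReal.ofReal_natCast, ← ENNReal.ofReal_mul (by positivity),
      ENNReal.ofReal_add hμi (by positivity), pow_one]
    congr 2; ring


/-! ### The reduction to LPN -/

/-- The oracle that answers the first `j` queries according to `E`, the next one according to `X` and
the others according to `U`. -/
noncomputable def hybrid {n : ℕ} (E U : PMF (Vec n)) (j : ℕ) (X : PMF (Vec n)) (k : ℕ) :
    PMF (List F2) :=
  (if k < j then E else if k = j then X else U).map List.ofFn

/-- Answers the query that is counted in variable `22`; the index of the special query is in
variable `39`. -/
def answer (b : ℕ) : Cmd :=
  block [.ite (.sub (var 39) (var 22)) encCore (.seq (assign 25 (.const 0))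
    (.ite (.sub (var 22) (var 39)) (emit 11 (var 4) (.coin 16 (.const 0) (.const 0)) 16 28 0 25)
      (emit 11 (var 4) (assign 16 ((Expr.get 0 (.const 2) (var 11)).xor
        (.get 0 (.const 1) (.add (var 8) (var 11))))) 16 28 0 25))),
    forLoop 11 (var 4) (.set b (.const 0) (var 11) (.get 28 (.const 0) (var 11))),
    .set b (.const 1) (.const 0) (var 4), assign 22 (.add (var 22) (.const 1))]

/-- The running time of an answer. -/
def answerTime (n g : ℕ) : ℕ := encTime n g n + n * 12 + 20

/-- The memory is prepared for answers. -/
structure Ready (K n : ℕ) (m : Mem) (pk : Vec (n * (rowWt K n * rowWt K n) + n)) (v : Vec n)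
    (r : ℕ × ℕ) (j : ℕ) : Prop where
  params : Params K n m
  key : Row m 0 1 (List.ofFn pk)
  sample : Row m 0 2 (List.ofFn v)
  num : m 18 0 0 = r.1
  den : m 19 0 0 = 2 ^ r.2
  coins : m 17 0 0 = n
  index : m 39 0 0 = j

theorem spec_answerCore {O : PMF (List F2)} {K n : ℕ} {m : Mem}
    {pk : Vec (n * (rowWt K n * rowWt K n) + n)} {v : Vec n} {r : ℕ × ℕ} {j k : ℕ}
    (h : Ready K n m pk v r j) (hk : m 22 0 0 = k) :
    Spec O [.ite (.sub (var 39) (var 22)) encCore (.seq (assign 25 (.const 0))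
    (.ite (.sub (var 22) (var 39)) (emit 11 (var 4) (.coin 16 (.const 0) (.const 0)) 16 28 0 25)
      (emit 11 (var 4) (assign 16 ((Expr.get 0 (.const 2) (var 11)).xor
        (.get 0 (.const 1) (.add (var 8) (var 11))))) 16 28 0 25)))] m
      (encTime n (rowWt K n * rowWt K n) n + n * 8 + 8)
      (if k < j then encodeWith (bernApprox r.1 (2 ^ r.2) n) pk else if k = j then
        PMF.pure (v + pairVec pk) else PMF.uniformOfFintype (Vec n)) fun x m' =>
      Row m' 28 0 (List.ofFn x) ∧ Frame encFrame m m' := by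
  have hz : ∀ i : Fin n, m 0 1 (n * (rowWt K n * rowWt K n) + i) = (pairVec pk i).val := fun i => by
    have := h.key.get (Fin.natAdd _ i)
    simp only [Fin.val_natAdd] at this
    rw [this]; rfl
  rcases lt_trichotomy k j with hkj | hkj | hkj
  · rw [if_pos hkj]
    refine (Spec.ite_true ?_ (spec_encCore h.params.eq_n h.params.eq_g h.params.eq_ng h.key h.num
      h.den h.coins)).time (by omega)
    simp only [Expr.eval, eval_var, h.index, hk]; omega
  · rw [if_neg (by omega), if_pos hkj]
    refine (Spec.ite_false ?_ (Spec.seq (Spec.assign (Spec.ite_false ?_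
      (Spec.map (X := PMF.pure ()) (fun _ => v + pairVec pk) (det_emit_expr (w := v + pairVec pk)
        (l₀ := []) (by norm_num) (by norm_num) (by norm_num) (by norm_num) (by norm_num)
        (Row.nil _ _ _) ?_ ?_ ?_) ?_))))).time (T := n * 8 + 7) (by omega)
      |> fun h => by rwa [PMF.pure_map] at h
    · simp only [Expr.eval, eval_var, h.index, hk]; omega
    · simp only [Expr.eval, eval_var, store_ne (show 22 ≠ 25 by norm_num),
        store_ne (show 39 ≠ 25 by norm_num), h.index, hk]; omega
    · rw [store_same]; rfl
    · intro m' h'; rw [eval_var, h'.1 4 (by simp), store_ne (by norm_num), h.params.eq_n]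
    · intro i m' h' hi
      refine Expr.eval_xor ?_ ?_
      · simp only [Expr.eval, eval_var, hi]
        rw [h'.1 0 (by simp), store_ne (by norm_num), h.sample.get]
      · simp only [Expr.eval, eval_var, hi]
        rw [h'.1 0 (by simp), h'.1 8 (by simp), store_ne (by norm_num), store_ne (by norm_num),
          h.params.eq_ng, hz]
    · rintro _ m' ⟨h1, -, h2, -⟩
      rw [List.nil_append] at h1
      exact ⟨h1, ((Frame.refl _ _).store (by simp [encFrame]) _ _ _).trans
        (h2.mono (by simp [encFrame, Set.insert_subset_iff]))⟩
  · rw [if_neg (by omega), if_neg (by omega)]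
    refine (Spec.ite_false ?_ (Spec.seq (Spec.assign (Spec.ite_true ?_
      (Spec.imp (spec_emit_coin (l₀ := []) (n := n) (by norm_num) (by norm_num) (by norm_num)
        (by norm_num) (by norm_num) (Row.nil _ _ _) ?_ ?_) ?_))))).time (T := n * 8 + 7) (by omega)
    · simp only [Expr.eval, eval_var, h.index, hk]; omega
    · simp only [Expr.eval, eval_var, store_ne (show 22 ≠ 25 by norm_num),
        store_ne (show 39 ≠ 25 by norm_num), h.index, hk]; omega
    · rw [store_same]; rfl
    · intro m' h'; rw [eval_var, h'.1 4 (by simp), store_ne (by norm_num), h.params.eq_n]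
    · rintro x m' ⟨h1, -, h2, -⟩
      rw [List.nil_append] at h1
      exact ⟨h1, ((Frame.refl _ _).store (by simp [encFrame]) _ _ _).trans
        (h2.mono (by simp [encFrame, Set.insert_subset_iff]))⟩

theorem Ready.frame {K n : ℕ} {m m' : Mem} {pk : Vec (n * (rowWt K n * rowWt K n) + n)} {v : Vec n}
    {r : ℕ × ℕ} {j : ℕ} (h : Ready K n m pk v r j) {S : Set ℕ} (h' : Frame S m m')
    (hS : ∀ a ∈ S, a ≠ 0 ∧ a ∉ Set.Icc 4 8 ∧ a ∉ Set.Icc 17 19 ∧ a ≠ 39) :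
    Ready K n m' pk v r j := by
  have h17 : ∀ a, 17 ≤ a → a ≤ 19 → a ∉ S := fun a h1 h2 h3 => (hS a h3).2.2.1 ⟨h1, h2⟩
  have h0 : 0 ∉ S := fun h3 => (hS 0 h3).1 rfl
  refine ⟨h.params.frame h' fun a h1 h2 h3 => (hS a h3).2.1 ⟨h1, h2⟩, h.key.frame h' h0,
    h.sample.frame h' h0, ?_, ?_, ?_, ?_⟩
  · rw [h' 18 (h17 _ (by norm_num) (by norm_num)), h.num]
  · rw [h' 19 (h17 _ (by norm_num) (by norm_num)), h.den]
  · rw [h' 17 (h17 _ (by norm_num) (by norm_num)), h.coins]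
  · rw [h' 39 (fun h3 => (hS 39 h3).2.2.2 rfl), h.index]

/-- Array `b` represents an array `a` of the simulated adversary. The last clause speaks of an
arbitrary memory `m₀` because the adversary's memory is not part of `m`; it is the form that
`Spec.compile` asks for. -/
theorem spec_answer {O : PMF (List F2)} {K n : ℕ} {m : Mem}
    {pk : Vec (n * (rowWt K n * rowWt K n) + n)} {v : Vec n} {r : ℕ × ℕ} {j k b : ℕ}
    (h : Ready K n m pk v r j) (hk : m 22 0 0 = k) (hb : 40 ≤ b) :
    Spec O [answer b] m (answerTime n (rowWt K n * rowWt K n))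
      (hybrid (encodeWith (bernApprox r.1 (2 ^ r.2) n) pk) (PMF.uniformOfFintype (Vec n)) j
        (PMF.pure (v + pairVec pk)) k) fun w m' =>
      Frame (encFrame ∪ {22, b}) m m' ∧ m' 22 0 0 = k + 1 ∧
        ∀ m₀ : Mem, ∀ a, m b = m₀ a → m' b = storeAnswer m₀ a w a := by
  rw [answerTime, hybrid, ← PMF.bind_pure_comp]
  refine (Spec.block_cons (Spec.cons (spec_answerCore h hk) (T' := n * 4 + 7) ?_)).time (by omega)
  rintro x m1 ⟨r1, f1⟩
  have n1 : m1 4 0 0 = n := by rw [f1 4 (by simp [encFrame]), h.params.eq_n]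
  have hb11 : b ≠ 11 := by omega
  have hb22 : b ≠ 22 := by omega
  have hb1 : m1 b = m b := f1 b (by simp [encFrame]; omega)
  refine (Spec.block_cons (Det.cons (Det.forLoop (n := n) (τ := 1) (Inv := fun l m' =>
    Frame {11, b} m1 m' ∧ ∀ i i', m' b i i' = if i = 0 ∧ i' < l then m1 28 0 i' else m1 b i i')
    ?_ ?_ ?_ ?_) (T' := 3) ?_)).time (by omega)
  · exact ⟨Frame.refl _ _, fun i i' => by simp⟩
  · intro l m' h'; rw [eval_var, h'.1 4 (by simp; omega), n1]
  · exact fun l m' c h' => ⟨h'.1.store (by simp) _ _ _, by rw [store_ne hb11]; exact h'.2⟩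
  · rintro l hl m' ⟨h1, h2⟩ hx
    refine Spec.set (Spec.nil ⟨⟨h1.store (by simp) _ _ _, fun i i' => ?_⟩, ?_⟩)
    · simp only [Expr.eval, eval_var, hx, store_apply, h2]
      rw [h1 28 (by simp; omega)]
      by_cases hi : i = 0
      · by_cases hi' : i' = l
        · simp [hi, hi']
        · have : i' < l + 1 ↔ i' < l := by omega
          simp [hi, hi', this]
      · simp [hi]
    · rw [store_ne hb11.symm]; exact hx
  rintro m2 ⟨f2, h2⟩
  refine (Spec.block_cons (Spec.set (Spec.block_last (Spec.assign (Spec.nil ⟨?_, ?_, ?_⟩))))).time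
    (by omega)
  · have f3 : Frame (encFrame ∪ {22, b}) m m2 :=
      (f1.mono Set.subset_union_left).trans (f2.mono (by simp [encFrame, Set.insert_subset_iff]))
    exact (f3.store (by simp) _ _ _).store (by simp) _ _ _
  · rw [store_same]
    simp only [Expr.eval, eval_var]
    rw [store_ne hb22.symm, f2 22 (by simp; omega), f1 22 (by simp [encFrame]), hk]
  · intro m₀ a hm
    rw [store_ne hb22]
    funext i i'
    simp only [Expr.eval, eval_var, f2 4 (by simp; omega), n1, store_apply, h2, storeAnswer,
      true_and, List.length_ofFn]
    rw [hb1, hm]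
    by_cases hi : i = 0
    · by_cases hi' : i' < n
      · have := r1.get ⟨i', hi'⟩
        simp [hi, hi', this]
      · simp [hi, hi']
    · simp [hi]

/-- Prepares the memory for the adversary. -/
def setup : Cmd :=
  block [forLoop 37 (var 4) (.set 41 (.const 0) (var 37) (.const 1)),
    forLoop 37 (.add (var 8) (var 4)) (.set 41 (.const 1) (var 37) (.get 0 (.const 1) (var 37))),
    assign 43 (var 4), .set 43 (.const 1) (.const 0) (.add (var 8) (var 4)), assign 22 (.const 0)]

theorem det_setup {O : PMF (List F2)} {m : Mem} {n g : ℕ} {pk : Vec (n * g + n)}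
    (hn : m 4 0 0 = n) (hng : m 8 0 0 = n * g) (hpk : Row m 0 1 (List.ofFn pk))
    (hz : ∀ a, m (41 + 2 * a) = 0) :
    Det O [setup] m (n * 4 + (n * g + n) * 4 + 15) fun m' =>
      Holds (fun a => 41 + 2 * a) (load [ones n, List.ofFn pk]) m' ∧ m' 22 0 0 = 0 ∧
        Frame {22, 37, 41, 43} m m' := by
  have v1 : (1 : F2).val = 1 := rfl
  refine (Spec.block_cons (Det.cons (Det.forLoop (n := n) (τ := 1) (Inv := fun l m' =>
    Frame {37, 41} m m' ∧ ∀ i j, m' 41 i j = if i = 0 ∧ j < l then 1 else 0) ?_ ?_ ?_ ?_)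
    (T' := (n * g + n) * 4 + 10) ?_)).time (by omega)
  · exact ⟨Frame.refl _ _, fun i j => by rw [show m 41 = 0 from hz 0]; simp⟩
  · intro l m' h; rw [eval_var, h.1 4 (by simp), hn]
  · exact fun l m' v h => ⟨h.1.store (by simp) _ _ _, by rw [store_ne (by norm_num)]; exact h.2⟩
  · rintro l hl m' ⟨h1, h2⟩ hx
    refine Spec.set (Spec.nil ⟨⟨h1.store (by simp) _ _ _, fun i j => ?_⟩, ?_⟩)
    · simp only [Expr.eval, eval_var, hx, store_apply, h2]
      split_ifs <;> first | rfl | omega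
    · rw [store_ne (by norm_num)]; exact hx
  rintro m1 ⟨f1, h1⟩
  refine (Spec.block_cons (Det.cons (Det.forLoop (n := n * g + n) (τ := 1) (Inv := fun l m' =>
    Frame {37, 41} m m' ∧ ∀ i j, m' 41 i j = if i = 1 ∧ j < l then m 0 1 j else m1 41 i j)
    ?_ ?_ ?_ ?_) (T' := 5) ?_)).time (by omega)
  · exact ⟨f1, fun i j => by simp⟩
  · intro l m' h
    simp only [Expr.eval, eval_var]
    rw [h.1 4 (by simp), h.1 8 (by simp), hn, hng]
  · exact fun l m' v h => ⟨h.1.store (by simp) _ _ _, by rw [store_ne (by norm_num)]; exact h.2⟩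
  · rintro l hl m' ⟨g1, g2⟩ hx
    refine Spec.set (Spec.nil ⟨⟨g1.store (by simp) _ _ _, fun i j => ?_⟩, ?_⟩)
    · simp only [Expr.eval, eval_var, hx, store_apply, g2, g1 0 (by simp)]
      by_cases hi : i = 1
      · by_cases hj : j = l
        · simp [hi, hj]
        · have : j < l + 1 ↔ j < l := by omega
          simp [hi, hj, this]
      · simp [hi]
    · rw [store_ne (by norm_num)]; exact hx
  rintro m2 ⟨f2, h2⟩
  have n2 : m2 4 0 0 = n := by rw [f2 4 (by simp), hn]
  have ng2 : m2 8 0 0 = n * g := by rw [f2 8 (by simp), hng]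
  refine (Spec.block_cons (Spec.assign (Spec.block_cons (Spec.set (Spec.block_last (Spec.assign
    (Spec.nil ⟨?_, ?_, ?_⟩))))))).time (by omega)
  · intro a
    beta_reduce
    rw [store_ne (by omega)]
    funext i j
    rcases a with _ | _ | a
    · rw [store_ne (by norm_num), store_ne (by norm_num)]
      simp only [Nat.mul_zero, Nat.add_zero, h2, h1]
      rcases i with _ | _ | i
      · by_cases hj : j < n <;> simp [load, ones, hj, v1]
      · by_cases hj : j < n * g + n
        · have := hpk.get ⟨j, hj⟩
          simp only at this
          simp [load, hj, this]
        · simp [load, hj]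
      · simp [load]
    · change store (store m2 43 0 0 _) 43 _ _ _ 43 i j = _
      simp only [Expr.eval, eval_var, store_apply, store_ne (show 8 ≠ 43 by norm_num),
        store_ne (show 4 ≠ 43 by norm_num), n2, ng2]
      rw [f2 43 (by simp), show m 43 = 0 from hz 1]
      rcases i with _ | _ | i <;> rcases j with _ | j <;> simp [load, ones]
    · rw [load_eq_zero (by omega), store_ne (by omega), store_ne (by omega), f2 _ (by simp; omega),
        hz]
  · rw [store_same]; rfl
  · exact (((f2.mono (by simp [Set.insert_subset_iff])).store (by simp) _ _ _).store (by simp)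
      _ _ _).store (by simp) _ _ _


/-- The LPN distinguisher that is built from the adversary `A`; `D` determines the number of
hybrids. -/
def reduceCmd (K : ℕ) (c : Cmd) (cap : Expr) (D : ℕ) (A : Cmd) : Cmd :=
  block [params K, assign 31 (var 8), emit 11 (var 4) (.coin 16 (.const 0) (.const 0)) 16 0 1 31,
    assign 18 (.const 0), assign 19 (.const 1), assign 17 (.smul D (.add (var 5) (.const 1))),
    randNum, assign 39 (var 15), etaCmd c cap, setup,
    A.compile (fun a => 41 + 2 * a) (fun a => answer (41 + 2 * a)), assign 2 (var 45)]

/-- The output of the adversary `A` after `N` steps, when the queries are answered by `O`. -/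
noncomputable def play (A : Cmd) (N n : ℕ) {l : ℕ} (pk : Vec l) (O : ℕ → PMF (List F2)) : PMF Bool :=
  (runS O N 0 ([A], load [ones n, List.ofFn pk])).map fun p => readBit p.2.2

/-- The output of the distinguisher for given `z`, given index of the special query and given noise
rate. -/
noncomputable def reduceFor (A : Cmd) (N : ℕ) {n g : ℕ} (B : Matrix (Fin n) (Fin g) F2) (v z : Vec n)
    (J : ℕ) (D : PMF F2) : PMF Bool :=
  play A N n (packPair B z) (hybrid (encodeWith D (packPair B z)) (PMF.uniformOfFintype (Vec n)) J
    (PMF.pure (v + z)))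

/-- The output of the distinguisher. -/
noncomputable def reduceDist (c : Cmd) (T s : ℕ) (A : Cmd) (N : ℕ) {n g : ℕ}
    (B : Matrix (Fin n) (Fin g) F2) (v : Vec n) : PMF Bool :=
  (PMF.uniformOfFintype (Vec n)).bind fun z =>
    (PMF.uniformOfFintype (Fin (2 ^ s))).bind fun J : Fin (2 ^ s) =>
      (etaDist c T n).bind fun r => reduceFor A N B v z J (bernApprox r.1 (2 ^ r.2) n)

/-- The running time of the distinguisher. -/
def reduceTime (c : Cmd) (T N n g s : ℕ) : ℕ :=
  20 * n + 50 + (n * 8 + 3) + (12 * s + 20) + etaTime c T n + (n * 4 + (n * g + n) * 4 + 15) +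
    N * (answerTime n g + 1) + 18

/-- The arrays that may change while the adversary runs. -/
def playFrame : Set ℕ := encFrame ∪ {22} ∪ {a | ∃ b, a = 41 + 2 * b}

theorem hybrid_support {n : ℕ} (E U X : PMF (Vec n)) (j k : ℕ) :
    (hybrid E U j X k).support ⊆ ((PMF.uniformOfFintype (Vec n)).map List.ofFn).support := by
  intro w hw
  rw [hybrid, PMF.mem_support_map_iff] at hw
  obtain ⟨x, -, rfl⟩ := hw
  rw [PMF.mem_support_map_iff]
  exact ⟨x, by simp, rfl⟩

/-- The adversary lives in the odd arrays from `41` on, while the keys, the challenge and all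
working variables are elsewhere, so neither side disturbs the other. -/
theorem spec_play {O : PMF (List F2)} {K n N : ℕ} {A : Cmd} {m : Mem}
    {pk : Vec (n * (rowWt K n * rowWt K n) + n)} {v : Vec n} {r : ℕ × ℕ} {j : ℕ}
    (hA : HaltsWithin ((PMF.uniformOfFintype (Vec n)).map List.ofFn) A N [ones n, List.ofFn pk])
    (h : Ready K n m pk v r j) (h22 : m 22 0 0 = 0)
    (hold : Holds (fun a => 41 + 2 * a) (load [ones n, List.ofFn pk]) m) :
    Spec O [A.compile (fun a => 41 + 2 * a) (fun a => answer (41 + 2 * a)), assign 2 (var 45)] m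
      (N * (answerTime n (rowWt K n * rowWt K n) + 1) + 1)
      (play A N n pk (hybrid (encodeWith (bernApprox r.1 (2 ^ r.2) n) pk)
        (PMF.uniformOfFintype (Vec n)) j (PMF.pure (v + pairVec pk)))) fun b m' => readBit m' = b := by
  set f : ℕ → ℕ := fun a => 41 + 2 * a with hf
  have hfi : Function.Injective f := fun a b h => by simp only [hf] at h; omega
  have hff : ∀ a, f a ∈ playFrame := fun a => Or.inr ⟨a, rfl⟩
  have key := Spec.compile (O := O) hfi (sub := fun a => answer (41 + 2 * a))
    (A := hybrid (encodeWith (bernApprox r.1 (2 ^ r.2) n) pk)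
        (PMF.uniformOfFintype (Vec n)) j (PMF.pure (v + pairVec pk)))
    (Inv := fun k m' => Frame playFrame m m' ∧ m' 22 0 0 = k)
    (τ := answerTime n (rowWt K n * rowWt K n)) (T := N) (k := 0)
    (L := [A]) (m := load [ones n, List.ofFn pk]) (m' := m)
    (fun k m₁ m₂ h hI => by
      refine ⟨fun a ha => ?_, ?_⟩
      · rw [h a ?_, hI.1 a ha]
        rintro b rfl
        exact ha (hff b)
      · rw [h 22 (by simp only [hf]; omega), hI.2])
    (fun k a m₁ m₂ hh hI => by
      have hr : Ready K n m₂ pk v r j := h.frame hI.1 (by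
        rintro a ((ha | ha) | ⟨b, rfl⟩)
        · simp only [encFrame, Set.mem_insert_iff, Set.mem_singleton_iff] at ha
          simp only [Set.mem_Icc]; omega
        · simp only [Set.mem_singleton_iff] at ha; subst ha; simp
        · simp only [Set.mem_Icc]; omega)
      refine (spec_answer hr hI.2 (b := 41 + 2 * a) (by omega)).imp ?_
      rintro w m₃ ⟨g1, g2, g3⟩
      refine ⟨fun b => ?_, hI.1.trans (g1.mono ?_), g2⟩
      · by_cases hb : b = a
        · subst hb; exact g3 _ _ (hh b)
        · have e : storeAnswer m₁ a w b = m₁ b := by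
            funext i i'; simp [storeAnswer, hb]
          rw [e, ← hh b]
          refine g1 _ ?_
          simp only [encFrame, hf, Set.mem_union, Set.mem_insert_iff, Set.mem_singleton_iff]
          omega
      · rintro x (hx | hx | hx)
        · exact Or.inl (Or.inl hx)
        · exact Or.inl (Or.inr hx)
        · rw [Set.mem_singleton_iff.1 hx]; exact hff a)
    hold ⟨Frame.refl _ _, h22⟩ (fun p hp => by
      have := mem_support_runS (fun k => hybrid_support _ _ _ _ _) _ _ _ p hp
      exact hA _ this)
  have := Spec.append key (L' := [assign 2 (var 45)]) (T' := 1)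
    (Y := fun p => PMF.pure (readBit p.2.2)) (R := fun b m' => readBit m' = b) (by
      rintro p - m' ⟨h1, -⟩
      refine Spec.assign (Spec.nil ?_)
      simp only [readBit, store_same, eval_var]
      rw [show m' 45 = p.2.2 2 from h1 2])
  exact this

theorem spec_reduceCmd {K : ℕ} (hK : K ≠ 0) {c A : Cmd} {T n D N s : ℕ}
    (hs : s = D * (rowWt K n + 1))
    (hc : HaltsWithin noOracle c T [ones n]) {cap : Expr}
    (hcap : ∀ m : Mem, m 4 0 0 = n → min n (cap.eval m) = min n T)
    (hA : ∀ pk : Vec (n * (rowWt K n * rowWt K n) + n),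
      HaltsWithin ((PMF.uniformOfFintype (Vec n)).map List.ofFn) A N [ones n, List.ofFn pk])
    (B : Matrix (Fin n) (Fin (rowWt K n * rowWt K n)) F2) (v : Vec n) :
    Spec noOracle [reduceCmd K c cap D A] (load (lpnInput B v))
      (reduceTime c T N n (rowWt K n * rowWt K n) s)
      (reduceDist c T s A N B v) fun b m => readBit m = b := by
  obtain ⟨g, hg⟩ : ∃ g, g = rowWt K n * rowWt K n := ⟨_, rfl⟩
  set m0 := load (lpnInput B v) with hm0
  have z0 : ∀ a, 2 ≤ a → m0 a = 0 := fun a ha => load_eq_zero ha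
  rw [reduceTime, reduceDist]
  simp only [← hg]
  refine (Spec.block_cons (Det.cons (det_params hK (n := n) (by simp [hm0, load, lpnInput, ones]))
    (T' := (n * 8 + 3) + (12 * s + 20) + etaTime c T n + (n * 4 + (n * g + n) * 4 + 15) +
    N * (answerTime n g + 1) + 17) ?_)).time (by omega)
  rintro m1 ⟨p1, f1⟩
  have r1 : Row m1 0 1 (List.ofFn (flat B)) := (row_load _ 1).frame f1 (by simp)
  refine (Spec.block_cons (Spec.assign (Spec.block_cons (Spec.cons (spec_emit_coin (n := n)
    (by norm_num) (by norm_num) (by norm_num) (by norm_num) (by norm_num)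
    (r1.congr (by rw [store_ne (by norm_num)])) ?_ ?_)
    (T' := (12 * s + 20) + etaTime c T n + (n * 4 + (n * g + n) * 4 + 15) +
    N * (answerTime n g + 1) + 14) ?_)))).time (by omega)
  · rw [store_same, eval_var, p1.eq_ng]; simp
  · intro m' h; rw [eval_var, h.1 4 (by simp), store_ne (by norm_num), p1.eq_n]
  rintro z m2 ⟨r2, -, f2, e2⟩
  -- Appending the random pad `z` to the LPN matrix in memory turns it into the public key.
  have hpk : Row m2 0 1 (List.ofFn (packPair B z)) := by
    rw [packPair, List.ofFn_fin_append]; exact r2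
  have hv : Row m2 0 2 (List.ofFn v) := by
    have : Row m0 0 2 (List.ofFn v) := row_load _ 2
    refine (this.frame f1 (by simp)).congr ?_
    rw [e2 2 (by norm_num), store_ne (by norm_num)]
  have F2 : Frame {0, 4, 5, 6, 7, 8, 9, 11, 13, 16, 31} m0 m2 :=
    ((f1.mono (by simp [Set.insert_subset_iff])).store (by simp) _ _ _).trans
      (f2.mono (by simp [Set.insert_subset_iff]))
  have p2 : Params K n m2 := by
    have : Params K n (store m1 31 0 0 ((var 8).eval m1)) :=
      p1.frame (S := {31}) ((Frame.refl _ _).store (by simp) _ _ _) (by intro a h1 h2; simp; omega)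
    exact this.frame f2 (by intro a h1 h2; simp; omega)
  -- With `a = 0` and `b = 1`, the subroutine returns a plain uniform number below `2 ^ s`: the
  -- index of the special query.
  refine (Spec.block_cons (Spec.assign (Spec.block_cons (Spec.assign (Spec.block_cons (Spec.assign
    (Spec.block_cons (Spec.cons (spec_randNum (a := 0) (b := 1) (l := s) ?_ ?_ ?_)
    (T' := etaTime c T n + (n * 4 + (n * g + n) * 4 + 15) +
    N * (answerTime n g + 1) + 7) ?_)))))))).time (T := 12 * s + 20 + (etaTime c T n +
    (n * 4 + (n * g + n) * 4 + 15) + N * (answerTime n g + 1) + 7) + 7) (by omega)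
  · simp [store, Expr.eval]
  · simp [store, Expr.eval]
  · simp [store, Expr.eval, Expr.eval_smul, p2.eq_t, hs]
  rintro J m3 ⟨-, h15, f3⟩
  rw [one_mul] at h15
  have F3 : Frame {12, 13, 14, 15, 16, 17, 18, 19} m2 m3 :=
    ((((Frame.refl _ _).store (by simp) _ _ _).store (by simp) _ _ _).store (by simp) _ _ _).trans
      (f3.mono (by simp [Set.insert_subset_iff]))
  set m4 := store m3 39 0 0 J with hm4
  have F4 : Frame {12, 13, 14, 15, 16, 17, 18, 19, 39} m2 m4 :=
    (F3.mono (by simp [Set.insert_subset_iff])).store (by simp) _ _ _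
  have p4 := p2.frame F4 (by intro a h1 h2; simp; omega)
  refine (Spec.block_cons (Spec.assign (T := etaTime c T n + (n * 4 + (n * g + n) * 4 + 15) +
    N * (answerTime n g + 1) + 5) ?_)).time (by omega)
  rw [eval_var, h15, ← hm4]
  refine (Spec.block_cons (Spec.cons (spec_etaCmd hc hcap p4.eq_n ?_)
    (T' := (n * 4 + (n * g + n) * 4 + 15) + N * (answerTime n g + 1) + 4) ?_)).time (by omega)
  · intro a ha _
    rw [F4 a (by simp; omega), F2 a (by simp; omega), z0 a (by omega)]
  rintro r m5 ⟨h18, h19, h17, f5⟩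
  have p5 := p4.frame f5 (by intro a h1 h2; simp [etaFrame]; omega)
  have F5 : m5 0 = m2 0 := by rw [f5 0 (by simp [etaFrame]), F4 0 (by simp)]
  have ready : Ready K n m5 (packPair B z) v r J := by
    refine ⟨p5, hpk.congr (by rw [F5]), hv.congr (by rw [F5]), h18, h19, h17, ?_⟩
    rw [f5 39 (by simp [etaFrame]), hm4, store_same]
  refine (Spec.block_cons (Det.cons (det_setup ready.params.eq_n ready.params.eq_ng ready.key ?_)
    (T' := N * (answerTime n g + 1) + 2) ?_)).time (by simp only [← hg]; omega)
  · intro a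
    rw [f5 _ (by simp [etaFrame]; omega), F4 _ (by simp; omega), F2 _ (by simp; omega),
      z0 _ (by omega)]
  rintro m6 ⟨h6, h22, f6⟩
  refine Spec.block_cons ?_
  have := spec_play (hA _) (ready.frame f6 (by simp)) h22 h6 (O := noOracle)
  rw [pairVec_packPair] at this
  exact this.time (by rw [hg])


/-! ### The hybrid argument -/

/-- The oracle that answers the first `j` queries according to `E` and the others according to
`U`. -/
noncomputable def mix {n : ℕ} (E U : PMF (Vec n)) (j k : ℕ) : PMF (List F2) :=
  (if k < j then E else U).map List.ofFn

theorem hybrid_left {n : ℕ} (E U : PMF (Vec n)) (j : ℕ) : hybrid E U j E = mix E U (j + 1) := by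
  funext k
  rw [hybrid, mix]
  congr 1
  split_ifs <;> first | rfl | omega

theorem hybrid_right {n : ℕ} (E U : PMF (Vec n)) (j : ℕ) : hybrid E U j U = mix E U j := by
  funext k
  rw [hybrid, mix]
  congr 1
  split_ifs <;> rfl

theorem hybrid_eq_update {n : ℕ} (E U X : PMF (Vec n)) (j : ℕ) :
    hybrid E U j X = Function.update (mix E U j) j (X.map List.ofFn) := by
  funext k
  by_cases hk : k = j
  · subst hk; simp [hybrid]
  · rw [Function.update_of_ne hk, hybrid, mix, if_neg hk]

/-- The special query is made at most once in a run, so a challenge fixed in advance and then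
averaged has the same effect as a fresh sample at that query. -/
theorem bind_play_hybrid (A : Cmd) (N : ℕ) {n l : ℕ} (pk : Vec l) (E U W : PMF (Vec n)) (j : ℕ) :
    W.bind (fun v => play A N n pk (hybrid E U j (PMF.pure v))) = play A N n pk (hybrid E U j W) := by
  simp only [play, hybrid_eq_update]
  rw [← PMF.map_bind, runS_bind]
  congr 3
  simp only [PMF.pure_map]
  exact PMF.bind_pure_comp _ _

theorem outBit_eq_play (A : Cmd) (N n : ℕ) {l : ℕ} (pk : Vec l) (O : PMF (List F2)) :
    outBit O A N [ones n, List.ofFn pk] = play A N n pk fun _ => O := by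
  rw [outBit, runOn, ← runS_const O N 0, PMF.map_comp]; rfl

theorem play_mix_of_le {A : Cmd} {N n l j : ℕ} (pk : Vec l) (E U : PMF (Vec n)) (h : N ≤ j) :
    play A N n pk (mix E U j) = play A N n pk fun _ => E.map List.ofFn := by
  rw [play, play, runS_congr]
  intro i _ hi
  rw [mix, if_pos (by omega)]

theorem play_mix_zero {A : Cmd} {N n l : ℕ} (pk : Vec l) (E U : PMF (Vec n)) :
    play A N n pk (mix E U 0) = play A N n pk fun _ => U.map List.ofFn := rfl

theorem dist_play {A : Cmd} {N n l : ℕ} (pk : Vec l) {O O' : ℕ → PMF (List F2)} {ε : ℝ≥0∞}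
    (h : ∀ k, Dist (O k) (O' k) ε) : Dist (play A N n pk O) (play A N n pk O') (N * ε) :=
  (dist_runS h N 0 _).map _

/-- The output of the distinguisher with the exact noise distribution `D`. -/
noncomputable def reduceIdeal (D : PMF F2) (s : ℕ) (A : Cmd) (N : ℕ) {n g : ℕ}
    (B : Matrix (Fin n) (Fin g) F2) (v : Vec n) : PMF Bool :=
  (PMF.uniformOfFintype (Vec n)).bind fun z =>
    (PMF.uniformOfFintype (Fin (2 ^ s))).bind fun J : Fin (2 ^ s) => reduceFor A N B v z J D

theorem dist_reduceDist {η : ℝ} (hη : η ∈ Set.Ico (0 : ℝ) (1 / 2)) {c : Cmd} {T n : ℕ} {w : List F2}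
    {ε : ℝ} (hw : |η - binaryValue w| ≤ 1 / 2 ^ n)
    (h : StatClose ((runOn noOracle c T [ones n]).map fun s => readStrings 1 T s.2)
      (PMF.pure [w]) ε) (s : ℕ) (A : Cmd) (N : ℕ) {g : ℕ} (B : Matrix (Fin n) (Fin g) F2)
    (v : Vec n) :
    Dist (reduceDist c T s A N B v) (reduceIdeal (ber η hη) s A N B v)
      (ENNReal.ofReal ε + N * (n * ENNReal.ofReal (6 * (1 / 2) ^ n))) := by
  refine Dist.bind_right _ fun z _ => Dist.bind_right _ fun J _ => dist_etaDist_bind hw h fun r hr =>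
    dist_play _ fun k => Dist.map _ ?_
  split_ifs
  · exact dist_encodeWith (dist_bernApprox_ber hη hr) _
  · exact (Dist.refl _).mono zero_le
  · exact (Dist.refl _).mono zero_le

/-- The output of the adversary when the public key is uniformly random and the first `j` queries
are answered with encodings. -/
noncomputable def game (D : PMF F2) (A : Cmd) (N n g j : ℕ) : PMF Bool :=
  (PMF.uniformOfFintype (Matrix (Fin n) (Fin g) F2)).bind fun B =>
    (PMF.uniformOfFintype (Vec n)).bind fun z => play A N n (packPair B z)
      (mix (encodeWith D (packPair B z)) (PMF.uniformOfFintype (Vec n)) j)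

theorem bind_reduceFor (A : Cmd) (N : ℕ) {n g : ℕ} (B : Matrix (Fin n) (Fin g) F2) (z : Vec n)
    (J : ℕ) (D : PMF F2) (W : PMF (Vec n)) :
    W.bind (fun v => reduceFor A N B v z J D) = play A N n (packPair B z)
      (hybrid (encodeWith D (packPair B z)) (PMF.uniformOfFintype (Vec n)) J (W.map (· + z))) := by
  rw [← bind_play_hybrid, ← PMF.bind_pure_comp, PMF.bind_bind]
  simp only [Function.comp_apply, PMF.pure_bind]; rfl

/-- For fixed `J`, `B` and `z`, the LPN vector enters only through the answer to the special query;
its distribution can be moved into the oracle. -/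
theorem bind_reduceIdeal (D : PMF F2) (s : ℕ) (A : Cmd) (N : ℕ) {n g : ℕ}
    (W : Matrix (Fin n) (Fin g) F2 → PMF (Vec n)) :
    ((PMF.uniformOfFintype (Matrix (Fin n) (Fin g) F2)).bind fun B => (W B).bind fun v =>
      reduceIdeal D s A N B v) = (PMF.uniformOfFintype (Fin (2 ^ s))).bind fun J : Fin (2 ^ s) =>
      (PMF.uniformOfFintype (Matrix (Fin n) (Fin g) F2)).bind fun B =>
        (PMF.uniformOfFintype (Vec n)).bind fun z => play A N n (packPair B z)
          (hybrid (encodeWith D (packPair B z)) (PMF.uniformOfFintype (Vec n)) J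
            ((W B).map (· + z))) := by
  rw [PMF.bind_comm]
  congr 1; funext B
  rw [PMF.bind_comm (PMF.uniformOfFintype (Fin (2 ^ s)))]
  simp only [reduceIdeal]
  rw [PMF.bind_comm]
  congr 1; funext z
  rw [PMF.bind_comm]
  congr 1; funext J
  exact bind_reduceFor _ _ _ _ _ _ _

/-- A genuine LPN sample plus `z` is an encoding under the key `(B, z)`, so query `J` joins the
encoded ones. A uniform vector plus `z` is uniform, which leaves only the queries before `J`
encoded. -/
theorem lpnSamples_bind_reduceIdeal (η : ℝ) (hη : η ∈ Set.Ico (0 : ℝ) (1 / 2)) (s : ℕ) (A : Cmd)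
    (N n g : ℕ) :
    ((lpnSamples n g η hη).bind fun x => reduceIdeal (ber η hη) s A N x.1 x.2)
      = (PMF.uniformOfFintype (Fin (2 ^ s))).bind fun J : Fin (2 ^ s) =>
        game (ber η hη) A N n g (J + 1) := by
  have := bind_reduceIdeal (ber η hη) s A N (n := n) (g := g) fun B =>
    (PMF.uniformOfFintype (Vec g)).bind fun u => (iid (ber η hη) n).map fun e => B.mulVec u + e
  rw [lpnSamples, PMF.bind_bind]
  simp only [← PMF.bind_pure_comp, PMF.bind_bind, Function.comp_apply, PMF.pure_bind] at this ⊢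
  rw [this]
  congr 1; funext J
  rw [game]
  congr 1; funext B
  congr 1; funext z
  rw [← hybrid_left]
  congr 2
  rw [encodeWith, pairMatrix_packPair, pairVec_packPair]
  congr 1; funext u
  rw [← PMF.bind_pure_comp]
  congr 1; funext e
  simp only [Function.comp_apply]
  congr 1; abel

theorem lpnUniform_bind_reduceIdeal (D : PMF F2) (s : ℕ) (A : Cmd) (N n g : ℕ) :
    ((lpnUniform n g).bind fun x => reduceIdeal D s A N x.1 x.2)
      = (PMF.uniformOfFintype (Fin (2 ^ s))).bind fun J : Fin (2 ^ s) => game D A N n g J := by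
  have := bind_reduceIdeal D s A N (n := n) (g := g) fun B => PMF.uniformOfFintype (Vec n)
  have hU : ∀ z : Vec n, (PMF.uniformOfFintype (Vec n)).map (· + z) = PMF.uniformOfFintype (Vec n) :=
    fun z => uniformOfFintype_map_equiv (Equiv.addRight z)
  simp only [hU, hybrid_right] at this
  rw [lpnUniform, PMF.bind_bind]
  simp only [← PMF.bind_pure_comp, PMF.bind_bind, Function.comp_apply, PMF.pure_bind]
  exact this

theorem pr_uniform_bind {M : ℕ} [NeZero M] {β : Type} (F : Fin M → PMF β) (S : Set β) :
    pr ((PMF.uniformOfFintype (Fin M)).bind F) S = (∑ J, pr (F J) S) / M := by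
  simp only [pr_eq]
  rw [prob_bind, expect_fintype, ENNReal.toReal_sum fun J _ =>
    ENNReal.mul_ne_top (PMF.apply_ne_top _ _) (prob_ne_top _ _), Finset.sum_div]
  refine Finset.sum_congr rfl fun J _ => ?_
  rw [ENNReal.toReal_mul, PMF.uniformOfFintype_apply, Fintype.card_fin]
  simp [div_eq_inv_mul]

/-- The telescoping sum of the hybrid argument. -/
theorem abs_game_sub_le {D : PMF F2} {A : Cmd} {N n g s : ℕ} {δ : ℝ}
    (h : |pr ((PMF.uniformOfFintype (Fin (2 ^ s))).bind fun J : Fin (2 ^ s) =>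
        game D A N n g (J + 1)) {true} - pr ((PMF.uniformOfFintype (Fin (2 ^ s))).bind
          fun J : Fin (2 ^ s) => game D A N n g J) {true}| ≤ δ) :
    |pr (game D A N n g (2 ^ s)) {true} - pr (game D A N n g 0) {true}| ≤ 2 ^ s * δ := by
  rw [pr_uniform_bind, pr_uniform_bind, ← sub_div, ← Finset.sum_sub_distrib] at h
  have e : ∑ J : Fin (2 ^ s), (pr (game D A N n g (J + 1)) {true} - pr (game D A N n g J) {true})
      = pr (game D A N n g (2 ^ s)) {true} - pr (game D A N n g 0) {true} := by
    rw [← Finset.sum_range_sub (fun j => pr (game D A N n g j) {true}), Finset.sum_range]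
  rw [e, abs_div, div_le_iff₀ (by simp)] at h
  push_cast at h
  rw [abs_of_pos (by positivity : (0 : ℝ) < 2 ^ s)] at h
  linarith

/-- The adversary sees the public key only, so merely the marginal distribution of the generator
matrix matters, and it may be replaced by a uniform matrix. At most `N` queries are made in `N`
steps, hence all are encoded once `j ≥ N`. -/
theorem dist_games {K : ℕ} {η : ℝ} {hη : η ∈ Set.Ico (0 : ℝ) (1 / 2)} {n : ℕ} {ε : ℝ≥0∞}
    (h : Dist (genDist (rowWt_le K n) (rowWt K n * rowWt K n) (rowNum n))
      (PMF.uniformOfFintype _) ε) (A : Cmd) (q : Polynomial ℕ) {N : ℕ}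
    (hN : N = q.eval (n + (code K η hη).pkLen n)) :
    (∀ j, N ≤ j → Dist ((code K η hη).realGame A q n)
      (game (ber η hη) A N n (rowWt K n * rowWt K n) j) ε) ∧
    Dist ((code K η hη).idealGame A q n)
      (game (ber η hη) A N n (rowWt K n * rowWt K n) 0) ε := by
  have key : ∀ F : Vec ((code K η hη).pkLen n) → PMF Bool,
      Dist (((code K η hη).keyGen n).bind fun k => F k.2)
        ((PMF.uniformOfFintype (Matrix (Fin n) (Fin (rowWt K n * rowWt K n)) F2)).bind fun B =>
          (PMF.uniformOfFintype (Vec n)).bind fun z => F (packPair B z)) ε := by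
    intro F
    have := h.bind_left fun B => (PMF.uniformOfFintype (Vec n)).bind fun z => F (packPair B z)
    rw [← ldpc_map_snd, ← PMF.bind_pure_comp, PMF.bind_bind] at this
    simp only [code, ldpcPRC, ← PMF.bind_pure_comp, PMF.bind_bind, Function.comp_apply,
      PMF.pure_bind] at this ⊢
    exact this
  constructor
  · intro j hj
    have := key fun pk => play A N n pk fun _ => ((code K η hη).encode n pk).map List.ofFn
    simp only [ZeroBitScheme.realGame, outBit_eq_play, ← hN, game, play_mix_of_le _ _ _ hj]
    exact this
  · have := key fun pk => play A N n pk fun _ => (PMF.uniformOfFintype (Vec n)).map List.ofFn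
    simp only [ZeroBitScheme.idealGame, outBit_eq_play, ← hN, game, play_mix_zero]
    exact this

/-- A polynomial is bounded by a power of two of the form in the reduction. -/
theorem exists_eval_le_two_pow {K : ℕ} (hK : K ≠ 0) (Q : Polynomial ℕ) :
    ∃ D, ∀ n, Q.eval n ≤ 2 ^ (D * (rowWt K n + 1)) := by
  refine ⟨Q.eval 1 + K * Q.natDegree, fun n => ?_⟩
  set M := 2 ^ (K * (rowWt K n + 1)) with hM
  have hM1 : 1 ≤ M := Nat.one_le_two_pow
  calc Q.eval n ≤ Q.eval M := PolyBounded.eval_mono Q (lt_two_pow_rowWt hK n).le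
    _ ≤ Q.eval 1 * M ^ Q.natDegree := by
      rw [Polynomial.eval_eq_sum_range, Polynomial.eval_eq_sum_range, Finset.sum_mul]
      refine Finset.sum_le_sum fun i hi => ?_
      rw [one_pow, mul_one]
      exact Nat.mul_le_mul_left _ (Nat.pow_le_pow_right hM1
        (Nat.lt_succ_iff.1 (Finset.mem_range.1 hi)))
    _ ≤ 2 ^ (Q.eval 1 * (rowWt K n + 1)) * M ^ Q.natDegree := by
      gcongr
      exact Nat.lt_two_pow_self.le.trans (Nat.pow_le_pow_right two_pos (by nlinarith))
    _ = _ := by rw [hM, ← pow_mul, ← pow_add]; congr 1; ring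

/-- The number of hybrids is a power of two, so that the index can be sampled exactly with fair
coins. This bound shows that it is still polynomial and that the hybrid argument loses a polynomial
factor only. -/
theorem two_pow_mul_rowWt_le {K : ℕ} (hK : K ≠ 0) (D : ℕ) {n : ℕ} (hn : n ≠ 0) :
    2 ^ (D * (rowWt K n + 1)) ≤ 2 ^ D * n ^ D := by
  have h : 2 ^ rowWt K n ≤ n := (Nat.pow_le_pow_right two_pos
    (Nat.le_mul_of_pos_left _ (Nat.pos_of_ne_zero hK))).trans (two_pow_rowWt_le K hn)
  calc 2 ^ (D * (rowWt K n + 1)) = 2 ^ D * (2 ^ rowWt K n) ^ D := by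
        rw [← pow_mul, ← pow_add]; congr 1; ring
    _ ≤ _ := by gcongr


theorem polyBounded_reduceTime {I : Type} {s n N g l : I → ℕ} (c : Cmd) (q : Polynomial ℕ)
    (hn : PolyBounded s n) (hN : PolyBounded s N) (hg : PolyBounded s g) (hl : PolyBounded s l) :
    PolyBounded s fun i => reduceTime c (q.eval (n i)) (N i) (n i) (g i) (l i) := by
  have hT := hn.eval q
  unfold reduceTime answerTime etaTime encTime logBound
  repeat' first | exact PolyBounded.const _ _ | exact hn | exact hg | exact hN | exact hl | exact hT | apply PolyBounded.mul | apply PolyBounded.add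

theorem pseudorandom_code {K : ℕ} (hK : 11 ≤ K) {η : ℝ} (hη : η ∈ Set.Ico (0 : ℝ) (1 / 2))
    (hc : EfficientlyComputable η) (hLPN : LPN (fun n => rowWt K n * rowWt K n) η hη) :
    (code K η hη).Pseudorandom := by
  intro A q hA
  have hK0 : K ≠ 0 := by omega
  obtain ⟨w, hw, c, qc, μ, hμ, hq⟩ := hc
  simp only [inputLength_ones] at hq
  obtain ⟨cap, hcap⟩ := exists_cap qc
  have hμ0 : ∀ n, 0 ≤ μ n := fun n => (abs_nonneg _).trans ((hq n).2 ∅)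
  set N : ℕ → ℕ := fun n => q.eval (n + (code K η hη).pkLen n) with hNdef
  have hNb : ∀ {I : Type} {s n : I → ℕ}, PolyBounded s n → PolyBounded s fun i => N (n i) := by
    intro I s n hn
    have hg : PolyBounded s fun i => rowWt K (n i) * rowWt K (n i) :=
      (hn.mul hn).mono fun i => Nat.mul_le_mul (rowWt_le K _) (rowWt_le K _)
    exact (hn.add ((hn.mul hg).add hn)).eval q
  obtain ⟨Q, hQ⟩ := hNb (PolyBounded.self fun n : ℕ => n)
  obtain ⟨D, hD⟩ := exists_eval_le_two_pow hK0 Q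
  -- The exponent is a multiple of `t + 1` because the program already has the row weight at hand;
  -- `D` is a constant in the program.
  set s : ℕ → ℕ := fun n => D * (rowWt K n + 1) with hs
  have hNs : ∀ n, N n ≤ 2 ^ s n := fun n => (hQ n).trans (hD n)
  have hspec : ∀ n (B : Matrix (Fin n) (Fin (rowWt K n * rowWt K n)) F2) (v : Vec n),
      Spec noOracle [reduceCmd K c cap D A] (load (lpnInput B v))
      (reduceTime c (qc.eval n) (N n) n (rowWt K n * rowWt K n) (s n))
      (reduceDist c (qc.eval n) (s n) A (N n) B v) fun b m => readBit m = b :=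
    fun n => spec_reduceCmd hK0 rfl (hq n).1 (fun m hm => by rw [← hm]; exact hcap m)
      fun pk => hA n pk (PMF.uniformOfFintype (Vec n))
  obtain ⟨qr, hqr⟩ : PolyBounded (fun i : Σ n : ℕ, Matrix (Fin n) (Fin (rowWt K n * rowWt K n)) F2 ×
      Vec n => inputLength (lpnInput i.2.1 i.2.2)) fun i => reduceTime c (qc.eval i.1) (N i.1) i.1
        (rowWt K i.1 * rowWt K i.1) (s i.1) := by
    have hn : PolyBounded (fun i : Σ n : ℕ, Matrix (Fin n) (Fin (rowWt K n * rowWt K n)) F2 ×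
      Vec n => inputLength (lpnInput i.2.1 i.2.2)) fun i => i.1 :=
      PolyBounded.of_le_self fun i => by simp [inputLength, lpnInput, ones]
    refine polyBounded_reduceTime c qc hn (hNb hn) ((hn.mul hn).mono fun i =>
      Nat.mul_le_mul (rowWt_le K _) (rowWt_le K _)) ?_
    refine ((PolyBounded.const _ D).mul (hn.add (PolyBounded.const _ 1))).mono fun i => ?_
    exact Nat.mul_le_mul_left _ (Nat.add_le_add_right (rowWt_le K _) 1)
  have hadv := hLPN (reduceCmd K c cap D A) qr fun n B v => by
    obtain ⟨_, -, h, -⟩ := (hspec n B v).time (hqr ⟨n, B, v⟩)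
    exact h.halts
  have hout : ∀ n (B : Matrix (Fin n) (Fin (rowWt K n * rowWt K n)) F2) (v : Vec n),
      outBit noOracle (reduceCmd K c cap D A) (qr.eval (inputLength (lpnInput B v))) (lpnInput B v)
        = reduceDist c (qc.eval n) (s n) A (N n) B v := fun n B v =>
    (outBit_of_spec (f := fun b => b) (hspec n B v) (hqr ⟨n, B, v⟩)).trans (PMF.map_id _)
  simp only [hout] at hadv
  set adv : ℕ → ℝ := fun n => |pr ((lpnSamples n (rowWt K n * rowWt K n) η hη).bind fun x =>
      reduceDist c (qc.eval n) (s n) A (N n) x.1 x.2) {true} -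
    pr ((lpnUniform n (rowWt K n * rowWt K n)).bind fun x =>
      reduceDist c (qc.eval n) (s n) A (N n) x.1 x.2) {true}| with hadvdef
  set ε : ℕ → ℝ := fun n => μ n + N n * (n * (6 * (1 / 2) ^ n)) with hε
  have hε0 : ∀ n, 0 ≤ ε n := fun n => by have := hμ0 n; simp only [hε]; positivity
  have hdist : ∀ n (B : Matrix (Fin n) (Fin (rowWt K n * rowWt K n)) F2) (v : Vec n),
      Dist (reduceDist c (qc.eval n) (s n) A (N n) B v)
        (reduceIdeal (ber η hη) (s n) A (N n) B v) (ENNReal.ofReal (ε n)) := fun n B v => by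
    refine (dist_reduceDist hη (hw n) (hq n).2 (s n) A (N n) B v).mono (le_of_eq ?_)
    rw [← ENNReal.ofReal_natCast, ← ENNReal.ofReal_natCast n, ← ENNReal.ofReal_mul (by positivity),
      ← ENNReal.ofReal_mul (by positivity), ← ENNReal.ofReal_add (hμ0 n) (by positivity)]
  -- The term `2 * ε` pays for replacing the program's approximate noise by exact noise, once for
  -- LPN samples and once for uniform ones.
  have hgames : ∀ n, |pr (game (ber η hη) A (N n) n (rowWt K n * rowWt K n) (2 ^ s n)) {true} -
      pr (game (ber η hη) A (N n) n (rowWt K n * rowWt K n) 0) {true}|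
      ≤ 2 ^ s n * (adv n + 2 * ε n) := fun n => by
    refine abs_game_sub_le ?_
    rw [← lpnSamples_bind_reduceIdeal, ← lpnUniform_bind_reduceIdeal]
    have h1 := (Dist.bind_right (lpnSamples n (rowWt K n * rowWt K n) η hη) fun x _ =>
      hdist n x.1 x.2).abs_pr_le (hε0 n) {true}
    have h2 := (Dist.bind_right (lpnUniform n (rowWt K n * rowWt K n)) fun x _ =>
      hdist n x.1 x.2).abs_pr_le (hε0 n) {true}
    simp only [hadvdef]
    rw [abs_le] at h1 h2 ⊢
    constructor
    · linarith [neg_abs_le (pr ((lpnSamples n (rowWt K n * rowWt K n) η hη).bind fun x =>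
        reduceDist c (qc.eval n) (s n) A (N n) x.1 x.2) {true} -
        pr ((lpnUniform n (rowWt K n * rowWt K n)).bind fun x =>
        reduceDist c (qc.eval n) (s n) A (N n) x.1 x.2) {true})]
    · linarith [le_abs_self (pr ((lpnSamples n (rowWt K n * rowWt K n) η hη).bind fun x =>
        reduceDist c (qc.eval n) (s n) A (N n) x.1 x.2) {true} -
        pr ((lpnUniform n (rowWt K n * rowWt K n)).bind fun x =>
        reduceDist c (qc.eval n) (s n) A (N n) x.1 x.2) {true})]
  -- The terms are the two replacements of the generator matrix, the LPN advantage and the error of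
  -- the machine for `η` times the number of hybrids, and the error of the Bernoulli samples.
  have hneg : Negligible fun n => 2 * negl K n + 2 ^ D * ((n : ℝ) ^ D * (adv n + 2 * μ n)) +
      12 * 2 ^ D * 2 ^ D * ((n : ℝ) ^ (D + D + 1) * (1 / 2) ^ n) :=
    (((negligible_negl hK0).const_mul 2).add (((hadv.add (hμ.const_mul 2)).pow_mul D).const_mul _)).add
      (negligible_pow_mul_half_pow _ _)
  refine Negligible.of_eventually_le hneg ?_
  filter_upwards [eventually_dist_genDist hK, eventually_ne_atTop 0] with n hn hn0
  rw [← rowNum_eq] at hn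
  obtain ⟨h1, h2⟩ := dist_games (η := η) (hη := hη) hn A q (N := N n) rfl
  have h3 := (h1 _ (hNs n)).abs_pr_le (negl_pos K n).le {true}
  have h4 := h2.abs_pr_le (negl_pos K n).le {true}
  have h5 := hgames n
  have h6 : (2 : ℝ) ^ s n ≤ 2 ^ D * n ^ D := by exact_mod_cast two_pow_mul_rowWt_le hK0 D hn0
  have h7 : (N n : ℝ) ≤ 2 ^ D * n ^ D :=
    le_trans (by exact_mod_cast hNs n) h6
  have h8 : 2 ^ s n * (adv n + 2 * ε n) ≤ 2 ^ D * ((n : ℝ) ^ D * (adv n + 2 * μ n)) +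
      12 * 2 ^ D * 2 ^ D * ((n : ℝ) ^ (D + D + 1) * (1 / 2) ^ n) := by
    have hadv0 : 0 ≤ adv n := abs_nonneg _
    have := hμ0 n
    have e : adv n + 2 * ε n ≤ adv n + 2 * μ n + 12 * ((2 ^ D * n ^ D) * (n * (1 / 2) ^ n)) := by
      have : (N n : ℝ) * (n * (1 / 2) ^ n) ≤ (2 ^ D * n ^ D) * (n * (1 / 2) ^ n) := by gcongr
      simp only [hε]
      linarith
    calc 2 ^ s n * (adv n + 2 * ε n)
        ≤ (2 ^ D * n ^ D) * (adv n + 2 * μ n + 12 * ((2 ^ D * n ^ D) * (n * (1 / 2) ^ n))) :=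
          mul_le_mul h6 e (by have := hε0 n; positivity) (by positivity)
      _ = _ := by ring
  rw [abs_abs]
  rw [abs_le] at h3 h4 h5 ⊢
  constructor <;> linarith


/-! ### The growth of the parameters -/

theorem mul_rowWt_le_logb (K : ℕ) {n : ℕ} (hn : n ≠ 0) : (K * rowWt K n : ℝ) ≤ Real.logb 2 n := by
  rw [Real.le_logb_iff_rpow_le one_lt_two (by exact_mod_cast Nat.pos_of_ne_zero hn)]
  exact_mod_cast two_pow_rowWt_le K hn

theorem logb_le_mul_rowWt {K : ℕ} (hK : K ≠ 0) {n : ℕ} (hn : n ≠ 0) :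
    Real.logb 2 n ≤ K * (rowWt K n + 1) := by
  rw [Real.logb_le_iff_le_rpow one_lt_two (by exact_mod_cast Nat.pos_of_ne_zero hn)]
  exact_mod_cast (lt_two_pow_rowWt hK n).le

theorem rowWt_isTheta_logb {K : ℕ} (hK : K ≠ 0) :
    (fun n => (rowWt K n : ℝ)) =Θ[atTop] fun n : ℕ => Real.logb 2 n := by
  have hK1 : (1 : ℝ) ≤ K := by exact_mod_cast Nat.one_le_iff_ne_zero.2 hK
  refine ⟨IsBigO.of_bound 1 ?_, IsBigO.of_bound (2 * K) ?_⟩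
  · filter_upwards [eventually_ne_atTop 0] with n hn
    have h := mul_rowWt_le_logb K hn
    have h0 : (0 : ℝ) ≤ rowWt K n := Nat.cast_nonneg _
    rw [Real.norm_of_nonneg h0, one_mul]
    exact (by nlinarith : (rowWt K n : ℝ) ≤ Real.logb 2 n).trans (le_abs_self _)
  · filter_upwards [eventually_ne_atTop 0, (tendsto_rowWt hK).eventually_ge_atTop 1] with n hn ht
    have h := logb_le_mul_rowWt hK hn
    have ht : (1 : ℝ) ≤ rowWt K n := by exact_mod_cast ht
    have h0 : 0 ≤ Real.logb 2 n := le_trans (by positivity) (mul_rowWt_le_logb K hn)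
    rw [Real.norm_of_nonneg h0, Real.norm_of_nonneg (by positivity)]
    nlinarith

end PRC

/-! ### Choice of the constants and conclusion. -/

theorem mainTheorem1 (p η : ℝ) (hp : p ∈ Set.Ioo (0 : ℝ) (1 / 2))
    (hη : η ∈ Set.Ioo (0 : ℝ) (1 / 2)) (hηc : PRC.EfficientlyComputable η) :
    ∃ (g t : ℕ → ℕ) (ht : ∀ n, t n ≤ n),
      (fun n : ℕ => Real.logb 2 n ^ 2) =O[atTop] (fun n : ℕ => (g n : ℝ)) ∧
      (fun n : ℕ => (t n : ℝ)) =Θ[atTop] (fun n : ℕ => Real.logb 2 n) ∧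
      let S : PRC.ZeroBitScheme :=
        PRC.ldpcPRC g t (fun n => ⌊(0.99 : ℝ) * n⌋₊) η ⟨hη.1.le, hη.2⟩
          (fun n => ((0.99 : ℝ) * n) ^ (-(1 / 4) : ℝ)) ht
      S.PolyTime ∧ S.Sound ∧
      (∀ E : PRC.Channel, PRC.IsBounded p E → S.RobustTo E) ∧
      (PRC.LPN g η ⟨hη.1.le, hη.2⟩ →
        ∀ E : PRC.Channel, PRC.IsBounded p E → S.IsPublicKeyPRC E) := by
  have hc : 0 < (1 - 2 * η) * (1 - 2 * p) / 2 := by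
    have := hp.2; have := hη.2
    have h1 : 0 < 1 - 2 * η := by linarith
    have h2 : 0 < 1 - 2 * p := by linarith
    positivity
  -- The constant `m` makes `2^(-m)` a lower bound for the mean sign of the total error. It is then
  -- enlarged to at least `2`, so that `8 * m ≥ 11` as the closeness of the generator matrix to
  -- uniform requires.
  obtain ⟨m, hm⟩ := exists_pow_lt_of_lt_one hc (show (1 / 2 : ℝ) < 1 by norm_num)
  obtain ⟨m, hm, hm2⟩ : ∃ m : ℕ, (1 / 2 : ℝ) ^ m ≤ (1 - 2 * η) * (1 - 2 * p) / 2 ∧ 2 ≤ m :=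
    ⟨max m 2, (pow_le_pow_of_le_one (by norm_num) (by norm_num) (le_max_left _ _)).trans hm.le,
      le_max_right _ _⟩
  have hη' : η ∈ Set.Ico (0 : ℝ) (1 / 2) := ⟨hη.1.le, hη.2⟩
  have hK : 8 * m ≠ 0 := by omega
  have hpoly : (PRC.code (8 * m) η hη').PolyTime :=
    ⟨PRC.polyTime_keyGen hK η hη', PRC.polyTime_encode hK hη' hηc, PRC.polyTime_decode hK η hη'⟩
  have hsound : (PRC.code (8 * m) η hη').Sound := PRC.code_sound (by omega) η hη'
  have hrob : ∀ E : PRC.Channel, PRC.IsBounded p E → (PRC.code (8 * m) η hη').RobustTo E :=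
    fun E hE => PRC.code_robust (by omega) hp hη' hm E hE
  have ht := PRC.rowWt_isTheta_logb hK
  refine ⟨fun n => PRC.rowWt (8 * m) n * PRC.rowWt (8 * m) n, PRC.rowWt (8 * m),
    PRC.rowWt_le (8 * m), ?_, ht, hpoly, hsound, hrob, fun hLPN E hE =>
      ⟨hpoly, hrob E hE, hsound, PRC.pseudorandom_code (by omega) hη' hηc hLPN⟩⟩
  simpa only [← pow_two, Nat.cast_pow] using ht.2.pow 2
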